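/- Let $d\ge 1$, $k\ge 0$, and let $\Omega\subset\mathbb R^d$ be a bounded polyhedral domain (a bounded connected open set that is the interior of its closure and whose closure is triangulable). Let $\alpha$ be a measurable, bounded, symmetric and uniformly positive definite matrix-valued function on $\Omega$, and $c=\alpha^{-1}$. Let $\sigma>0$ and let $\mathcal T_h$ range over the conforming simplicial triangulations of $\overline\Omega$ that are shape regular with constant $\sigma$: every $K\in\mathcal T_h$ contains a ball of radius $h_K/\sigma$, where $h_K=\operatorname{diam}K$ (for $d=2$, a minimal angle condition). Put $h=\max_K h_K$, and let $n_K$ be the outward unit normal on $\partial K$. Let $\boldsymbol Q_h^k$ and $V_h^{k+1}$ be the spaces of vector fields, respectively functions, on $\Omega$ whose restrictions to each $K\in\mathcal T_h$ are polynomial of degree at most $k$, respectively $k+1$. Let $\hat V_h^{k+1}$ be the space of functions on the union of the $(d-1)$-dimensional faces of $\mathcal T_h$ that are polynomial of degree at most $k+1$ on every interior face and vanish on the faces contained in $\partial\Omega$. For a parameter $\rho>0$, the HDG method with stabilization $\tau=\rho^{-1}h_K^{-1}$ is: find $\boldsymbol p_h\in\boldsymbol Q_h^k$ and $\tilde u_h=(u_h,\hat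 u_h)\in V_h^{k+1}\times\hat V_h^{k+1}$ such that for all $\boldsymbol q_h\in\boldsymbol Q_h^k$ and $(v_h,\hat v_h)\in V_h^{k+1}\times\hat V_h^{k+1}$ $$\sum_{K}\Big[(c\,\boldsymbol p_h,\boldsymbol q_h)_K-(u_h,\operatorname{div}\boldsymbol q_h)_K+\langle\hat u_h,\boldsymbol q_h\cdot n_K\rangle_{\partial K}\Big]=0,$$ $$\sum_{K}\Big[-(v_h,\operatorname{div}\boldsymbol p_h)_K+\langle\hat v_h,\boldsymbol p_h\cdot n_K\rangle_{\partial K}-\rho^{-1}h_K^{-1}\langle u_h-\hat u_h,v_h-\hat v_h\rangle_{\partial K}\Big]=-\sum_K(f,v_h)_K,$$ where $(\cdot,\cdot)_K$ and $\langle\cdot,\cdot\rangle_{\partial K}$ are the $L^2$ inner products on $K$ and $\partial K$. Put $$\|\boldsymbol q\|^2=\sum_K(c\,\boldsymbol q,\boldsymbol q)_K,\qquad \|(v,\hat v)\|_{\tilde 1,\rho,h}^2=\sum_K(\nabla v,\nabla v)_K+\rho^{-1}\sum_K h_K^{-1}\langle v-\hat v,v-\hat v\rangle_{\partial K},$$ and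 read $u-\tilde u_h$ as the pair $(u-u_h,\,u-\hat u_h)$, where in the second component $u$ stands for its trace on the faces. Let $|\cdot|_m$ be the $H^m(\Omega)$ semi-norm. Theorem. There are constants $\rho_0>0$ and $C>0$, depending only on $d$, $k$, $\Omega$, $\alpha$ and $\sigma$, such that the following holds for every triangulation $\mathcal T_h$ as above and every $0<\rho\le\rho_0$. Let $f\in L^2(\Omega)$, let $(\boldsymbol p,u)\in L^2(\Omega)^d\times H^1_0(\Omega)$ solve $c\,\boldsymbol p+\nabla u=0$ and $\operatorname{div}\boldsymbol p=f$ in $\Omega$ in the weak sense, suppose $\boldsymbol p\in H^{k+1}(\Omega)^d$ and $u\in H^{k+2}(\Omega)$, and let $(\boldsymbol p_h,\tilde u_h)$ be the solution of the HDG method. Then $$\|\boldsymbol p-\boldsymbol p_h\|+\|u-\tilde u_h\|_{\tilde 1,\rho,h}\le C\,h^{k+1}\big(|\boldsymbol p|_{k+1}+|u|_{k+2}\big).$$ -/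

import Mathlib

open MeasureTheory Filter Topology
open scoped ContDiff Matrix ENNReal

noncomputable section

namespace HDG

/-- Euclidean space `ℝᵈ`. -/
abbrev Sp (d : ℕ) : Type := EuclideanSpace ℝ (Fin d)

/-! ### Sobolev spaces on an open set -/

/-- Test functions on `Ω`: smooth functions with compact support contained in `Ω`. -/
structure IsTest {d : ℕ} (Ω : Set (Sp d)) (φ : Sp d → ℝ) : Prop where
  smooth : ContDiff ℝ ∞ φ
  compact : HasCompactSupport φ
  supp : tsupport φ ⊆ Ω

/-- The classical partial derivative `∂ᵢ φ`. -/
def pderiv {d : ℕ} (i : Fin d) (φ : Sp d → ℝ) : Sp d → ℝ :=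
  fun x => fderiv ℝ φ x (EuclideanSpace.single i 1)

/-- The classical derivative `∂^β φ` for a multi-index `β`. -/
def multiDeriv {d : ℕ} (β : Fin d → ℕ) (φ : Sp d → ℝ) : Sp d → ℝ :=
  (List.finRange d).foldr (fun i g => (pderiv i)^[β i] g) φ

/-- `g ∈ L²(Ω)` is the weak derivative `D^β u` on `Ω`. -/
structure IsWeakDeriv {d : ℕ} (Ω : Set (Sp d)) (β : Fin d → ℕ) (u g : Sp d → ℝ) : Prop where
  memLp : MemLp g 2 (volume.restrict Ω)
  integral_eq : ∀ φ : Sp d → ℝ, IsTest Ω φ →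
    ∫ x in Ω, u x * multiDeriv β φ x = (-1 : ℝ) ^ (∑ i, β i) * ∫ x in Ω, g x * φ x

/-- `u ∈ H^m(Ω)`. -/
structure MemH {d : ℕ} (Ω : Set (Sp d)) (m : ℕ) (u : Sp d → ℝ) : Prop where
  memLp : MemLp u 2 (volume.restrict Ω)
  weak : ∀ β : Fin d → ℕ, ∑ i, β i ≤ m → ∃ g, IsWeakDeriv Ω β u g

open Classical in
/-- The weak derivative `D^β u` on `Ω` (unique almost everywhere in `Ω` when it exists in `L²`). -/
def weakDeriv {d : ℕ} (Ω : Set (Sp d)) (β : Fin d → ℕ) (u : Sp d → ℝ) : Sp d → ℝ :=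
  if h : ∃ g, IsWeakDeriv Ω β u g then h.choose else 0

/-- The weak gradient of `u` on `Ω`. -/
def weakGrad {d : ℕ} (Ω : Set (Sp d)) (u : Sp d → ℝ) : Sp d → Sp d :=
  fun x => WithLp.toLp 2 (fun i => weakDeriv Ω (Pi.single i 1) u x)

/-- The square of the Sobolev semi-norm, `|u|²_{m,Ω} = ∑_{|β| = m} ‖D^β u‖²_{0,Ω}`. -/
def semiSq {d : ℕ} (Ω : Set (Sp d)) (m : ℕ) (u : Sp d → ℝ) : ℝ :=
  ∑ β ∈ Finset.piAntidiag (Finset.univ : Finset (Fin d)) m, ∫ x in Ω, (weakDeriv Ω β u x) ^ 2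

/-- The Sobolev semi-norm `|u|_{m,Ω}` of a scalar function. -/
def semi {d : ℕ} (Ω : Set (Sp d)) (m : ℕ) (u : Sp d → ℝ) : ℝ :=
  √(semiSq Ω m u)

/-- The Sobolev semi-norm `|p|_{m,Ω}` of a vector field. -/
def vecSemi {d : ℕ} (Ω : Set (Sp d)) (m : ℕ) (p : Sp d → Sp d) : ℝ :=
  √(∑ i, semiSq Ω m (fun x => p x i))

/-- `u ∈ H¹₀(Ω)`: `u ∈ H¹(Ω)` is an `H¹(Ω)`-limit of test functions on `Ω`. -/
structure MemH10 {d : ℕ} (Ω : Set (Sp d)) (u : Sp d → ℝ) : Prop where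
  memH : MemH Ω 1 u
  approx : ∃ φ : ℕ → Sp d → ℝ, (∀ n, IsTest Ω (φ n)) ∧
    Tendsto (fun n => eLpNorm (fun x => φ n x - u x) 2 (volume.restrict Ω)) atTop (𝓝 0) ∧
    ∀ i, Tendsto (fun n => eLpNorm
      (fun x => pderiv i (φ n) x - weakDeriv Ω (Pi.single i 1) u x) 2 (volume.restrict Ω))
      atTop (𝓝 0)

/-! ### The boundary value problem -/

/-- A polygonal (polyhedral) domain: a bounded connected open set that is the interior of its
closure. That it is polyhedral is expressed by the existence of a triangulation. -/
structure IsBddDomain {d : ℕ} (Ω : Set (Sp d)) : Prop where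
  isOpen : IsOpen Ω
  connected : IsConnected Ω
  bounded : Bornology.IsBounded Ω
  regular : interior (closure Ω) = Ω

/-- A measurable, bounded, symmetric and uniformly positive definite coefficient matrix on `Ω`. -/
structure IsCoefficient {d : ℕ} (Ω : Set (Sp d)) (α : Sp d → Matrix (Fin d) (Fin d) ℝ) :
    Prop where
  measurable : ∀ i j, AEMeasurable (fun x => α x i j) (volume.restrict Ω)
  bounded : ∃ M : ℝ, ∀ x ∈ Ω, ∀ i j, |α x i j| ≤ M
  symm : ∀ x ∈ Ω, (α x).IsSymm
  posDef : ∃ lam : ℝ, 0 < lam ∧ ∀ x ∈ Ω, ∀ ξ : Fin d → ℝ, lam * (ξ ⬝ᵥ ξ) ≤ ξ ⬝ᵥ (α x *ᵥ ξ)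

/-- The vector `c(x) q`, where `c = α⁻¹`. -/
def cMul {d : ℕ} (α : Sp d → Matrix (Fin d) (Fin d) ℝ) (x : Sp d) (q : Sp d) : Sp d :=
  WithLp.toLp 2 ((α x)⁻¹ *ᵥ (WithLp.ofLp q))

/-- `(p, u) ∈ L²(Ω)ᵈ × H¹(Ω)` solves `c p + ∇u = 0`, `div p = f` in `Ω` and `u = 0` on `∂Ω`. -/
structure IsExactSolution {d : ℕ} (Ω : Set (Sp d)) (α : Sp d → Matrix (Fin d) (Fin d) ℝ)
    (f : Sp d → ℝ) (p : Sp d → Sp d) (u : Sp d → ℝ) : Prop where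
  p_memLp : MemLp p 2 (volume.restrict Ω)
  u_mem : MemH10 Ω u
  flux : ∀ᵐ x ∂(volume.restrict Ω), cMul α x (p x) + weakGrad Ω u x = 0
  div_eq : ∀ φ : Sp d → ℝ, IsTest Ω φ →
    -∫ x in Ω, inner ℝ (p x) (gradient φ x) = ∫ x in Ω, f x * φ x

/-! ### Triangulations -/

/-- A (conforming) triangulation of `closure Ω`: a finite simplicial complex all of whose simplices
are faces of `d`-dimensional ones and whose union is `closure Ω`. Simplices are given by their
vertex sets. -/
structure Triangulation {d : ℕ} (Ω : Set (Sp d)) where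
  complex : Geometry.SimplicialComplex ℝ (Sp d)
  finite : complex.faces.Finite
  pure : ∀ s ∈ complex.faces, ∃ K ∈ complex.faces, s ⊆ K ∧ K.card = d + 1
  space_eq : complex.space = closure Ω

/-- The closed simplex with the given vertices. -/
def hull {d : ℕ} (s : Finset (Sp d)) : Set (Sp d) := convexHull ℝ (s : Set (Sp d))

/-- `diam K`; for an element `K` this is `h_K`. -/
def size {d : ℕ} (K : Finset (Sp d)) : ℝ := Metric.diam (hull K)

/-- The `(d-1)`-dimensional faces of an element `K`. -/
def sides {d : ℕ} (K : Finset (Sp d)) : Finset (Finset (Sp d)) := K.powersetCard d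

/-- The unit normal on the side `e` of `K` pointing out of `K`: the normalized component orthogonal
to `e` of the vector from the barycentre of `K` to the barycentre of `e`. -/
def outNormal {d : ℕ} (K e : Finset (Sp d)) : Sp d :=
  let w : Sp d := (vectorSpan ℝ (e : Set (Sp d)))ᗮ.starProjection
    (e.centroid ℝ id - K.centroid ℝ id)
  ‖w‖⁻¹ • w

/-- Lebesgue measure on an element. -/
def volOn {d : ℕ} (K : Finset (Sp d)) : Measure (Sp d) := volume.restrict (hull K)

/-- Surface measure on a side (counting measure if `d = 1`). -/
def surfOn {d : ℕ} (e : Finset (Sp d)) : Measure (Sp d) := (μHE[d - 1]).restrict (hull e)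

namespace Triangulation

variable {d : ℕ} {Ω : Set (Sp d)}

/-- The elements of the triangulation: its `d`-dimensional simplices. -/
def elements (T : Triangulation Ω) : Finset (Finset (Sp d)) :=
  {K ∈ T.finite.toFinset | K.card = d + 1}

/-- The mesh size `h = max_K h_K`. -/
def meshSize (T : Triangulation Ω) : ℝ := ⨆ K : T.elements, size K.1

/-- Shape regularity with constant `σ` (for `d = 2` this is the minimal angle condition): every
element `K` contains a ball of radius `h_K / σ`. -/
def ShapeRegular (T : Triangulation Ω) (σ : ℝ) : Prop :=
  ∀ K ∈ T.elements, ∃ x, Metric.closedBall x (size K / σ) ⊆ hull K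

end Triangulation

/-! ### Discrete spaces

A piecewise function is a family `v` indexed by the elements, `v K` being its restriction to `K`
(extended to `ℝᵈ` as a polynomial); a function on the skeleton is a family indexed by the sides. -/

/-- `v` is a polynomial function of degree at most `m`. -/
def IsPoly {d : ℕ} (m : ℕ) (v : Sp d → ℝ) : Prop :=
  ∃ P : MvPolynomial (Fin d) ℝ, P.totalDegree ≤ m ∧ ∀ x, v x = MvPolynomial.eval (fun i => x i) P

/-- `v ∈ V_h^m`: piecewise polynomials of degree at most `m`. -/
def MemV {d : ℕ} {Ω : Set (Sp d)} (T : Triangulation Ω) (m : ℕ)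
    (v : Finset (Sp d) → Sp d → ℝ) : Prop :=
  ∀ K ∈ T.elements, IsPoly m (v K)

/-- `q ∈ Q_h^m`: piecewise vector polynomials of degree at most `m`. -/
def MemQ {d : ℕ} {Ω : Set (Sp d)} (T : Triangulation Ω) (m : ℕ)
    (q : Finset (Sp d) → Sp d → Sp d) : Prop :=
  ∀ K ∈ T.elements, ∀ i, IsPoly m (fun x => q K x i)

/-- `v ∈ V̂_h^m`: polynomial of degree at most `m` on every interior side, zero on the sides that
lie on `∂Ω`. -/
def MemVhat {d : ℕ} {Ω : Set (Sp d)} (T : Triangulation Ω) (m : ℕ)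
    (v : Finset (Sp d) → Sp d → ℝ) : Prop :=
  ∀ K ∈ T.elements, ∀ e ∈ sides K,
    (hull e ⊆ frontier Ω → ∀ x ∈ hull e, v e x = 0) ∧
    (¬ hull e ⊆ frontier Ω → ∃ P : Sp d → ℝ, IsPoly m P ∧ Set.EqOn (v e) P (hull e))

/-! ### The HDG method -/

/-- The divergence of a (classically differentiable) vector field. -/
def divg {d : ℕ} (q : Sp d → Sp d) (x : Sp d) : ℝ := ∑ i, pderiv i (fun y => q y i) x

section Forms

variable {d : ℕ} {Ω : Set (Sp d)} (T : Triangulation Ω)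

/-- `a_h(p, q) = (c p, q)_{𝒯_h}`. -/
def aForm (α : Sp d → Matrix (Fin d) (Fin d) ℝ) (p q : Finset (Sp d) → Sp d → Sp d) : ℝ :=
  ∑ K ∈ T.elements, ∫ x, inner ℝ (cMul α x (p K x)) (q K x) ∂(volOn K)

/-- `b_h(q, (u, û)) = -(u, div q)_{𝒯_h} + ⟨û, q · n_K⟩_{∂𝒯_h}`. -/
def bForm (q : Finset (Sp d) → Sp d → Sp d) (u uhat : Finset (Sp d) → Sp d → ℝ) : ℝ :=
  -(∑ K ∈ T.elements, ∫ x, u K x * divg (q K) x ∂(volOn K)) +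
    ∑ K ∈ T.elements, ∑ e ∈ sides K,
      ∫ x, uhat e x * inner ℝ (q K x) (outNormal K e) ∂(surfOn e)

/-- `c_h((u, û), (v, v̂)) = -⟨τ (u - û), v - v̂⟩_{∂𝒯_h}`, with `τ` constant on each `∂K`. -/
def cForm (τ : Finset (Sp d) → ℝ) (u uhat v vhat : Finset (Sp d) → Sp d → ℝ) : ℝ :=
  -(∑ K ∈ T.elements, (τ K * ∑ e ∈ sides K,
      ∫ x, (u K x - uhat e x) * (v K x - vhat e x) ∂(surfOn e)))

/-- `(f, v)_{𝒯_h}`. -/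
def load (f : Sp d → ℝ) (v : Finset (Sp d) → Sp d → ℝ) : ℝ :=
  ∑ K ∈ T.elements, ∫ x, f x * v K x ∂(volOn K)

/-- `(p, (u, û))` is a solution of the HDG method with stabilization `τ` and the spaces
`Q_h^k × (V_h^l × V̂_h^r)`. -/
structure IsHDGSolution (α : Sp d → Matrix (Fin d) (Fin d) ℝ) (f : Sp d → ℝ)
    (τ : Finset (Sp d) → ℝ) (k l r : ℕ) (p : Finset (Sp d) → Sp d → Sp d)
    (u uhat : Finset (Sp d) → Sp d → ℝ) : Prop where
  p_mem : MemQ T k p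
  u_mem : MemV T l u
  uhat_mem : MemVhat T r uhat
  eq_flux : ∀ q, MemQ T k q → aForm T α p q + bForm T q u uhat = 0
  eq_div : ∀ v vhat, MemV T l v → MemVhat T r vhat →
    bForm T p v vhat + cForm T τ u uhat v vhat = -load T f v

/-! ### Norms -/

/-- The norm `‖q‖ = (c q, q)_{𝒯_h}^{1/2}` of a piecewise vector field. -/
def fluxNorm (α : Sp d → Matrix (Fin d) (Fin d) ℝ) (q : Finset (Sp d) → Sp d → Sp d) : ℝ :=
  √(aForm T α q q)

/-- The norm
`‖(v, v̂)‖_{1̃,ρ,h} = ((∇_h v, ∇_h v)_{𝒯_h} + ρ⁻¹ ∑_K h_K⁻¹ ⟨v - v̂, v - v̂⟩_{∂K})^{1/2}`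
of a piecewise `H¹` function `v`, given by its piecewise gradient `G = ∇_h v` and its traces
`w K = v|_K` on the boundaries `∂K`, and a function `what = v̂` on the skeleton. -/
def tildeNorm (ρ : ℝ) (G : Finset (Sp d) → Sp d → Sp d) (w what : Finset (Sp d) → Sp d → ℝ) : ℝ :=
  √((∑ K ∈ T.elements, ∫ x, inner ℝ (G K x) (G K x) ∂(volOn K)) +
    ρ⁻¹ * ∑ K ∈ T.elements, ((size K)⁻¹ * ∑ e ∈ sides K,
      ∫ x, (w K x - what e x) * (w K x - what e x) ∂(surfOn e)))

/-- `t` is the trace of `u ∈ H¹(Ω)` on the skeleton: on every element `K`, there are smooth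
functions that converge to `u` in `H¹(K)` and whose restrictions to `∂K` converge to `t` in
`L²(∂K)`. -/
def IsSkeletonTrace (u t : Sp d → ℝ) : Prop :=
  ∀ K ∈ T.elements, ∃ φ : ℕ → Sp d → ℝ, (∀ n, ContDiff ℝ ∞ (φ n)) ∧
    Tendsto (fun n => eLpNorm (fun x => φ n x - u x) 2 (volOn K)) atTop (𝓝 0) ∧
    (∀ i, Tendsto (fun n => eLpNorm
      (fun x => pderiv i (φ n) x - weakDeriv Ω (Pi.single i 1) u x) 2 (volOn K)) atTop (𝓝 0)) ∧
    ∀ e ∈ sides K, Tendsto (fun n => eLpNorm (fun x => φ n x - t x) 2 (surfOn e)) atTop (𝓝 0)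

end Forms

end HDG

end

open MeasureTheory Filter Topology
open scoped ContDiff Matrix ENNReal

noncomputable section

namespace HDG

open scoped Classical

variable {d : ℕ}

/-! The estimate is an energy argument for the discrete errors, in which `u` is compared with a
function that is continuous across the elements. Let `Q` be a piecewise polynomial of degree `k`
close to `p`, and let `I`, with skeleton values `Ie`, be a conforming piecewise polynomial of degree
`k + 1` close to `u` and zero on `∂Ω`. Put `E = Q - ph`, `ψ = ∇(uh - I)` and let `w = uh - uhat` be
the gap on the element boundaries. Integration by parts on each element turns the method into two
error identities, `error_flux` and `error_div`. Since `I` is conforming, the pair `(uh - I, uhat -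
Ie)` also has gap `w`. The first identity tested with `E` and the second tested with this pair are
added: the couplings `(ψ, E)` and `⟨w, E · n⟩` cancel, and `‖E‖² + ρ⁻¹ ∑ h_K⁻¹ ‖w‖²` is left against
products of approximation errors with discrete errors. For the missing gradient, `ψ` is itself a
piecewise polynomial of degree `k`, so the first identity may be tested with it, and the discrete
trace inequality bounds `‖ψ‖` by `‖E‖`, the gap and approximation errors. Young's inequality with
small weights closes the loop (`exists_energy_const`, `exists_energy_estimate`). Only `ρ⁻¹ ≥ 1` is
needed, whence `ρ₀ = 1`.

What remains is approximation theory. For `Q` (`exists_flux_approx`), the polynomial having the same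
means of derivatives as the given function on an element is accurate by repeated use of Poincaré's
inequality (`SobFam.exists_poly`), and the trace inequality handles its boundary values. For `I`
(`exists_interpolant`), `u` need not be continuous when `d` is large, so there are no nodal values
to interpolate. Instead the elementwise approximations of `u` are glued through their Bernstein
coefficients: a coefficient whose exponent is supported on a face belongs to all elements containing
that face, and it is replaced by one common value, zero on the boundary (`exists_conforming`). The
change is bounded by the jumps met on a chain of side-adjacent elements around the face. By
`reachable_of_interior` such a chain either reaches any prescribed element of the star or meets a
boundary side, where zero is the right value anyway; hence no Lipschitz condition on `Ω` is needed.
Chains are short because few elements meet at a vertex (`card_vertex_star_le`).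

The analysis on a simplex rests on cone coordinates for Hausdorff surface measure (`volOn_eq_map`).
They give the divergence theorem for radial fields (`integral_radial`), and from it Green's formula
and the trace inequality. Both pass to `H¹(K)` because smooth functions are dense there
(`exists_approxH1`). Consistency of the method needs that the normal traces of `p` from the two
elements at an interior side are opposite (`ae_sum_trace_eq_zero`). -/

/-! ### Barycentric coordinates -/

/-- `K` is the vertex set of a nondegenerate `d`-simplex. -/
structure IsSimplex (K : Finset (Sp d)) : Prop where
  indep : AffineIndependent ℝ ((↑) : K → Sp d)
  card : K.card = d + 1

/-- The affine basis given by the vertices of a simplex. -/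
def IsSimplex.basis {K : Finset (Sp d)} (hK : IsSimplex K) : AffineBasis K ℝ (Sp d) where
  toFun := (↑)
  ind' := hK.indep
  tot' := by
    rw [hK.indep.affineSpan_eq_top_iff_card_eq_finrank_add_one]
    simp [hK.card]

@[simp] lemma IsSimplex.basis_apply {K : Finset (Sp d)} (hK : IsSimplex K) (v : K) :
    hK.basis v = (v : Sp d) := rfl

/-- The barycentric coordinate of `x` with respect to the vertex `v` of `K`. -/
def bary (K : Finset (Sp d)) (v x : Sp d) : ℝ :=
  -- The value zero off the vertices lets nonnegativity, the bound by one, continuity and degree at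
  -- most one hold for every `v`, without a membership hypothesis.
  if h : IsSimplex K ∧ v ∈ K then h.1.basis.coord ⟨v, h.2⟩ x else 0

lemma bary_eq_zero {K : Finset (Sp d)} {v : Sp d} (hv : v ∉ K) (x : Sp d) : bary K v x = 0 := by
  simp [bary, hv]

namespace IsSimplex

variable {K : Finset (Sp d)} (hK : IsSimplex K)
include hK

lemma bary_eq {v : Sp d} (hv : v ∈ K) (x : Sp d) : bary K v x = hK.basis.coord ⟨v, hv⟩ x := by
  simp [bary, hK, hv]

lemma sum_bary (x : Sp d) : ∑ v ∈ K, bary K v x = 1 := by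
  rw [← Finset.sum_coe_sort, ← hK.basis.sum_coord_apply_eq_one x]
  exact Finset.sum_congr rfl fun v _ => hK.bary_eq v.2 x

lemma sum_bary_smul (x : Sp d) : ∑ v ∈ K, bary K v x • v = x := by
  rw [← Finset.sum_coe_sort]
  conv_rhs => rw [← hK.basis.linear_combination_coord_eq_self x]
  exact Finset.sum_congr rfl fun v _ => by rw [hK.bary_eq v.2 x, hK.basis_apply]

lemma bary_lineMap {v : Sp d} (hv : v ∈ K) (x y : Sp d) (s : ℝ) :
    bary K v (x + s • (y - x)) = bary K v x + s * (bary K v y - bary K v x) := by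
  have : x + s • (y - x) = AffineMap.lineMap x y s := by
    simp [AffineMap.lineMap_apply, add_comm]
  rw [this, hK.bary_eq hv, hK.bary_eq hv, hK.bary_eq hv, AffineMap.apply_lineMap]
  simp [AffineMap.lineMap_apply, add_comm]

lemma bary_sum {l : Sp d → ℝ} (hl : ∑ w ∈ K, l w = 1) {v : Sp d} (hv : v ∈ K) :
    bary K v (∑ w ∈ K, l w • w) = l v := by
  rw [hK.bary_eq hv]
  have h1 : ∑ w : K, l w = 1 := by rw [← hl, ← Finset.sum_coe_sort K]
  have h2 : ∑ w ∈ K, l w • w = (Finset.univ : Finset K).affineCombination ℝ hK.basis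
      (fun w => l w) := by
    rw [Finset.affineCombination_eq_linear_combination _ _ _ h1, ← Finset.sum_coe_sort]
    rfl
  rw [h2, hK.basis.coord_apply_combination_of_mem (Finset.mem_univ _) h1]

lemma bary_self {v : Sp d} (hv : v ∈ K) : bary K v v = 1 := by
  rw [hK.bary_eq hv]
  exact hK.basis.coord_apply_eq ⟨v, hv⟩

lemma bary_of_ne {v w : Sp d} (hv : v ∈ K) (hw : w ∈ K) (h : v ≠ w) : bary K v w = 0 := by
  rw [hK.bary_eq hv]
  exact hK.basis.coord_apply_ne (i := ⟨v, hv⟩) (j := ⟨w, hw⟩) (by simpa using h)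

lemma continuous_bary (v : Sp d) : Continuous (bary K v) := by
  by_cases hv : v ∈ K
  · have : bary K v = hK.basis.coord ⟨v, hv⟩ := funext (hK.bary_eq hv)
    rw [this]
    exact AffineMap.continuous_of_finiteDimensional _
  · have : bary K v = fun _ => 0 := funext (HDG.bary_eq_zero hv)
    rw [this]; exact continuous_const

lemma mem_hull_iff {x : Sp d} : x ∈ hull K ↔ ∀ v ∈ K, 0 ≤ bary K v x := by
  have h := hK.basis.convexHull_eq_nonneg_coord
  have hr : Set.range hK.basis = (K : Set (Sp d)) := by
    ext y; simp
  rw [hr] at h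
  rw [hull, h]
  simp only [Set.mem_ofPred_eq, Subtype.forall]
  exact forall₂_congr fun v hv => by rw [hK.bary_eq hv]

lemma mem_interior_iff {x : Sp d} : x ∈ interior (hull K) ↔ ∀ v ∈ K, 0 < bary K v x := by
  have h := hK.basis.interior_convexHull
  have hr : Set.range hK.basis = (K : Set (Sp d)) := by
    ext y; simp
  rw [hr] at h
  rw [hull, h]
  simp only [Set.mem_ofPred_eq, Subtype.forall]
  exact forall₂_congr fun v hv => by rw [hK.bary_eq hv]

lemma bary_nonneg {x : Sp d} (hx : x ∈ hull K) (v : Sp d) : 0 ≤ bary K v x := by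
  by_cases hv : v ∈ K
  · exact hK.mem_hull_iff.1 hx v hv
  · rw [HDG.bary_eq_zero hv]

lemma bary_le_one {x : Sp d} (hx : x ∈ hull K) (v : Sp d) : bary K v x ≤ 1 := by
  by_cases hv : v ∈ K
  · rw [← hK.sum_bary x]
    exact Finset.single_le_sum (f := fun v => bary K v x) (fun w _ => hK.bary_nonneg hx w) hv
  · rw [HDG.bary_eq_zero hv]; exact zero_le_one

lemma nonempty : K.Nonempty := Finset.card_pos.1 (by rw [hK.card]; omega)

lemma interior_nonempty : (interior (hull K)).Nonempty := by
  have hc : (0 : ℝ) < K.card := by exact_mod_cast hK.nonempty.card_pos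
  have h1 : ∑ w ∈ K, (fun _ : Sp d => (K.card : ℝ)⁻¹) w = 1 := by
    simp [hc.ne']
  refine ⟨∑ w ∈ K, (fun _ : Sp d => (K.card : ℝ)⁻¹) w • w, hK.mem_interior_iff.2 fun v hv => ?_⟩
  rw [hK.bary_sum h1 hv]
  positivity

end IsSimplex

lemma convex_hull (s : Finset (Sp d)) : Convex ℝ (hull s) := convex_convexHull ℝ _

lemma isCompact_hull (s : Finset (Sp d)) : IsCompact (hull s) :=
  s.finite_toSet.isCompact_convexHull (𝕜 := ℝ)

lemma isClosed_hull (s : Finset (Sp d)) : IsClosed (hull s) := (isCompact_hull s).isClosed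

lemma measurableSet_hull (s : Finset (Sp d)) : MeasurableSet (hull s) :=
  (isClosed_hull s).measurableSet

lemma mem_hull_of_mem {s : Finset (Sp d)} {v : Sp d} (hv : v ∈ s) : v ∈ hull s :=
  subset_convexHull ℝ _ hv

lemma hull_mono {s t : Finset (Sp d)} (h : s ⊆ t) : hull s ⊆ hull t :=
  convexHull_mono (by exact_mod_cast h)

lemma mem_hull_iff_exists {s : Finset (Sp d)} {x : Sp d} :
    x ∈ hull s ↔ ∃ l : Sp d → ℝ, (∀ w ∈ s, 0 ≤ l w) ∧ ∑ w ∈ s, l w = 1 ∧ ∑ w ∈ s, l w • w = x := by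
  rw [hull, Finset.mem_convexHull]
  constructor
  · rintro ⟨l, h0, h1, h2⟩
    refine ⟨l, h0, h1, ?_⟩
    rwa [Finset.centerMass_eq_of_sum_1 _ _ h1] at h2
  · rintro ⟨l, h0, h1, h2⟩
    refine ⟨l, h0, h1, ?_⟩
    rwa [Finset.centerMass_eq_of_sum_1 _ _ h1]

/-- Weights on a face become weights on the whole simplex by zero extension. This is how
combinations of the vertices of a face are read in the barycentric coordinates of `K`. -/
lemma sum_extend {s K : Finset (Sp d)} (h : s ⊆ K) {M : Type*} [AddCommMonoid M] [Module ℝ M]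
    (l : Sp d → ℝ) (f : Sp d → M) :
    ∑ w ∈ K, (if w ∈ s then l w else 0) • f w = ∑ w ∈ s, l w • f w := by
  rw [← Finset.sum_subset h]
  · exact Finset.sum_congr rfl fun w hw => by simp [hw]
  · intro w _ hw; simp [hw]

/-- By uniqueness of barycentric coordinates. It reduces questions about faces, sides and
intersections of elements to signs and zeros of coordinates. -/
lemma IsSimplex.mem_hull_face_iff {K s : Finset (Sp d)} (hK : IsSimplex K) (h : s ⊆ K) {x : Sp d} :
    x ∈ hull s ↔ (∀ v ∈ K, 0 ≤ bary K v x) ∧ ∀ v ∈ K, v ∉ s → bary K v x = 0 := by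
  constructor
  · intro hx
    refine ⟨hK.mem_hull_iff.1 (hull_mono h hx), fun v hv hvs => ?_⟩
    obtain ⟨l, h0, h1, rfl⟩ := mem_hull_iff_exists.1 hx
    rw [← sum_extend h l (fun w => w), hK.bary_sum _ hv]
    · simp [hvs]
    · have := sum_extend h l (fun _ => (1 : ℝ))
      simpa [h1] using this
  · rintro ⟨h0, h1⟩
    refine mem_hull_iff_exists.2 ⟨fun v => bary K v x, fun w hw => h0 w (h hw), ?_, ?_⟩
    · rw [← hK.sum_bary x]
      exact Finset.sum_subset h fun v hv hvs => h1 v hv hvs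
    · conv_rhs => rw [← hK.sum_bary_smul x]
      exact Finset.sum_subset h fun v hv hvs => by simp [h1 v hv hvs]

lemma IsSimplex.mem_hull_erase_iff {K : Finset (Sp d)} (hK : IsSimplex K) {a x : Sp d}
    (ha : a ∈ K) : x ∈ hull (K.erase a) ↔ x ∈ hull K ∧ bary K a x = 0 := by
  rw [hK.mem_hull_face_iff (Finset.erase_subset _ _), hK.mem_hull_iff]
  refine and_congr_right fun _ => ⟨fun h => h a ha (by simp), fun h v hv hva => ?_⟩
  have : v = a := by by_contra hne; exact hva (Finset.mem_erase.2 ⟨hne, hv⟩)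
  rwa [this]

lemma IsSimplex.mem_sides_iff {K e : Finset (Sp d)} (hK : IsSimplex K) :
    e ∈ sides K ↔ ∃ a ∈ K, e = K.erase a := by
  rw [sides, Finset.mem_powersetCard]
  constructor
  · rintro ⟨h1, h2⟩
    have h3 : (K \ e).card = 1 := by rw [Finset.card_sdiff_of_subset h1, hK.card, h2]; omega
    obtain ⟨a, ha⟩ := Finset.card_eq_one.1 h3
    have ha' : a ∈ K \ e := by rw [ha]; simp
    refine ⟨a, (Finset.mem_sdiff.1 ha').1, ?_⟩
    rw [Finset.erase_eq, ← ha, Finset.sdiff_sdiff_eq_self h1]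
  · rintro ⟨a, ha, rfl⟩
    exact ⟨Finset.erase_subset _ _, by rw [Finset.card_erase_of_mem ha, hK.card]; rfl⟩

lemma IsSimplex.sum_sides {K : Finset (Sp d)} (hK : IsSimplex K) {M : Type*} [AddCommMonoid M]
    (F : Finset (Sp d) → M) : ∑ e ∈ sides K, F e = ∑ a ∈ K, F (K.erase a) := by
  have : sides K = K.image fun a => K.erase a := by
    ext e
    rw [hK.mem_sides_iff, Finset.mem_image]
    exact ⟨fun ⟨a, ha, h⟩ => ⟨a, ha, h.symm⟩, fun ⟨a, ha, h⟩ => ⟨a, ha, h.symm⟩⟩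
  rw [this, Finset.sum_image]
  intro a ha b hb hab
  by_contra hne
  have h1 : b ∈ K.erase a := Finset.mem_erase.2 ⟨fun h => hne h.symm, hb⟩
  have h2 : K.erase a = K.erase b := hab
  rw [h2] at h1
  simp at h1

lemma IsSimplex.erase_nonempty {K : Finset (Sp d)} (hK : IsSimplex K) (hd : 1 ≤ d) {a : Sp d}
    (ha : a ∈ K) : (K.erase a).Nonempty :=
  Finset.card_pos.1 (by rw [Finset.card_erase_of_mem ha, hK.card]; omega)

/-! ### Normals and heights -/

/-- The height of `K` over the side opposite to the vertex `a`. -/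
def height (K : Finset (Sp d)) (a : Sp d) : ℝ :=
  inner ℝ ((K.erase a).centroid ℝ id - a) (outNormal K (K.erase a))

section Normal

variable {K : Finset (Sp d)} (hK : IsSimplex K) (hd : 1 ≤ d) {a : Sp d} (ha : a ∈ K)
include hK hd ha

/-- `outNormal` is defined by the two barycentres, `height` by the vertex and the barycentre of the
side; the two vectors differ by a positive factor, so they have the same normalized projection. -/
lemma IsSimplex.centroid_sub :
    (K.erase a).centroid ℝ id - K.centroid ℝ id =
      ((d : ℝ) + 1)⁻¹ • ((K.erase a).centroid ℝ id - a) := by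
  have hc : (K.erase a).card = d := by rw [Finset.card_erase_of_mem ha, hK.card]; rfl
  have hd0 : (d : ℝ) ≠ 0 := by positivity
  have hd1 : (d : ℝ) + 1 ≠ 0 := by positivity
  have h1 : (K.erase a).centroid ℝ id = (d : ℝ)⁻¹ • ∑ v ∈ K.erase a, v := by
    rw [Finset.centroid_def, Finset.affineCombination_eq_linear_combination]
    · simp [Finset.centroidWeights, Finset.smul_sum, hc]
    · exact Finset.sum_centroidWeights_eq_one_of_nonempty ℝ _ (hK.erase_nonempty hd ha)
  have h2 : K.centroid ℝ id = ((d : ℝ) + 1)⁻¹ • (a + ∑ v ∈ K.erase a, v) := by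
    rw [Finset.centroid_def, Finset.affineCombination_eq_linear_combination]
    · rw [Finset.add_sum_erase _ (fun v : Sp d => v) ha]
      simp [Finset.centroidWeights, Finset.smul_sum, hK.card]
    · exact Finset.sum_centroidWeights_eq_one_of_nonempty ℝ _ hK.nonempty
  rw [h1, h2]
  have : ((d : ℝ) + 1)⁻¹ = (d : ℝ)⁻¹ - ((d : ℝ) + 1)⁻¹ * (d : ℝ)⁻¹ := by field_simp; ring
  generalize (∑ v ∈ K.erase a, v) = S
  have h3 : (d : ℝ)⁻¹ • S - ((d : ℝ) + 1)⁻¹ • S = (((d : ℝ) + 1)⁻¹ * (d : ℝ)⁻¹) • S := by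
    rw [← sub_smul]; congr 1; linarith
  rw [smul_add, smul_sub, smul_smul, ← h3]
  abel

omit hd in
lemma IsSimplex.bary_of_mem_affineSpan {x : Sp d}
    (hx : x ∈ affineSpan ℝ ((K.erase a : Finset (Sp d)) : Set (Sp d))) : bary K a x = 0 := by
  have h : affineSpan ℝ ((K.erase a : Finset (Sp d)) : Set (Sp d)) ≤
      (AffineSubspace.mk' (0 : ℝ) ⊥).comap (hK.basis.coord ⟨a, ha⟩) := by
    rw [affineSpan_le]
    intro v hv
    have hv' := Finset.mem_erase.1 (Finset.mem_coe.1 hv)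
    have := hK.bary_of_ne ha hv'.2 (Ne.symm hv'.1)
    rw [hK.bary_eq ha] at this
    simp [this]
  have := h hx
  rw [hK.bary_eq ha]
  simpa using this

omit ha hK hd in
lemma mem_affineSpan_of_mem_hull {e : Finset (Sp d)} {y : Sp d} (hy : y ∈ hull e) :
    y ∈ affineSpan ℝ (e : Set (Sp d)) := convexHull_subset_affineSpan _ hy

lemma IsSimplex.centroid_mem : (K.erase a).centroid ℝ id ∈ hull (K.erase a) := by
  have := Finset.centroid_mem_convexHull (R := ℝ) (K.erase a) (hK.erase_nonempty hd ha)
  simpa [hull] using this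

/-- The projected vector cannot vanish: otherwise `a` would lie in the affine span of the opposite
side, where its own coordinate is zero, whereas that coordinate is one at `a`. -/
lemma IsSimplex.outNormal_spec :
    (∀ x ∈ affineSpan ℝ ((K.erase a : Finset (Sp d)) : Set (Sp d)),
      ∀ y ∈ affineSpan ℝ ((K.erase a : Finset (Sp d)) : Set (Sp d)),
      inner ℝ (x - y) (outNormal K (K.erase a)) = 0) ∧ ‖outNormal K (K.erase a)‖ = 1 ∧
    0 < height K a := by
  set V := vectorSpan ℝ ((K.erase a : Finset (Sp d)) : Set (Sp d)) with hV
  set c := (K.erase a).centroid ℝ id with hc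
  have hcm := mem_affineSpan_of_mem_hull (hK.centroid_mem hd ha)
  set ν := Vᗮ.starProjection (c - a) with hν
  have hw : outNormal K (K.erase a) = ‖((d : ℝ) + 1)⁻¹ • ν‖⁻¹ • (((d : ℝ) + 1)⁻¹ • ν) := by
    rw [outNormal, hK.centroid_sub hd ha, map_smul]
  have hd1 : (0 : ℝ) < ((d : ℝ) + 1)⁻¹ := by positivity
  have hν0 : ν ≠ 0 := by
    intro h0
    have : c - a ∈ V := by
      have := (Submodule.starProjection_apply_eq_zero_iff (K := Vᗮ)).1 (hν.symm.trans h0)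
      rwa [Submodule.orthogonal_orthogonal] at this
    have h2 : a ∈ affineSpan ℝ ((K.erase a : Finset (Sp d)) : Set (Sp d)) := by
      have h3 : -(c - a) ∈ (affineSpan ℝ ((K.erase a : Finset (Sp d)) : Set (Sp d))).direction := by
        rw [direction_affineSpan]; exact V.neg_mem this
      have := AffineSubspace.vadd_mem_of_mem_direction h3 hcm
      rwa [← hc, vadd_eq_add, neg_sub, sub_add_cancel] at this
    have h4 := hK.bary_of_mem_affineSpan ha h2
    rw [hK.bary_self ha] at h4
    exact one_ne_zero h4
  have hn : outNormal K (K.erase a) = ‖ν‖⁻¹ • ν := by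
    rw [hw, norm_smul, Real.norm_of_nonneg hd1.le, smul_smul]
    congr 1
    field_simp
  have hνpos : 0 < ‖ν‖ := norm_pos_iff.2 hν0
  have hνmem : ν ∈ Vᗮ := Submodule.starProjection_apply_mem _ _
  refine ⟨fun x hx y hy => ?_, ?_, ?_⟩
  · rw [hn, inner_smul_right]
    have hxy : x - y ∈ V := by
      have := AffineSubspace.vsub_mem_direction hx hy
      rwa [direction_affineSpan] at this
    rw [(Submodule.mem_orthogonal _ _).1 hνmem _ hxy, mul_zero]
  · rw [hn, norm_smul, norm_inv, norm_norm, inv_mul_cancel₀ hνpos.ne']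
  · rw [height, hn, inner_smul_right]
    have : inner ℝ (c - a) ν = ‖ν‖ ^ 2 := by
      have h1 : c - a = V.starProjection (c - a) + ν :=
        (Submodule.starProjection_add_starProjection_orthogonal (K := V) (c - a)).symm
      rw [h1, inner_add_left, real_inner_self_eq_norm_sq,
        (Submodule.mem_orthogonal _ _).1 hνmem _ (Submodule.starProjection_apply_mem _ _), zero_add]
    rw [← hc, this]
    positivity

lemma IsSimplex.norm_outNormal : ‖outNormal K (K.erase a)‖ = 1 := (hK.outNormal_spec hd ha).2.1

lemma IsSimplex.height_pos : 0 < height K a := (hK.outNormal_spec hd ha).2.2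

lemma IsSimplex.inner_outNormal {y : Sp d} (hy : y ∈ hull (K.erase a)) :
    inner ℝ (y - a) (outNormal K (K.erase a)) = height K a := by
  have h := (hK.outNormal_spec hd ha).1 _ (mem_affineSpan_of_mem_hull hy) _
    (mem_affineSpan_of_mem_hull (hK.centroid_mem hd ha))
  rw [height, ← sub_eq_zero, ← inner_sub_left]
  simpa using h

/-- Both sides are affine in `x` and agree at the vertices of `K`. In other words the gradient of
`bary K a` is the outward normal divided by minus the height. -/
lemma IsSimplex.inner_outNormal_eq (x : Sp d) :
    inner ℝ (x - a) (outNormal K (K.erase a)) = height K a * (1 - bary K a x) := by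
  have h1 : x - a = ∑ v ∈ K, bary K v x • (v - a) := by
    simp_rw [smul_sub, Finset.sum_sub_distrib, ← Finset.sum_smul, hK.sum_bary, hK.sum_bary_smul,
      one_smul]
  have h2 : ∑ v ∈ K.erase a, bary K v x = 1 - bary K a x := by
    rw [← hK.sum_bary x, ← Finset.add_sum_erase _ _ ha]; ring
  rw [h1, sum_inner, ← Finset.add_sum_erase _ _ ha, ← h2, Finset.mul_sum]
  simp only [sub_self, smul_zero, inner_zero_left, zero_add]
  refine Finset.sum_congr rfl fun v hv => ?_
  rw [real_inner_smul_left, hK.inner_outNormal hd ha (mem_hull_of_mem hv), mul_comm]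

lemma IsSimplex.inner_div_height (w : Sp d) :
    inner ℝ w (outNormal K (K.erase a)) / height K a = bary K a 0 - bary K a w := by
  have h1 := hK.inner_outNormal_eq hd ha w
  have h2 := hK.inner_outNormal_eq hd ha 0
  have hH := hK.height_pos hd ha
  rw [div_eq_iff hH.ne']
  have : w = (w - a) - (0 - a) := by abel
  conv_lhs => rw [this]
  rw [inner_sub_left, h1, h2]; ring

end Normal

section Normal

variable {K : Finset (Sp d)} (hK : IsSimplex K) (hd : 1 ≤ d)
include hK hd

/-- The coordinates add up to a constant, so their gradients cancel. Together with the next identity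
this writes a constant field as a combination of the radial fields `x - a`. -/
lemma IsSimplex.sum_inner_div_height (w : Sp d) :
    ∑ a ∈ K, inner ℝ w (outNormal K (K.erase a)) / height K a = 0 := by
  rw [Finset.sum_congr rfl fun a ha => hK.inner_div_height hd ha w, Finset.sum_sub_distrib,
    hK.sum_bary, hK.sum_bary, sub_self]

lemma IsSimplex.sum_inner_div_height_smul (w : Sp d) :
    ∑ a ∈ K, (inner ℝ w (outNormal K (K.erase a)) / height K a) • a = -w := by
  rw [Finset.sum_congr rfl fun a ha => by rw [hK.inner_div_height hd ha w]]
  simp_rw [sub_smul]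
  rw [Finset.sum_sub_distrib, hK.sum_bary_smul, hK.sum_bary_smul, zero_sub]

end Normal

/-! ### Sizes -/

lemma dist_le_size {K : Finset (Sp d)} {x y : Sp d} (hx : x ∈ hull K) (hy : y ∈ hull K) :
    dist x y ≤ size K :=
  Metric.dist_le_diam_of_mem (isCompact_hull K).isBounded hx hy

section Size

variable {K : Finset (Sp d)} (hK : IsSimplex K) (hd : 1 ≤ d) {a : Sp d} (ha : a ∈ K)
include hK hd ha

lemma IsSimplex.height_le_norm {y : Sp d} (hy : y ∈ hull (K.erase a)) : height K a ≤ ‖y - a‖ := by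
  rw [← hK.inner_outNormal hd ha hy]
  refine (real_inner_le_norm _ _).trans ?_
  rw [hK.norm_outNormal hd ha, mul_one]

lemma IsSimplex.height_le_size : height K a ≤ size K := by
  refine (hK.height_le_norm hd ha (hK.centroid_mem hd ha)).trans ?_
  rw [← dist_eq_norm]
  exact dist_le_size (hull_mono (Finset.erase_subset _ _) (hK.centroid_mem hd ha))
    (mem_hull_of_mem ha)

/-- On `K` the coordinate of `a` stays in `[0, 1]`, so the extent of `K` in the normal direction is
at most the height, and the ball needs its diameter there. Through this bound shape regularity makes
every height comparable with `size K`. -/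
lemma IsSimplex.two_mul_le_height {x : Sp d} {r : ℝ} (hr : 0 ≤ r)
    (hb : Metric.closedBall x r ⊆ hull K) : 2 * r ≤ height K a := by
  set n := outNormal K (K.erase a) with hn
  have hn1 : ‖n‖ = 1 := hK.norm_outNormal hd ha
  have h1 : x + r • n ∈ hull K := hb (by simp [norm_smul, hn1, abs_of_nonneg hr])
  have h2 : x - r • n ∈ hull K := hb (by simp [norm_smul, hn1, abs_of_nonneg hr])
  have e1 := hK.inner_outNormal_eq hd ha (x + r • n)
  have e2 := hK.inner_outNormal_eq hd ha (x - r • n)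
  have b1 := hK.bary_nonneg h1 a
  have b2 := hK.bary_le_one h2 a
  have hH := hK.height_pos hd ha
  rw [← hn] at e1 e2
  have e3 : inner ℝ (x + r • n - a) n - inner ℝ (x - r • n - a) n = 2 * r := by
    rw [← inner_sub_left]
    have : x + r • n - a - (x - r • n - a) = (2 * r) • n := by module
    rw [this, real_inner_smul_left, real_inner_self_eq_norm_sq, hn1]; ring
  nlinarith

omit ha in
lemma IsSimplex.size_pos : 0 < size K := by
  obtain ⟨a, ha⟩ := hK.nonempty
  exact (hK.height_pos hd ha).trans_le (hK.height_le_size hd ha)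

end Size

/-! ### Surface measure and the cone formula -/

section Cone

variable {K : Finset (Sp d)} (hK : IsSimplex K) (hd : 1 ≤ d) {a : Sp d} (ha : a ∈ K)
include hK hd ha

/-- The side is an isometric image of a compact set in its direction space, whose dimension is `d -
1`, and there the measure is finite on compact sets. -/
lemma IsSimplex.surfOn_univ_lt_top : surfOn (K.erase a) Set.univ < ⊤ := by
  set e := K.erase a with he
  have hind : AffineIndependent ℝ ((↑) : e → Sp d) :=
    hK.indep.mono (by rw [he]; exact_mod_cast Finset.erase_subset a K)
  have hcard : e.card = d := by rw [he, Finset.card_erase_of_mem ha, hK.card]; rfl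
  set V := vectorSpan ℝ (e : Set (Sp d)) with hV
  have hfr : Module.finrank ℝ V = d - 1 := by
    have h := hind.finrank_vectorSpan (n := d - 1) (by simp [hcard]; omega)
    have hr : Set.range ((↑) : e → Sp d) = (e : Set (Sp d)) := Subtype.range_coe
    rw [hV, ← hr]
    exact h
  obtain ⟨b, hb⟩ := hK.erase_nonempty hd ha
  have hsub : hull e ⊆ (fun y : Sp d => y + b) '' (V.subtype '' (V.subtype ⁻¹' ((fun y => y + b) ⁻¹' (hull e)))) := by
    intro y hy
    refine ⟨y - b, ⟨⟨y - b, ?_⟩, ?_, rfl⟩, by simp⟩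
    · have := AffineSubspace.vsub_mem_direction (mem_affineSpan_of_mem_hull hy)
        (mem_affineSpan_of_mem_hull (mem_hull_of_mem hb))
      rwa [direction_affineSpan] at this
    · simpa using hy
  have hcomp : IsCompact (V.subtype ⁻¹' ((fun y => y + b) ⁻¹' (hull e))) := by
    have h1 : Topology.IsClosedEmbedding (fun y : V => (y : Sp d) + b) :=
      (Homeomorph.addRight b).isClosedEmbedding.comp (Submodule.closed_of_finiteDimensional V).isClosedEmbedding_subtypeVal
    exact h1.isCompact_preimage (isCompact_hull e)
  have hiso : Isometry (fun y : V => (y : Sp d) + b) :=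
    (isometry_add_right b).comp isometry_subtype_coe
  rw [surfOn, Measure.restrict_apply_univ]
  refine (measure_mono hsub).trans_lt ?_
  rw [← Set.image_comp]
  have : ((fun y : Sp d => y + b) ∘ V.subtype) = fun y : V => (y : Sp d) + b := rfl
  rw [this, hiso.euclideanHausdorffMeasure_image, ← hfr]
  exact hcomp.measure_lt_top

lemma IsSimplex.isFiniteMeasure_surfOn : IsFiniteMeasure (surfOn (K.erase a)) :=
  ⟨hK.surfOn_univ_lt_top hd ha⟩

omit hd in
/-- The homothety with centre `a` maps slices of `K` to the side opposite to `a`. -/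
lemma IsSimplex.slice_eq {s : ℝ} (hs : 0 < s) (hs1 : s ≤ 1) :
    {x | x ∈ hull K ∧ bary K a x = 1 - s} = AffineMap.homothety a s '' (hull (K.erase a)) := by
  have hb : ∀ y, bary K a (AffineMap.homothety a s y) = 1 + s * (bary K a y - 1) := by
    intro y
    have : AffineMap.homothety a s y = a + s • (y - a) := by
      simp [AffineMap.homothety_apply, add_comm]
    rw [this, hK.bary_lineMap ha, hK.bary_self ha]
  have hb' : ∀ v ∈ K, v ≠ a → ∀ y, bary K v (AffineMap.homothety a s y) = s * bary K v y := by
    intro v hv hva y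
    have : AffineMap.homothety a s y = a + s • (y - a) := by
      simp [AffineMap.homothety_apply, add_comm]
    rw [this, hK.bary_lineMap hv, hK.bary_of_ne hv ha hva]; ring
  ext x
  constructor
  · rintro ⟨hx, hxa⟩
    have hinv : AffineMap.homothety a s (AffineMap.homothety a s⁻¹ x) = x := by
      rw [← AffineMap.comp_apply, ← AffineMap.homothety_mul, mul_inv_cancel₀ hs.ne']
      simp
    refine ⟨AffineMap.homothety a s⁻¹ x, ?_, hinv⟩
    rw [hK.mem_hull_erase_iff ha, hK.mem_hull_iff]
    have h0 : bary K a (AffineMap.homothety a s⁻¹ x) = 0 := by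
      have := hb (AffineMap.homothety a s⁻¹ x)
      rw [hinv, hxa] at this
      have h2 : s * bary K a (AffineMap.homothety a s⁻¹ x) = 0 := by linarith
      exact (mul_eq_zero.1 h2).resolve_left hs.ne'
    refine ⟨fun v hv => ?_, h0⟩
    by_cases hva : v = a
    · rw [hva, h0]
    · have := hb' v hv hva (AffineMap.homothety a s⁻¹ x)
      rw [hinv] at this
      have h3 := hK.bary_nonneg hx v
      rw [this] at h3
      exact nonneg_of_mul_nonneg_right h3 hs
  · rintro ⟨y, hy, rfl⟩
    rw [hK.mem_hull_erase_iff ha] at hy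
    refine ⟨?_, by rw [hb, hy.2]; ring⟩
    rw [hK.mem_hull_iff]
    intro v hv
    by_cases hva : v = a
    · rw [hva, hb, hy.2]; linarith
    · rw [hb' v hv hva]; exact mul_nonneg hs.le (hK.bary_nonneg hy.1 v)

/-- Cone coordinates: Lebesgue measure on `K` in terms of surface measure on a side. -/
lemma IsSimplex.volOn_eq_map :
    volOn K = (((volume.restrict (Set.Ioc (0 : ℝ) 1)).withDensity
      (fun s => ENNReal.ofReal (height K a * s ^ (d - 1)))).prod (surfOn (K.erase a))).map
      (fun z : ℝ × Sp d => a + z.1 • (z.2 - a)) := by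
  have := hK.isFiniteMeasure_surfOn hd ha
  set n := outNormal K (K.erase a) with hn
  set H := height K a with hH
  have hHpos : 0 < H := hK.height_pos hd ha
  have hn1 : ‖n‖ = 1 := hK.norm_outNormal hd ha
  have hv : H • n ≠ 0 := by
    intro h
    have : ‖H • n‖ = 0 := by rw [h, norm_zero]
    rw [norm_smul, hn1, Real.norm_of_nonneg hHpos.le] at this
    linarith
  have hmeas : Measurable (fun z : ℝ × Sp d => a + z.1 • (z.2 - a)) := by fun_prop
  refine Measure.ext fun t ht => ?_
  rw [Measure.map_apply hmeas ht, Measure.prod_apply (hmeas ht),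
    lintegral_withDensity_eq_lintegral_mul _ (by fun_prop)
      (measurable_measure_prodMk_left (hmeas ht)), volOn, Measure.restrict_apply ht]
  have hvol : (volume : Measure (Sp d)) = μHE[Module.finrank ℝ (Sp d)] :=
    InnerProductSpace.euclideanHausdorffMeasure_eq_volume.symm
  -- Fubini along the normal: the slice at parameter `s` is where `bary K a = 1 - s`, the image of
  -- the side under the homothety of ratio `s` centred at `a`. This accounts for the density `height
  -- K a * s ^ (d - 1)`.
  rw [hvol, EuclideanGeometry.euclideanHausdorffMeasure_eq_lintegral a hv
    (ht.inter (measurableSet_hull K)), finrank_euclideanSpace_fin]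
  have hslice : ∀ s : ℝ, t ∩ hull K ∩ AffineSubspace.mk' (s • H • n +ᵥ a) (Submodule.span ℝ {H • n})ᗮ =
      t ∩ {x | x ∈ hull K ∧ bary K a x = 1 - s} := by
    intro s
    ext x
    have : x ∈ AffineSubspace.mk' (s • H • n +ᵥ a) (Submodule.span ℝ {H • n})ᗮ ↔ bary K a x = 1 - s := by
      rw [AffineSubspace.mem_mk', Submodule.mem_orthogonal_singleton_iff_inner_left]
      have h1 : x -ᵥ (s • H • n +ᵥ a) = (x - a) - (s * H) • n := by
        simp only [vsub_eq_sub, vadd_eq_add]; module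
      rw [h1, inner_smul_right, inner_sub_left, hK.inner_outNormal_eq hd ha, real_inner_smul_left,
        real_inner_self_eq_norm_sq, hn1, ← hH]
      constructor
      · intro h
        have h2 := (mul_eq_zero.1 h).resolve_left hHpos.ne'
        have h3 : H * (1 - bary K a x - s) = 0 := by linarith
        have := (mul_eq_zero.1 h3).resolve_left hHpos.ne'
        linarith
      · intro h; rw [h]; ring
    simp only [Set.mem_inter_iff, SetLike.mem_coe, this]
    simp only [Set.mem_ofPred_eq, and_assoc]
  simp_rw [hslice]
  rw [← lintegral_const_mul' _ _ (by simp), ← lintegral_indicator measurableSet_Ioc]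
  refine lintegral_congr_ae ?_
  -- At `s = 0` the homothety is not invertible and `slice_eq` does not apply; a single parameter is
  -- negligible.
  have h0 : ∀ᵐ s : ℝ, s ≠ 0 := by simp [ae_iff]
  filter_upwards [h0] with s hs0
  by_cases hs : s ∈ Set.Ioc (0 : ℝ) 1
  · rw [Set.indicator_of_mem hs, hK.slice_eq ha hs.1 hs.2]
    have h1 : t ∩ AffineMap.homothety a s '' hull (K.erase a) =
        AffineMap.homothety a s '' ((fun y => a + s • (y - a)) ⁻¹' t ∩ hull (K.erase a)) := by
      have : (AffineMap.homothety a s : Sp d → Sp d) = fun y => a + s • (y - a) := by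
        ext1 y; simp [AffineMap.homothety_apply, add_comm]
      rw [this, Set.image_preimage_inter]
    rw [h1, euclideanHausdorffMeasure_homothety_image _ _ hs.1.ne']
    simp only [Pi.mul_apply]
    have h2 : ‖H • n‖ₑ = ENNReal.ofReal H := by
      rw [← ofReal_norm, norm_smul, hn1, Real.norm_of_nonneg hHpos.le, mul_one]
    rw [h2, ENNReal.ofReal_mul hHpos.le, mul_assoc]
    congr 1
    rw [surfOn, Measure.restrict_apply]
    · rw [ENNReal.smul_def, smul_eq_mul]
      congr 1
      rw [ENNReal.ofReal_pow hs.1.le, ENNReal.coe_pow]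
      congr 1
      rw [← Real.enorm_of_nonneg hs.1.le]
      rfl
    · exact (by fun_prop : Measurable fun y : Sp d => a + s • (y - a)) ht
  · rw [Set.indicator_of_notMem hs]
    have : {x | x ∈ hull K ∧ bary K a x = 1 - s} = ∅ := by
      ext x
      simp only [Set.mem_ofPred_eq, Set.mem_empty_iff_false, iff_false, not_and]
      intro hx hxs
      have b1 := hK.bary_nonneg hx a
      have b2 := hK.bary_le_one hx a
      exact hs ⟨lt_of_le_of_ne (by linarith) (Ne.symm hs0), by linarith⟩
    rw [this]; simp

omit hK hd ha in
lemma exists_bound_hull {F : Sp d → ℝ} (hF : Continuous F) (s : Finset (Sp d)) :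
    ∃ C, ∀ x ∈ hull s, ‖F x‖ ≤ C :=
  (isCompact_hull s).exists_bound_of_continuousOn hF.continuousOn

omit hK hd ha in
instance : IsFiniteMeasure (volOn K) :=
  ⟨by rw [volOn, Measure.restrict_apply_univ]; exact (isCompact_hull K).measure_lt_top⟩

omit hK hd ha in
lemma ae_mem_hull_volOn (K : Finset (Sp d)) : ∀ᵐ x ∂(volOn K), x ∈ hull K :=
  ae_restrict_mem (measurableSet_hull K)

omit hK hd ha in
lemma ae_mem_hull_surfOn (e : Finset (Sp d)) : ∀ᵐ x ∂(surfOn e), x ∈ hull e :=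
  ae_restrict_mem (measurableSet_hull e)

omit hK hd ha in
lemma memLp_volOn {F : Sp d → ℝ} (hF : Continuous F) (p : ℝ≥0∞) : MemLp F p (volOn K) := by
  obtain ⟨C, hC⟩ := exists_bound_hull hF K
  exact MemLp.of_bound hF.aestronglyMeasurable C
    ((ae_mem_hull_volOn K).mono fun x hx => hC x hx)

omit hK hd ha in
lemma integrable_volOn {F : Sp d → ℝ} (hF : Continuous F) : Integrable F (volOn K) :=
  memLp_one_iff_integrable.1 (memLp_volOn hF 1)

lemma IsSimplex.memLp_surfOn {F : Sp d → ℝ} (hF : Continuous F) (p : ℝ≥0∞) :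
    MemLp F p (surfOn (K.erase a)) := by
  have := hK.isFiniteMeasure_surfOn hd ha
  obtain ⟨C, hC⟩ := exists_bound_hull hF (K.erase a)
  exact MemLp.of_bound hF.aestronglyMeasurable C
    ((ae_mem_hull_surfOn _).mono fun x hx => hC x hx)

lemma IsSimplex.integrable_surfOn {F : Sp d → ℝ} (hF : Continuous F) :
    Integrable F (surfOn (K.erase a)) :=
  memLp_one_iff_integrable.1 (hK.memLp_surfOn hd ha hF 1)

lemma IsSimplex.integral_cone {F : Sp d → ℝ} (hF : Continuous F) :
    ∫ x, F x ∂(volOn K) = ∫ y, (∫ s in (0 : ℝ)..1, height K a * s ^ (d - 1) *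
      F (a + s • (y - a))) ∂(surfOn (K.erase a)) := by
  have := hK.isFiniteMeasure_surfOn hd ha
  have hmeas : Measurable (fun z : ℝ × Sp d => a + z.1 • (z.2 - a)) := by fun_prop
  have hmid := integrable_volOn (K := K) hF
  have hHpos : 0 < height K a := hK.height_pos hd ha
  rw [hK.volOn_eq_map hd ha] at hmid ⊢
  rw [integrable_map_measure hF.aestronglyMeasurable hmeas.aemeasurable] at hmid
  rw [integral_map hmeas.aemeasurable hF.aestronglyMeasurable, integral_prod_symm (fun z : ℝ × Sp d => F (a + z.1 • (z.2 - a))) hmid]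
  refine integral_congr_ae (ae_of_all _ fun y => ?_)
  simp only
  rw [integral_withDensity_eq_integral_toReal_smul (by fun_prop) (by simp),
    intervalIntegral.integral_of_le zero_le_one]
  refine setIntegral_congr_fun measurableSet_Ioc fun s hs => ?_
  simp only [smul_eq_mul]
  rw [ENNReal.toReal_ofReal (mul_nonneg hHpos.le (pow_nonneg hs.1.le _))]

/-- The divergence theorem for the radial field `g(x) (x - a)` on a simplex with vertex `a`. -/
lemma IsSimplex.integral_radial {g : Sp d → ℝ} (hg : ContDiff ℝ 1 g) :
    ∫ x, (d * g x + fderiv ℝ g x (x - a)) ∂(volOn K) =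
      height K a * ∫ y, g y ∂(surfOn (K.erase a)) := by
  have hc : Continuous fun x => (d * g x + fderiv ℝ g x (x - a)) := by
    have := hg.continuous
    have h2 : Continuous fun x => fderiv ℝ g x (x - a) :=
      (hg.continuous_fderiv one_ne_zero).clm_apply (by fun_prop)
    fun_prop
  rw [hK.integral_cone hd ha hc, ← integral_const_mul]
  refine integral_congr_ae (ae_of_all _ fun y => ?_)
  simp only
  -- On the ray from `a` through `y` the weighted divergence is the derivative of `s ^ d * g`. The
  -- end `s = 0` contributes nothing because `d ≥ 1`.
  have hder : ∀ s : ℝ, HasDerivAt (fun s : ℝ => height K a * (s ^ d * g (a + s • (y - a))))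
      (height K a * s ^ (d - 1) * (d * g (a + s • (y - a)) +
        fderiv ℝ g (a + s • (y - a)) (a + s • (y - a) - a))) s := by
    intro s
    have h1 : HasDerivAt (fun s : ℝ => a + s • (y - a)) (y - a) s := by
      simpa using ((hasDerivAt_id s).smul_const (y - a)).const_add a
    have h2 := ((hg.differentiable one_ne_zero) (a + s • (y - a))).hasFDerivAt.comp_hasDerivAt s h1
    have h3 := ((hasDerivAt_pow d s).mul h2).const_mul (height K a)
    refine h3.congr_deriv ?_
    have h4 : s ^ d = s ^ (d - 1) * s := by
      rw [← pow_succ]; congr 1; omega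
    rw [add_sub_cancel_left, map_smul, smul_eq_mul, h4]
    simp only [Function.comp]
    ring
  rw [intervalIntegral.integral_eq_sub_of_hasDerivAt (fun s _ => hder s)]
  · have : d ≠ 0 := by omega
    simp [this]
  · apply Continuous.intervalIntegrable
    have : Continuous fun s : ℝ => a + s • (y - a) := by fun_prop
    exact (by fun_prop : Continuous fun s : ℝ => height K a * s ^ (d - 1)).mul (hc.comp this)

end Cone

/-- Green's formula on a simplex. -/
lemma IsSimplex.integral_fderiv {K : Finset (Sp d)} (hK : IsSimplex K) (hd : 1 ≤ d)
    {g : Sp d → ℝ} (hg : ContDiff ℝ 1 g) (w : Sp d) :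
    ∫ x, fderiv ℝ g x w ∂(volOn K) =
      ∑ e ∈ sides K, inner ℝ w (outNormal K e) * ∫ y, g y ∂(surfOn e) := by
  have hcg := hg.continuous
  have hcd : ∀ f : Sp d → Sp d, Continuous f → Continuous fun x => fderiv ℝ g x (f x) := fun f hf =>
    (hg.continuous_fderiv one_ne_zero).clm_apply hf
  set c : Sp d → ℝ := fun a => inner ℝ w (outNormal K (K.erase a)) / height K a with hc
  have h0 : ∑ a ∈ K, c a = 0 := hK.sum_inner_div_height hd w
  have h1 : ∑ a ∈ K, c a • a = -w := hK.sum_inner_div_height_smul hd w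
  -- The constant field `w` is a combination of radial fields with coefficients of sum zero, so the
  -- terms `d * g x` produced by their divergences cancel.
  have key : ∀ x, fderiv ℝ g x w = ∑ a ∈ K, c a * (d * g x + fderiv ℝ g x (x - a)) := by
    intro x
    have : w = ∑ a ∈ K, c a • (x - a) := by
      simp_rw [smul_sub, Finset.sum_sub_distrib, ← Finset.sum_smul, h0, h1]; simp
    conv_lhs => rw [this]
    rw [map_sum]
    simp_rw [mul_add, Finset.sum_add_distrib, map_smul, smul_eq_mul]
    rw [← Finset.sum_mul, h0]; simp
  simp_rw [key]
  rw [integral_finsetSum, hK.sum_sides]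
  · refine Finset.sum_congr rfl fun a ha => ?_
    rw [integral_const_mul, hK.integral_radial hd ha hg, hc]
    have := hK.height_pos hd ha
    field_simp
  · intro a _
    apply integrable_volOn
    have := hcd (fun x => x - a) (by fun_prop)
    fun_prop

section Surf

variable {K : Finset (Sp d)} (hK : IsSimplex K) (hd : 1 ≤ d) {a : Sp d} (ha : a ∈ K)
include hK hd ha

lemma IsSimplex.volume_eq : (d : ℝ) * (volOn K).real Set.univ =
    height K a * (surfOn (K.erase a)).real Set.univ := by
  have := hK.integral_radial hd ha (g := fun _ => 1) contDiff_const
  simpa [mul_comm] using this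

/-- Lower dimensional faces are null sets for the surface measure. -/
lemma IsSimplex.ae_bary_pos : ∀ᵐ y ∂(surfOn (K.erase a)), ∀ v ∈ K.erase a, 0 < bary K v y := by
  have hfin := hK.isFiniteMeasure_surfOn hd ha
  have hae : ∀ v ∈ K.erase a, ∀ᵐ y ∂(surfOn (K.erase a)), bary K v y ≠ 0 := by
    intro v hv
    have hv' := Finset.mem_erase.1 hv
    have hmeas : Measurable (fun z : ℝ × Sp d => a + z.1 • (z.2 - a)) := by fun_prop
    set Z : Set (Sp d) := {x | bary K v x = 0} with hZ
    have hZm : MeasurableSet Z :=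
      (isClosed_eq (hK.continuous_bary v) continuous_const).measurableSet
    -- A point of `K` with a vanishing coordinate lies on the frontier of a convex set, which is a
    -- Lebesgue null set.
    have hvol : volOn K Z = 0 := by
      have h1 : volume (frontier (hull K)) = 0 := (convex_hull K).addHaar_frontier _
      rw [volOn, Measure.restrict_apply hZm]
      refine measure_mono_null ?_ h1
      rintro x ⟨hx0, hx⟩
      rw [(isClosed_hull K).frontier_eq]
      refine ⟨hx, fun hi => ?_⟩
      have := hK.mem_interior_iff.1 hi v hv'.2
      exact this.ne' hx0
    rw [hK.volOn_eq_map hd ha, Measure.map_apply hmeas hZm, Measure.prod_apply (hmeas hZm),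
      lintegral_withDensity_eq_lintegral_mul _ (by fun_prop)
      (measurable_measure_prodMk_left (hmeas hZm))] at hvol
    rw [lintegral_eq_zero_iff] at hvol
    · rw [EventuallyEq, ae_restrict_iff' measurableSet_Ioc] at hvol
      -- Since `bary K v` vanishes at `a`, all slices of `Z` with `s > 0` project to the same subset
      -- of the side. One slice of measure zero is therefore enough.
      have h3 : ∃ s ∈ Set.Ioc (0 : ℝ) 1, (ENNReal.ofReal (height K a * s ^ (d - 1)) *
          surfOn (K.erase a) (Prod.mk s ⁻¹' ((fun z : ℝ × Sp d => a + z.1 • (z.2 - a)) ⁻¹' Z))) = 0 := by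
        by_contra hcon
        push Not at hcon
        have h4 : ∀ᵐ s : ℝ, s ∉ Set.Ioc (0 : ℝ) 1 := by
          filter_upwards [hvol] with s hs hmem
          exact hcon s hmem (hs hmem)
        have h5 : volume (Set.Ioc (0 : ℝ) 1) = 0 := measure_eq_zero_iff_ae_notMem.2 h4
        simp at h5
      obtain ⟨s, hs, h4⟩ := h3
      have h5 : ENNReal.ofReal (height K a * s ^ (d - 1)) ≠ 0 := by
        have h6 := hK.height_pos hd ha
        have h7 := hs.1
        rw [Ne, ENNReal.ofReal_eq_zero, not_le]; positivity
      have h6 := (mul_eq_zero.1 h4).resolve_left h5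
      rw [ae_iff]
      refine measure_mono_null ?_ h6
      intro y hy
      simp only [ne_eq, not_not, Set.mem_ofPred_eq] at hy
      simp only [Set.mem_preimage, hZ, Set.mem_ofPred_eq]
      rw [hK.bary_lineMap hv'.2, hy, hK.bary_of_ne hv'.2 ha hv'.1]; ring
    · exact (by fun_prop : Measurable _).mul (measurable_measure_prodMk_left (hmeas hZm))
  have h2 := (ae_ball_iff (K.erase a).countable_toSet).2 hae
  filter_upwards [h2, ae_mem_hull_surfOn (K.erase a)] with y hy hyh v hv
  exact lt_of_le_of_ne (hK.bary_nonneg (hull_mono (Finset.erase_subset _ _) hyh) v)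
    (Ne.symm (hy v hv))

end Surf

/-! ### Polynomial functions -/

lemma IsPoly.mono {m m' : ℕ} (h : m ≤ m') {v : Sp d → ℝ} (hv : IsPoly m v) : IsPoly m' v := by
  obtain ⟨P, hP, hv⟩ := hv
  exact ⟨P, hP.trans h, hv⟩

lemma isPoly_const (m : ℕ) (c : ℝ) : IsPoly m (fun _ : Sp d => c) :=
  ⟨MvPolynomial.C c, by simp, by simp⟩

lemma isPoly_coord (i : Fin d) : IsPoly 1 (fun x : Sp d => x i) :=
  ⟨MvPolynomial.X i, by simp, by simp⟩

lemma IsPoly.add {m : ℕ} {v w : Sp d → ℝ} (hv : IsPoly m v) (hw : IsPoly m w) :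
    IsPoly m (fun x => v x + w x) := by
  obtain ⟨P, hP, hv⟩ := hv
  obtain ⟨Q, hQ, hw⟩ := hw
  exact ⟨P + Q, (MvPolynomial.totalDegree_add _ _).trans (max_le hP hQ), by simp [hv, hw]⟩

lemma IsPoly.mul {m n : ℕ} {v w : Sp d → ℝ} (hv : IsPoly m v) (hw : IsPoly n w) :
    IsPoly (m + n) (fun x => v x * w x) := by
  obtain ⟨P, hP, hv⟩ := hv
  obtain ⟨Q, hQ, hw⟩ := hw
  exact ⟨P * Q, (MvPolynomial.totalDegree_mul _ _).trans (add_le_add hP hQ), by simp [hv, hw]⟩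

lemma IsPoly.const_mul {m : ℕ} (c : ℝ) {v : Sp d → ℝ} (hv : IsPoly m v) :
    IsPoly m (fun x => c * v x) := by
  simpa using (isPoly_const 0 c).mul hv

lemma IsPoly.sub {m : ℕ} {v w : Sp d → ℝ} (hv : IsPoly m v) (hw : IsPoly m w) :
    IsPoly m (fun x => v x - w x) := by
  simpa [sub_eq_add_neg] using hv.add (hw.const_mul (-1))

lemma IsPoly.pow {m : ℕ} {v : Sp d → ℝ} (hv : IsPoly m v) (n : ℕ) :
    IsPoly (n * m) (fun x => v x ^ n) := by
  induction n with
  | zero => simpa using isPoly_const 0 1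
  | succ n ih => simpa [pow_succ, add_mul] using ih.mul hv

lemma isPoly_sum {m : ℕ} {ι : Type*} (s : Finset ι) (f : ι → Sp d → ℝ)
    (h : ∀ i ∈ s, IsPoly m (f i)) : IsPoly m (fun x => ∑ i ∈ s, f i x) := by
  induction s using Finset.induction_on with
  | empty => simpa using isPoly_const m 0
  | insert a s ha ih =>
    simp_rw [Finset.sum_insert ha]
    exact (h a (by simp)).add (ih fun i hi => h i (by simp [hi]))

lemma isPoly_prod {ι : Type*} (s : Finset ι) (f : ι → Sp d → ℝ) (n : ι → ℕ)
    (h : ∀ i ∈ s, IsPoly (n i) (f i)) : IsPoly (∑ i ∈ s, n i) (fun x => ∏ i ∈ s, f i x) := by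
  induction s using Finset.induction_on with
  | empty => simpa using isPoly_const 0 1
  | insert a s ha ih =>
    simp_rw [Finset.prod_insert ha, Finset.sum_insert ha]
    exact (h a (by simp)).mul (ih fun i hi => h i (by simp [hi]))

/-- The substitution of functions of degree at most one into a polynomial. -/
lemma isPoly_eval_comp {m : ℕ} {P : MvPolynomial (Fin d) ℝ} (hP : P.totalDegree ≤ m)
    (f : Fin d → Sp d → ℝ) (hf : ∀ i, IsPoly 1 (f i)) :
    IsPoly m (fun x => MvPolynomial.eval (fun i => f i x) P) := by
  simp_rw [MvPolynomial.eval_eq]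
  refine isPoly_sum _ _ fun γ hγ => IsPoly.const_mul _ ?_
  have h1 := isPoly_prod γ.support (fun i x => f i x ^ γ i) (fun i => γ i * 1)
    (fun i _ => (hf i).pow (γ i))
  refine h1.mono ?_
  simp only [mul_one]
  exact (MvPolynomial.le_totalDegree hγ).trans hP

lemma IsPoly.comp_affine {m : ℕ} {v : Sp d → ℝ} (hv : IsPoly m v) (x₀ : Sp d) (t : ℝ) :
    IsPoly m (fun y => v (x₀ + t • y)) := by
  obtain ⟨P, hP, hv⟩ := hv
  simp_rw [hv]
  refine isPoly_eval_comp hP (fun i y => (x₀ + t • y) i) fun i => ?_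
  simp only [PiLp.add_apply, PiLp.smul_apply, smul_eq_mul]
  exact (isPoly_const 1 _).add ((isPoly_coord i).const_mul t)

lemma hasFDerivAt_eval (P : MvPolynomial (Fin d) ℝ) (x : Sp d) :
    HasFDerivAt (fun x : Sp d => MvPolynomial.eval (fun i => x i) P)
      (∑ i, MvPolynomial.eval (fun i => x i) (MvPolynomial.pderiv i P) •
        (EuclideanSpace.proj i : Sp d →L[ℝ] ℝ)) x := by
  induction P using MvPolynomial.induction_on with
  | C a => simpa using hasFDerivAt_const a x
  | add p q hp hq =>
    simp only [map_add, add_smul, Finset.sum_add_distrib]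
    exact hp.add hq
  | mul_X p j hp =>
    have h1 : HasFDerivAt (fun x : Sp d => x j) (EuclideanSpace.proj j : Sp d →L[ℝ] ℝ) x :=
      (EuclideanSpace.proj j : Sp d →L[ℝ] ℝ).hasFDerivAt
    simp only [map_mul, MvPolynomial.eval_X]
    refine (hp.mul h1).congr_fderiv ?_
    simp only [MvPolynomial.pderiv_mul, map_add, map_mul, MvPolynomial.eval_X,
      MvPolynomial.pderiv_X, add_smul, Finset.sum_add_distrib]
    have h2 : ∑ i, (MvPolynomial.eval (fun i => x i) p *
        MvPolynomial.eval (fun i => x i) (Pi.single (M := fun _ => MvPolynomial (Fin d) ℝ) i 1 j)) •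
        (EuclideanSpace.proj i : Sp d →L[ℝ] ℝ) =
        MvPolynomial.eval (fun i => x i) p • (EuclideanSpace.proj j : Sp d →L[ℝ] ℝ) := by
      rw [Finset.sum_eq_single j]
      · simp
      · intro b _ hb; simp [hb.symm]
      · simp
    rw [h2, add_comm]
    congr 1
    rw [Finset.smul_sum]
    exact Finset.sum_congr rfl fun i _ => by rw [smul_smul, mul_comm]

lemma pderiv_eval (P : MvPolynomial (Fin d) ℝ) (i : Fin d) (x : Sp d) :
    pderiv i (fun x : Sp d => MvPolynomial.eval (fun i => x i) P) x =
      MvPolynomial.eval (fun i => x i) (MvPolynomial.pderiv i P) := by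
  rw [pderiv, (hasFDerivAt_eval P x).fderiv]
  simp only [sum_apply, smul_apply, smul_eq_mul]
  rw [Finset.sum_eq_single i]
  · simp
  · intro b _ hb; simp [hb]
  · simp

lemma contDiff_eval (P : MvPolynomial (Fin d) ℝ) :
    ContDiff ℝ ∞ (fun x : Sp d => MvPolynomial.eval (fun i => x i) P) := by
  induction P using MvPolynomial.induction_on with
  | C a => simpa using contDiff_const
  | add p q hp hq => simpa using hp.add hq
  | mul_X p j hp =>
    simp only [map_mul, MvPolynomial.eval_X]
    exact hp.mul (EuclideanSpace.proj j : Sp d →L[ℝ] ℝ).contDiff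

lemma IsPoly.contDiff {m : ℕ} {v : Sp d → ℝ} (hv : IsPoly m v) : ContDiff ℝ ∞ v := by
  obtain ⟨P, -, h⟩ := hv
  rw [funext h]
  exact contDiff_eval P

lemma IsPoly.continuous {m : ℕ} {v : Sp d → ℝ} (hv : IsPoly m v) : Continuous v :=
  hv.contDiff.continuous

lemma totalDegree_pderiv_le {P : MvPolynomial (Fin d) ℝ} {m : ℕ} (hP : P.totalDegree ≤ m)
    (i : Fin d) : (MvPolynomial.pderiv i P).totalDegree ≤ m - 1 := by
  refine Finset.sup_le fun γ hγ => ?_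
  have h1 : γ + Finsupp.single i 1 ∈ P.support := by
    rw [MvPolynomial.mem_support_iff, MvPolynomial.coeff_pderiv] at hγ
    rw [MvPolynomial.mem_support_iff]
    exact left_ne_zero_of_mul hγ
  have h2 := (MvPolynomial.le_totalDegree h1).trans hP
  rw [Finsupp.sum_fintype _ _ (by simp)] at h2 ⊢
  simp only [Finsupp.add_apply, Finset.sum_add_distrib] at h2
  rw [Finset.sum_eq_single (f := fun x => (Finsupp.single i 1) x) i] at h2
  · simp at h2; omega
  · intro b _ hb; simp [hb.symm]
  · simp

lemma IsPoly.pderiv {m : ℕ} {v : Sp d → ℝ} (hv : IsPoly m v) (i : Fin d) :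
    IsPoly (m - 1) (pderiv i v) := by
  obtain ⟨P, hP, h⟩ := hv
  exact ⟨MvPolynomial.pderiv i P, totalDegree_pderiv_le hP i, fun x => by
    rw [funext h, pderiv_eval]⟩

lemma IsPoly.pderiv_eq_zero {v : Sp d → ℝ} (hv : IsPoly 0 v) (i : Fin d) :
    HDG.pderiv i v = fun _ => 0 := by
  obtain ⟨P, hP, h⟩ := hv
  have h1 : P = MvPolynomial.C (P.coeff 0) :=
    (MvPolynomial.totalDegree_eq_zero_iff_eq_C).1 (Nat.le_zero.1 hP)
  ext x
  rw [funext h, pderiv_eval, h1]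
  simp

lemma eval_eq_zero_of_isOpen {P : MvPolynomial (Fin d) ℝ} {U : Set (Sp d)} (hU : IsOpen U)
    (hne : U.Nonempty) (h : ∀ x ∈ U, MvPolynomial.eval (fun i => x i) P = 0) : P = 0 := by
  obtain ⟨x, hx⟩ := hne
  have h1 : (fun y : Fin d → ℝ => WithLp.toLp 2 y) ⁻¹' U ∈ 𝓝 (WithLp.ofLp x) :=
    (PiLp.continuous_toLp 2 _).continuousAt.preimage_mem_nhds (by simpa using hU.mem_nhds hx)
  obtain ⟨ε, hε, hball⟩ := Metric.mem_nhds_iff.1 h1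
  refine MvPolynomial.funext_set (fun i => Metric.ball (x i) ε) (fun i => ?_) fun y hy => ?_
  · rw [Real.ball_eq_Ioo]; exact Set.Ioo_infinite (by linarith)
  · rw [map_zero]
    have : y ∈ Metric.ball (WithLp.ofLp x) ε := by
      rw [ball_pi _ hε]; exact hy
    exact h (WithLp.toLp 2 y) (hball this)

lemma IsSimplex.isPoly_bary {K : Finset (Sp d)} (hK : IsSimplex K) (v : Sp d) :
    IsPoly 1 (bary K v) := by
  by_cases hv : v ∈ K
  · have h1 : ∀ x, bary K v x = bary K v 0 + ∑ i, x i *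
        (hK.basis.coord ⟨v, hv⟩).linear (EuclideanSpace.single i 1) := by
      intro x
      rw [hK.bary_eq hv, hK.bary_eq hv]
      have h2 : x = ∑ i, x i • (EuclideanSpace.single i (1 : ℝ)) := by
        ext j
        simp [Pi.single_apply]
      have h3 := (hK.basis.coord ⟨v, hv⟩).map_vadd 0 x
      rw [vadd_eq_add, add_zero] at h3
      rw [h3, vadd_eq_add, add_comm]
      congr 1
      conv_lhs => rw [h2]
      rw [map_sum]
      simp
    rw [funext h1]
    refine (isPoly_const 1 _).add (isPoly_sum _ _ fun i _ => ?_)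
    simpa only [mul_comm] using (isPoly_coord i).const_mul
      ((hK.basis.coord ⟨v, hv⟩).linear (EuclideanSpace.single i 1))
  · rw [funext (bary_eq_zero hv)]
    exact isPoly_const 1 0

/-! ### Inverse inequalities -/

/-- The minimum over the compact unit sphere is positive, and homogeneity spreads it to all vectors.
It serves as the equivalence of norms for a quadratic form given only by its values. -/
lemma exists_pos_le_of_homogeneous {ι : Type*} [Fintype ι] (N : (ι → ℝ) → ℝ) (hc : Continuous N)
    (hhom : ∀ (t : ℝ) c, N (t • c) = t ^ 2 * N c) (hpos : ∀ c, c ≠ 0 → 0 < N c) :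
    ∃ δ > 0, ∀ c i, δ * c i ^ 2 ≤ N c := by
  rcases (Metric.sphere (0 : ι → ℝ) 1).eq_empty_or_nonempty with h | h
  · refine ⟨1, one_pos, fun c i => ?_⟩
    exfalso
    have : Nonempty ι := ⟨i⟩
    have h2 : (fun _ => 1 : ι → ℝ) ∈ Metric.sphere (0 : ι → ℝ) 1 := by
      rw [mem_sphere_zero_iff_norm, pi_norm_const, norm_one]
    rw [h] at h2; exact h2
  · obtain ⟨c₀, hc₀, hmin⟩ := (isCompact_sphere (0 : ι → ℝ) 1).exists_isMinOn h hc.continuousOn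
    have hc0 : c₀ ≠ 0 := by
      rintro rfl
      simp at hc₀
    refine ⟨N c₀, hpos c₀ hc0, fun c i => ?_⟩
    by_cases hcz : c = 0
    · subst hcz
      have := hhom 0 0
      simp at this ⊢
      rw [this]
    · have hn : 0 < ‖c‖ := norm_pos_iff.2 hcz
      have h1 : ‖c‖⁻¹ • c ∈ Metric.sphere (0 : ι → ℝ) 1 := by
        simp [norm_smul, inv_mul_cancel₀ hn.ne']
      have h2 : N c₀ ≤ N (‖c‖⁻¹ • c) := hmin h1
      rw [hhom] at h2
      have h3 : |c i| ≤ ‖c‖ := norm_le_pi_norm c i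
      have h4 : c i ^ 2 ≤ ‖c‖ ^ 2 := by
        rw [← sq_abs]; gcongr
      calc N c₀ * c i ^ 2 ≤ (‖c‖⁻¹ ^ 2 * N c) * ‖c‖ ^ 2 := by
            have := (hpos c₀ hc0).le
            have := (hpos c hcz).le
            gcongr
        _ = N c := by field_simp

/-- The monomials with exponents at most `m`. -/
def monom {m : ℕ} (β : Fin d → Fin (m + 1)) (x : Sp d) : ℝ := ∏ i, x i ^ (β i : ℕ)

lemma continuous_monom {m : ℕ} (β : Fin d → Fin (m + 1)) : Continuous (monom β) := by
  unfold monom; fun_prop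

lemma contDiff_monom {m : ℕ} (β : Fin d → Fin (m + 1)) : ContDiff ℝ ∞ (monom β) := by
  unfold monom
  exact contDiff_prod fun i _ => (EuclideanSpace.proj i : Sp d →L[ℝ] ℝ).contDiff.pow _

/-- The polynomial with monomial coefficients `c`. -/
def polyOf {m : ℕ} (c : (Fin d → Fin (m + 1)) → ℝ) : MvPolynomial (Fin d) ℝ :=
  ∑ β, MvPolynomial.monomial (Finsupp.equivFunOnFinite.symm fun i => (β i : ℕ)) (c β)

lemma eval_polyOf {m : ℕ} (c : (Fin d → Fin (m + 1)) → ℝ) (x : Sp d) :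
    MvPolynomial.eval (fun i => x i) (polyOf c) = ∑ β, c β * monom β x := by
  rw [polyOf, map_sum]
  refine Finset.sum_congr rfl fun β _ => ?_
  rw [MvPolynomial.eval_monomial, Finsupp.prod_fintype _ _ (by simp)]
  rfl

lemma polyOf_eq_zero {m : ℕ} {c : (Fin d → Fin (m + 1)) → ℝ} (h : polyOf c = 0) : c = 0 := by
  ext β
  have h1 : (polyOf c).coeff (Finsupp.equivFunOnFinite.symm fun i => (β i : ℕ)) = c β := by
    rw [polyOf, MvPolynomial.coeff_sum, Finset.sum_eq_single β]
    · simp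
    · intro γ _ hγ
      rw [MvPolynomial.coeff_monomial, if_neg]
      intro h
      apply hγ
      have := Finsupp.equivFunOnFinite.symm.injective h
      ext i
      exact congrFun this i
    · simp
  rw [← h1, h]; simp

lemma IsPoly.exists_coeff {m : ℕ} {v : Sp d → ℝ} (hv : IsPoly m v) :
    ∃ c : (Fin d → Fin (m + 1)) → ℝ, ∀ x, v x = ∑ β, c β * monom β x := by
  obtain ⟨P, hP, h⟩ := hv
  refine ⟨fun β => P.coeff (Finsupp.equivFunOnFinite.symm fun i => (β i : ℕ)), fun x => ?_⟩
  rw [h, MvPolynomial.eval_eq]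
  symm
  have hle : ∀ γ ∈ P.support, ∀ i, γ i < m + 1 := by
    intro γ hγ i
    have h1 := (MvPolynomial.le_totalDegree hγ).trans hP
    rw [Finsupp.sum_fintype _ _ (by simp)] at h1
    have := Finset.single_le_sum (f := fun i => γ i) (fun _ _ => Nat.zero_le _) (Finset.mem_univ i)
    omega
  refine Finset.sum_bij_ne_zero (fun β _ _ => Finsupp.equivFunOnFinite.symm fun i => (β i : ℕ))
    ?_ ?_ ?_ ?_
  · intro β _ hβ
    rw [MvPolynomial.mem_support_iff]
    exact left_ne_zero_of_mul hβ
  · intro β _ _ γ _ _ h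
    have := Finsupp.equivFunOnFinite.symm.injective h
    ext i
    exact congrFun this i
  · intro γ hγ hne
    have hγe : (Finsupp.equivFunOnFinite.symm fun i => γ i) = γ := by ext; simp
    refine ⟨fun i => ⟨γ i, hle γ hγ i⟩, Finset.mem_univ _, ?_, hγe⟩
    simp only
    rw [hγe]
    refine mul_ne_zero (MvPolynomial.mem_support_iff.1 hγ) ?_
    have := right_ne_zero_of_mul hne
    rw [monom]
    rwa [Finset.prod_subset (Finset.subset_univ γ.support) (by
      intro i _ hi
      rw [Finsupp.notMem_support_iff.1 hi, pow_zero])] at this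
  · intro β _ _
    congr 1
    rw [monom]
    symm
    exact Finset.prod_subset (Finset.subset_univ _) (by
      intro i _ hi
      rw [Finsupp.notMem_support_iff.1 hi, pow_zero])

/-- The square of the `L²` norm on the ball is a continuous quadratic function of the coefficients,
and it is definite because a polynomial vanishing on an open set is zero. -/
lemma exists_coeff_bound (d m : ℕ) {r : ℝ} (hr : 0 < r) :
    ∃ δ > 0, ∀ (c : (Fin d → Fin (m + 1)) → ℝ) β,
      δ * c β ^ 2 ≤ ∫ x in Metric.closedBall (0 : Sp d) r, (∑ β, c β * monom β x) ^ 2 := by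
  have hmid : ∀ F : Sp d → ℝ, Continuous F →
      Integrable F (volume.restrict (Metric.closedBall (0 : Sp d) r)) := fun F hF =>
    hF.continuousOn.integrableOn_compact (isCompact_closedBall _ _)
  have hcm := fun β => continuous_monom (d := d) (m := m) β
  have hcs : ∀ c : (Fin d → Fin (m + 1)) → ℝ, Continuous fun x => ∑ β, c β * monom β x := by
    intro c; fun_prop
  refine exists_pos_le_of_homogeneous _ ?_ ?_ ?_
  · have : (fun c : (Fin d → Fin (m + 1)) → ℝ =>
        ∫ x in Metric.closedBall (0 : Sp d) r, (∑ β, c β * monom β x) ^ 2) = fun c =>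
        ∑ β, ∑ γ, c β * c γ * ∫ x in Metric.closedBall (0 : Sp d) r, monom β x * monom γ x := by
      ext c
      have h1 : ∀ x, (∑ β, c β * monom β x) ^ 2 = ∑ β, ∑ γ, c β * c γ * (monom β x * monom γ x) := by
        intro x
        rw [sq, Finset.sum_mul_sum]
        exact Finset.sum_congr rfl fun β _ => Finset.sum_congr rfl fun γ _ => by ring
      simp_rw [h1]
      rw [integral_finsetSum _ fun β _ => hmid _ (by fun_prop)]
      refine Finset.sum_congr rfl fun β _ => ?_
      rw [integral_finsetSum _ fun γ _ => hmid _ (by fun_prop)]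
      exact Finset.sum_congr rfl fun γ _ => integral_const_mul _ _
    rw [this]
    fun_prop
  · intro t c
    rw [← integral_const_mul]
    congr 1
    ext x
    simp only [Pi.smul_apply, smul_eq_mul]
    rw [← mul_pow, Finset.mul_sum]
    simp_rw [mul_assoc]
  · intro c hc
    rw [integral_pos_iff_support_of_nonneg (fun x => sq_nonneg _) (hmid _ ((hcs c).pow 2))]
    by_contra hcon
    apply hc
    apply polyOf_eq_zero
    refine eval_eq_zero_of_isOpen (Metric.isOpen_ball (x := (0 : Sp d)) (ε := r))
      ⟨0, Metric.mem_ball_self hr⟩ fun x hx => ?_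
    rw [eval_polyOf]
    by_contra hx0
    apply hcon
    set U := Metric.ball (0 : Sp d) r ∩ {x | (∑ β, c β * monom β x) ≠ 0} with hU
    have hUo : IsOpen U := Metric.isOpen_ball.inter (isOpen_ne_fun (hcs c) continuous_const)
    have hpos : 0 < volume U := hUo.measure_pos _ ⟨x, hx, hx0⟩
    rw [Measure.restrict_apply']
    · refine hpos.trans_le (measure_mono ?_)
      rintro y ⟨hy1, hy2⟩
      exact ⟨by simpa using hy2, Metric.ball_subset_closedBall hy1⟩
    · exact Metric.isClosed_closedBall.measurableSet

/-- Equivalence of norms on a finite-dimensional space, in two steps: the integral over the small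
ball controls the coefficients, and the coefficients control values and first derivatives on the
unit ball. -/
lemma exists_ball_inverse (d m : ℕ) {r : ℝ} (hr : 0 < r) :
    ∃ C > 0, ∀ v : Sp d → ℝ, IsPoly m v → ∀ y : Sp d, ‖y‖ ≤ 1 →
      v y ^ 2 ≤ C * ∫ x in Metric.closedBall (0 : Sp d) r, v x ^ 2 ∧
      ∀ i, pderiv i v y ^ 2 ≤ C * ∫ x in Metric.closedBall (0 : Sp d) r, v x ^ 2 := by
  obtain ⟨δ, hδ, hb⟩ := exists_coeff_bound d m hr
  have hM : ∃ M : ℝ, 0 < M ∧ ∀ (β : Fin d → Fin (m + 1)) (y : Sp d), ‖y‖ ≤ 1 →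
      |monom β y| ≤ M ∧ ∀ i, |pderiv i (monom β) y| ≤ M := by
    have h1 : ∀ β : Fin d → Fin (m + 1), ∃ M : ℝ, ∀ y : Sp d, ‖y‖ ≤ 1 → |monom β y| ≤ M := by
      intro β
      obtain ⟨M, hM⟩ := (isCompact_closedBall (0 : Sp d) 1).exists_bound_of_continuousOn
        (continuous_monom β).continuousOn
      exact ⟨M, fun y hy => hM y (by simpa using hy)⟩
    have h2 : ∀ (β : Fin d → Fin (m + 1)) (i : Fin d), ∃ M : ℝ, ∀ y : Sp d, ‖y‖ ≤ 1 →
        |pderiv i (monom β) y| ≤ M := by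
      intro β i
      have hcont : Continuous (pderiv i (monom β)) :=
        ((contDiff_monom β).continuous_fderiv (by simp)).clm_apply continuous_const
      obtain ⟨M, hM⟩ := (isCompact_closedBall (0 : Sp d) 1).exists_bound_of_continuousOn
        hcont.continuousOn
      exact ⟨M, fun y hy => hM y (by simpa using hy)⟩
    choose M₁ hM₁ using h1
    choose M₂ hM₂ using h2
    refine ⟨1 + ∑ β, |M₁ β| + ∑ β, ∑ i, |M₂ β i|, by positivity, fun β y hy => ⟨?_, fun i => ?_⟩⟩
    · have := Finset.single_le_sum (f := fun β => |M₁ β|) (fun _ _ => abs_nonneg _)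
        (Finset.mem_univ β)
      have h3 : 0 ≤ ∑ β, ∑ i, |M₂ β i| := by positivity
      have := hM₁ β y hy
      have := le_abs_self (M₁ β)
      linarith
    · have h4 := Finset.single_le_sum (f := fun β => ∑ i, |M₂ β i|)
        (fun _ _ => Finset.sum_nonneg fun _ _ => abs_nonneg _) (Finset.mem_univ β)
      have h5 := Finset.single_le_sum (f := fun i => |M₂ β i|) (fun _ _ => abs_nonneg _)
        (Finset.mem_univ i)
      have h3 : 0 ≤ ∑ β, |M₁ β| := by positivity
      have := hM₂ β i y hy
      have := le_abs_self (M₂ β i)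
      linarith
  obtain ⟨M, hM0, hM⟩ := hM
  set n : ℝ := ((Fintype.card (Fin d → Fin (m + 1)) : ℕ) : ℝ) with hn
  have hnpos : 0 < n := by
    rw [hn]; exact_mod_cast Fintype.card_pos
  refine ⟨n * (n * M ^ 2 / δ), by positivity, fun v hv y hy => ?_⟩
  obtain ⟨c, hc⟩ := hv.exists_coeff
  have hsum : ∀ g : (Fin d → Fin (m + 1)) → ℝ, (∀ β, |g β| ≤ M) →
      (∑ β, c β * g β) ^ 2 ≤ n * (n * M ^ 2 / δ) *
        ∫ x in Metric.closedBall (0 : Sp d) r, v x ^ 2 := by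
    intro g hg
    have h1 := sq_sum_le_card_mul_sum_sq (s := (Finset.univ : Finset (Fin d → Fin (m + 1))))
      (f := fun β => c β * g β)
    rw [Finset.card_univ] at h1
    refine h1.trans ?_
    rw [mul_assoc]
    gcongr
    have h2 : ∀ β, (c β * g β) ^ 2 ≤ M ^ 2 / δ *
        ∫ x in Metric.closedBall (0 : Sp d) r, v x ^ 2 := by
      intro β
      have h3 := hb c β
      simp_rw [← hc] at h3
      have h4 : g β ^ 2 ≤ M ^ 2 := by rw [← sq_abs]; have := hg β; gcongr
      calc (c β * g β) ^ 2 = (δ * c β ^ 2) * g β ^ 2 / δ := by field_simp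
        _ ≤ (∫ x in Metric.closedBall (0 : Sp d) r, v x ^ 2) * M ^ 2 / δ := by
          have : 0 ≤ ∫ x in Metric.closedBall (0 : Sp d) r, v x ^ 2 :=
            integral_nonneg fun _ => sq_nonneg _
          gcongr
        _ = _ := by ring
    calc _ ≤ ∑ β : Fin d → Fin (m + 1), M ^ 2 / δ *
          ∫ x in Metric.closedBall (0 : Sp d) r, v x ^ 2 := Finset.sum_le_sum fun β _ => h2 β
      _ = _ := by rw [Finset.sum_const, Finset.card_univ, nsmul_eq_mul]; ring
  constructor
  · rw [hc y]
    exact hsum _ fun β => (hM β y hy).1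
  · intro i
    have : pderiv i v y = ∑ β, c β * pderiv i (monom β) y := by
      rw [funext hc]
      unfold pderiv
      rw [fderiv_fun_sum fun β _ => (((contDiff_monom β).differentiable (by simp)) y).const_mul _]
      rw [sum_apply]
      refine Finset.sum_congr rfl fun β _ => ?_
      rw [fderiv_const_mul (((contDiff_monom β).differentiable (by simp)) y)]
      rfl
    rw [this]
    exact hsum _ fun β => (hM β y hy).2 i

/-- Inverse inequalities on a set that contains a ball and is contained in a comparable one. -/
lemma exists_inverse (d m : ℕ) {σ : ℝ} (hσ : 0 < σ) :
    ∃ C > 0, ∀ (K : Finset (Sp d)) (x₀ : Sp d) (h : ℝ), 0 < h →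
      Metric.closedBall x₀ (h / σ) ⊆ hull K → (∀ x ∈ hull K, dist x x₀ ≤ h) →
      ∀ v : Sp d → ℝ, IsPoly m v → ∀ x ∈ hull K,
      h ^ d * v x ^ 2 ≤ C * ∫ x, v x ^ 2 ∂(volOn K) ∧
      ∀ i, h ^ (d + 2) * pderiv i v x ^ 2 ≤ C * ∫ x, v x ^ 2 ∂(volOn K) := by
  obtain ⟨C, hC, hb⟩ := exists_ball_inverse d m (r := σ⁻¹) (by positivity)
  refine ⟨C, hC, fun K x₀ h hh hball hK v hv x hx => ?_⟩
  -- Scaling by `h` about `x₀` turns the inner ball into the fixed ball of radius `σ⁻¹` and puts `K`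
  -- inside the unit ball. The constant thus depends on `d`, `m` and `σ` only, and the powers of `h`
  -- come from the change of variables.
  set w : Sp d → ℝ := fun y => v (x₀ + h • y) with hw
  have hwp : IsPoly m w := hv.comp_affine x₀ h
  set y : Sp d := h⁻¹ • (x - x₀) with hy
  have hxy : x₀ + h • y = x := by
    rw [hy, smul_smul, mul_inv_cancel₀ hh.ne', one_smul, add_sub_cancel]
  have hy1 : ‖y‖ ≤ 1 := by
    rw [hy, norm_smul, norm_inv, Real.norm_of_nonneg hh.le, inv_mul_le_iff₀ hh, mul_one,
      ← dist_eq_norm]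
    exact hK x hx
  obtain ⟨h1, h2⟩ := hb w hwp y hy1
  have hmid : h ^ d * ∫ z in Metric.closedBall (0 : Sp d) σ⁻¹, w z ^ 2 ≤
      ∫ x, v x ^ 2 ∂(volOn K) := by
    set F : Sp d → ℝ := Set.indicator (Metric.closedBall x₀ (h / σ)) fun x => v x ^ 2 with hF
    have e1 : ∫ z in Metric.closedBall (0 : Sp d) σ⁻¹, w z ^ 2 = ∫ z, F (x₀ + h • z) := by
      rw [← integral_indicator Metric.isClosed_closedBall.measurableSet]
      congr 1
      ext z
      have : z ∈ Metric.closedBall (0 : Sp d) σ⁻¹ ↔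
          x₀ + h • z ∈ Metric.closedBall x₀ (h / σ) := by
        simp only [Metric.mem_closedBall, dist_zero_right, dist_self_add_left, norm_smul,
          Real.norm_of_nonneg hh.le]
        rw [div_eq_mul_inv, mul_le_mul_iff_right₀ hh]
      by_cases hz : z ∈ Metric.closedBall (0 : Sp d) σ⁻¹
      · rw [Set.indicator_of_mem hz, hF, Set.indicator_of_mem (this.1 hz)]
      · rw [Set.indicator_of_notMem hz, hF, Set.indicator_of_notMem (fun h' => hz (this.2 h'))]
    have e2 : ∫ z, F (x₀ + h • z) = (h ^ d)⁻¹ * ∫ z, F z := by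
      have e3 := Measure.integral_comp_smul (volume : Measure (Sp d)) (fun z => F (x₀ + z)) h
      rw [finrank_euclideanSpace_fin, abs_of_nonneg (by positivity), smul_eq_mul] at e3
      rw [e3, integral_add_left_eq_self]
    rw [e1, e2, ← mul_assoc, mul_inv_cancel₀ (by positivity), one_mul, hF,
      integral_indicator Metric.isClosed_closedBall.measurableSet, volOn]
    refine setIntegral_mono_set ?_ (ae_of_all _ fun _ => sq_nonneg _) hball.eventuallyLE
    exact integrable_volOn (hv.continuous.pow 2)
  have hfin : ∀ X : ℝ, X ≤ C * ∫ z in Metric.closedBall (0 : Sp d) σ⁻¹, w z ^ 2 →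
      h ^ d * X ≤ C * ∫ x, v x ^ 2 ∂(volOn K) := by
    intro X hX
    calc h ^ d * X ≤ h ^ d * (C * ∫ z in Metric.closedBall (0 : Sp d) σ⁻¹, w z ^ 2) := by gcongr
      _ = C * (h ^ d * ∫ z in Metric.closedBall (0 : Sp d) σ⁻¹, w z ^ 2) := by ring
      _ ≤ _ := by gcongr
  constructor
  · have := hfin _ h1
    simpa only [hw, hxy] using this
  · intro i
    have := hfin _ (h2 i)
    have hder : pderiv i w y = h * pderiv i v x := by
      unfold pderiv
      have h3 : HasFDerivAt (fun y : Sp d => x₀ + h • y) (h • ContinuousLinearMap.id ℝ (Sp d)) y :=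
        ((hasFDerivAt_id y).const_smul h).const_add x₀
      have h4 : HasFDerivAt v (fderiv ℝ v x) (x₀ + h • y) := by
        rw [hxy]; exact (hv.contDiff.differentiable (by simp) x).hasFDerivAt
      have h5 : fderiv ℝ w y = _ := (h4.comp y h3).fderiv
      rw [h5]
      simp
    rw [hder] at this
    calc h ^ (d + 2) * pderiv i v x ^ 2 = h ^ d * (h * pderiv i v x) ^ 2 := by ring
      _ ≤ _ := this

/-! ### Bernstein representation -/

/-- The homogeneous polynomial of degree `m` with coefficients `c` in the variables `l w`, `w ∈ s`. -/
def bern {ι : Type*} [DecidableEq ι] (s : Finset ι) (m : ℕ) (c : (ι → ℕ) → ℝ) (l : ι → ℝ) : ℝ :=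
  ∑ β ∈ s.piAntidiag m, c β * ∏ w ∈ s, l w ^ β w

/-- `v` is on the simplex with vertices `s` the Bernstein polynomial with coefficients `c`. -/
def Rep (s : Finset (Sp d)) (m : ℕ) (c : (Sp d → ℕ) → ℝ) (v : Sp d → ℝ) : Prop :=
  ∀ l : Sp d → ℝ, (∀ w ∈ s, 0 ≤ l w) → ∑ w ∈ s, l w = 1 → v (∑ w ∈ s, l w • w) = bern s m c l

lemma bern_sub {ι : Type*} [DecidableEq ι] (s : Finset ι) (m : ℕ) (c c' : (ι → ℕ) → ℝ) (l : ι → ℝ) :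
    bern s m (fun β => c β - c' β) l = bern s m c l - bern s m c' l := by
  simp [bern, sub_mul, Finset.sum_sub_distrib]

lemma Rep.sub {s : Finset (Sp d)} {m : ℕ} {c c' : (Sp d → ℕ) → ℝ} {v v' : Sp d → ℝ}
    (h : Rep s m c v) (h' : Rep s m c' v') :
    Rep s m (fun β => c β - c' β) (fun x => v x - v' x) := by
  intro l h0 h1
  rw [bern_sub, ← h l h0 h1, ← h' l h0 h1]

lemma piAntidiag_mono {ι : Type*} [DecidableEq ι] {s t : Finset ι} (h : s ⊆ t) {m : ℕ} :
    s.piAntidiag m ⊆ t.piAntidiag m := by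
  intro β hβ
  rw [Finset.mem_piAntidiag] at hβ ⊢
  refine ⟨?_, fun i hi => h (hβ.2 i hi)⟩
  rw [← hβ.1]
  symm
  exact Finset.sum_subset h fun i _ hi => by_contra fun h' => hi (hβ.2 i h')

/-- On a face, every monomial that involves a vertex off the face vanishes. The restriction to a
face therefore sees only the coefficients whose exponents are supported there, which is what makes
gluing by coefficients possible. -/
lemma bern_extend {ι : Type*} [DecidableEq ι] {s t : Finset ι} (h : s ⊆ t) (m : ℕ) (c : (ι → ℕ) → ℝ) (l : ι → ℝ)
    (hl : ∀ w ∈ t, w ∉ s → l w = 0) : bern t m c l = bern s m c l := by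
  unfold bern
  symm
  rw [← Finset.sum_subset (piAntidiag_mono h)]
  · refine Finset.sum_congr rfl fun β hβ => ?_
    rw [Finset.mem_piAntidiag] at hβ
    congr 1
    refine Finset.prod_subset h fun w _ hw => ?_
    have : β w = 0 := by_contra fun h' => hw (hβ.2 w h')
    rw [this, pow_zero]
  · intro β hβ hβs
    rw [Finset.mem_piAntidiag] at hβ
    have : ∃ w ∈ t, w ∉ s ∧ β w ≠ 0 := by
      by_contra hcon
      push Not at hcon
      apply hβs
      rw [Finset.mem_piAntidiag]
      refine ⟨?_, fun i hi => by_contra fun h' => hi (hcon i (hβ.2 i hi) h')⟩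
      rw [← hβ.1]
      exact Finset.sum_subset h fun i hi his => hcon i hi his
    obtain ⟨w, hw, hws, hwβ⟩ := this
    rw [Finset.prod_eq_zero hw, mul_zero]
    rw [hl w hw hws, zero_pow hwβ]

lemma Rep.face {s t : Finset (Sp d)} (h : s ⊆ t) {m : ℕ} {c : (Sp d → ℕ) → ℝ} {v : Sp d → ℝ}
    (hr : Rep t m c v) : Rep s m c v := by
  intro l h0 h1
  have h2 := hr (fun w => if w ∈ s then l w else 0)
    (fun w _ => by by_cases hw : w ∈ s <;> simp [hw, h0]) (by
      have := sum_extend h l (fun _ => (1 : ℝ))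
      simpa [h1] using this)
  rw [sum_extend h l (fun w => w)] at h2
  rw [h2, bern_extend h m c _ (fun w _ hw => by simp [hw])]
  unfold bern
  refine Finset.sum_congr rfl fun β _ => ?_
  congr 1
  exact Finset.prod_congr rfl fun w hw => by simp [hw]

lemma exists_bern_of_homogeneous {s : Finset (Sp d)} {m : ℕ} {F : MvPolynomial s ℝ}
    (hF : F.IsHomogeneous m) :
    ∃ c, ∀ l : Sp d → ℝ, MvPolynomial.eval (fun w : s => l w) F = bern s m c l := by
  refine ⟨fun β => F.coeff (Finsupp.equivFunOnFinite.symm fun w : s => β w), fun l => ?_⟩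
  rw [MvPolynomial.eval_eq, bern]
  symm
  have hprod : ∀ β : Sp d → ℕ, ∏ w ∈ s, l w ^ β w =
      ∏ i ∈ (Finsupp.equivFunOnFinite.symm fun w : s => β w).support,
        l i ^ (Finsupp.equivFunOnFinite.symm fun w : s => β w) i := by
    intro β
    rw [← Finset.prod_coe_sort]
    symm
    exact Finset.prod_subset (Finset.subset_univ _) (by
      intro i _ hi
      rw [Finsupp.notMem_support_iff.1 hi, pow_zero])
  refine Finset.sum_bij_ne_zero (fun β _ _ => Finsupp.equivFunOnFinite.symm fun w : s => β w)
    ?_ ?_ ?_ ?_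
  · intro β _ hβ
    rw [MvPolynomial.mem_support_iff]
    exact left_ne_zero_of_mul hβ
  · intro β hβ _ γ hγ _ h
    have h1 := Finsupp.equivFunOnFinite.symm.injective h
    rw [Finset.mem_piAntidiag] at hβ hγ
    ext w
    by_cases hw : w ∈ s
    · exact congrFun h1 ⟨w, hw⟩
    · have e1 : β w = 0 := by_contra fun h' => hw (hβ.2 w h')
      have e2 : γ w = 0 := by_contra fun h' => hw (hγ.2 w h')
      rw [e1, e2]
  · intro γ hγ hne
    set β : Sp d → ℕ := fun w => if h : w ∈ s then γ ⟨w, h⟩ else 0 with hβ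
    have hγe : (Finsupp.equivFunOnFinite.symm fun w : s => β w) = γ := by
      ext w; simp [hβ]
    have hmem : β ∈ s.piAntidiag m := by
      rw [Finset.mem_piAntidiag]
      constructor
      · rw [← Finset.sum_coe_sort]
        have h1 := hF (MvPolynomial.mem_support_iff.1 hγ)
        rw [Finsupp.weight_apply, Finsupp.sum_fintype _ _ (by simp)] at h1
        rw [← h1]
        exact Finset.sum_congr rfl fun w _ => by simp
      · intro w hw
        by_contra h
        exact hw (by simp [hβ, h])
    refine ⟨β, hmem, ?_, hγe⟩
    rw [hprod, hγe]
    exact hne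
  · intro β _ _
    rw [hprod]

/-- Substitute `x = ∑ w, l w • w` and multiply each monomial by the power of `∑ w, l w = 1` that
raises its degree to `m`. The result is homogeneous in `l`, and no affine independence of `s` is
involved. -/
lemma IsPoly.exists_rep {m : ℕ} {v : Sp d → ℝ} (hv : IsPoly m v) (s : Finset (Sp d)) :
    ∃ c, Rep s m c v := by
  obtain ⟨P, hP, h⟩ := hv
  set L : Fin d → MvPolynomial s ℝ := fun i =>
    ∑ w : s, MvPolynomial.C ((w : Sp d) i) * MvPolynomial.X w with hL
  set I : MvPolynomial s ℝ := ∑ w : s, MvPolynomial.X w with hI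
  have hLh : ∀ i, (L i).IsHomogeneous 1 := fun i =>
    MvPolynomial.IsHomogeneous.sum _ _ _ fun w _ => (MvPolynomial.isHomogeneous_X ℝ w).C_mul _
  have hIh : I.IsHomogeneous 1 :=
    MvPolynomial.IsHomogeneous.sum _ _ _ fun w _ => MvPolynomial.isHomogeneous_X ℝ w
  set F : MvPolynomial s ℝ := ∑ γ ∈ P.support, MvPolynomial.C (P.coeff γ) *
    ((∏ i, L i ^ γ i) * I ^ (m - ∑ i, γ i)) with hF
  have hFh : F.IsHomogeneous m := by
    refine MvPolynomial.IsHomogeneous.sum _ _ _ fun γ hγ => MvPolynomial.IsHomogeneous.C_mul ?_ _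
    have h1 : (∏ i, L i ^ γ i).IsHomogeneous (∑ i, 1 * γ i) :=
      MvPolynomial.IsHomogeneous.prod _ _ _ fun i _ => (hLh i).pow _
    have h2 := h1.mul (hIh.pow (m - ∑ i, γ i))
    have h3 := (MvPolynomial.le_totalDegree hγ).trans hP
    rw [Finsupp.sum_fintype _ _ (by simp)] at h3
    convert h2 using 1
    simp only [one_mul]
    omega
  obtain ⟨c, hc⟩ := exists_bern_of_homogeneous hFh
  refine ⟨c, fun l h0 h1 => ?_⟩
  rw [← hc, h, hF, map_sum, MvPolynomial.eval_eq']
  refine Finset.sum_congr rfl fun γ _ => ?_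
  have e1 : MvPolynomial.eval (fun w : s => l w) I = 1 := by
    rw [hI, map_sum, ← h1, ← Finset.sum_coe_sort s]
    simp
  have e2 : ∀ i, MvPolynomial.eval (fun w : s => l w) (L i) = (∑ w ∈ s, l w • w) i := by
    intro i
    rw [hL, map_sum, ← Finset.sum_coe_sort s]
    simp [mul_comm]
  simp only [map_mul, map_prod, map_pow, MvPolynomial.eval_C, e1, e2, one_pow, mul_one]

/-! ### Bounds for Bernstein coefficients -/

/-- The linear map sending Bernstein coefficients to functions on the standard simplex. -/
def bernMap (n m : ℕ) : ((Finset.univ : Finset (Fin n)).piAntidiag m → ℝ) →ₗ[ℝ]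
    C(stdSimplex ℝ (Fin n), ℝ) where
  toFun c := ⟨fun l => ∑ β, c β * ∏ w, (l : Fin n → ℝ) w ^ (β : Fin n → ℕ) w, by
    have : ∀ w, Continuous fun l : stdSimplex ℝ (Fin n) => (l : Fin n → ℝ) w := fun w =>
      (continuous_apply w).comp continuous_subtype_val
    exact continuous_finsetSum _ fun β _ => continuous_const.mul
      (continuous_finsetProd _ fun w _ => (this w).pow _)⟩
  map_add' c c' := ContinuousMap.ext fun l => by
    change ∑ β, (c β + c' β) * _ = (∑ β, c β * _) + ∑ β, c' β * _
    simp_rw [add_mul]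
    exact Finset.sum_add_distrib
  map_smul' t c := ContinuousMap.ext fun l => by
    change ∑ β, (t * c β) * _ = t * ∑ β, c β * _
    simp_rw [mul_assoc]
    exact (Finset.mul_sum _ _ _).symm

/-- A homogeneous polynomial that vanishes on the standard simplex vanishes on the positive orthant
by scaling, hence identically. -/
lemma ker_bernMap {n m : ℕ} (hn : 0 < n) : LinearMap.ker (bernMap n m) = ⊥ := by
  rw [LinearMap.ker_eq_bot']
  intro c hc
  have hz : ∀ l : Fin n → ℝ, (∀ i, 0 ≤ l i) → ∑ i, l i = 1 →
      ∑ β, c β * ∏ w, l w ^ (β : Fin n → ℕ) w = 0 := by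
    intro l h0 h1
    have := congrArg (fun f : C(stdSimplex ℝ (Fin n), ℝ) => f ⟨l, h0, h1⟩) hc
    exact this
  set P : MvPolynomial (Fin n) ℝ := ∑ β : (Finset.univ : Finset (Fin n)).piAntidiag m,
    MvPolynomial.monomial (Finsupp.equivFunOnFinite.symm (β : Fin n → ℕ)) (c β) with hP
  have hPe : ∀ l : Fin n → ℝ, MvPolynomial.eval l P =
      ∑ β, c β * ∏ w, l w ^ (β : Fin n → ℕ) w := by
    intro l
    rw [hP, map_sum]
    refine Finset.sum_congr rfl fun β _ => ?_
    rw [MvPolynomial.eval_monomial, Finsupp.prod_fintype _ _ (by simp)]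
    rfl
  have hcoeff : ∀ β : (Finset.univ : Finset (Fin n)).piAntidiag m,
      P.coeff (Finsupp.equivFunOnFinite.symm (β : Fin n → ℕ)) = c β := by
    intro β
    rw [hP, MvPolynomial.coeff_sum, Finset.sum_eq_single β]
    · simp
    · intro γ _ hγ
      rw [MvPolynomial.coeff_monomial, if_neg]
      intro h
      exact hγ (Subtype.ext (Finsupp.equivFunOnFinite.symm.injective h))
    · simp
  have hP0 : P = 0 := by
    have : Nonempty (Fin n) := ⟨⟨0, hn⟩⟩
    refine MvPolynomial.funext_set (fun _ => Set.Ioi (0 : ℝ)) (fun _ => Set.Ioi_infinite 0)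
      fun l hl => ?_
    have hl' : ∀ i, 0 < l i := fun i => hl i trivial
    set S := ∑ i, l i with hS
    have hSpos : 0 < S := Finset.sum_pos (fun i _ => hl' i) Finset.univ_nonempty
    have h1 := hz (fun i => S⁻¹ * l i) (fun i => by have := hl' i; positivity)
      (by rw [← Finset.mul_sum, inv_mul_cancel₀ hSpos.ne'])
    rw [map_zero, hPe]
    have h2 : ∑ β, c β * ∏ w, (S⁻¹ * l w) ^ (β : Fin n → ℕ) w =
        S⁻¹ ^ m * ∑ β, c β * ∏ w, l w ^ (β : Fin n → ℕ) w := by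
      rw [Finset.mul_sum]
      refine Finset.sum_congr rfl fun β _ => ?_
      simp_rw [mul_pow]
      rw [Finset.prod_mul_distrib, Finset.prod_pow_eq_pow_sum,
        (Finset.mem_piAntidiag.1 β.2).1]
      ring
    rw [h2] at h1
    exact (mul_eq_zero.1 h1).resolve_left (by positivity)
  ext β
  rw [← hcoeff β, hP0]; simp

/-- An injective linear map on a finite-dimensional space is bounded below; here the target carries
the supremum norm over the standard simplex. The constant involves `n` and `m` alone, so it is
independent of the shape of any simplex. -/
lemma exists_bern_bound_fin {n : ℕ} (hn : 0 < n) (m : ℕ) :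
    ∃ C > 0, ∀ (c : (Fin n → ℕ) → ℝ) (M : ℝ),
      (∀ l : Fin n → ℝ, (∀ i, 0 ≤ l i) → ∑ i, l i = 1 → |bern Finset.univ m c l| ≤ M) →
      ∀ γ ∈ (Finset.univ : Finset (Fin n)).piAntidiag m, |c γ| ≤ C * M := by
  obtain ⟨C, hC, hanti⟩ := LinearMap.exists_antilipschitzWith (bernMap n m) (ker_bernMap hn)
  refine ⟨C, hC, fun c M hM γ hγ => ?_⟩
  set c' : (Finset.univ : Finset (Fin n)).piAntidiag m → ℝ := fun β => c β with hc'
  have hM0 : 0 ≤ M := by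
    refine (abs_nonneg _).trans (hM (Pi.single ⟨0, hn⟩ 1) (fun i => ?_) (by simp))
    by_cases h : i = ⟨0, hn⟩ <;> simp [h]
  have h1 : ‖bernMap n m c'‖ ≤ M := by
    rw [ContinuousMap.norm_le _ hM0]
    intro l
    have := hM l l.2.1 l.2.2
    rw [bern, ← Finset.sum_coe_sort] at this
    exact this
  have h2 := hanti.le_mul_dist c' 0
  rw [map_zero, dist_zero_right, dist_zero_right] at h2
  calc |c γ| = ‖c' ⟨γ, hγ⟩‖ := rfl
    _ ≤ ‖c'‖ := norm_le_pi_norm c' _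
    _ ≤ C * ‖bernMap n m c'‖ := h2
    _ ≤ C * M := by gcongr

lemma exists_bern_bound {n : ℕ} (hn : 0 < n) (m : ℕ) :
    ∃ C > 0, ∀ (ι : Type) [DecidableEq ι] (s : Finset ι), s.card = n →
      ∀ (c : (ι → ℕ) → ℝ) (M : ℝ),
      (∀ l : ι → ℝ, (∀ i ∈ s, 0 ≤ l i) → ∑ i ∈ s, l i = 1 → |bern s m c l| ≤ M) →
      ∀ γ ∈ s.piAntidiag m, |c γ| ≤ C * M := by
  obtain ⟨C, hC, hb⟩ := exists_bern_bound_fin hn m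
  refine ⟨C, hC, fun ι _ s hs c M hM γ hγ => ?_⟩
  have e : s ≃ Fin n := s.equivFinOfCardEq hs
  set up : (Fin n → ℕ) → (ι → ℕ) := fun β w => if h : w ∈ s then β (e ⟨w, h⟩) else 0 with hup
  set dn : (ι → ℕ) → (Fin n → ℕ) := fun β i => β (e.symm i) with hdn
  have hsum : ∀ {M : Type} [AddCommMonoid M] (f : ι → M), ∑ w ∈ s, f w = ∑ i, f (e.symm i) := by
    intro M _ f
    rw [← Finset.sum_coe_sort s]
    exact (Equiv.sum_comp e.symm (fun w : s => f w)).symm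
  have hprod : ∀ (f : ι → ℝ), ∏ w ∈ s, f w = ∏ i, f (e.symm i) := by
    intro f
    rw [← Finset.prod_coe_sort s]
    exact (Equiv.prod_comp e.symm (fun w : s => f w)).symm
  have hdu : ∀ β, dn (up β) = β := by
    intro β; ext i; simp [hdn, hup]
  have hud : ∀ β ∈ s.piAntidiag m, up (dn β) = β := by
    intro β hβ
    rw [Finset.mem_piAntidiag] at hβ
    ext w
    by_cases hw : w ∈ s
    · simp [hdn, hup, hw]
    · have : β w = 0 := by_contra fun h' => hw (hβ.2 w h')
      simp [hup, hw, this]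
  have hdm : ∀ β ∈ s.piAntidiag m, dn β ∈ (Finset.univ : Finset (Fin n)).piAntidiag m := by
    intro β hβ
    rw [Finset.mem_piAntidiag] at hβ ⊢
    exact ⟨by rw [← hβ.1, hsum], fun _ _ => Finset.mem_univ _⟩
  have hum : ∀ β ∈ (Finset.univ : Finset (Fin n)).piAntidiag m, up β ∈ s.piAntidiag m := by
    intro β hβ
    rw [Finset.mem_piAntidiag] at hβ ⊢
    refine ⟨?_, fun w hw => by_contra fun h => hw (by simp [hup, h])⟩
    rw [← hβ.1, hsum]
    exact Finset.sum_congr rfl fun i _ => by simp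
  have key := hb (fun β => c (up β)) M (fun l h0 h1 => ?_) (dn γ) (hdm γ hγ)
  · simpa only [hud γ hγ] using key
  · have h2 := hM (fun w => if h : w ∈ s then l (e ⟨w, h⟩) else 0)
      (fun w hw => by simp [hw, h0]) (by rw [hsum]; simpa using h1)
    convert h2 using 2
    unfold bern
    refine Finset.sum_bij' (fun β _ => up β) (fun β _ => dn β) hum hdm (fun β _ => hdu β) hud ?_
    intro β _
    rw [hprod]
    simp [hup]

/-- The Bernstein polynomial with coefficients `c` on a face of the simplex `K`. -/
def bernPoly (K s : Finset (Sp d)) (m : ℕ) (c : (Sp d → ℕ) → ℝ) (x : Sp d) : ℝ :=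
  bern s m c (fun w => bary K w x)

lemma IsSimplex.isPoly_bernPoly {K : Finset (Sp d)} (hK : IsSimplex K) (s : Finset (Sp d)) (m : ℕ)
    (c : (Sp d → ℕ) → ℝ) : IsPoly m (bernPoly K s m c) := by
  unfold bernPoly bern
  refine isPoly_sum _ _ fun β hβ => IsPoly.const_mul _ ?_
  have h := isPoly_prod s (fun w x => bary K w x ^ β w) (fun w => β w * 1)
    (fun w _ => (hK.isPoly_bary w).pow _)
  simp only [mul_one] at h
  rwa [(Finset.mem_piAntidiag.1 hβ).1] at h

lemma IsSimplex.rep_bernPoly {K s : Finset (Sp d)} (hK : IsSimplex K) (hs : s ⊆ K) (m : ℕ)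
    (c : (Sp d → ℕ) → ℝ) : Rep s m c (bernPoly K s m c) := by
  intro l h0 h1
  unfold bernPoly bern
  refine Finset.sum_congr rfl fun β _ => ?_
  congr 1
  refine Finset.prod_congr rfl fun w hw => ?_
  simp only
  rw [← sum_extend hs l (fun w => w), hK.bary_sum _ (hs hw)]
  · simp [hw]
  · have := sum_extend hs l (fun _ => (1 : ℝ))
    simpa [h1] using this

lemma Rep.abs_le {s : Finset (Sp d)} {m : ℕ} {c : (Sp d → ℕ) → ℝ} {v : Sp d → ℝ}
    (h : Rep s m c v) {x : Sp d} (hx : x ∈ hull s) : |v x| ≤ ∑ β ∈ s.piAntidiag m, |c β| := by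
  obtain ⟨l, h0, h1, rfl⟩ := mem_hull_iff_exists.1 hx
  rw [h l h0 h1, bern]
  refine (Finset.abs_sum_le_sum_abs _ _).trans (Finset.sum_le_sum fun β _ => ?_)
  rw [abs_mul]
  refine mul_le_of_le_one_right (abs_nonneg _) ?_
  rw [Finset.abs_prod]
  refine Finset.prod_le_one (fun _ _ => abs_nonneg _) fun w hw => ?_
  rw [abs_pow]
  refine pow_le_one₀ (abs_nonneg _) ?_
  rw [abs_of_nonneg (h0 w hw), ← h1]
  exact Finset.single_le_sum h0 hw

/-- Bernstein coefficients on a side are controlled by the `L²` norm on that side. -/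
lemma exists_bern_surf_bound {d : ℕ} (hd : 1 ≤ d) (m : ℕ) {σ : ℝ} (hσ : 0 < σ) :
    ∃ C > 0, ∀ (K : Finset (Sp d)), IsSimplex K →
      (∃ x₀, Metric.closedBall x₀ (size K / σ) ⊆ hull K) → ∀ a ∈ K,
      ∀ (c : (Sp d → ℕ) → ℝ) (g : Sp d → ℝ), Rep (K.erase a) m c g →
      ∀ β ∈ (K.erase a).piAntidiag m,
        size K ^ d * c β ^ 2 ≤ C * (size K * ∫ y, g y ^ 2 ∂(surfOn (K.erase a))) := by
  obtain ⟨C₁, hC₁, hinv⟩ := exists_inverse d m hσ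
  obtain ⟨C₂, hC₂, hbern⟩ := exists_bern_bound (n := d) (by omega) m
  refine ⟨C₂ ^ 2 * C₁, by positivity, fun K hK hball a ha c g hg β hβ => ?_⟩
  obtain ⟨x₀, hx₀⟩ := hball
  have hh := hK.size_pos hd
  have hx₀m : x₀ ∈ hull K := hx₀ (Metric.mem_closedBall_self (by positivity))
  set e := K.erase a with he
  have hsub : e ⊆ K := Finset.erase_subset _ _
  -- The function on the side is extended to `K` by the same Bernstein polynomial in the coordinates
  -- of `K`. The extension is homogeneous of degree `m` about `a`, so cone coordinates bound its
  -- `L²` norm on `K` by that on the side, and the inverse inequality on `K` becomes available.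
  set P := bernPoly K e m c with hP
  have hPp : IsPoly m P := hK.isPoly_bernPoly e m c
  have hPr : Rep e m c P := hK.rep_bernPoly hsub m c
  have hPg : ∀ y ∈ hull e, P y = g y := by
    intro y hy
    obtain ⟨l, h0, h1, rfl⟩ := mem_hull_iff_exists.1 hy
    rw [hPr l h0 h1, hg l h0 h1]
  have hcone : ∀ (s : ℝ) (y : Sp d), P (a + s • (y - a)) = s ^ m * P y := by
    intro s y
    rw [hP]
    unfold bernPoly bern
    rw [Finset.mul_sum]
    refine Finset.sum_congr rfl fun γ hγ => ?_
    have h1 : ∏ w ∈ e, bary K w (a + s • (y - a)) ^ γ w =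
        ∏ w ∈ e, (s ^ γ w * bary K w y ^ γ w) := by
      refine Finset.prod_congr rfl fun w hw => ?_
      have hw' := Finset.mem_erase.1 hw
      rw [hK.bary_lineMap hw'.2, hK.bary_of_ne hw'.2 ha hw'.1, ← mul_pow]
      congr 1; ring
    rw [h1, Finset.prod_mul_distrib, Finset.prod_pow_eq_pow_sum, (Finset.mem_piAntidiag.1 hγ).1]
    ring
  have hmid : ∫ x, P x ^ 2 ∂(volOn K) ≤ size K * ∫ y, g y ^ 2 ∂(surfOn e) := by
    have h0 : ∫ y, g y ^ 2 ∂(surfOn e) = ∫ y, P y ^ 2 ∂(surfOn e) :=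
      integral_congr_ae ((ae_mem_hull_surfOn e).mono fun y hy => by simp only [hPg y hy])
    rw [hK.integral_cone hd ha (F := fun x => P x ^ 2) (hPp.continuous.pow 2), h0, ← integral_const_mul]
    refine integral_mono_of_nonneg (ae_of_all _ fun y => ?_) ?_ (ae_of_all _ fun y => ?_)
    · refine intervalIntegral.integral_nonneg zero_le_one fun s hs => ?_
      have := (hK.height_pos hd ha).le
      have := hs.1
      positivity
    · exact (hK.integrable_surfOn hd ha (hPp.continuous.pow 2)).const_mul _
    · have h2 : ∀ s : ℝ, height K a * s ^ (d - 1) * P (a + s • (y - a)) ^ 2 =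
          height K a * P y ^ 2 * s ^ (d - 1 + 2 * m) := by
        intro s
        rw [hcone, pow_add, pow_mul]; ring
      simp_rw [h2]
      rw [intervalIntegral.integral_const_mul, integral_pow]
      have h3 : ((1 : ℝ) ^ (d - 1 + 2 * m + 1) - 0 ^ (d - 1 + 2 * m + 1)) /
          ((d - 1 + 2 * m : ℕ) + 1) ≤ 1 := by
        rw [one_pow, zero_pow (by omega), sub_zero]
        refine div_le_one_of_le₀ ?_ (by positivity)
        have : (0 : ℝ) ≤ (d - 1 + 2 * m : ℕ) := by positivity
        linarith
      have h4 := hK.height_le_size hd ha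
      have h5 := (hK.height_pos hd ha).le
      calc _ ≤ height K a * P y ^ 2 * 1 := by gcongr
        _ ≤ size K * P y ^ 2 := by rw [mul_one]; gcongr
  have hcard : e.card = d := by rw [he, Finset.card_erase_of_mem ha, hK.card]; rfl
  set I := ∫ x, P x ^ 2 ∂(volOn K) with hI
  have hI0 : 0 ≤ I := integral_nonneg fun _ => sq_nonneg _
  have hM : ∀ l : Sp d → ℝ, (∀ i ∈ e, 0 ≤ l i) → ∑ i ∈ e, l i = 1 →
      |bern e m c l| ≤ √(C₁ * I / size K ^ d) := by
    intro l h0 h1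
    rw [← hPr l h0 h1]
    refine Real.abs_le_sqrt ?_
    rw [le_div_iff₀ (by positivity), mul_comm]
    exact (hinv K x₀ (size K) hh hx₀ (fun x hx => dist_le_size hx hx₀m) P hPp _
      (hull_mono hsub (mem_hull_iff_exists.2 ⟨l, h0, h1, rfl⟩))).1
  have h1 := hbern (Sp d) e hcard c _ hM β hβ
  have h2 : c β ^ 2 ≤ C₂ ^ 2 * (C₁ * I / size K ^ d) := by
    rw [← sq_abs]
    calc |c β| ^ 2 ≤ (C₂ * √(C₁ * I / size K ^ d)) ^ 2 := by gcongr
      _ = _ := by rw [mul_pow, Real.sq_sqrt (by positivity)]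
  calc size K ^ d * c β ^ 2 ≤ size K ^ d * (C₂ ^ 2 * (C₁ * I / size K ^ d)) := by gcongr
    _ = C₂ ^ 2 * C₁ * I := by field_simp
    _ ≤ _ := by gcongr

/-! ### Mollification with dilation -/

lemma sq_lintegral_le {α : Type*} [MeasurableSpace α] (ν : Measure α) [IsProbabilityMeasure ν]
    {f : α → ℝ≥0∞} (hf : AEMeasurable f ν) : (∫⁻ t, f t ∂ν) ^ 2 ≤ ∫⁻ t, f t ^ 2 ∂ν := by
  have h := ENNReal.lintegral_mul_le_Lp_mul_Lq ν (p := 2) (q := 2) Real.HolderConjugate.two_two hf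
    (g := fun _ => 1) aemeasurable_const
  simp only [Pi.mul_apply, mul_one, ENNReal.one_rpow, lintegral_const, measure_univ] at h
  calc (∫⁻ t, f t ∂ν) ^ 2 ≤ ((∫⁻ a, f a ^ (2 : ℝ) ∂ν) ^ (1 / (2 : ℝ))) ^ 2 := by gcongr
    _ = ∫⁻ t, f t ^ 2 ∂ν := by
      rw [← ENNReal.rpow_natCast, ← ENNReal.rpow_mul]
      norm_num

open ContinuousLinearMap in
/-- Mollification of `F` composed with the dilation of ratio `1 - ε` and centre `x₀`. -/
def dilMoll (b : ContDiffBump (0 : Sp d)) (x₀ : Sp d) (ε : ℝ) (F : Sp d → ℝ) (x : Sp d) : ℝ :=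
  (convolution (b.normed volume) F (lsmul ℝ ℝ) volume) (x + ε • (x₀ - x))

lemma convolution_normed_apply (b : ContDiffBump (0 : Sp d)) (F : Sp d → ℝ) (x : Sp d) :
    (convolution (b.normed volume) F (ContinuousLinearMap.lsmul ℝ ℝ) volume) x =
      ∫ t, b.normed volume t * F (x - t) := rfl

/-- The normalized bump is a probability density, so the square of the average is at most the
average of the squares; then Tonelli and translation invariance. -/
lemma lintegral_sq_convolution_le (b : ContDiffBump (0 : Sp d)) {F : Sp d → ℝ} (hF : Measurable F) :
    ∫⁻ x, ‖(convolution (b.normed volume) F (ContinuousLinearMap.lsmul ℝ ℝ) volume) x‖ₑ ^ 2 ≤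
      ∫⁻ x, ‖F x‖ₑ ^ 2 := by
  set ν : Measure (Sp d) := volume.withDensity fun t => ENNReal.ofReal (b.normed volume t) with hν
  have hbm : Measurable fun t => ENNReal.ofReal (b.normed volume t) :=
    (b.continuous_normed).measurable.ennreal_ofReal
  have hprob : IsProbabilityMeasure ν := ⟨by
    rw [hν, withDensity_apply _ MeasurableSet.univ, Measure.restrict_univ,
      ← ofReal_integral_eq_lintegral_ofReal b.integrable_normed (ae_of_all _ b.nonneg_normed),
      b.integral_normed, ENNReal.ofReal_one]⟩
  have h1 : ∀ x, ‖(convolution (b.normed volume) F (ContinuousLinearMap.lsmul ℝ ℝ) volume) x‖ₑ ^ 2 ≤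
      ∫⁻ t, ‖F (x - t)‖ₑ ^ 2 ∂ν := by
    intro x
    have hm : Measurable fun t => ‖F (x - t)‖ₑ := (hF.comp (by fun_prop)).enorm
    refine le_trans ?_ (sq_lintegral_le ν hm.aemeasurable)
    gcongr
    rw [convolution_normed_apply, hν, lintegral_withDensity_eq_lintegral_mul _ hbm hm]
    refine (enorm_integral_le_lintegral_enorm _).trans (lintegral_mono fun t => ?_)
    simp only [Pi.mul_apply]
    rw [enorm_mul, Real.enorm_of_nonneg (b.nonneg_normed t)]
  calc _ ≤ ∫⁻ x, ∫⁻ t, ‖F (x - t)‖ₑ ^ 2 ∂ν := lintegral_mono h1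
    _ = ∫⁻ t, (∫⁻ x, ‖F (x - t)‖ₑ ^ 2) ∂ν := by
      rw [lintegral_lintegral_swap]
      exact ((hF.comp (measurable_fst.sub measurable_snd)).enorm.pow_const 2).aemeasurable
    _ = ∫⁻ t, (∫⁻ x, ‖F x‖ₑ ^ 2) ∂ν := by
      refine lintegral_congr fun t => ?_
      exact lintegral_sub_right_eq_self (fun x => ‖F x‖ₑ ^ 2) t
    _ = _ := by simp

lemma lintegral_comp_dilation (x₀ : Sp d) {ε : ℝ} (hε : ε ≤ 1 / 2) (f : Sp d → ℝ≥0∞)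
    (hf : Measurable f) : ∫⁻ x, f (x + ε • (x₀ - x)) ≤ 2 ^ d * ∫⁻ x, f x := by
  have h1 : ∀ x : Sp d, x + ε • (x₀ - x) = (1 - ε) • x + ε • x₀ := fun x => by module
  simp_rw [h1]
  have hne : (1 - ε) ≠ 0 := by linarith
  have h2 : ∫⁻ x, f ((1 - ε) • x + ε • x₀) =
      ENNReal.ofReal |((1 - ε) ^ d)⁻¹| * ∫⁻ x, f x := by
    have h3 := lintegral_map (μ := (volume : Measure (Sp d))) (f := fun y => f (y + ε • x₀))
      (g := fun x : Sp d => (1 - ε) • x) (hf.comp (by fun_prop)) (by fun_prop)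
    rw [Measure.map_addHaar_smul _ hne, lintegral_smul_measure, finrank_euclideanSpace_fin,
      lintegral_add_right_eq_self, smul_eq_mul] at h3
    exact h3.symm
  rw [h2]
  gcongr
  rw [abs_of_nonneg (by have : 0 ≤ 1 - ε := by linarith
                        positivity), ← inv_pow, ENNReal.ofReal_pow (by
    have : 0 < 1 - ε := by linarith
    positivity)]
  gcongr
  rw [show (2 : ℝ≥0∞) = ENNReal.ofReal 2 by simp]
  apply ENNReal.ofReal_le_ofReal
  rw [inv_le_comm₀ (by linarith) (by norm_num)]
  linarith

lemma eLpNorm_two_eq {α : Type*} [MeasurableSpace α] (μ : Measure α) (f : α → ℝ) :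
    eLpNorm f 2 μ = (∫⁻ x, ‖f x‖ₑ ^ 2 ∂μ) ^ (1 / 2 : ℝ) := by
  rw [eLpNorm_eq_lintegral_rpow_enorm_toReal (by norm_num) (by norm_num)]
  simp

lemma measurable_dilMoll (b : ContDiffBump (0 : Sp d)) (x₀ : Sp d) (ε : ℝ) {F : Sp d → ℝ}
    (hF : LocallyIntegrable F) : ContDiff ℝ ∞ (dilMoll b x₀ ε F) := by
  have h1 : ContDiff ℝ ∞ (convolution (b.normed volume) F (ContinuousLinearMap.lsmul ℝ ℝ) volume) :=
    b.hasCompactSupport_normed.contDiff_convolution_left _ b.contDiff_normed hF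
  exact h1.comp (by fun_prop)

lemma eLpNorm_dilMoll_le (b : ContDiffBump (0 : Sp d)) (x₀ : Sp d) {ε : ℝ}
    (hε : ε ≤ 1 / 2) {F : Sp d → ℝ} (hF : Measurable F) (hFi : LocallyIntegrable F) :
    eLpNorm (dilMoll b x₀ ε F) 2 volume ≤ 2 ^ d * eLpNorm F 2 volume := by
  have hc : Continuous (convolution (b.normed volume) F (ContinuousLinearMap.lsmul ℝ ℝ) volume) :=
    (b.hasCompactSupport_normed.contDiff_convolution_left (n := 0) _ b.contDiff_normed hFi).continuous
  rw [eLpNorm_two_eq, eLpNorm_two_eq]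
  have h1 : ∫⁻ x, ‖dilMoll b x₀ ε F x‖ₑ ^ 2 ≤ 2 ^ d * ∫⁻ x, ‖F x‖ₑ ^ 2 := by
    refine (lintegral_comp_dilation x₀ hε _ (hc.measurable.enorm.pow_const 2)).trans ?_
    exact mul_le_mul_right (lintegral_sq_convolution_le b hF) _
  calc _ ≤ (2 ^ d * ∫⁻ x, ‖F x‖ₑ ^ 2) ^ (1 / 2 : ℝ) := by gcongr
    _ = (2 ^ d) ^ (1 / 2 : ℝ) * (∫⁻ x, ‖F x‖ₑ ^ 2) ^ (1 / 2 : ℝ) :=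
      ENNReal.mul_rpow_of_nonneg _ _ (by norm_num)
    _ ≤ _ := by
      gcongr
      have : (1 : ℝ≥0∞) ≤ 2 ^ d := one_le_pow₀ (by norm_num)
      calc ((2 : ℝ≥0∞) ^ d) ^ (1 / 2 : ℝ) ≤ (2 ^ d) ^ (1 : ℝ) :=
            ENNReal.rpow_le_rpow_of_exponent_le this (by norm_num)
        _ = 2 ^ d := ENNReal.rpow_one _

/-- A sequence of bump functions whose radii tend to zero. -/
def bumpSeq (r : ℝ) (hr : 0 < r) (n : ℕ) : ContDiffBump (0 : Sp d) where
  rIn := r / (n + 2) / 2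
  -- The outer radius is `r` times the dilation parameter `(n + 2)⁻¹` used throughout, the relation
  -- required by `pderiv_dilMoll`; the shift by two keeps that parameter at most one half.
  rOut := r / (n + 2)
  rIn_pos := by positivity
  rIn_lt_rOut := half_lt_self (by positivity)

lemma tendsto_dilMoll_of_continuous {r : ℝ} (hr : 0 < r) (x₀ : Sp d) {G : Sp d → ℝ}
    (hG : Continuous G) (hGs : HasCompactSupport G) (K : Finset (Sp d)) :
    Tendsto (fun n : ℕ => eLpNorm (fun x => dilMoll (bumpSeq r hr n) x₀ ((n + 2 : ℝ)⁻¹) G x - G x) 2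
      (volOn K)) atTop (𝓝 0) := by
  have huc : UniformContinuous G := hGs.uniformContinuous_of_continuous hG
  obtain ⟨R, hR⟩ : ∃ R : ℝ, ∀ x ∈ hull K, ‖x₀ - x‖ ≤ R :=
    (isCompact_hull K).exists_bound_of_continuousOn (by fun_prop)
  set V := (volOn K Set.univ) ^ (1 / 2 : ℝ) with hV
  have hVt : V ≠ ⊤ := ENNReal.rpow_ne_top_of_nonneg (by norm_num) (measure_ne_top _ _)
  rw [ENNReal.tendsto_nhds_zero]
  intro δ hδ
  obtain ⟨η, hη, hηδ⟩ : ∃ η : ℝ, 0 < η ∧ V * ENNReal.ofReal η ≤ δ := by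
    rcases eq_or_ne δ ⊤ with h | h
    · exact ⟨1, one_pos, by rw [h]; exact le_top⟩
    · refine ⟨δ.toReal / (V.toReal + 1), ?_, ?_⟩
      · have := ENNReal.toReal_pos hδ.ne' h
        positivity
      · rw [← ENNReal.ofReal_toReal hVt, ← ENNReal.ofReal_mul ENNReal.toReal_nonneg]
        conv_rhs => rw [← ENNReal.ofReal_toReal h]
        apply ENNReal.ofReal_le_ofReal
        rw [ENNReal.toReal_ofReal ENNReal.toReal_nonneg, ← mul_div_assoc,
          div_le_iff₀ (by have : 0 ≤ V.toReal := ENNReal.toReal_nonneg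
                          positivity)]
        nlinarith [ENNReal.toReal_nonneg (a := V), ENNReal.toReal_nonneg (a := δ)]
  obtain ⟨κ, hκ, hG'⟩ := Metric.uniformContinuous_iff.1 huc (η / 2) (by positivity)
  have hlim : Tendsto (fun n : ℕ => ((n : ℝ) + 2)⁻¹) atTop (𝓝 0) :=
    tendsto_inv_atTop_zero.comp (tendsto_atTop_add_const_right _ _ tendsto_natCast_atTop_atTop)
  have h1 : ∀ᶠ n : ℕ in atTop, ((n : ℝ) + 2)⁻¹ * r < κ := by
    have := hlim.mul_const r
    rw [zero_mul] at this
    exact this.eventually (gt_mem_nhds hκ)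
  have h2 : ∀ᶠ n : ℕ in atTop, ((n : ℝ) + 2)⁻¹ * R < κ := by
    have := hlim.mul_const R
    rw [zero_mul] at this
    exact this.eventually (gt_mem_nhds hκ)
  filter_upwards [h1, h2] with n hn1 hn2
  have hpt : ∀ x ∈ hull K, ‖dilMoll (bumpSeq r hr n) x₀ ((n + 2 : ℝ)⁻¹) G x - G x‖ ≤ η := by
    intro x hx
    set X := x + ((n : ℝ) + 2)⁻¹ • (x₀ - x) with hX
    have e1 : dist (dilMoll (bumpSeq r hr n) x₀ ((n + 2 : ℝ)⁻¹) G x) (G X) ≤ η / 2 := by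
      refine ContDiffBump.dist_normed_convolution_le hG.aestronglyMeasurable fun y hy => ?_
      refine (hG' (lt_of_lt_of_le (Metric.mem_ball.1 hy) ?_)).le
      rw [inv_mul_eq_div] at hn1
      exact hn1.le
    have e2 : dist (G X) (G x) ≤ η / 2 := by
      refine (hG' ?_).le
      rw [hX, dist_self_add_left, norm_smul, Real.norm_of_nonneg (by positivity)]
      refine lt_of_le_of_lt ?_ hn2
      have := hR x hx
      gcongr
    rw [← dist_eq_norm]
    linarith [dist_triangle (dilMoll (bumpSeq r hr n) x₀ ((n + 2 : ℝ)⁻¹) G x) (G X) (G x)]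
  refine (eLpNorm_le_of_ae_bound ((ae_mem_hull_volOn K).mono fun x hx => hpt x hx)).trans ?_
  refine le_trans (le_of_eq ?_) hηδ
  rw [hV]
  congr 2
  norm_num

/-- Continuous functions of compact support are dense in `L²`, for them the convergence is uniform
on `K`, and `eLpNorm_dilMoll_le` bounds the operators uniformly in `n`. -/
lemma tendsto_dilMoll {r : ℝ} (hr : 0 < r) (x₀ : Sp d) {F : Sp d → ℝ} (hFm : Measurable F)
    (hF : MemLp F 2 volume) (K : Finset (Sp d)) :
    Tendsto (fun n : ℕ => eLpNorm (fun x => dilMoll (bumpSeq r hr n) x₀ ((n + 2 : ℝ)⁻¹) F x - F x) 2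
      (volOn K)) atTop (𝓝 0) := by
  have hFi : LocallyIntegrable F := hF.locallyIntegrable (by norm_num)
  rw [ENNReal.tendsto_nhds_zero]
  intro δ hδ
  obtain ⟨η, hη, hηδ⟩ : ∃ η : ℝ≥0∞, η ≠ 0 ∧ 2 ^ d * η + η + η ≤ δ := by
    rcases eq_or_ne δ ⊤ with h | h
    · exact ⟨1, one_ne_zero, by rw [h]; exact le_top⟩
    · refine ⟨δ / (2 ^ d + 2), ?_, ?_⟩
      · rw [ENNReal.div_ne_zero]
        exact ⟨hδ.ne', by simp⟩
      · have : 2 ^ d * (δ / (2 ^ d + 2)) + δ / (2 ^ d + 2) + δ / (2 ^ d + 2) =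
            (2 ^ d + 2) * (δ / (2 ^ d + 2)) := by ring
        rw [this]
        exact ENNReal.mul_div_le
  obtain ⟨G, hGs, hGle, hG, hGm⟩ := hF.exists_hasCompactSupport_eLpNorm_sub_le (by norm_num) hη
  have hGi : LocallyIntegrable G := hG.locallyIntegrable
  have hlim := tendsto_dilMoll_of_continuous hr x₀ hG hGs K
  rw [ENNReal.tendsto_nhds_zero] at hlim
  filter_upwards [hlim η (pos_iff_ne_zero.2 hη)] with n hn
  set b := bumpSeq (d := d) r hr n with hb
  set ε := ((n : ℝ) + 2)⁻¹ with hε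
  have hε1 : ε ≤ 1 / 2 := by
    rw [hε, one_div]
    exact inv_anti₀ (by norm_num) (by have : (0 : ℝ) ≤ n := by positivity
                                      linarith)
  have hFGi : LocallyIntegrable (fun x => F x - G x) := hFi.sub hGi
  have hlin : ∀ x, dilMoll b x₀ ε (fun x => F x - G x) x = dilMoll b x₀ ε F x - dilMoll b x₀ ε G x := by
    intro x
    unfold dilMoll
    rw [convolution_normed_apply, convolution_normed_apply, convolution_normed_apply,
      ← integral_sub]
    · simp_rw [mul_sub]
    · exact b.hasCompactSupport_normed.convolutionExists_left (ContinuousLinearMap.lsmul ℝ ℝ)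
        b.continuous_normed hFi _
    · exact b.hasCompactSupport_normed.convolutionExists_left (ContinuousLinearMap.lsmul ℝ ℝ)
        b.continuous_normed hGi _
  have e0 : (fun x => dilMoll b x₀ ε F x - F x) = (dilMoll b x₀ ε (fun x => F x - G x) +
      fun x => dilMoll b x₀ ε G x - G x) + fun x => -(F x - G x) := by
    ext x
    simp only [Pi.add_apply, hlin]
    ring
  have m1 := (measurable_dilMoll b x₀ ε hFGi).continuous
  have m2 := (measurable_dilMoll b x₀ ε hGi).continuous
  have e1 : eLpNorm (dilMoll b x₀ ε (fun x => F x - G x)) 2 (volOn K) ≤ 2 ^ d * η := by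
    refine (eLpNorm_mono_measure _ Measure.restrict_le_self).trans ?_
    refine (eLpNorm_dilMoll_le b x₀ hε1 (hFm.sub hG.measurable) hFGi).trans ?_
    exact mul_le_mul_right hGle _
  have e2 : eLpNorm (fun x => -(F x - G x)) 2 (volOn K) ≤ η := by
    refine (eLpNorm_mono_measure _ Measure.restrict_le_self).trans ?_
    rw [show (fun x => -(F x - G x)) = -(F - G) from rfl, eLpNorm_neg]
    exact hGle
  rw [e0]
  refine le_trans (eLpNorm_add_le (by fun_prop)
    (hFm.sub hG.measurable).neg.aestronglyMeasurable (by norm_num)) ?_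
  refine le_trans (add_le_add (eLpNorm_add_le (by fun_prop) (by fun_prop) (by norm_num)) le_rfl) ?_
  refine le_trans ?_ hηδ
  gcongr

/-! ### Weak derivatives on an element and smooth approximation -/

/-- `g` is the weak gradient of `w` in the interior of `K`, both being square integrable. -/
structure HasWeakGrad (K : Finset (Sp d)) (w : Sp d → ℝ) (g : Fin d → Sp d → ℝ) : Prop where
  memLp : MemLp w 2 (volOn K)
  memLp_grad : ∀ i, MemLp (g i) 2 (volOn K)
  weak : ∀ φ : Sp d → ℝ, IsTest (interior (hull K)) φ → ∀ i,
    ∫ x, w x * pderiv i φ x ∂(volOn K) = -∫ x, g i x * φ x ∂(volOn K)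

/-- The smooth functions `φ n` converge to `w` in `H¹(K)`, `g` being the gradient of `w`. -/
structure ApproxH1 (K : Finset (Sp d)) (w : Sp d → ℝ) (g : Fin d → Sp d → ℝ)
    (φ : ℕ → Sp d → ℝ) : Prop where
  smooth : ∀ n, ContDiff ℝ ∞ (φ n)
  tendsto : Tendsto (fun n => eLpNorm (fun x => φ n x - w x) 2 (volOn K)) atTop (𝓝 0)
  tendsto_grad : ∀ i, Tendsto (fun n => eLpNorm (fun x => pderiv i (φ n) x - g i x) 2 (volOn K))
    atTop (𝓝 0)

lemma continuous_pderiv {φ : Sp d → ℝ} (hφ : ContDiff ℝ ∞ φ) (i : Fin d) :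
    Continuous (pderiv i φ) :=
  (hφ.continuous_fderiv (by simp)).clm_apply continuous_const

lemma integral_volOn_eq (K : Finset (Sp d)) (f φ : Sp d → ℝ) :
    ∫ x, f x * φ x ∂(volOn K) = ∫ x, Set.indicator (hull K) f x * φ x := by
  rw [volOn, ← integral_indicator (measurableSet_hull K)]
  congr 1
  ext x
  by_cases hx : x ∈ hull K <;> simp [hx]

lemma integrable_fderiv_convolution {B W : Sp d → ℝ} (hcs : HasCompactSupport B)
    (hBs : ContDiff ℝ 1 B) (hW : LocallyIntegrable W) (X : Sp d) :
    Integrable (fun t => (ContinuousLinearMap.precompL (Sp d)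
      (ContinuousLinearMap.lsmul ℝ ℝ : ℝ →L[ℝ] ℝ →L[ℝ] ℝ)) (fderiv ℝ B t) (W (X - t))) volume := by
  have h := (hcs.fderiv ℝ).convolutionExists_left (μ := volume) (ContinuousLinearMap.precompL (Sp d)
    (ContinuousLinearMap.lsmul ℝ ℝ)) (hBs.continuous_fderiv one_ne_zero) hW X
  exact h

lemma fderiv_convolution_apply {B W : Sp d → ℝ} (X e : Sp d)
    (hmid : Integrable (fun t => (ContinuousLinearMap.precompL (Sp d)
      (ContinuousLinearMap.lsmul ℝ ℝ : ℝ →L[ℝ] ℝ →L[ℝ] ℝ)) (fderiv ℝ B t) (W (X - t))) volume) :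
    (convolution (fderiv ℝ B) W (ContinuousLinearMap.precompL (Sp d)
      (ContinuousLinearMap.lsmul ℝ ℝ)) volume X) e = ∫ t, fderiv ℝ B t e * W (X - t) := by
  rw [convolution_def, ContinuousLinearMap.integral_apply hmid]
  rfl

lemma hasFDerivAt_convolution_normed {B W : Sp d → ℝ} (hcs : HasCompactSupport B)
    (hBs : ContDiff ℝ 1 B) (hW : LocallyIntegrable W) (X : Sp d) :
    HasFDerivAt (convolution B W (ContinuousLinearMap.lsmul ℝ ℝ) volume)
      (convolution (fderiv ℝ B) W (ContinuousLinearMap.precompL (Sp d)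
        (ContinuousLinearMap.lsmul ℝ ℝ)) volume X) X :=
  hcs.hasFDerivAt_convolution_left (ContinuousLinearMap.lsmul ℝ ℝ) hBs hW X

lemma exists_hasFDerivAt_convolution {B W : Sp d → ℝ} (hcs : HasCompactSupport B)
    (hBs : ContDiff ℝ 1 B) (hW : LocallyIntegrable W) (X : Sp d) :
    ∃ L : Sp d →L[ℝ] ℝ,
      HasFDerivAt (convolution B W (ContinuousLinearMap.lsmul ℝ ℝ) volume) L X ∧
      ∀ e, L e = ∫ t, fderiv ℝ B t e * W (X - t) :=
  ⟨_, hasFDerivAt_convolution_normed hcs hBs hW X, fun e => fderiv_convolution_apply X e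
    (integrable_fderiv_convolution hcs hBs hW X)⟩

/-- By convexity, moving a point of `K` towards `x₀` by the fraction `ε` leaves room for a ball of
radius `ε * r` in the interior. The translated bump is then a test function on the interior, so the
derivative passes to `g` and the jump of the zero extension across the boundary is never seen. The
factor `1 - ε` is the chain rule. -/
lemma pderiv_dilMoll {K : Finset (Sp d)} {w : Sp d → ℝ} {g : Fin d → Sp d → ℝ}
    (h : HasWeakGrad K w g) (hwi : LocallyIntegrable (Set.indicator (hull K) w))
    (b : ContDiffBump (0 : Sp d)) {x₀ : Sp d} {r ε : ℝ} (hε : 0 < ε) (hε1 : ε < 1)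
    (hr : Metric.closedBall x₀ r ⊆ interior (hull K)) (hb : b.rOut = ε * r) {x : Sp d}
    (hx : x ∈ hull K) (i : Fin d) :
    pderiv i (dilMoll b x₀ ε (Set.indicator (hull K) w)) x =
      (1 - ε) * dilMoll b x₀ ε (Set.indicator (hull K) (g i)) x := by
  set W := Set.indicator (hull K) w with hW
  set X := x + ε • (x₀ - x) with hX
  set B := b.normed (volume : Measure (Sp d)) with hB
  have hBs : ContDiff ℝ ∞ B := b.contDiff_normed
  obtain ⟨L, hconv, hL⟩ := exists_hasFDerivAt_convolution b.hasCompactSupport_normed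
    (hBs.of_le (by simp)) hwi X
  have hA : HasFDerivAt (fun y : Sp d => y + ε • (x₀ - y)) ((1 - ε) • ContinuousLinearMap.id ℝ (Sp d)) x := by
    have h1 : (fun y : Sp d => y + ε • (x₀ - y)) = fun y => (1 - ε) • y + ε • x₀ := by
      ext1 y; module
    rw [h1]
    exact ((hasFDerivAt_id x).const_smul (1 - ε)).add_const _
  set e : Sp d := EuclideanSpace.single i 1 with he
  have h1 : pderiv i (dilMoll b x₀ ε W) x = (1 - ε) * L e := by
    have h2 : fderiv ℝ (dilMoll b x₀ ε W) x = _ := (hconv.comp x hA).fderiv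
    rw [pderiv, h2]
    simp [he]
  have h3 := hL e
  set φ : Sp d → ℝ := fun z => B (X - z) with hφ
  have hφd : ∀ z, pderiv i φ z = - fderiv ℝ B (X - z) e := by
    intro z
    have h4 : HasFDerivAt (fun z : Sp d => X - z) (-ContinuousLinearMap.id ℝ (Sp d)) z :=
      (hasFDerivAt_id z).const_sub X
    have h5 := ((hBs.differentiable (by simp)) (X - z)).hasFDerivAt.comp z h4
    have h6 : fderiv ℝ φ z = _ := h5.fderiv
    rw [pderiv, h6]
    simp [he]
  have hball : ∀ z, dist z X ≤ ε * r → z ∈ interior (hull K) := by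
    intro z hz
    set y := x₀ + ε⁻¹ • (z - X) with hy
    have hym : y ∈ interior (hull K) := hr (by
      rw [Metric.mem_closedBall, hy, dist_self_add_left, norm_smul, norm_inv,
        Real.norm_of_nonneg hε.le, ← dist_eq_norm, inv_mul_le_iff₀ hε]
      exact hz)
    have hzy : z = (1 - ε) • x + ε • y := by
      rw [hy, smul_add, smul_smul, mul_inv_cancel₀ hε.ne', one_smul, hX]; module
    rw [hzy]
    exact (convex_hull K).combo_self_interior_mem_interior hx hym (by linarith) hε (by ring)
  have htest : IsTest (interior (hull K)) φ := by
    have hsupp : tsupport φ ⊆ Metric.closedBall X (ε * r) := by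
      refine closure_minimal ?_ Metric.isClosed_closedBall
      intro z hz
      have hz' : X - z ∈ Function.support B := hz
      rw [hB, b.support_normed_eq, hb, mem_ball_zero_iff, norm_sub_rev, ← dist_eq_norm] at hz'
      exact hz'.le
    refine ⟨hBs.comp (by fun_prop), ?_, fun z hz => hball z (hsupp hz)⟩
    exact HasCompactSupport.of_support_subset_isCompact (isCompact_closedBall X (ε * r))
      (subset_closure.trans hsupp)
  have h7 := h.weak φ htest i
  rw [integral_volOn_eq, integral_volOn_eq] at h7
  have h8 : ∫ t, fderiv ℝ B t e * W (X - t) = ∫ z, fderiv ℝ B (X - z) e * W z := by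
    rw [← integral_sub_left_eq_self (fun t => fderiv ℝ B t e * W (X - t)) volume X]
    simp
  have h9 : ∫ t, B t * Set.indicator (hull K) (g i) (X - t) =
      ∫ z, Set.indicator (hull K) (g i) z * φ z := by
    rw [← integral_sub_left_eq_self (fun t => B t * Set.indicator (hull K) (g i) (X - t)) volume X]
    simp [hφ, mul_comm]
  rw [h1, h3, h8]
  congr 1
  unfold dilMoll
  rw [convolution_normed_apply, ← hB, ← hX, h9, ← neg_eq_iff_eq_neg.2 h7, ← integral_neg]
  congr 1
  ext z
  rw [hφd]; ring

/-- Mollification alone would lose control near the boundary; the preceding contraction towards an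
interior point makes the approximants smooth up to the boundary and convergent on all of `K`. -/
lemma IsSimplex.exists_approxH1 {K : Finset (Sp d)} (hK : IsSimplex K) {w : Sp d → ℝ}
    {g : Fin d → Sp d → ℝ} (h : HasWeakGrad K w g) : ∃ φ, ApproxH1 K w g φ := by
  -- measurable representatives
  obtain ⟨w', hw'm, hww'⟩ : ∃ w', Measurable w' ∧ w =ᵐ[volOn K] w' :=
    ⟨h.memLp.1.mk w, h.memLp.1.stronglyMeasurable_mk.measurable, h.memLp.1.ae_eq_mk⟩
  have hg' : ∀ i, ∃ g', Measurable g' ∧ g i =ᵐ[volOn K] g' := fun i =>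
    ⟨(h.memLp_grad i).1.mk (g i), (h.memLp_grad i).1.stronglyMeasurable_mk.measurable,
      (h.memLp_grad i).1.ae_eq_mk⟩
  choose g' hg'm hgg' using hg'
  have h' : HasWeakGrad K w' g' := by
    refine ⟨h.memLp.ae_eq hww', fun i => (h.memLp_grad i).ae_eq (hgg' i), fun φ hφ i => ?_⟩
    have e1 : ∫ x, w' x * pderiv i φ x ∂(volOn K) = ∫ x, w x * pderiv i φ x ∂(volOn K) :=
      integral_congr_ae (hww'.symm.mono fun x hx => by simp only [hx])
    have e2 : ∫ x, g' i x * φ x ∂(volOn K) = ∫ x, g i x * φ x ∂(volOn K) :=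
      integral_congr_ae ((hgg' i).symm.mono fun x hx => by simp only [hx])
    rw [e1, e2, h.weak φ hφ i]
  obtain ⟨x₀, hx₀⟩ := hK.interior_nonempty
  obtain ⟨r, hr, hball⟩ := Metric.isOpen_iff.1 isOpen_interior x₀ hx₀
  have hr2 : 0 < r / 2 := by positivity
  have hcball : Metric.closedBall x₀ (r / 2) ⊆ interior (hull K) :=
    (Metric.closedBall_subset_ball (by linarith)).trans hball
  have hmem : ∀ f : Sp d → ℝ, MemLp f 2 (volOn K) → MemLp (Set.indicator (hull K) f) 2 volume :=
    fun f hf => (memLp_indicator_iff_restrict (measurableSet_hull K)).2 hf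
  have hind : ∀ f : Sp d → ℝ, Set.indicator (hull K) f =ᵐ[volOn K] f := fun f =>
    (ae_mem_hull_volOn K).mono fun x hx => Set.indicator_of_mem hx f
  have hW := hmem _ h'.memLp
  have hWi : LocallyIntegrable (Set.indicator (hull K) w') := hW.locallyIntegrable (by norm_num)
  refine ⟨fun n => dilMoll (bumpSeq (r / 2) hr2 n) x₀ ((n + 2 : ℝ)⁻¹) (Set.indicator (hull K) w'),
    fun n => measurable_dilMoll _ _ _ hWi, ?_, fun i => ?_⟩
  · refine (tendsto_dilMoll hr2 x₀ (hw'm.indicator (measurableSet_hull K)) hW K).congr fun n => ?_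
    refine eLpNorm_congr_ae ?_
    filter_upwards [hind w', hww'] with x hx1 hx2
    rw [hx1, hx2]
  · have hG := hmem _ (h'.memLp_grad i)
    set G := Set.indicator (hull K) (g' i) with hGdef
    have hGm : Measurable G := (hg'm i).indicator (measurableSet_hull K)
    have hGi : LocallyIntegrable G := hG.locallyIntegrable (by norm_num)
    have hlim := tendsto_dilMoll hr2 x₀ hGm hG K
    have hε : Tendsto (fun n : ℕ => ENNReal.ofReal ((n : ℝ) + 2)⁻¹) atTop (𝓝 0) := by
      rw [← ENNReal.ofReal_zero]
      exact ENNReal.tendsto_ofReal (tendsto_inv_atTop_zero.comp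
        (tendsto_atTop_add_const_right _ _ tendsto_natCast_atTop_atTop))
    have hbound : ∀ n : ℕ, eLpNorm (fun x => pderiv i (dilMoll (bumpSeq (r / 2) hr2 n) x₀
        ((n + 2 : ℝ)⁻¹) (Set.indicator (hull K) w')) x - g i x) 2 (volOn K) ≤
        eLpNorm (fun x => dilMoll (bumpSeq (r / 2) hr2 n) x₀ ((n + 2 : ℝ)⁻¹) G x - G x) 2 (volOn K) +
        ENNReal.ofReal ((n : ℝ) + 2)⁻¹ * (2 ^ d * eLpNorm G 2 volume) := by
      intro n
      set b := bumpSeq (d := d) (r / 2) hr2 n with hb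
      set ε := ((n : ℝ) + 2)⁻¹ with hεdef
      have hε0 : 0 < ε := by positivity
      have hε1 : ε ≤ 1 / 2 := by
        rw [hεdef, one_div]
        exact inv_anti₀ (by norm_num) (by have : (0 : ℝ) ≤ n := by positivity
                                          linarith)
      have hc := (measurable_dilMoll b x₀ ε hGi).continuous
      have e1 : eLpNorm (fun x => pderiv i (dilMoll b x₀ ε (Set.indicator (hull K) w')) x - g i x) 2
          (volOn K) = eLpNorm ((fun x => dilMoll b x₀ ε G x - G x) +
            fun x => (-ε) • dilMoll b x₀ ε G x) 2 (volOn K) := by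
        refine eLpNorm_congr_ae ?_
        filter_upwards [hind (g' i), hgg' i, ae_mem_hull_volOn K] with x hx1 hx2 hx3
        rw [pderiv_dilMoll h' hWi b hε0 (by linarith) hcball
          (by rw [hb, hεdef, inv_mul_eq_div]; rfl) hx3]
        simp only [Pi.add_apply, smul_eq_mul]
        rw [← hGdef] at hx1 ⊢
        rw [hx1, hx2]; ring
      rw [e1]
      refine (eLpNorm_add_le ((hc.measurable.sub hGm).aestronglyMeasurable) (by fun_prop)
        (by norm_num)).trans ?_
      refine add_le_add le_rfl ?_
      rw [show (fun x => (-ε) • dilMoll b x₀ ε G x) = (-ε) • dilMoll b x₀ ε G from rfl,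
        eLpNorm_const_smul]
      gcongr
      · rw [enorm_neg, Real.enorm_of_nonneg hε0.le]
      · exact (eLpNorm_mono_measure _ Measure.restrict_le_self).trans
          (eLpNorm_dilMoll_le b x₀ hε1 hGm hGi)
    -- The error splits into the mollification error of `G` and the part `ε` times a bounded norm
    -- caused by the factor `1 - ε`.
    refine tendsto_of_tendsto_of_tendsto_of_le_of_le tendsto_const_nhds ?_ (fun _ => zero_le)
      hbound
    have hne : (2 ^ d * eLpNorm G 2 volume) ≠ ⊤ := ENNReal.mul_ne_top (by simp) hG.2.ne
    have := hlim.add (ENNReal.Tendsto.mul_const hε (Or.inr hne))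
    simpa using this

/-! ### Square integrable functions -/

section L2

variable {X : Type*} [MeasurableSpace X] {μ : Measure X}

lemma memLp_sub_fun {f g : X → ℝ} (hf : MemLp f 2 μ) (hg : MemLp g 2 μ) :
    MemLp (fun x => f x - g x) 2 μ := hf.sub hg

lemma integrable_mul_L2 {f g : X → ℝ} (hf : MemLp f 2 μ) (hg : MemLp g 2 μ) :
    Integrable (fun x => f x * g x) μ := hf.integrable_mul hg

lemma sq_integral_mul_le {f g : X → ℝ} (hf : MemLp f 2 μ) (hg : MemLp g 2 μ) :
    (∫ x, f x * g x ∂μ) ^ 2 ≤ (∫ x, f x ^ 2 ∂μ) * ∫ x, g x ^ 2 ∂μ := by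
  have h : ∀ s : ℝ, 0 ≤ (∫ x, g x ^ 2 ∂μ) * (s * s) + (2 * ∫ x, f x * g x ∂μ) * s +
      ∫ x, f x ^ 2 ∂μ := by
    intro s
    have h1 : ∫ x, (f x + s * g x) ^ 2 ∂μ = (∫ x, g x ^ 2 ∂μ) * (s * s) +
        (2 * ∫ x, f x * g x ∂μ) * s + ∫ x, f x ^ 2 ∂μ := by
      have e : (fun x => (f x + s * g x) ^ 2) = fun x => (s * s) * g x ^ 2 +
          (2 * s) * (f x * g x) + f x ^ 2 := by ext x; ring
      rw [e, integral_add, integral_add, integral_const_mul, integral_const_mul]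
      · ring
      · exact hg.integrable_sq.const_mul _
      · exact (integrable_mul_L2 hf hg).const_mul _
      · exact (hg.integrable_sq.const_mul _).add ((integrable_mul_L2 hf hg).const_mul _)
      · exact hf.integrable_sq
    rw [← h1]
    exact integral_nonneg fun x => sq_nonneg _
  have := discrim_le_zero h
  rw [discrim] at this
  nlinarith

lemma abs_integral_mul_le {f g : X → ℝ} (hf : MemLp f 2 μ) (hg : MemLp g 2 μ) :
    |∫ x, f x * g x ∂μ| ≤ √(∫ x, f x ^ 2 ∂μ) * √(∫ x, g x ^ 2 ∂μ) := by
  rw [← Real.sqrt_mul (integral_nonneg fun x => sq_nonneg _)]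
  exact Real.abs_le_sqrt (sq_integral_mul_le hf hg)

lemma integral_add_sq_le {f g : X → ℝ} (hf : MemLp f 2 μ) (hg : MemLp g 2 μ) :
    ∫ x, (f x + g x) ^ 2 ∂μ ≤ 2 * ∫ x, f x ^ 2 ∂μ + 2 * ∫ x, g x ^ 2 ∂μ := by
  rw [← integral_const_mul, ← integral_const_mul, ← integral_add]
  · refine integral_mono (hf.add hg).integrable_sq
      ((hf.integrable_sq.const_mul _).add (hg.integrable_sq.const_mul _)) fun x => ?_
    change (f x + g x) ^ 2 ≤ 2 * f x ^ 2 + 2 * g x ^ 2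
    nlinarith [sq_nonneg (f x - g x)]
  · exact hf.integrable_sq.const_mul _
  · exact hg.integrable_sq.const_mul _

lemma integral_sub_sq_le {f g : X → ℝ} (hf : MemLp f 2 μ) (hg : MemLp g 2 μ) :
    ∫ x, (f x - g x) ^ 2 ∂μ ≤ 2 * ∫ x, f x ^ 2 ∂μ + 2 * ∫ x, g x ^ 2 ∂μ := by
  have := integral_add_sq_le hf hg.neg
  simpa [sub_eq_add_neg] using this

lemma eLpNorm_two_eq_sqrt {f : X → ℝ} (hf : MemLp f 2 μ) :
    eLpNorm f 2 μ = ENNReal.ofReal √(∫ x, f x ^ 2 ∂μ) := by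
  rw [hf.eLpNorm_eq_integral_rpow_norm (by norm_num) (by norm_num), Real.sqrt_eq_rpow]
  simp

/-- `φ n → w` in `L²(μ)`. -/
structure L2Lim (μ : Measure X) (φ : ℕ → X → ℝ) (w : X → ℝ) : Prop where
  memLp_seq : ∀ n, MemLp (φ n) 2 μ
  memLp : MemLp w 2 μ
  tendsto : Tendsto (fun n => ∫ x, (φ n x - w x) ^ 2 ∂μ) atTop (𝓝 0)

lemma L2Lim.of_eLpNorm {φ : ℕ → X → ℝ} {w : X → ℝ} (hφ : ∀ n, MemLp (φ n) 2 μ)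
    (hw : MemLp w 2 μ) (h : Tendsto (fun n => eLpNorm (fun x => φ n x - w x) 2 μ) atTop (𝓝 0)) :
    L2Lim μ φ w := by
  refine ⟨hφ, hw, ?_⟩
  have h1 := (ENNReal.tendsto_toReal ENNReal.zero_ne_top).comp h
  have h2 : ∀ n, ((ENNReal.toReal ∘ fun n => eLpNorm (fun x => φ n x - w x) 2 μ) n) ^ 2 =
      ∫ x, (φ n x - w x) ^ 2 ∂μ := by
    intro n
    rw [Function.comp_apply, eLpNorm_two_eq_sqrt (memLp_sub_fun (hφ n) hw),
      ENNReal.toReal_ofReal (Real.sqrt_nonneg _), Real.sq_sqrt (integral_nonneg fun x => sq_nonneg _)]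
  have h3 := h1.pow 2
  simp only [ENNReal.toReal_zero, ne_eq, OfNat.ofNat_ne_zero, not_false_eq_true, zero_pow] at h3
  exact h3.congr h2

lemma L2Lim.const {w : X → ℝ} (hw : MemLp w 2 μ) : L2Lim μ (fun _ => w) w :=
  ⟨fun _ => hw, hw, by simp⟩

lemma L2Lim.sub_const {φ : ℕ → X → ℝ} {w g : X → ℝ} (h : L2Lim μ φ w) (hg : MemLp g 2 μ) :
    L2Lim μ (fun n x => φ n x - g x) (fun x => w x - g x) :=
  ⟨fun n => (h.memLp_seq n).sub hg, h.memLp.sub hg, by simpa using h.tendsto⟩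

lemma L2Lim.integral_mul {φ ψ : ℕ → X → ℝ} {w v : X → ℝ} (h : L2Lim μ φ w) (h' : L2Lim μ ψ v) :
    Tendsto (fun n => ∫ x, φ n x * ψ n x ∂μ) atTop (𝓝 (∫ x, w x * v x ∂μ)) := by
  have hs := h.tendsto.sqrt
  have hs' := h'.tendsto.sqrt
  rw [Real.sqrt_zero] at hs hs'
  rw [tendsto_iff_norm_sub_tendsto_zero]
  refine squeeze_zero (fun n => norm_nonneg _) (fun n => ?_) (t₀ := atTop)
    (g := fun n => √(∫ x, (φ n x - w x) ^ 2 ∂μ) * √(∫ x, (ψ n x - v x) ^ 2 ∂μ) +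
      √(∫ x, (φ n x - w x) ^ 2 ∂μ) * √(∫ x, v x ^ 2 ∂μ) +
      √(∫ x, w x ^ 2 ∂μ) * √(∫ x, (ψ n x - v x) ^ 2 ∂μ)) ?_
  · have a := memLp_sub_fun (h.memLp_seq n) h.memLp
    have b := memLp_sub_fun (h'.memLp_seq n) h'.memLp
    have e : ∫ x, φ n x * ψ n x ∂μ - ∫ x, w x * v x ∂μ =
        ∫ x, (φ n x - w x) * (ψ n x - v x) ∂μ + ∫ x, (φ n x - w x) * v x ∂μ +
          ∫ x, w x * (ψ n x - v x) ∂μ := by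
      rw [← integral_sub (integrable_mul_L2 (h.memLp_seq n) (h'.memLp_seq n))
        (integrable_mul_L2 h.memLp h'.memLp),
        ← integral_add (integrable_mul_L2 a b) (integrable_mul_L2 a h'.memLp),
        ← integral_add (by exact (integrable_mul_L2 a b).add (integrable_mul_L2 a h'.memLp))
          (integrable_mul_L2 h.memLp b)]
      congr 1
      ext x
      ring
    rw [e, Real.norm_eq_abs]
    refine (abs_add_le _ _).trans (add_le_add ((abs_add_le _ _).trans (add_le_add ?_ ?_)) ?_)
    · exact abs_integral_mul_le a b
    · exact abs_integral_mul_le a h'.memLp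
    · exact abs_integral_mul_le h.memLp b
  · simpa using ((hs.mul hs').add (hs.mul_const _)).add (hs'.const_mul (√(∫ x, w x ^ 2 ∂μ)))

lemma L2Lim.integral_sq {φ : ℕ → X → ℝ} {w : X → ℝ} (h : L2Lim μ φ w) :
    Tendsto (fun n => ∫ x, φ n x ^ 2 ∂μ) atTop (𝓝 (∫ x, w x ^ 2 ∂μ)) := by
  simpa only [← sq] using h.integral_mul h

lemma L2Lim.integral [IsFiniteMeasure μ] {φ : ℕ → X → ℝ} {w : X → ℝ} (h : L2Lim μ φ w) :
    Tendsto (fun n => ∫ x, φ n x ∂μ) atTop (𝓝 (∫ x, w x ∂μ)) := by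
  simpa using h.integral_mul (L2Lim.const (memLp_const (1 : ℝ)))

/-- Completeness of `L²`. -/
lemma exists_L2Lim {φ : ℕ → X → ℝ} (hφ : ∀ n, MemLp (φ n) 2 μ) (b : ℕ → ℝ)
    (hb : Tendsto b atTop (𝓝 0))
    (h : ∀ n m, ∫ x, (φ n x - φ m x) ^ 2 ∂μ ≤ b n + b m) : ∃ w, L2Lim μ φ w := by
  have hd : ∀ n m, dist ((hφ n).toLp (φ n)) ((hφ m).toLp (φ m)) = √(∫ x, (φ n x - φ m x) ^ 2 ∂μ) := by
    intro n m
    rw [dist_edist, Lp.edist_toLp_toLp, eLpNorm_two_eq_sqrt ((hφ n).sub (hφ m)),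
      ENNReal.toReal_ofReal (Real.sqrt_nonneg _)]
    rfl
  have hc : CauchySeq (fun n => (hφ n).toLp (φ n)) := by
    rw [Metric.cauchySeq_iff]
    intro ε hε
    have := (Metric.tendsto_atTop.1 hb) (ε ^ 2 / 2) (by positivity)
    obtain ⟨N, hN⟩ := this
    refine ⟨N, fun n hn m hm => ?_⟩
    rw [hd]
    have h1 := hN n hn
    have h2 := hN m hm
    rw [Real.dist_eq, sub_zero] at h1 h2
    rw [Real.sqrt_lt' hε]
    have := h n m
    linarith [le_abs_self (b n), le_abs_self (b m)]
  obtain ⟨w, hw⟩ := cauchySeq_tendsto_of_complete hc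
  refine ⟨w, L2Lim.of_eLpNorm hφ (Lp.memLp w) ?_⟩
  rw [Lp.tendsto_Lp_iff_tendsto_eLpNorm'] at hw
  refine hw.congr fun n => eLpNorm_congr_ae ?_
  filter_upwards [(hφ n).coeFn_toLp] with x hx
  rw [Pi.sub_apply, hx]

end L2

/-! ### Poincaré inequality -/

lemma sq_fderiv_apply_le {φ : Sp d → ℝ} (x v : Sp d) :
    (fderiv ℝ φ x v) ^ 2 ≤ (∑ i, pderiv i φ x ^ 2) * ‖v‖ ^ 2 := by
  have hv : v = ∑ i, v i • EuclideanSpace.single i (1 : ℝ) := by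
    have := (EuclideanSpace.basisFun (Fin d) ℝ).sum_repr v
    simpa using this.symm
  have h1 : fderiv ℝ φ x v = ∑ i, pderiv i φ x * v i := by
    conv_lhs => rw [hv]
    rw [map_sum]
    refine Finset.sum_congr rfl fun i _ => ?_
    rw [map_smul, smul_eq_mul, mul_comm]; rfl
  rw [h1, EuclideanSpace.norm_sq_eq]
  simpa using Finset.sum_mul_sq_le_sq_mul_sq Finset.univ (fun i => pderiv i φ x) (fun i => v i)

/-- The fundamental theorem of calculus on the segment from `x` to `y`, followed by Cauchy–Schwarz.
The indicator costs nothing on the segment and allows the base point to range over all of space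
later. -/
lemma sq_sub_le_lintegral {φ : Sp d → ℝ} (hφ : ContDiff ℝ ∞ φ) {K : Finset (Sp d)} {x y : Sp d}
    (hx : x ∈ hull K) (hy : y ∈ hull K) :
    ENNReal.ofReal ((φ x - φ y) ^ 2) ≤ ∫⁻ s in Set.Ioc (0 : ℝ) 1, ENNReal.ofReal (size K ^ 2) *
      (hull K).indicator (fun z => ENNReal.ofReal (∑ i, pderiv i φ z ^ 2)) (x + s • (y - x)) := by
  have hc : Continuous fun s : ℝ => fderiv ℝ φ (x + s • (y - x)) (y - x) :=
    ((hφ.continuous_fderiv (by simp)).comp (by fun_prop)).clm_apply continuous_const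
  have hftc : ∫ s in (0 : ℝ)..1, fderiv ℝ φ (x + s • (y - x)) (y - x) = φ y - φ x := by
    have := intervalIntegral.integral_eq_sub_of_hasDerivAt (a := 0) (b := 1)
      (f := fun s : ℝ => φ (x + s • (y - x))) (f' := fun s => fderiv ℝ φ (x + s • (y - x)) (y - x))
      (fun s _ => ?_) (hc.intervalIntegrable _ _)
    · simpa using this
    · have h1 : HasDerivAt (fun s : ℝ => x + s • (y - x)) (y - x) s := by
        simpa using ((hasDerivAt_id s).smul_const (y - x)).const_add x
      exact ((hφ.differentiable (by simp)) _).hasFDerivAt.comp_hasDerivAt s h1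
  have hm : MemLp (fun s : ℝ => fderiv ℝ φ (x + s • (y - x)) (y - x)) 2
      (volume.restrict (Set.Ioc (0 : ℝ) 1)) := by
    obtain ⟨C, hC⟩ := (isCompact_Icc (a := (0 : ℝ)) (b := 1)).exists_bound_of_continuousOn
      hc.continuousOn
    refine MemLp.of_bound hc.aestronglyMeasurable C ?_
    filter_upwards [ae_restrict_mem measurableSet_Ioc] with s hs
    exact hC s ⟨hs.1.le, hs.2⟩
  have hcs := sq_integral_mul_le hm (memLp_const (1 : ℝ))
  rw [intervalIntegral.integral_of_le zero_le_one] at hftc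
  simp only [mul_one, hftc, one_pow, integral_const, smul_eq_mul] at hcs
  have hv : (volume.restrict (Set.Ioc (0 : ℝ) 1)).real Set.univ = 1 := by simp [Measure.real]
  rw [hv, mul_one] at hcs
  rw [show (φ x - φ y) ^ 2 = (φ y - φ x) ^ 2 by ring]
  refine (ENNReal.ofReal_le_ofReal hcs).trans ?_
  rw [ofReal_integral_eq_lintegral_ofReal hm.integrable_sq (ae_of_all _ fun s => sq_nonneg _)]
  refine lintegral_mono_ae ?_
  filter_upwards [ae_restrict_mem measurableSet_Ioc] with s hs
  have hmem : x + s • (y - x) ∈ hull K := by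
    have := convex_hull K hx hy (a := 1 - s) (b := s) (by linarith [hs.2]) hs.1.le (by ring)
    convert this using 1; module
  rw [Set.indicator_of_mem hmem, ← ENNReal.ofReal_mul (by positivity)]
  refine ENNReal.ofReal_le_ofReal ((sq_fderiv_apply_le _ _).trans ?_)
  rw [mul_comm]
  refine mul_le_mul_of_nonneg_right ?_ (Finset.sum_nonneg fun i _ => sq_nonneg _)
  rw [← dist_eq_norm]
  exact pow_le_pow_left₀ dist_nonneg (dist_le_size hy hx) 2

/-- Put `v = y - x`, which lies in the ball of radius `size K`, and enlarge the domain of `x` to the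
whole space. Translation invariance then removes the shift by `s • v`, and the integral over `v`
contributes the volume of the ball. -/
lemma lintegral_sq_sub_le {φ : Sp d → ℝ} (hφ : ContDiff ℝ ∞ φ) (K : Finset (Sp d)) :
    ∫⁻ x, ∫⁻ y, ENNReal.ofReal ((φ x - φ y) ^ 2) ∂(volOn K) ∂(volOn K) ≤
      volume (Metric.closedBall (0 : Sp d) (size K)) * (ENNReal.ofReal (size K ^ 2) *
        ∫⁻ x, ENNReal.ofReal (∑ i, pderiv i φ x ^ 2) ∂(volOn K)) := by
  set G := (hull K).indicator (fun z => ENNReal.ofReal (∑ i, pderiv i φ z ^ 2)) with hG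
  have hGm : Measurable G := by
    refine Measurable.indicator ?_ (measurableSet_hull K)
    have : ∀ i, Continuous (pderiv i φ) := continuous_pderiv hφ
    fun_prop
  set A := Metric.closedBall (0 : Sp d) (size K) with hA
  have hAm : MeasurableSet A := Metric.isClosed_closedBall.measurableSet
  set R : Sp d → Sp d → ℝ≥0∞ := fun x v => ∫⁻ s in Set.Ioc (0 : ℝ) 1,
    ENNReal.ofReal (size K ^ 2) * G (x + s • v) with hR
  have hRm : Measurable (Function.uncurry R) := by
    refine Measurable.lintegral_prod_right' (f := fun z : (Sp d × Sp d) × ℝ =>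
      ENNReal.ofReal (size K ^ 2) * G (z.1.1 + z.2 • z.1.2)) ?_
    exact (hGm.comp (by fun_prop)).const_mul _
  calc ∫⁻ x, ∫⁻ y, ENNReal.ofReal ((φ x - φ y) ^ 2) ∂(volOn K) ∂(volOn K)
      ≤ ∫⁻ x, ∫⁻ y, A.indicator (R x) (y - x) ∂volume ∂(volOn K) := by
        refine lintegral_mono_ae ?_
        filter_upwards [ae_mem_hull_volOn K] with x hx
        refine le_trans ?_ (setLIntegral_le_lintegral (hull K) _)
        refine lintegral_mono_ae ?_
        filter_upwards [ae_mem_hull_volOn K] with y hy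
        rw [Set.indicator_of_mem (by
          rw [hA, mem_closedBall_zero_iff, ← dist_eq_norm]; exact dist_le_size hy hx)]
        exact sq_sub_le_lintegral hφ hx hy
    _ = ∫⁻ x, ∫⁻ v in A, R x v ∂volume ∂(volOn K) := by
        refine lintegral_congr fun x => ?_
        rw [lintegral_sub_right_eq_self (fun v => A.indicator (R x) v), lintegral_indicator hAm]
    _ ≤ ∫⁻ x, ∫⁻ v in A, R x v ∂volume ∂volume := setLIntegral_le_lintegral _ _
    _ = ∫⁻ v in A, ∫⁻ x, R x v ∂volume := lintegral_lintegral_swap hRm.aemeasurable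
    _ = ∫⁻ _ in A, ENNReal.ofReal (size K ^ 2) * ∫⁻ x, G x := by
        refine lintegral_congr fun v => ?_
        simp only [hR]
        rw [lintegral_lintegral_swap]
        · have : ∀ s : ℝ, ∫⁻ x, ENNReal.ofReal (size K ^ 2) * G (x + s • v) =
              ENNReal.ofReal (size K ^ 2) * ∫⁻ x, G x := by
            intro s
            rw [lintegral_const_mul (f := fun x => G (x + s • v)) _ (hGm.comp (by fun_prop)),
              lintegral_add_right_eq_self (fun x => G x)]
          simp [this]
        · exact ((hGm.comp (by fun_prop)).const_mul _).aemeasurable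
    _ = _ := by
        rw [setLIntegral_const, mul_comm, hG, lintegral_indicator (measurableSet_hull K)]
        rfl

lemma lintegral_sq_sub_eq {φ : Sp d → ℝ} (hφ : Continuous φ) (K : Finset (Sp d)) :
    ∫⁻ x, ∫⁻ y, ENNReal.ofReal ((φ x - φ y) ^ 2) ∂(volOn K) ∂(volOn K) =
      ENNReal.ofReal (2 * ((volOn K).real Set.univ * ∫ x, φ x ^ 2 ∂(volOn K) -
        (∫ x, φ x ∂(volOn K)) ^ 2)) := by
  set V := (volOn K).real Set.univ with hV
  set m := ∫ x, φ x ∂(volOn K) with hm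
  set q := ∫ x, φ x ^ 2 ∂(volOn K) with hq
  have h1 : Integrable φ (volOn K) := integrable_volOn hφ
  have h2 : Integrable (fun x => φ x ^ 2) (volOn K) := integrable_volOn (by fun_prop)
  have hin : ∀ x, ∫ y, (φ x - φ y) ^ 2 ∂(volOn K) = V * φ x ^ 2 - 2 * m * φ x + q := by
    intro x
    have e : (fun y => (φ x - φ y) ^ 2) = fun y => φ x ^ 2 - (2 * φ x) * φ y + φ y ^ 2 := by
      ext y; ring
    rw [e, integral_add (by exact (integrable_const _).sub (h1.const_mul _)) h2,
      integral_sub (integrable_const _) (h1.const_mul _), integral_const_mul, integral_const,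
      smul_eq_mul]
    ring
  have hin' : ∀ x, ∫⁻ y, ENNReal.ofReal ((φ x - φ y) ^ 2) ∂(volOn K) =
      ENNReal.ofReal (V * φ x ^ 2 - 2 * m * φ x + q) := by
    intro x
    rw [← hin, ofReal_integral_eq_lintegral_ofReal (integrable_volOn (by fun_prop))
      (ae_of_all _ fun s => sq_nonneg _)]
  simp only [hin']
  rw [← ofReal_integral_eq_lintegral_ofReal (integrable_volOn (by fun_prop))
    (ae_of_all _ fun x => by rw [Pi.zero_apply, ← hin]; exact integral_nonneg fun y => sq_nonneg _)]
  rw [integral_add (by exact (h2.const_mul _).sub (h1.const_mul _)) (integrable_const _),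
    integral_sub (h2.const_mul _) (h1.const_mul _), integral_const_mul, integral_const_mul,
    integral_const, smul_eq_mul, ← hV, ← hm, ← hq]
  congr 1
  ring

lemma volume_closedBall_toReal (x : Sp d) {r : ℝ} (hr : 0 ≤ r) :
    (volume (Metric.closedBall x r)).toReal = r ^ d * (volume (Metric.ball (0 : Sp d) 1)).toReal := by
  rw [Measure.addHaar_closedBall _ _ hr, ENNReal.toReal_mul, ENNReal.toReal_ofReal (by positivity)]
  simp

lemma size_nonneg (K : Finset (Sp d)) : 0 ≤ size K := Metric.diam_nonneg

lemma poincare_smooth {φ : Sp d → ℝ} (hφ : ContDiff ℝ ∞ φ) (K : Finset (Sp d)) :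
    (volOn K).real Set.univ * ∫ x, φ x ^ 2 ∂(volOn K) - (∫ x, φ x ∂(volOn K)) ^ 2 ≤
      size K ^ (d + 2) * (volume (Metric.ball (0 : Sp d) 1)).toReal *
        ∑ i, ∫ x, pderiv i φ x ^ 2 ∂(volOn K) := by
  have hc : ∀ i, Continuous (pderiv i φ) := continuous_pderiv hφ
  have h := lintegral_sq_sub_le hφ K
  rw [lintegral_sq_sub_eq hφ.continuous, ← ofReal_integral_eq_lintegral_ofReal
    (integrable_volOn (by fun_prop)) (ae_of_all _ fun x => Finset.sum_nonneg fun i _ => sq_nonneg _),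
    ← ENNReal.ofReal_mul (by positivity), ← ENNReal.ofReal_toReal
    (measure_closedBall_lt_top (μ := volume) (x := (0 : Sp d)) (r := size K)).ne,
    ← ENNReal.ofReal_mul ENNReal.toReal_nonneg, volume_closedBall_toReal _ (size_nonneg K),
    integral_finsetSum _ (fun i _ => integrable_volOn (by fun_prop)),
    ENNReal.ofReal_le_ofReal_iff (by
      have := size_nonneg K
      have : 0 ≤ ∑ i, ∫ x, pderiv i φ x ^ 2 ∂(volOn K) :=
        Finset.sum_nonneg fun i _ => integral_nonneg fun x => sq_nonneg _
      positivity)] at h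
  have hV : 0 ≤ (volOn K).real Set.univ * ∫ x, φ x ^ 2 ∂(volOn K) - (∫ x, φ x ∂(volOn K)) ^ 2 := by
    have := sq_integral_mul_le (memLp_volOn hφ.continuous 2 (K := K)) (memLp_const (1 : ℝ))
    simp only [mul_one, one_pow, integral_const, smul_eq_mul] at this
    linarith
  -- The double integral controls twice the left side; that side is nonnegative by Cauchy–Schwarz,
  -- so a factor two may be dropped.
  calc _ ≤ _ := by linarith
    _ ≤ _ := h
    _ = _ := by ring

/-- `w` is the limit in `H¹(K)` of the smooth functions `φ n`, with gradient `g`. -/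
structure H1Lim (K : Finset (Sp d)) (w : Sp d → ℝ) (g : Fin d → Sp d → ℝ)
    (φ : ℕ → Sp d → ℝ) : Prop where
  smooth : ∀ n, ContDiff ℝ ∞ (φ n)
  lim : L2Lim (volOn K) φ w
  lim_grad : ∀ i, L2Lim (volOn K) (fun n => pderiv i (φ n)) (g i)

lemma H1Lim.of_eLpNorm {K : Finset (Sp d)} {w : Sp d → ℝ} {g : Fin d → Sp d → ℝ}
    {φ : ℕ → Sp d → ℝ} (hw : MemLp w 2 (volOn K)) (hg : ∀ i, MemLp (g i) 2 (volOn K))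
    (h : ApproxH1 K w g φ) : H1Lim K w g φ :=
  ⟨h.smooth, L2Lim.of_eLpNorm (fun n => memLp_volOn (h.smooth n).continuous 2) hw h.tendsto,
    fun i => L2Lim.of_eLpNorm (fun n => memLp_volOn (continuous_pderiv (h.smooth n) i) 2) (hg i)
      (h.tendsto_grad i)⟩

lemma IsSimplex.exists_H1Lim {K : Finset (Sp d)} (hK : IsSimplex K) {w : Sp d → ℝ}
    {g : Fin d → Sp d → ℝ} (h : HasWeakGrad K w g) : ∃ φ, H1Lim K w g φ :=
  let ⟨φ, hφ⟩ := hK.exists_approxH1 h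
  ⟨φ, H1Lim.of_eLpNorm h.memLp h.memLp_grad hφ⟩

/-- The smooth inequality is divided by the volume of `K`. The ball of radius `size K / σ` bounds
this volume from below, the volume of the unit ball cancels, and the constant is `σ ^ d * size K ^
2`. -/
lemma H1Lim.poincare {K : Finset (Sp d)} {w : Sp d → ℝ} {g : Fin d → Sp d → ℝ}
    {φ : ℕ → Sp d → ℝ} (h : H1Lim K w g φ) {σ : ℝ} (hσ : 0 < σ) (hK : 0 < size K) {x₀ : Sp d}
    (hball : Metric.closedBall x₀ (size K / σ) ⊆ hull K) (hmean : ∫ x, w x ∂(volOn K) = 0) :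
    ∫ x, w x ^ 2 ∂(volOn K) ≤ σ ^ d * size K ^ 2 * ∑ i, ∫ x, g i x ^ 2 ∂(volOn K) := by
  set ω' := (volume (Metric.ball (0 : Sp d) 1)).toReal with hω
  have hω0 : 0 < ω' := ENNReal.toReal_pos (Metric.measure_ball_pos _ _ one_pos).ne'
    measure_ball_lt_top.ne
  have hlim : (volOn K).real Set.univ * ∫ x, w x ^ 2 ∂(volOn K) - (∫ x, w x ∂(volOn K)) ^ 2 ≤
      size K ^ (d + 2) * ω' * ∑ i, ∫ x, g i x ^ 2 ∂(volOn K) := by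
    refine le_of_tendsto_of_tendsto' ((h.lim.integral_sq.const_mul _).sub (h.lim.integral.pow 2))
      ((tendsto_finsetSum _ fun i _ => (h.lim_grad i).integral_sq).const_mul _) fun n => ?_
    exact poincare_smooth (h.smooth n) K
  have hvol : (size K / σ) ^ d * ω' ≤ (volOn K).real Set.univ := by
    rw [hω, ← volume_closedBall_toReal x₀ (by positivity), Measure.real, volOn,
      Measure.restrict_apply_univ]
    exact ENNReal.toReal_mono (isCompact_hull K).measure_lt_top.ne (measure_mono hball)
  rw [hmean] at hlim
  have hnn : 0 ≤ ∫ x, w x ^ 2 ∂(volOn K) := integral_nonneg fun x => sq_nonneg _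
  have h1 : (size K / σ) ^ d * ω' * ∫ x, w x ^ 2 ∂(volOn K) ≤
      size K ^ (d + 2) * ω' * ∑ i, ∫ x, g i x ^ 2 ∂(volOn K) :=
    (mul_le_mul_of_nonneg_right hvol hnn).trans (by linarith)
  have h2 : size K ^ d * ω' * ∫ x, w x ^ 2 ∂(volOn K) ≤
      size K ^ d * ω' * (σ ^ d * size K ^ 2 * ∑ i, ∫ x, g i x ^ 2 ∂(volOn K)) := by
    have := mul_le_mul_of_nonneg_left h1 (pow_nonneg hσ.le d)
    rw [div_pow] at this
    calc _ = σ ^ d * (size K ^ d / σ ^ d * ω' * ∫ x, w x ^ 2 ∂(volOn K)) := by field_simp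
      _ ≤ _ := this
      _ = _ := by ring
  exact le_of_mul_le_mul_left h2 (by positivity)

/-! ### Traces -/

lemma pderiv_mul {φ q : Sp d → ℝ} (hφ : Differentiable ℝ φ) (hq : Differentiable ℝ q) (i : Fin d)
    (x : Sp d) :
    pderiv i (fun x => φ x * q x) x = pderiv i φ x * q x + φ x * pderiv i q x := by
  unfold pderiv
  rw [fderiv_fun_mul (hφ x) (hq x)]
  simp only [_root_.add_apply, _root_.smul_apply, smul_eq_mul]
  ring

lemma pderiv_sub {φ q : Sp d → ℝ} (hφ : Differentiable ℝ φ) (hq : Differentiable ℝ q) (i : Fin d) :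
    pderiv i (fun x => φ x - q x) = fun x => pderiv i φ x - pderiv i q x := by
  ext x
  unfold pderiv
  rw [fderiv_fun_sub (hφ x) (hq x)]
  rfl

/-- `integral_radial` applied to `φ ^ 2`; the cross term `2 φ ∂φ(x - a)` is split by Young's
inequality, with `‖x - a‖ ≤ size K`. -/
lemma IsSimplex.trace_smooth {K : Finset (Sp d)} (hK : IsSimplex K) (hd : 1 ≤ d) {a : Sp d}
    (ha : a ∈ K) {φ : Sp d → ℝ} (hφ : ContDiff ℝ ∞ φ) :
    height K a * ∫ x, φ x ^ 2 ∂(surfOn (K.erase a)) ≤ (d + 1) * (∫ x, φ x ^ 2 ∂(volOn K) +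
      size K ^ 2 * ∑ i, ∫ x, pderiv i φ x ^ 2 ∂(volOn K)) := by
  have hc : ∀ i, Continuous (pderiv i φ) := continuous_pderiv hφ
  have hcφ := hφ.continuous
  have hcf : Continuous fun x => fderiv ℝ φ x (x - a) :=
    (hφ.continuous_fderiv (by simp)).clm_apply (by fun_prop)
  rw [← hK.integral_radial hd ha (g := fun x => φ x ^ 2) ((hφ.of_le (by simp)).pow 2)]
  have hfd : ∀ x, fderiv ℝ (fun x => φ x ^ 2) x (x - a) = 2 * φ x * fderiv ℝ φ x (x - a) := by
    intro x
    have : HasFDerivAt (fun x => φ x ^ 2) _ x :=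
      ((hφ.differentiable (by simp) x).hasFDerivAt).pow 2
    rw [this.fderiv]
    simp
  simp only [hfd]
  have hle : ∫ x, (d * φ x ^ 2 + 2 * φ x * fderiv ℝ φ x (x - a)) ∂(volOn K) ≤
      ∫ x, ((d + 1) * φ x ^ 2 + size K ^ 2 * ∑ i, pderiv i φ x ^ 2) ∂(volOn K) := by
    refine integral_mono_ae (integrable_volOn (by fun_prop)) (integrable_volOn (by fun_prop)) ?_
    filter_upwards [ae_mem_hull_volOn K] with x hx
    have h1 := sq_fderiv_apply_le (φ := φ) x (x - a)
    have h2 : ‖x - a‖ ^ 2 ≤ size K ^ 2 := by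
      rw [← dist_eq_norm]
      exact pow_le_pow_left₀ dist_nonneg (dist_le_size hx (mem_hull_of_mem ha)) 2
    have h3 : (0 : ℝ) ≤ ∑ i, pderiv i φ x ^ 2 := Finset.sum_nonneg fun i _ => sq_nonneg _
    nlinarith [sq_nonneg (φ x - fderiv ℝ φ x (x - a)), mul_le_mul_of_nonneg_left h2 h3]
  refine hle.trans ?_
  rw [integral_add (integrable_volOn (by fun_prop)) (integrable_volOn (by fun_prop)),
    integral_const_mul, integral_const_mul, integral_finsetSum _ (fun i _ => integrable_volOn (by fun_prop))]
  have h4 : 0 ≤ size K ^ 2 * ∑ i, ∫ x, pderiv i φ x ^ 2 ∂(volOn K) :=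
    mul_nonneg (sq_nonneg _) (Finset.sum_nonneg fun i _ => integral_nonneg fun x => sq_nonneg _)
  have h5 : (0 : ℝ) ≤ d := by positivity
  nlinarith [mul_nonneg h5 h4]

/-- By `trace_smooth` a sequence converging in `H¹(K)` is Cauchy in `L²` of each side. The same
sequence `φ` serves all sides and, if shared, neighbouring elements. -/
lemma H1Lim.exists_trace {K : Finset (Sp d)} (hK : IsSimplex K) (hd : 1 ≤ d) {w : Sp d → ℝ}
    {g : Fin d → Sp d → ℝ} {φ : ℕ → Sp d → ℝ} (h : H1Lim K w g φ) {e : Finset (Sp d)}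
    (he : e ∈ sides K) : ∃ t, L2Lim (surfOn e) φ t := by
  obtain ⟨a, ha, rfl⟩ := hK.mem_sides_iff.1 he
  have hH := hK.height_pos hd ha
  have hdiff : ∀ n, Differentiable ℝ (φ n) := fun n => (h.smooth n).differentiable (by simp)
  refine exists_L2Lim (fun n => hK.memLp_surfOn hd ha (h.smooth n).continuous 2)
    (fun n => (height K a)⁻¹ * ((d + 1) * (2 * ∫ x, (φ n x - w x) ^ 2 ∂(volOn K) +
      size K ^ 2 * ∑ i, 2 * ∫ x, (pderiv i (φ n) x - g i x) ^ 2 ∂(volOn K)))) ?_ fun n m => ?_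
  · have h1 := ((h.lim.tendsto.const_mul 2).add ((tendsto_finsetSum Finset.univ fun i _ =>
      (h.lim_grad i).tendsto.const_mul 2).const_mul (size K ^ 2))).const_mul ((d : ℝ) + 1)
    have h2 := h1.const_mul (height K a)⁻¹
    simpa using h2
  · have h1 := hK.trace_smooth hd ha (φ := fun x => φ n x - φ m x) ((h.smooth n).sub (h.smooth m))
    have key : ∀ (f g c : Sp d → ℝ), MemLp f 2 (volOn K) → MemLp g 2 (volOn K) →
        MemLp c 2 (volOn K) → ∫ x, (f x - g x) ^ 2 ∂(volOn K) ≤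
        2 * ∫ x, (f x - c x) ^ 2 ∂(volOn K) + 2 * ∫ x, (g x - c x) ^ 2 ∂(volOn K) := by
      intro f g c hf hg hc
      have := integral_sub_sq_le (memLp_sub_fun hf hc) (memLp_sub_fun hg hc)
      simpa using this
    have h2 := key _ _ _ (h.lim.memLp_seq n) (h.lim.memLp_seq m) h.lim.memLp
    have h3 : ∑ i, ∫ x, pderiv i (fun x => φ n x - φ m x) x ^ 2 ∂(volOn K) ≤
        ∑ i, 2 * ∫ x, (pderiv i (φ n) x - g i x) ^ 2 ∂(volOn K) +
        ∑ i, 2 * ∫ x, (pderiv i (φ m) x - g i x) ^ 2 ∂(volOn K) := by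
      rw [← Finset.sum_add_distrib]
      refine Finset.sum_le_sum fun i _ => ?_
      rw [pderiv_sub (hdiff n) (hdiff m)]
      exact key _ _ _ ((h.lim_grad i).memLp_seq n) ((h.lim_grad i).memLp_seq m) (h.lim_grad i).memLp
    rw [← mul_add, ← div_eq_inv_mul, le_div_iff₀ hH, mul_comm _ (height K a)]
    refine h1.trans ?_
    rw [← mul_add]
    refine mul_le_mul_of_nonneg_left ?_ (by positivity)
    have h4 := mul_le_mul_of_nonneg_left h3 (sq_nonneg (size K))
    linarith

/-- `t` is the trace on the sides of `K` of the function `w ∈ H¹(K)` with gradient `g`. -/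
def HasTrace (K : Finset (Sp d)) (w : Sp d → ℝ) (g : Fin d → Sp d → ℝ)
    (t : Finset (Sp d) → Sp d → ℝ) : Prop :=
  ∃ φ, H1Lim K w g φ ∧ ∀ e ∈ sides K, L2Lim (surfOn e) φ (t e)

lemma H1Lim.exists_hasTrace {K : Finset (Sp d)} (hK : IsSimplex K) (hd : 1 ≤ d) {w : Sp d → ℝ}
    {g : Fin d → Sp d → ℝ} {φ : ℕ → Sp d → ℝ} (h : H1Lim K w g φ) : ∃ t, HasTrace K w g t := by
  have h1 : ∀ e, ∃ t, e ∈ sides K → L2Lim (surfOn e) φ t := by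
    intro e
    by_cases he : e ∈ sides K
    · obtain ⟨t, ht⟩ := h.exists_trace hK hd he
      exact ⟨t, fun _ => ht⟩
    · exact ⟨0, fun h => absurd h he⟩
  choose t ht using h1
  exact ⟨t, φ, h, ht⟩

lemma HasTrace.memLp {K : Finset (Sp d)} {w : Sp d → ℝ} {g : Fin d → Sp d → ℝ}
    {t : Finset (Sp d) → Sp d → ℝ} (h : HasTrace K w g t) {e : Finset (Sp d)} (he : e ∈ sides K) :
    MemLp (t e) 2 (surfOn e) :=
  let ⟨_, _, h2⟩ := h
  (h2 e he).memLp

lemma IsSimplex.memLp_surfOn_of_mem_sides {K : Finset (Sp d)} (hK : IsSimplex K) (hd : 1 ≤ d)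
    {e : Finset (Sp d)} (he : e ∈ sides K) {F : Sp d → ℝ} (hF : Continuous F) (p : ℝ≥0∞) :
    MemLp F p (surfOn e) := by
  obtain ⟨a, ha, rfl⟩ := hK.mem_sides_iff.1 he
  exact hK.memLp_surfOn hd ha hF p

lemma IsSimplex.integral_pderiv {K : Finset (Sp d)} (hK : IsSimplex K) (hd : 1 ≤ d)
    {g : Sp d → ℝ} (hg : ContDiff ℝ ∞ g) (i : Fin d) :
    ∫ x, pderiv i g x ∂(volOn K) = ∑ e ∈ sides K, outNormal K e i * ∫ y, g y ∂(surfOn e) := by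
  have := hK.integral_fderiv hd (hg.of_le (by simp)) (EuclideanSpace.single i 1)
  rw [show (∫ x, pderiv i g x ∂(volOn K)) = _ from this]
  refine Finset.sum_congr rfl fun e _ => ?_
  rw [EuclideanSpace.inner_single_left]
  simp

/-- Green's formula. -/
lemma HasTrace.green {K : Finset (Sp d)} (hK : IsSimplex K) (hd : 1 ≤ d) {w : Sp d → ℝ}
    {g : Fin d → Sp d → ℝ} {t : Finset (Sp d) → Sp d → ℝ} (h : HasTrace K w g t)
    {q : Sp d → ℝ} (hq : ContDiff ℝ ∞ q) (i : Fin d) :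
    ∫ x, g i x * q x ∂(volOn K) + ∫ x, w x * pderiv i q x ∂(volOn K) =
      ∑ e ∈ sides K, outNormal K e i * ∫ x, t e x * q x ∂(surfOn e) := by
  obtain ⟨φ, h1, h2⟩ := h
  have hcq := hq.continuous
  have l1 := ((h1.lim_grad i).integral_mul (L2Lim.const (memLp_volOn hcq 2))).add
    (h1.lim.integral_mul (L2Lim.const (memLp_volOn (continuous_pderiv hq i) 2)))
  have l2 := tendsto_finsetSum (sides K) fun e he => ((h2 e he).integral_mul
    (L2Lim.const (hK.memLp_surfOn_of_mem_sides hd he hcq 2))).const_mul (outNormal K e i)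
  refine tendsto_nhds_unique l1 (l2.congr fun n => ?_)
  have hc := (h1.smooth n).continuous
  have hcp := continuous_pderiv (h1.smooth n) i
  have hcp' := continuous_pderiv hq i
  rw [← integral_add (integrable_volOn (by fun_prop)) (integrable_volOn (by fun_prop)),
    ← hK.integral_pderiv hd ((h1.smooth n).mul hq)]
  congr 1
  ext x
  rw [pderiv_mul ((h1.smooth n).differentiable (by simp)) (hq.differentiable (by simp))]

lemma H1Lim.sub_smooth {K : Finset (Sp d)} {w : Sp d → ℝ} {g : Fin d → Sp d → ℝ}
    {φ : ℕ → Sp d → ℝ} (h : H1Lim K w g φ) {P : Sp d → ℝ} (hP : ContDiff ℝ ∞ P) :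
    H1Lim K (fun x => w x - P x) (fun i x => g i x - pderiv i P x) (fun n x => φ n x - P x) := by
  refine ⟨fun n => (h.smooth n).sub hP, h.lim.sub_const (memLp_volOn hP.continuous 2), fun i => ?_⟩
  have := (h.lim_grad i).sub_const (memLp_volOn (continuous_pderiv hP i) 2)
  refine (funext fun n => ?_ : (fun n => pderiv i fun x => φ n x - P x) = _) ▸ this
  exact pderiv_sub ((h.smooth n).differentiable (by simp)) (hP.differentiable (by simp)) i

lemma IsSimplex.size_le_height {K : Finset (Sp d)} (hK : IsSimplex K) (hd : 1 ≤ d) {a : Sp d}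
    (ha : a ∈ K) {σ : ℝ} (hσ : 0 < σ) {x₀ : Sp d}
    (hball : Metric.closedBall x₀ (size K / σ) ⊆ hull K) : 2 * size K ≤ σ * height K a := by
  have := hK.two_mul_le_height hd ha (div_nonneg (size_nonneg K) hσ.le) hball
  rw [← mul_div_assoc, div_le_iff₀ hσ] at this
  linarith

/-- The trace inequality. -/
lemma HasTrace.trace_le {K : Finset (Sp d)} (hK : IsSimplex K) (hd : 1 ≤ d) {w : Sp d → ℝ}
    {g : Fin d → Sp d → ℝ} {t : Finset (Sp d) → Sp d → ℝ} (h : HasTrace K w g t)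
    {P : Sp d → ℝ} (hP : ContDiff ℝ ∞ P) {σ : ℝ} (hσ : 0 < σ) {x₀ : Sp d}
    (hball : Metric.closedBall x₀ (size K / σ) ⊆ hull K) {e : Finset (Sp d)} (he : e ∈ sides K) :
    size K * ∫ x, (t e x - P x) ^ 2 ∂(surfOn e) ≤ σ * (d + 1) *
      (∫ x, (w x - P x) ^ 2 ∂(volOn K) +
        size K ^ 2 * ∑ i, ∫ x, (g i x - pderiv i P x) ^ 2 ∂(volOn K)) := by
  obtain ⟨φ, h1, h2⟩ := h
  have h3 := (h2 e he).sub_const (hK.memLp_surfOn_of_mem_sides hd he hP.continuous 2)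
  have h1' := h1.sub_smooth hP
  refine le_of_tendsto_of_tendsto' (h3.integral_sq.const_mul _) ((h1'.lim.integral_sq.add
    ((tendsto_finsetSum _ fun i _ => (h1'.lim_grad i).integral_sq).const_mul _)).const_mul _)
    fun n => ?_
  obtain ⟨a, ha, rfl⟩ := hK.mem_sides_iff.1 he
  have h4 := hK.trace_smooth hd ha (h1'.smooth n)
  have h5 := hK.size_le_height hd ha hσ hball
  have h6 : 0 ≤ ∫ x, (φ n x - P x) ^ 2 ∂(surfOn (K.erase a)) := integral_nonneg fun x => sq_nonneg _
  have h7 := mul_le_mul_of_nonneg_left h4 hσ.le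
  have h8 := mul_le_mul_of_nonneg_right h5 h6
  have h9 := mul_nonneg (size_nonneg K) h6
  rw [mul_assoc σ]
  linarith

/-! ### Higher derivatives -/

lemma contDiff_pderiv {φ : Sp d → ℝ} (hφ : ContDiff ℝ ∞ φ) (i : Fin d) :
    ContDiff ℝ ∞ (pderiv i φ) :=
  (hφ.fderiv_right (m := ∞) (by simp)).clm_apply contDiff_const

lemma pderiv_comm {φ : Sp d → ℝ} (hφ : ContDiff ℝ ∞ φ) (i j : Fin d) :
    pderiv i (pderiv j φ) = pderiv j (pderiv i φ) := by
  have hd2 : Differentiable ℝ (fderiv ℝ φ) :=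
    (hφ.fderiv_right (m := ∞) (by simp)).differentiable (by simp)
  have key : ∀ (x v w : Sp d), fderiv ℝ (fun y => fderiv ℝ φ y v) x w =
      fderiv ℝ (fderiv ℝ φ) x w v := by
    intro x v w
    rw [fderiv_clm_apply (hd2 x) (differentiableAt_const v)]
    simp
  ext x
  have hs : IsSymmSndFDerivAt ℝ φ x := by
    refine hφ.contDiffAt.isSymmSndFDerivAt ?_
    rw [minSmoothness_of_isRCLikeNormedField]
    exact WithTop.coe_le_coe.2 le_top
  change fderiv ℝ (fun y => fderiv ℝ φ y _) x _ = fderiv ℝ (fun y => fderiv ℝ φ y _) x _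
  rw [key, key]
  exact hs _ _

lemma contDiff_iterate_pderiv {φ : Sp d → ℝ} (hφ : ContDiff ℝ ∞ φ) (i : Fin d) (n : ℕ) :
    ContDiff ℝ ∞ ((pderiv i)^[n] φ) := by
  induction n with
  | zero => exact hφ
  | succ n ih => rw [Function.iterate_succ_apply']; exact contDiff_pderiv ih i

lemma iterate_pderiv_comm {φ : Sp d → ℝ} (hφ : ContDiff ℝ ∞ φ) (i j : Fin d) (n : ℕ) :
    (pderiv i)^[n] (pderiv j φ) = pderiv j ((pderiv i)^[n] φ) := by
  induction n with
  | zero => rfl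
  | succ n ih =>
    rw [Function.iterate_succ_apply', Function.iterate_succ_apply', ih,
      pderiv_comm (contDiff_iterate_pderiv hφ i n)]

/-- The partial derivatives of `φ` in the directions from the list `l`. -/
def derivList (l : List (Fin d)) (β : Fin d → ℕ) (φ : Sp d → ℝ) : Sp d → ℝ :=
  l.foldr (fun i g => (pderiv i)^[β i] g) φ

lemma contDiff_derivList {φ : Sp d → ℝ} (hφ : ContDiff ℝ ∞ φ) (l : List (Fin d)) (β : Fin d → ℕ) :
    ContDiff ℝ ∞ (derivList l β φ) := by
  induction l with
  | nil => exact hφ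
  | cons i l ih => exact contDiff_iterate_pderiv ih i _

lemma derivList_pderiv {φ : Sp d → ℝ} (hφ : ContDiff ℝ ∞ φ) (l : List (Fin d)) (β : Fin d → ℕ)
    (i : Fin d) : derivList l β (pderiv i φ) = pderiv i (derivList l β φ) := by
  induction l with
  | nil => rfl
  | cons j l ih =>
    change (pderiv j)^[β j] (derivList l β (pderiv i φ)) = pderiv i ((pderiv j)^[β j] (derivList l β φ))
    rw [ih, iterate_pderiv_comm (contDiff_derivList hφ l β)]

/-- `multiDeriv` composes the partial derivatives in a fixed order. They commute on smooth
functions, so the extra derivative moves to the front; absence of repetitions ensures that it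
appears once. -/
lemma derivList_add_single {φ : Sp d → ℝ} (hφ : ContDiff ℝ ∞ φ) (l : List (Fin d)) (hl : l.Nodup)
    (β : Fin d → ℕ) (i : Fin d) : derivList l (β + Pi.single i 1) φ =
      if i ∈ l then pderiv i (derivList l β φ) else derivList l β φ := by
  induction l with
  | nil => rfl
  | cons j l ih =>
    obtain ⟨hj, hl'⟩ := List.nodup_cons.1 hl
    change (pderiv j)^[(β + Pi.single i 1 : Fin d → ℕ) j] (derivList l (β + Pi.single i 1) φ) =
      if i ∈ j :: l then pderiv i ((pderiv j)^[β j] (derivList l β φ))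
      else (pderiv j)^[β j] (derivList l β φ)
    rw [ih hl']
    by_cases hij : j = i
    · subst hij
      simp [hj, Function.iterate_succ_apply']
    · have h1 : (β + Pi.single i 1 : Fin d → ℕ) j = β j := by simp [hij]
      rw [h1]
      by_cases hi : i ∈ l
      · simp [hi, iterate_pderiv_comm (contDiff_derivList hφ l β)]
      · simp [hi, Ne.symm hij]

lemma contDiff_multiDeriv {φ : Sp d → ℝ} (hφ : ContDiff ℝ ∞ φ) (β : Fin d → ℕ) :
    ContDiff ℝ ∞ (multiDeriv β φ) := contDiff_derivList hφ _ β

lemma multiDeriv_add_single {φ : Sp d → ℝ} (hφ : ContDiff ℝ ∞ φ) (β : Fin d → ℕ) (i : Fin d) :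
    multiDeriv (β + Pi.single i 1) φ = pderiv i (multiDeriv β φ) := by
  have := derivList_add_single hφ (List.finRange d) (List.nodup_finRange d) β i
  rwa [if_pos (List.mem_finRange i)] at this

lemma multiDeriv_pderiv {φ : Sp d → ℝ} (hφ : ContDiff ℝ ∞ φ) (β : Fin d → ℕ) (i : Fin d) :
    multiDeriv β (pderiv i φ) = multiDeriv (β + Pi.single i 1) φ := by
  rw [multiDeriv_add_single hφ]
  exact derivList_pderiv hφ _ β i

lemma multiDeriv_zero (φ : Sp d → ℝ) : multiDeriv 0 φ = φ := by
  have : ∀ l : List (Fin d), derivList l 0 φ = φ := by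
    intro l
    induction l with
    | nil => rfl
    | cons j l ih => exact ih
  exact this _

lemma multiDeriv_single {φ : Sp d → ℝ} (hφ : ContDiff ℝ ∞ φ) (i : Fin d) :
    multiDeriv (Pi.single i 1) φ = pderiv i φ := by
  have := multiDeriv_add_single hφ 0 i
  rwa [zero_add, multiDeriv_zero] at this

lemma exists_eq_add_single {n : ℕ} {β : Fin d → ℕ} (h : ∑ i, β i = n + 1) :
    ∃ (γ : Fin d → ℕ) (i : Fin d), β = γ + Pi.single i 1 ∧ ∑ i, γ i = n := by
  obtain ⟨i, -, hi⟩ : ∃ i ∈ Finset.univ, β i ≠ 0 := by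
    by_contra! hc
    rw [Finset.sum_eq_zero hc] at h
    omega
  have e : β = (β - Pi.single i 1) + Pi.single i 1 := by
    ext j
    by_cases hj : j = i
    · subst hj; simp; omega
    · simp [hj]
  refine ⟨β - Pi.single i 1, i, e, ?_⟩
  have : ∑ j, β j = ∑ j, (β - Pi.single i 1 : Fin d → ℕ) j + 1 := by
    conv_lhs => rw [e]
    simp only [Pi.add_apply, Finset.sum_add_distrib]
    simp
  omega

lemma sum_add_single (β : Fin d → ℕ) (i : Fin d) :
    ∑ j, (β + Pi.single i 1 : Fin d → ℕ) j = ∑ j, β j + 1 := by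
  simp only [Pi.add_apply, Finset.sum_add_distrib]
  simp

lemma pderiv_sum_smul {ι : Type*} (s : Finset ι) (c : ι → ℝ) (f : ι → Sp d → ℝ)
    (hf : ∀ γ, ContDiff ℝ ∞ (f γ)) (i : Fin d) :
    pderiv i (fun x => ∑ γ ∈ s, c γ * f γ x) = fun x => ∑ γ ∈ s, c γ * pderiv i (f γ) x := by
  ext x
  have h : HasFDerivAt (fun x => ∑ γ ∈ s, c γ * f γ x) (∑ γ ∈ s, c γ • fderiv ℝ (f γ) x) x := by
    refine HasFDerivAt.fun_sum fun γ _ => ?_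
    exact (((hf γ).differentiable (by simp)) x).hasFDerivAt.const_mul (c γ)
  simp only [pderiv]
  rw [h.fderiv]
  simp [_root_.sum_apply]

lemma multiDeriv_sum_smul {ι : Type*} (s : Finset ι) (c : ι → ℝ) (f : ι → Sp d → ℝ)
    (hf : ∀ γ, ContDiff ℝ ∞ (f γ)) (β : Fin d → ℕ) :
    multiDeriv β (fun x => ∑ γ ∈ s, c γ * f γ x) = fun x => ∑ γ ∈ s, c γ * multiDeriv β (f γ) x := by
  have hs : ContDiff ℝ ∞ (fun x => ∑ γ ∈ s, c γ * f γ x) :=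
    ContDiff.sum fun γ _ => contDiff_const.mul (hf γ)
  induction hn : ∑ i, β i generalizing β with
  | zero =>
    have : β = 0 := by
      ext i
      exact (Finset.sum_eq_zero_iff.1 hn) i (Finset.mem_univ i)
    subst this
    simp only [multiDeriv_zero]
  | succ n ih =>
    obtain ⟨γ, i, rfl, hγ⟩ := exists_eq_add_single hn
    simp only [multiDeriv_add_single hs, multiDeriv_add_single (hf _), ih γ hγ]
    exact pderiv_sum_smul s c _ (fun γ' => contDiff_multiDeriv (hf γ') γ) i

lemma IsPoly.multiDeriv {r : ℕ} {v : Sp d → ℝ} (hv : IsPoly r v) (β : Fin d → ℕ) :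
    IsPoly (r - ∑ i, β i) (multiDeriv β v) := by
  induction hn : ∑ i, β i generalizing β with
  | zero =>
    have : β = 0 := by
      ext i
      exact (Finset.sum_eq_zero_iff.1 hn) i (Finset.mem_univ i)
    subst this
    rw [multiDeriv_zero]; exact hv
  | succ n ih =>
    obtain ⟨γ, i, rfl, hγ⟩ := exists_eq_add_single hn
    rw [multiDeriv_add_single hv.contDiff]
    exact (ih γ hγ).pderiv i

lemma IsPoly.multiDeriv_eq_zero {r : ℕ} {v : Sp d → ℝ} (hv : IsPoly r v) {β : Fin d → ℕ}
    (hβ : ∑ i, β i = r + 1) : HDG.multiDeriv β v = fun _ => 0 := by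
  obtain ⟨γ, i, rfl, hγ⟩ := exists_eq_add_single hβ
  rw [multiDeriv_add_single hv.contDiff]
  have := hv.multiDeriv γ
  rw [hγ, Nat.sub_self] at this
  exact this.pderiv_eq_zero i

/-! ### Polynomial approximation -/

/-- `D β`, `|β| ≤ m`, are the derivatives of a function in `H^m(K)`. -/
def SobFam (K : Finset (Sp d)) (m : ℕ) (D : (Fin d → ℕ) → Sp d → ℝ) : Prop :=
  ∀ β : Fin d → ℕ, ∑ i, β i < m → ∃ φ, H1Lim K (D β) (fun i => D (β + Pi.single i 1)) φ

/-- The square of the semi-norm of order `j` on `K`. -/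
def semiSqOn (K : Finset (Sp d)) (D : (Fin d → ℕ) → Sp d → ℝ) (j : ℕ) : ℝ :=
  ∑ β ∈ Finset.piAntidiag (Finset.univ : Finset (Fin d)) j, ∫ x, D β x ^ 2 ∂(volOn K)

lemma semiSqOn_nonneg (K : Finset (Sp d)) (D : (Fin d → ℕ) → Sp d → ℝ) (j : ℕ) :
    0 ≤ semiSqOn K D j := Finset.sum_nonneg fun _ _ => integral_nonneg fun _ => sq_nonneg _

lemma mem_piAntidiag_univ {β : Fin d → ℕ} {j : ℕ} :
    β ∈ Finset.piAntidiag (Finset.univ : Finset (Fin d)) j ↔ ∑ i, β i = j := by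
  simp [Finset.mem_piAntidiag]

lemma sum_add_single_le (K : Finset (Sp d)) (D : (Fin d → ℕ) → Sp d → ℝ) (j : ℕ) (i : Fin d) :
    ∑ β ∈ Finset.piAntidiag (Finset.univ : Finset (Fin d)) j,
      ∫ x, D (β + Pi.single i 1) x ^ 2 ∂(volOn K) ≤ semiSqOn K D (j + 1) := by
  have hinj : Function.Injective fun β : Fin d → ℕ => β + Pi.single i 1 :=
    fun β γ h => add_right_cancel h
  rw [← Finset.sum_image (f := fun γ => ∫ x, D γ x ^ 2 ∂(volOn K))
    (g := fun β : Fin d → ℕ => β + Pi.single i 1) hinj.injOn]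
  refine Finset.sum_le_sum_of_subset_of_nonneg ?_ fun _ _ _ => integral_nonneg fun _ => sq_nonneg _
  intro γ hγ
  obtain ⟨β, hβ, rfl⟩ := Finset.mem_image.1 hγ
  rw [mem_piAntidiag_univ] at hβ ⊢
  rw [sum_add_single, hβ]

/-- Poincaré applied `m - j` times, each mean being zero. A multi-index of order `j + 1` arises at
most once for each direction, hence the factor `d` at every step. -/
lemma SobFam.semiSqOn_le {K : Finset (Sp d)} {m : ℕ} {D : (Fin d → ℕ) → Sp d → ℝ}
    (h : SobFam K m D) {σ : ℝ} (hσ : 0 < σ) (hK : 0 < size K) {x₀ : Sp d}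
    (hball : Metric.closedBall x₀ (size K / σ) ⊆ hull K)
    (hmean : ∀ β : Fin d → ℕ, ∑ i, β i < m → ∫ x, D β x ∂(volOn K) = 0) {j : ℕ} (hj : j ≤ m) :
    semiSqOn K D j ≤ (σ ^ d * size K ^ 2 * d) ^ (m - j) * semiSqOn K D m := by
  induction hn : m - j generalizing j with
  | zero =>
    have : j = m := by omega
    subst this; simp
  | succ n ih =>
    have h1 : semiSqOn K D j ≤ σ ^ d * size K ^ 2 * d * semiSqOn K D (j + 1) := by
      calc semiSqOn K D j ≤ ∑ β ∈ Finset.piAntidiag (Finset.univ : Finset (Fin d)) j,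
            σ ^ d * size K ^ 2 * ∑ i, ∫ x, D (β + Pi.single i 1) x ^ 2 ∂(volOn K) := by
            refine Finset.sum_le_sum fun β hβ => ?_
            rw [mem_piAntidiag_univ] at hβ
            obtain ⟨φ, hφ⟩ := h β (by omega)
            exact hφ.poincare hσ hK hball (hmean β (by omega))
        _ = σ ^ d * size K ^ 2 * ∑ i, ∑ β ∈ Finset.piAntidiag (Finset.univ : Finset (Fin d)) j,
            ∫ x, D (β + Pi.single i 1) x ^ 2 ∂(volOn K) := by
            rw [← Finset.mul_sum, Finset.sum_comm]
        _ ≤ σ ^ d * size K ^ 2 * ∑ _i : Fin d, semiSqOn K D (j + 1) := by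
            gcongr with i
            exact sum_add_single_le K D j i
        _ = _ := by simp; ring
    refine h1.trans ?_
    rw [pow_succ' (σ ^ d * size K ^ 2 * d), mul_assoc (σ ^ d * size K ^ 2 * d)]
    exact mul_le_mul_of_nonneg_left (ih (j := j + 1) (by omega) (by omega)) (by positivity)

lemma sobFam_smooth (K : Finset (Sp d)) (m : ℕ) {P : Sp d → ℝ} (hP : ContDiff ℝ ∞ P) :
    SobFam K m (fun β => multiDeriv β P) := by
  intro β _
  refine ⟨fun _ => multiDeriv β P, fun _ => contDiff_multiDeriv hP β,
    L2Lim.const (memLp_volOn (contDiff_multiDeriv hP β).continuous 2), fun i => ?_⟩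
  simp only [multiDeriv_add_single hP]
  exact L2Lim.const (memLp_volOn (continuous_pderiv (contDiff_multiDeriv hP β) i) 2)

lemma SobFam.sub_smooth {K : Finset (Sp d)} {m : ℕ} {D : (Fin d → ℕ) → Sp d → ℝ}
    (h : SobFam K m D) {P : Sp d → ℝ} (hP : ContDiff ℝ ∞ P) :
    SobFam K m (fun β x => D β x - multiDeriv β P x) := by
  intro β hβ
  obtain ⟨φ, hφ⟩ := h β hβ
  refine ⟨fun n x => φ n x - multiDeriv β P x, ?_⟩
  have := hφ.sub_smooth (contDiff_multiDeriv hP β)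
  simp only [multiDeriv_add_single hP]
  exact this

lemma isPoly_monom {r : ℕ} (γ : Fin d → Fin (r + 1)) : IsPoly (∑ i, (γ i : ℕ)) (monom γ) := by
  have := isPoly_prod Finset.univ (fun i (x : Sp d) => x i ^ (γ i : ℕ)) (fun i => (γ i : ℕ) * 1)
    (fun i _ => (isPoly_coord i).pow (γ i : ℕ))
  simp only [mul_one] at this
  exact this

/-- A polynomial of degree at most `r` is determined by the means over `K` of its derivatives, and
these can be prescribed. -/
lemma IsSimplex.exists_poly_of_means {K : Finset (Sp d)} (hK : IsSimplex K) (hd : 1 ≤ d) {σ : ℝ}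
    (hσ : 0 < σ) {x₀ : Sp d} (hball : Metric.closedBall x₀ (size K / σ) ⊆ hull K) (r : ℕ)
    (b : (Fin d → ℕ) → ℝ) : ∃ P : Sp d → ℝ, IsPoly r P ∧
      ∀ β : Fin d → ℕ, ∑ i, β i ≤ r → ∫ x, multiDeriv β P x ∂(volOn K) = b β := by
  set ι := Fin d → Fin (r + 1)
  let Q : (ι → ℝ) → Sp d → ℝ := fun c x =>
    ∑ γ : ι, (if ∑ i, (γ i : ℕ) ≤ r then c γ else 0) * monom γ x
  have hQ : ∀ c, IsPoly r (Q c) := by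
    intro c
    refine isPoly_sum _ _ fun γ _ => ?_
    split_ifs with h
    · exact ((isPoly_monom γ).mono h).const_mul _
    · simpa using isPoly_const (d := d) r 0
  have hQi : ∀ c (β : Fin d → ℕ), ∫ x, multiDeriv β (Q c) x ∂(volOn K) =
      ∑ γ : ι, (if ∑ i, (γ i : ℕ) ≤ r then c γ else 0) *
        ∫ x, multiDeriv β (monom γ) x ∂(volOn K) := by
    intro c β
    have := multiDeriv_sum_smul Finset.univ
      (fun γ : ι => if ∑ i, (γ i : ℕ) ≤ r then c γ else 0) (fun γ => monom γ)
      (fun γ => contDiff_monom γ) β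
    rw [show multiDeriv β (Q c) = _ from this, integral_finsetSum]
    · exact Finset.sum_congr rfl fun γ _ => integral_const_mul _ _
    · intro γ _
      exact (integrable_volOn (contDiff_multiDeriv (contDiff_monom γ) β).continuous).const_mul _
  -- The exponents range over a box that also contains orders above `r`. Their coefficients are
  -- masked in `Q`, and on them the map is the identity, so it is an endomorphism and injectivity
  -- yields surjectivity.
  let L : (ι → ℝ) →ₗ[ℝ] (ι → ℝ) :=
    { toFun := fun c β => if ∑ i, (β i : ℕ) ≤ r then
        ∑ γ : ι, (if ∑ i, (γ i : ℕ) ≤ r then c γ else 0) *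
          ∫ x, multiDeriv (fun i => (β i : ℕ)) (monom γ) x ∂(volOn K) else c β
      map_add' := by
        intro c c'
        ext β
        simp only [Pi.add_apply]
        split_ifs
        · rw [← Finset.sum_add_distrib]
          refine Finset.sum_congr rfl fun γ _ => ?_
          split_ifs <;> ring
        · rfl
      map_smul' := by
        intro s c
        ext β
        simp only [Pi.smul_apply, smul_eq_mul, RingHom.id_apply]
        split_ifs
        · rw [Finset.mul_sum]
          refine Finset.sum_congr rfl fun γ _ => ?_
          split_ifs <;> ring
        · rfl }
  have hL : ∀ c (β : ι), L c β = if ∑ i, (β i : ℕ) ≤ r then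
      ∫ x, multiDeriv (fun i => (β i : ℕ)) (Q c) x ∂(volOn K) else c β := by
    intro c β
    rw [hQi]; rfl
  have hlift : ∀ β : Fin d → ℕ, ∑ i, β i ≤ r → ∃ γ : ι, β = fun i => (γ i : ℕ) := by
    intro β hβ
    refine ⟨fun i => ⟨β i, ?_⟩, rfl⟩
    have := Finset.single_le_sum (f := β) (fun j _ => Nat.zero_le _) (Finset.mem_univ i)
    omega
  -- If the means of all derivatives of order at most `r` vanish, iterated Poincaré bounds `Q c` by
  -- its derivatives of order `r + 1`, which are zero. The inverse inequality upgrades this to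
  -- vanishing on all of `K`.
  have hinj : Function.Injective L := by
    rw [← LinearMap.ker_eq_bot, LinearMap.ker_eq_bot']
    intro c hc
    have hmean : ∀ β : Fin d → ℕ, ∑ i, β i < r + 1 →
        ∫ x, multiDeriv β (Q c) x ∂(volOn K) = 0 := by
      intro β hβ
      obtain ⟨γ, rfl⟩ := hlift β (by omega)
      have := congrFun hc γ
      rwa [hL, if_pos (Nat.lt_succ_iff.1 hβ)] at this
    have h1 := (sobFam_smooth K (r + 1) (hQ c).contDiff).semiSqOn_le hσ (hK.size_pos hd) hball hmean
      (Nat.zero_le _)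
    have h2 : semiSqOn K (fun β => multiDeriv β (Q c)) (r + 1) = 0 := by
      refine Finset.sum_eq_zero fun β hβ => ?_
      rw [mem_piAntidiag_univ] at hβ
      simp [(hQ c).multiDeriv_eq_zero hβ]
    have h3 : semiSqOn K (fun β => multiDeriv β (Q c)) 0 = ∫ x, Q c x ^ 2 ∂(volOn K) := by
      simp [semiSqOn, multiDeriv_zero]
    rw [h2, h3, mul_zero] at h1
    obtain ⟨C, hC, hinv⟩ := exists_inverse d r hσ
    have hx₀ : x₀ ∈ hull K := hball (Metric.mem_closedBall_self
      (div_nonneg (size_nonneg K) hσ.le))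
    have hz : ∀ x ∈ hull K, Q c x = 0 := by
      intro x hx
      have h4 := (hinv K x₀ (size K) (hK.size_pos hd) hball
        (fun y hy => dist_le_size hy hx₀) (Q c) (hQ c) x hx).1
      have h5 : size K ^ d * Q c x ^ 2 ≤ 0 := h4.trans (mul_nonpos_of_nonneg_of_nonpos hC.le h1)
      have h6 : 0 < size K ^ d := pow_pos (hK.size_pos hd) d
      have h7 : Q c x ^ 2 ≤ 0 := by
        by_contra hcon
        push Not at hcon
        nlinarith [mul_pos h6 hcon]
      exact pow_eq_zero_iff (two_ne_zero) |>.1 (le_antisymm h7 (sq_nonneg _))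
    have h8 : polyOf (fun γ : ι => if ∑ i, (γ i : ℕ) ≤ r then c γ else 0) = 0 := by
      refine eval_eq_zero_of_isOpen isOpen_interior hK.interior_nonempty fun x hx => ?_
      rw [eval_polyOf]
      exact hz x (interior_subset hx)
    have h9 := polyOf_eq_zero h8
    ext β
    by_cases hβ : ∑ i, (β i : ℕ) ≤ r
    · have := congrFun h9 β
      simpa [hβ] using this
    · have := congrFun hc β
      rwa [hL, if_neg hβ] at this
  obtain ⟨c, hc⟩ := (LinearMap.injective_iff_surjective.1 hinj) (fun β => b fun i => (β i : ℕ))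
  refine ⟨Q c, hQ c, fun β hβ => ?_⟩
  obtain ⟨γ, rfl⟩ := hlift β hβ
  have := congrFun hc γ
  rwa [hL, if_pos hβ] at this

/-- The Bramble–Hilbert lemma on an element. -/
lemma SobFam.exists_poly {K : Finset (Sp d)} (hK : IsSimplex K) (hd : 1 ≤ d) {r : ℕ}
    {D : (Fin d → ℕ) → Sp d → ℝ} (h : SobFam K (r + 1) D) {σ : ℝ} (hσ : 0 < σ) {x₀ : Sp d}
    (hball : Metric.closedBall x₀ (size K / σ) ⊆ hull K) : ∃ P : Sp d → ℝ, IsPoly r P ∧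
      ∫ x, (D 0 x - P x) ^ 2 ∂(volOn K) ≤
        (σ ^ d * size K ^ 2 * d) ^ (r + 1) * semiSqOn K D (r + 1) ∧
      ∑ i, ∫ x, (D (Pi.single i 1) x - pderiv i P x) ^ 2 ∂(volOn K) ≤
        d * ((σ ^ d * size K ^ 2 * d) ^ r * semiSqOn K D (r + 1)) := by
  -- With matching means every derivative of the difference of order at most `r` has mean zero, so
  -- Poincaré can be iterated; the top derivatives of `P` vanish, so only the semi-norm of `D`
  -- remains.
  obtain ⟨P, hP, hm⟩ := hK.exists_poly_of_means hd hσ hball r (fun β => ∫ x, D β x ∂(volOn K))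
  have hE := h.sub_smooth hP.contDiff
  have hmean : ∀ β : Fin d → ℕ, ∑ i, β i < r + 1 →
      ∫ x, (D β x - multiDeriv β P x) ∂(volOn K) = 0 := by
    intro β hβ
    obtain ⟨φ, hφ⟩ := h β hβ
    rw [integral_sub (hφ.lim.memLp.integrable (by norm_num))
      (integrable_volOn (contDiff_multiDeriv hP.contDiff β).continuous), hm β (by omega), sub_self]
  have htop : semiSqOn K (fun β x => D β x - multiDeriv β P x) (r + 1) = semiSqOn K D (r + 1) := by
    refine Finset.sum_congr rfl fun β hβ => ?_
    rw [mem_piAntidiag_univ] at hβ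
    simp [hP.multiDeriv_eq_zero hβ]
  have h0 := hE.semiSqOn_le hσ (hK.size_pos hd) hball hmean (Nat.zero_le _)
  have h1 := hE.semiSqOn_le hσ (hK.size_pos hd) hball hmean (Nat.succ_le_succ (Nat.zero_le r))
  rw [htop] at h0 h1
  refine ⟨P, hP, ?_, ?_⟩
  · have h3 : semiSqOn K (fun β x => D β x - multiDeriv β P x) 0 =
        ∫ x, (D 0 x - P x) ^ 2 ∂(volOn K) := by
      simp [semiSqOn, multiDeriv_zero]
    rw [h3] at h0
    simpa using h0
  · have h2 : ∀ i, ∫ x, (D (Pi.single i 1) x - pderiv i P x) ^ 2 ∂(volOn K) ≤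
        semiSqOn K (fun β x => D β x - multiDeriv β P x) 1 := by
      intro i
      have := sum_add_single_le K (fun β x => D β x - multiDeriv β P x) 0 i
      simpa [multiDeriv_single hP.contDiff] using this
    calc _ ≤ ∑ _i : Fin d, semiSqOn K (fun β x => D β x - multiDeriv β P x) 1 :=
          Finset.sum_le_sum fun i _ => h2 i
      _ = d * semiSqOn K (fun β x => D β x - multiDeriv β P x) 1 := by simp
      _ ≤ _ := mul_le_mul_of_nonneg_left (by simpa using h1) (by positivity)

/-! ### Sobolev functions on a domain, restricted to an element -/

/-- The derivatives of `w`, with the function itself as derivative of order zero. -/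
def derivFam (Ω : Set (Sp d)) (w : Sp d → ℝ) (β : Fin d → ℕ) : Sp d → ℝ :=
  -- `weakDeriv Ω 0 w` is merely some representative of `w`; keeping `w` itself avoids changes on
  -- null sets.
  if β = 0 then w else weakDeriv Ω β w

lemma MemH.isWeakDeriv {Ω : Set (Sp d)} {m : ℕ} {w : Sp d → ℝ} (h : MemH Ω m w) {β : Fin d → ℕ}
    (hβ : ∑ i, β i ≤ m) : IsWeakDeriv Ω β w (weakDeriv Ω β w) := by
  have := h.weak β hβ
  rw [weakDeriv, dif_pos this]
  exact this.choose_spec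

lemma MemH.isWeakDeriv_derivFam {Ω : Set (Sp d)} {m : ℕ} {w : Sp d → ℝ} (h : MemH Ω m w)
    {β : Fin d → ℕ} (hβ : ∑ i, β i ≤ m) : IsWeakDeriv Ω β w (derivFam Ω w β) := by
  unfold derivFam
  split_ifs with h0
  · subst h0
    exact ⟨h.memLp, fun φ _ => by simp [multiDeriv_zero]⟩
  · exact h.isWeakDeriv hβ

lemma volOn_eq_interior (K : Finset (Sp d)) : volOn K = volume.restrict (interior (hull K)) := by
  refine (Measure.restrict_congr_set ?_).symm
  exact interior_ae_eq_of_null_frontier ((convex_hull K).addHaar_frontier volume)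

lemma volOn_le_restrict {Ω : Set (Sp d)} {K : Finset (Sp d)} (hK : interior (hull K) ⊆ Ω) :
    volOn K ≤ volume.restrict Ω := by
  rw [volOn_eq_interior]
  exact Measure.restrict_mono hK le_rfl

lemma integral_volOn_test {Ω : Set (Sp d)} {K : Finset (Sp d)} (hK : interior (hull K) ⊆ Ω)
    (f : Sp d → ℝ) {φ : Sp d → ℝ} (hφ : ∀ x ∉ interior (hull K), φ x = 0) :
    ∫ x, f x * φ x ∂(volOn K) = ∫ x in Ω, f x * φ x := by
  rw [volOn_eq_interior, setIntegral_eq_integral_of_forall_compl_eq_zero,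
    setIntegral_eq_integral_of_forall_compl_eq_zero]
  · intro x hx; rw [hφ x fun h => hx (hK h), mul_zero]
  · intro x hx; rw [hφ x hx, mul_zero]

lemma IsTest.pderiv {Ω : Set (Sp d)} {φ : Sp d → ℝ} (h : IsTest Ω φ) (i : Fin d) :
    IsTest Ω (pderiv i φ) := by
  have hsub : tsupport (HDG.pderiv i φ) ⊆ tsupport φ := by
    refine closure_minimal ?_ (isClosed_tsupport φ)
    intro x hx
    by_contra hn
    refine hx ?_
    have : fderiv ℝ φ x = 0 := by
      by_contra h0
      exact hn (support_fderiv_subset ℝ h0)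
    simp [HDG.pderiv, this]
  refine ⟨contDiff_pderiv h.smooth i, ?_, hsub.trans h.supp⟩
  exact HasCompactSupport.of_support_subset_isCompact h.compact (subset_closure.trans hsub)

lemma IsTest.eq_zero {Ω : Set (Sp d)} {φ : Sp d → ℝ} (h : IsTest Ω φ) {x : Sp d} (hx : x ∉ Ω) :
    φ x = 0 := image_eq_zero_of_notMem_tsupport fun hx' => hx (h.supp hx')

/-- A test function on the interior of `K` and its partial derivatives are test functions on `Ω`.
Comparing the defining identities for `β` and `β + Pi.single i 1` on the same `φ` yields the weak
gradient of the `β`-derivative. -/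
lemma MemH.hasWeakGrad {Ω : Set (Sp d)} {m : ℕ} {w : Sp d → ℝ} (h : MemH Ω m w)
    {K : Finset (Sp d)} (hK : interior (hull K) ⊆ Ω) {β : Fin d → ℕ} (hβ : ∑ i, β i < m) :
    HasWeakGrad K (derivFam Ω w β) (fun i => derivFam Ω w (β + Pi.single i 1)) := by
  have h1 := h.isWeakDeriv_derivFam hβ.le
  have h2 : ∀ i, IsWeakDeriv Ω (β + Pi.single i 1) w (derivFam Ω w (β + Pi.single i 1)) :=
    fun i => h.isWeakDeriv_derivFam (by rw [sum_add_single]; exact hβ)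
  refine ⟨h1.memLp.mono_measure (volOn_le_restrict hK),
    fun i => (h2 i).memLp.mono_measure (volOn_le_restrict hK), fun φ hφ i => ?_⟩
  have hφΩ : IsTest Ω φ := ⟨hφ.smooth, hφ.compact, hφ.supp.trans hK⟩
  rw [integral_volOn_test hK _ fun x hx => (hφ.pderiv i).eq_zero hx,
    integral_volOn_test hK _ fun x hx => hφ.eq_zero hx]
  have e1 := h1.integral_eq _ (hφΩ.pderiv i)
  have e2 := (h2 i).integral_eq _ hφΩ
  rw [multiDeriv_pderiv hφ.smooth, e2, sum_add_single, pow_succ] at e1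
  have h3 : ((-1 : ℝ) ^ ∑ i, β i) ≠ 0 := pow_ne_zero _ (by norm_num)
  have h4 : ((-1 : ℝ) ^ ∑ i, β i) * (-∫ x in Ω, derivFam Ω w (β + Pi.single i 1) x * φ x) =
      ((-1 : ℝ) ^ ∑ i, β i) * ∫ x in Ω, derivFam Ω w β x * HDG.pderiv i φ x := by
    rw [← e1]; ring
  exact (mul_left_cancel₀ h3 h4).symm

lemma MemH.sobFam {Ω : Set (Sp d)} {m : ℕ} {w : Sp d → ℝ} (h : MemH Ω m w)
    {K : Finset (Sp d)} (hKs : IsSimplex K) (hK : interior (hull K) ⊆ Ω) :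
    SobFam K m (derivFam Ω w) := fun _ hβ => hKs.exists_H1Lim (h.hasWeakGrad hK hβ)

/-! ### Simplices sharing a side -/

/-- The coordinate is affine; the point is that the combination may use arbitrary points, in
particular the vertices of another simplex. -/
lemma IsSimplex.bary_combination {K : Finset (Sp d)} (hK : IsSimplex K) (hd : 1 ≤ d) {a : Sp d}
    (ha : a ∈ K) {t : Finset (Sp d)} {l : Sp d → ℝ} (hl : ∑ w ∈ t, l w = 1) :
    bary K a (∑ w ∈ t, l w • w) = ∑ w ∈ t, l w * bary K a w := by
  have h1 : ∀ w, bary K a w = bary K a 0 - inner ℝ w (outNormal K (K.erase a)) / height K a := by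
    intro w
    rw [hK.inner_div_height hd ha w]; ring
  have h2 : ∑ w ∈ t, l w * bary K a w = ∑ w ∈ t, (l w * bary K a 0 -
      inner ℝ (l w • w) (outNormal K (K.erase a)) / height K a) := by
    refine Finset.sum_congr rfl fun w _ => ?_
    rw [h1 w, real_inner_smul_left]; ring
  rw [h1, sum_inner, h2, Finset.sum_sub_distrib, ← Finset.sum_mul, hl, one_mul, Finset.sum_div]

/-- `bary K a` vanishes on the common vertices, so only the apex `a'` contributes when `y` is
expanded in `K'`. The sign of `bary K a a'` then tells on which side of the common face the second
simplex lies. -/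
lemma IsSimplex.bary_shared {K K' : Finset (Sp d)} (hK : IsSimplex K) (hK' : IsSimplex K')
    (hd : 1 ≤ d) {a a' : Sp d} (ha : a ∈ K) (ha' : a' ∈ K') (he : K.erase a = K'.erase a')
    (y : Sp d) : bary K a y = bary K' a' y * bary K a a' := by
  conv_lhs => rw [← hK'.sum_bary_smul y, hK.bary_combination hd ha (hK'.sum_bary y)]
  rw [← Finset.add_sum_erase _ _ ha', Finset.sum_eq_zero, add_zero]
  intro v hv
  rw [← he, Finset.mem_erase] at hv
  rw [hK.bary_of_ne ha hv.2 (Ne.symm hv.1), mul_zero]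

lemma IsSimplex.bary_eq_of_face {K K' s : Finset (Sp d)} (hK : IsSimplex K) (hK' : IsSimplex K')
    (hs : s ⊆ K) (hs' : s ⊆ K') {x v : Sp d} (hx : x ∈ hull s) (hv : v ∈ s) :
    bary K v x = bary K' v x := by
  obtain ⟨l, -, h1, rfl⟩ := mem_hull_iff_exists.1 hx
  have key : ∀ {L : Finset (Sp d)}, IsSimplex L → s ⊆ L → bary L v (∑ w ∈ s, l w • w) = l v := by
    intro L hL hsL
    rw [← sum_extend hsL l (fun w => w), hL.bary_sum _ (hsL hv)]
    · simp [hv]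
    · have := sum_extend hsL l (fun _ => (1 : ℝ))
      simpa [h1] using this
  rw [key hK hs, key hK' hs']

lemma IsSimplex.exists_relint {K s : Finset (Sp d)} (hK : IsSimplex K) (hs : s ⊆ K)
    (hne : s.Nonempty) : ∃ x ∈ hull s, ∀ v ∈ s, 0 < bary K v x := by
  have hc : (0 : ℝ) < s.card := by exact_mod_cast hne.card_pos
  set l : Sp d → ℝ := fun _ => (s.card : ℝ)⁻¹ with hl
  have h1 : ∑ w ∈ s, l w = 1 := by simp [hl, hc.ne']
  refine ⟨∑ w ∈ s, l w • w, mem_hull_iff_exists.2 ⟨l, fun w _ => by positivity, h1, rfl⟩,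
    fun v hv => ?_⟩
  rw [← sum_extend hs l (fun w => w), hK.bary_sum _ (hs hv)]
  · simp [hv, hl, hc]
  · have := sum_extend hs l (fun _ => (1 : ℝ))
    simpa [h1] using this

lemma tendsto_segment (x w : Sp d) : Tendsto (fun s : ℝ => x + s • (w - x)) (𝓝[>] 0) (𝓝 x) := by
  have h : Continuous fun s : ℝ => x + s • (w - x) := by fun_prop
  have := h.tendsto 0
  simp only [zero_smul, add_zero] at this
  exact this.mono_left nhdsWithin_le_nhds

lemma segment_mem_hull {s : Finset (Sp d)} {x y : Sp d} (hx : x ∈ hull s) (hy : y ∈ hull s) {t : ℝ}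
    (h0 : 0 ≤ t) (h1 : t ≤ 1) : x + t • (y - x) ∈ hull s := by
  have := convex_hull s hx hy (a := 1 - t) (b := t) (by linarith) h0 (by ring)
  convert this using 1; module

lemma eventually_Ioo_one : ∀ᶠ s : ℝ in 𝓝[>] 0, s ∈ Set.Ioo (0 : ℝ) 1 :=
  Ioo_mem_nhdsGT one_pos

/-! ### Incidence and adjacency of the elements of a triangulation. -/

namespace Triangulation

variable {Ω : Set (Sp d)} {T : Triangulation Ω}

lemma mem_elements {K : Finset (Sp d)} :
    K ∈ T.elements ↔ K ∈ T.complex.faces ∧ K.card = d + 1 := by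
  simp [elements]

lemma isSimplex {K : Finset (Sp d)} (hK : K ∈ T.elements) : IsSimplex K :=
  ⟨T.complex.indep (mem_elements.1 hK).1, (mem_elements.1 hK).2⟩

/-- In a simplicial complex two simplices meet in the hull of their common vertices. In
contrapositive form, a positive coordinate at a point of both elements forces a common vertex, which
recovers incidence from position. -/
lemma bary_eq_zero_of_notMem {K K' : Finset (Sp d)} (hK : K ∈ T.elements) (hK' : K' ∈ T.elements)
    {x v : Sp d} (hx : x ∈ hull K) (hx' : x ∈ hull K') (hv : v ∈ K) (hv' : v ∉ K') :
    bary K v x = 0 := by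
  have h := T.complex.inter_subset_convexHull (mem_elements.1 hK).1 (mem_elements.1 hK').1 ⟨hx, hx'⟩
  rw [← Finset.coe_inter] at h
  exact ((isSimplex hK).mem_hull_face_iff (s := K ∩ K') Finset.inter_subset_left).1 h |>.2 v hv
    fun h => hv' (Finset.mem_inter.1 h).2

lemma subset_of_bary_pos {K K' s : Finset (Sp d)} (hK : K ∈ T.elements) (hK' : K' ∈ T.elements)
    (hs : s ⊆ K) {x : Sp d} (hx : x ∈ hull K) (hx' : x ∈ hull K') (hpos : ∀ v ∈ s, 0 < bary K v x) :
    s ⊆ K' := by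
  intro v hv
  by_contra hv'
  exact (hpos v hv).ne' (bary_eq_zero_of_notMem hK hK' hx hx' (hs hv) hv')

lemma eq_of_mem_interior {K K' : Finset (Sp d)} (hK : K ∈ T.elements) (hK' : K' ∈ T.elements)
    {x : Sp d} (hx : x ∈ interior (hull K)) (hx' : x ∈ hull K') : K = K' := by
  have h := subset_of_bary_pos hK hK' le_rfl (interior_subset hx) hx'
    ((isSimplex hK).mem_interior_iff.1 hx)
  exact Finset.eq_of_subset_of_card_le h (by rw [(isSimplex hK).card, (isSimplex hK').card])

lemma exists_mem_hull {x : Sp d} (hx : x ∈ closure Ω) : ∃ K ∈ T.elements, x ∈ hull K := by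
  rw [← T.space_eq, Geometry.SimplicialComplex.mem_space_iff] at hx
  obtain ⟨s, hs, hx⟩ := hx
  obtain ⟨K, hK, hsK, hc⟩ := T.pure s hs
  exact ⟨K, mem_elements.2 ⟨hK, hc⟩, hull_mono hsK hx⟩

lemma hull_subset_closure {K : Finset (Sp d)} (hK : K ∈ T.elements) : hull K ⊆ closure Ω := by
  rw [← T.space_eq]
  exact Geometry.SimplicialComplex.convexHull_subset_space (mem_elements.1 hK).1

lemma interior_hull_subset (hΩ : IsBddDomain Ω) {K : Finset (Sp d)} (hK : K ∈ T.elements) :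
    interior (hull K) ⊆ Ω := by
  rw [← hΩ.regular]
  exact interior_mono (hull_subset_closure hK)

/-- The open elements are disjoint subsets of `Ω`, and what they miss lies on frontiers of convex
sets, which are null. -/
lemma integral_eq_sum (hΩ : IsBddDomain Ω) (T : Triangulation Ω) {F : Sp d → ℝ}
    (hF : IntegrableOn F Ω) : ∫ x in Ω, F x = ∑ K ∈ T.elements, ∫ x, F x ∂(volOn K) := by
  have hae : Ω =ᵐ[volume] ⋃ K ∈ T.elements, interior (hull K) := by
    refine ((LE.le.eventuallyLE (?_ : _ ≤ _)).antisymm ?_).symm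
    · exact Set.iUnion₂_subset fun K hK => interior_hull_subset hΩ hK
    · refine ae_le_set.2 ?_
      refine measure_mono_null (t := ⋃ K ∈ T.elements, frontier (hull K)) ?_ ?_
      · rintro x ⟨hx, hx'⟩
        obtain ⟨K, hK, hxK⟩ := exists_mem_hull (T := T) (subset_closure hx)
        simp only [Set.mem_iUnion, not_exists] at hx' ⊢
        exact ⟨K, hK, subset_closure hxK, hx' K hK⟩
      · refine (measure_biUnion_null_iff T.elements.countable_toSet).2 fun K _ => ?_
        exact (convex_hull K).addHaar_frontier volume
  rw [setIntegral_congr_set hae, integral_biUnion_finset]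
  · exact Finset.sum_congr rfl fun K _ => by rw [volOn_eq_interior]
  · exact fun K _ => isOpen_interior.measurableSet
  · intro K hK K' hK' hne
    refine Set.disjoint_left.2 fun x hx hx' => hne ?_
    exact eq_of_mem_interior hK hK' hx (interior_subset hx')
  · exact fun K hK => hF.mono_set (interior_hull_subset hΩ hK)

/-- If both apexes lay on the same side, moving from the relative interior of the common side
towards `a'` would stay in `K'` and enter the interior of `K`. The value zero is excluded by
`bary_shared` at `y = a`. -/
lemma bary_opposite_neg (hd : 1 ≤ d) {K K' : Finset (Sp d)} (hK : K ∈ T.elements)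
    (hK' : K' ∈ T.elements) (hne : K ≠ K') {a a' : Sp d} (ha : a ∈ K) (ha' : a' ∈ K')
    (he : K.erase a = K'.erase a') : bary K a a' < 0 := by
  have hs := isSimplex hK
  have hs' := isSimplex hK'
  by_contra! hcon
  rcases hcon.eq_or_lt with h0 | hpos
  · have := hs.bary_shared hs' hd ha ha' he a
    rw [← h0, mul_zero, hs.bary_self ha] at this
    exact one_ne_zero this
  · obtain ⟨x, hx, hxp⟩ := hs.exists_relint (Finset.erase_subset a K) (hs.erase_nonempty hd ha)
    have hxa : bary K a x = 0 := ((hs.mem_hull_erase_iff ha).1 hx).2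
    have hev : ∀ᶠ s : ℝ in 𝓝[>] 0, ∀ v ∈ K.erase a, 0 < bary K v (x + s • (a' - x)) := by
      rw [Filter.eventually_all_finset]
      intro v hv
      exact (((hs.continuous_bary v).tendsto x).comp (tendsto_segment x a')).eventually_const_lt
        (hxp v hv)
    obtain ⟨s, h1, h2⟩ := (hev.and eventually_Ioo_one).exists
    have hmid : x + s • (a' - x) ∈ interior (hull K) := by
      rw [hs.mem_interior_iff]
      intro v hv
      by_cases hva : v = a
      · subst hva
        rw [hs.bary_lineMap ha, hxa, zero_add, sub_zero]
        exact mul_pos h2.1 hpos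
      · exact h1 v (Finset.mem_erase.2 ⟨hva, hv⟩)
    refine hne (eq_of_mem_interior hK hK' hmid (segment_mem_hull ?_ (mem_hull_of_mem ha') h2.1.le
      h2.2.le))
    rw [he] at hx
    exact hull_mono (Finset.erase_subset _ _) hx

/-- Near `x` the coordinates at the common vertices stay positive in both elements. A nearby point
belongs to `K` or to `K'` according to the sign of its coordinate at `a`, since the apexes lie on
opposite sides. -/
lemma union_mem_nhds (hd : 1 ≤ d) {K K' : Finset (Sp d)} (hK : K ∈ T.elements)
    (hK' : K' ∈ T.elements) (hne : K ≠ K') {a a' : Sp d} (ha : a ∈ K) (ha' : a' ∈ K')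
    (he : K.erase a = K'.erase a') {x : Sp d} (hx : x ∈ hull (K.erase a))
    (hpos : ∀ v ∈ K.erase a, 0 < bary K v x) : hull K ∪ hull K' ∈ 𝓝 x := by
  have hs := isSimplex hK
  have hs' := isSimplex hK'
  have hneg := bary_opposite_neg hd hK hK' hne ha ha' he
  have h1 : ∀ᶠ y in 𝓝 x, ∀ v ∈ K.erase a, 0 < bary K v y := by
    rw [Filter.eventually_all_finset]
    exact fun v hv => ((hs.continuous_bary v).tendsto x).eventually_const_lt (hpos v hv)
  have h2 : ∀ᶠ y in 𝓝 x, ∀ v ∈ K.erase a, 0 < bary K' v y := by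
    rw [Filter.eventually_all_finset]
    intro v hv
    refine ((hs'.continuous_bary v).tendsto x).eventually_const_lt ?_
    rw [← hs.bary_eq_of_face hs' (Finset.erase_subset a K)
      (by rw [he]; exact Finset.erase_subset a' K') hx hv]
    exact hpos v hv
  filter_upwards [h1, h2] with y hy hy'
  rcases le_or_gt 0 (bary K a y) with h | h
  · left
    rw [hs.mem_hull_iff]
    intro v hv
    by_cases hva : v = a
    · rwa [hva]
    · exact (hy v (Finset.mem_erase.2 ⟨hva, hv⟩)).le
  · right
    rw [hs'.mem_hull_iff]
    intro v hv
    by_cases hva : v = a'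
    · subst hva
      by_contra! hc
      have := hs.bary_shared hs' hd ha ha' he y
      nlinarith [mul_pos_of_neg_of_neg hc hneg]
    · exact (hy' v (by rw [he]; exact Finset.mem_erase.2 ⟨hva, hv⟩)).le

lemma mem_sides_of_subset {K e : Finset (Sp d)} (hc : e.card = d) (h : e ⊆ K) : e ∈ sides K :=
  Finset.mem_powersetCard.2 ⟨h, hc⟩

/-- A side that does not lie on the boundary belongs to a second element. -/
lemma exists_neighbor (hΩ : IsBddDomain Ω) (hd : 1 ≤ d) {K e : Finset (Sp d)}
    (hK : K ∈ T.elements) (he : e ∈ sides K) (hmid : ¬ hull e ⊆ frontier Ω) :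
    ∃ K' ∈ T.elements, K ≠ K' ∧ e ∈ sides K' := by
  have hs := isSimplex hK
  have hcard : e.card = d := (Finset.mem_powersetCard.1 he).2
  obtain ⟨a, ha, rfl⟩ := hs.mem_sides_iff.1 he
  by_contra! hcon
  apply hmid
  have key : ∀ x ∈ hull (K.erase a), (∀ v ∈ K.erase a, 0 < bary K v x) → x ∈ frontier Ω := by
    intro x hx hpos
    have hxK : x ∈ hull K := hull_mono (Finset.erase_subset _ _) hx
    refine ⟨hull_subset_closure hK hxK, ?_⟩
    rw [hΩ.isOpen.interior_eq]
    intro hxΩ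
    have hxa : bary K a x = 0 := ((hs.mem_hull_erase_iff ha).1 hx).2
    have ht := tendsto_segment x (x + (x - a))
    have h1 : ∀ᶠ y in 𝓝 x, y ∈ Ω := hΩ.isOpen.mem_nhds hxΩ
    -- Step from `x` out of `K`, away from `a`. If `x` were in `Ω`, a nearby point on this ray would
    -- lie in an element that contains `x`, hence contains the whole side. Having no other choice it
    -- would be `K`, where the coordinate of `a` cannot be negative.
    have h2 : ∀ᶠ y in 𝓝 x, ∀ K' ∈ T.elements, x ∉ hull K' → y ∉ hull K' := by
      rw [Filter.eventually_all_finset]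
      intro K' _
      by_cases hx' : x ∈ hull K'
      · simp [hx']
      · filter_upwards [(isClosed_hull K').isOpen_compl.mem_nhds hx'] with y hy _ using hy
    obtain ⟨s, ⟨h3, h4⟩, h5⟩ := ((ht.eventually (h1.and h2)).and eventually_Ioo_one).exists
    obtain ⟨K', hK', hy⟩ := exists_mem_hull (T := T) (subset_closure h3)
    have hx' : x ∈ hull K' := by
      by_contra hx'
      exact h4 K' hK' hx' hy
    have hsub := subset_of_bary_pos hK hK' (Finset.erase_subset a K) hxK hx' hpos
    have hKK' : K = K' := by
      by_contra hne
      exact hcon K' hK' hne (mem_sides_of_subset hcard hsub)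
    subst hKK'
    have h6 := hs.bary_nonneg hy a
    have h7 : x + s • (x + (x - a) - x) = x + (-s) • (a - x) := by module
    rw [h7, hs.bary_lineMap ha, hxa, hs.bary_self ha] at h6
    linarith [h5.1]
  -- The remaining points of the side are limits of relatively interior ones, and the frontier is
  -- closed.
  intro x hx
  obtain ⟨c, hc, hcp⟩ := hs.exists_relint (Finset.erase_subset a K) (hs.erase_nonempty hd ha)
  refine isClosed_frontier.mem_of_tendsto (tendsto_segment x c) ?_
  filter_upwards [eventually_Ioo_one] with s h
  refine key _ (segment_mem_hull hx hc h.1.le h.2.le) fun v hv => ?_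
  rw [hs.bary_lineMap (Finset.mem_of_mem_erase hv)]
  have h1 := hs.bary_nonneg (hull_mono (Finset.erase_subset _ _) hx) v
  have h2 := mul_pos h.1 (hcp v hv)
  nlinarith [mul_nonneg (sub_nonneg.2 h.2.le) h1]

/-- The two elements at the side form a neighbourhood of `x` inside `closure Ω`, and `Ω` is the
interior of its closure. This rules out slits along interior sides. -/
lemma mem_of_bary_pos (hΩ : IsBddDomain Ω) (hd : 1 ≤ d) {K : Finset (Sp d)} {a : Sp d}
    (hK : K ∈ T.elements) (ha : a ∈ K) (hmid : ¬ hull (K.erase a) ⊆ frontier Ω) {x : Sp d}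
    (hx : x ∈ hull (K.erase a)) (hpos : ∀ v ∈ K.erase a, 0 < bary K v x) : x ∈ Ω := by
  obtain ⟨K', hK', hne, he'⟩ := exists_neighbor hΩ hd hK
    ((isSimplex hK).mem_sides_iff.2 ⟨a, ha, rfl⟩) hmid
  obtain ⟨a', ha', he⟩ := (isSimplex hK').mem_sides_iff.1 he'
  have := union_mem_nhds hd hK hK' hne ha ha' he hx hpos
  rw [← hΩ.regular, mem_interior_iff_mem_nhds]
  exact Filter.mem_of_superset this
    (Set.union_subset (hull_subset_closure hK) (hull_subset_closure hK'))

/-! ### Stars -/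

/-- The elements that contain the vertices `s`. -/
def star (T : Triangulation Ω) (s : Finset (Sp d)) : Finset (Finset (Sp d)) :=
  {K ∈ T.elements | s ⊆ K}

lemma mem_star {s K : Finset (Sp d)} : K ∈ T.star s ↔ K ∈ T.elements ∧ s ⊆ K := by
  simp [star]

/-- Elements containing `s` are adjacent if they have a common side containing `s`. -/
def starGraph (T : Triangulation Ω) (s : Finset (Sp d)) : SimpleGraph (T.star s) where
  Adj K K' := K ≠ K' ∧ ∃ e, e ∈ sides K.1 ∧ e ∈ sides K'.1 ∧ s ⊆ e
  symm := ⟨fun _ _ ⟨h, e, h1, h2, h3⟩ => ⟨h.symm, e, h2, h1, h3⟩⟩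
  loopless := ⟨fun _ h => h.1 rfl⟩

lemma affineSpan_ne_top {F : Finset (Sp d)} (hF : F.card ≤ d) (hne : F.Nonempty) :
    affineSpan ℝ (F : Set (Sp d)) ≠ ⊤ := by
  intro h
  have : Nonempty F := hne.coe_sort
  have h1 := finrank_vectorSpan_range_add_one_le ℝ (fun x : F => (x : Sp d))
  rw [Subtype.range_coe_subtype] at h1
  have h2 : vectorSpan ℝ {x : Sp d | x ∈ F} = ⊤ := by
    rw [← direction_affineSpan]
    change (affineSpan ℝ (F : Set (Sp d))).direction = ⊤
    rw [h, AffineSubspace.direction_top]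
  rw [h2, finrank_top, finrank_euclideanSpace_fin, Fintype.card_coe] at h1
  omega

/-- Each of these affine spans is generated by at most `d` points, so it is a null set, and there
are finitely many. A segment from such an `x` to `y` meets no face of codimension two before its
end. -/
lemma exists_generic {U : Set (Sp d)} (hU : IsOpen U) (hne : U.Nonempty) (T : Triangulation Ω)
    (y : Sp d) : ∃ x ∈ U, ∀ K ∈ T.elements, ∀ a ∈ K, ∀ b ∈ K.erase a,
      x ∉ affineSpan ℝ ((insert y ((K.erase a).erase b) : Finset (Sp d)) : Set (Sp d)) := by
  by_contra! hcon
  have hsub : U ⊆ ⋃ K ∈ T.elements, ⋃ a ∈ K, ⋃ b ∈ K.erase a,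
      (affineSpan ℝ ((insert y ((K.erase a).erase b) : Finset (Sp d)) : Set (Sp d)) : Set (Sp d)) := by
    intro x hx
    obtain ⟨K, hK, a, ha, b, hb, h⟩ := hcon x hx
    simp only [Set.mem_iUnion]
    exact ⟨K, hK, a, ha, b, hb, h⟩
  refine (hU.measure_pos volume hne).ne' (measure_mono_null hsub ?_)
  refine (measure_biUnion_null_iff (Finset.countable_toSet _)).2 fun K hK => ?_
  refine (measure_biUnion_null_iff (Finset.countable_toSet _)).2 fun a ha => ?_
  refine (measure_biUnion_null_iff (Finset.countable_toSet _)).2 fun b hb => ?_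
  refine Measure.addHaar_affineSubspace _ _ (affineSpan_ne_top ?_ (Finset.insert_nonempty _ _))
  refine (Finset.card_insert_le _ _).trans ?_
  rw [Finset.card_erase_of_mem hb, Finset.card_erase_of_mem ha, (isSimplex hK).card]
  have : 0 < (K.erase a).card := Finset.card_pos.2 ⟨b, hb⟩
  rw [Finset.card_erase_of_mem ha, (isSimplex hK).card] at this
  omega

/-- Either the boundary is reached from `K` through the sides containing `s`, or every element of
the star is. -/
lemma reachable_of_interior (hΩ : IsBddDomain Ω) (hd : 1 ≤ d) {s : Finset (Sp d)}
    (hs : s.Nonempty) (K L : T.star s)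
    (hno : ∀ M : T.star s, (T.starGraph s).Reachable K M → ∀ e ∈ sides M.1, s ⊆ e →
      ¬ hull e ⊆ frontier Ω) : (T.starGraph s).Reachable K L := by
  have hel : ∀ M : T.star s, M.1 ∈ T.elements := fun M => (mem_star.1 M.2).1
  have hsub : ∀ M : T.star s, s ⊆ M.1 := fun M => (mem_star.1 M.2).2
  obtain ⟨z, hz, hzp⟩ := (isSimplex (hel K)).exists_relint (hsub K) hs
  -- Close to a relatively interior point `z` of the face `s`, all coordinates at `s` are positive
  -- in every element of the star. A path staying this close can leave an element only through a
  -- side that contains `s`.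
  have hev : ∀ᶠ y in 𝓝 z, ∀ M : T.star s, ∀ v ∈ s, 0 < bary M.1 v y := by
    rw [Filter.eventually_all]
    intro M
    rw [Filter.eventually_all_finset]
    intro v hv
    refine (((isSimplex (hel M)).continuous_bary v).tendsto z).eventually_const_lt ?_
    rw [← (isSimplex (hel K)).bary_eq_of_face (isSimplex (hel M)) (hsub K) (hsub M) hz hv]
    exact hzp v hv
  obtain ⟨ε, hε, hball⟩ := Metric.eventually_nhds_iff_ball.1 hev
  have hacc : ∀ M : T.star s, (interior (hull M.1) ∩ Metric.ball z ε).Nonempty := by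
    intro M
    have h1 : z ∈ closure (interior (hull M.1)) := by
      rw [(convex_hull M.1).closure_interior_eq_closure_of_nonempty_interior
        (isSimplex (hel M)).interior_nonempty]
      exact subset_closure (hull_mono (hsub M) hz)
    rw [Set.inter_comm]
    exact mem_closure_iff.1 h1 _ Metric.isOpen_ball (Metric.mem_ball_self hε)
  obtain ⟨y, hyL, hyB⟩ := hacc L
  obtain ⟨x, ⟨hxK, hxB⟩, hgen⟩ := exists_generic (isOpen_interior.inter Metric.isOpen_ball)
    (hacc K) T y
  set γ : ℝ → Sp d := fun t => x + t • (y - x) with hγ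
  have hγc : Continuous γ := by fun_prop
  -- The times at which the segment lies in a reachable element. This set is closed, and at each of
  -- its points below one it contains a neighbourhood, because the side being crossed is interior
  -- and its other element is adjacent. Hence it fills `[0, 1]`.
  set S : Set ℝ := {t | ∃ M : T.star s, (T.starGraph s).Reachable K M ∧ γ t ∈ hull M.1} with hS
  have hSc : IsClosed S := by
    have : S = ⋃ M : T.star s, {t | (T.starGraph s).Reachable K M ∧ γ t ∈ hull M.1} := by
      ext t; simp [hS]
    rw [this]
    refine isClosed_iUnion_of_finite fun M => ?_
    exact isClosed_const.and ((isClosed_hull M.1).preimage hγc)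
  have hIcc : Set.Icc (0 : ℝ) 1 ⊆ S := by
    refine IsClosed.Icc_subset_of_forall_exists_gt (hSc.inter isClosed_Icc) ?_ ?_
    · exact ⟨K, SimpleGraph.Reachable.refl K, by simpa [hγ] using interior_subset hxK⟩
    · rintro t ⟨⟨M, hM, htM⟩, ht0, ht1⟩ t' ht'
      have hMs := isSimplex (hel M)
      have hnhds : S ∈ 𝓝 t := by
        by_cases hi : γ t ∈ interior (hull M.1)
        · have := hγc.continuousAt.preimage_mem_nhds (mem_interior_iff_mem_nhds.1 hi)
          exact Filter.mem_of_superset this fun r hr => ⟨M, hM, hr⟩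
        · have hbd : ∃ a ∈ M.1, bary M.1 a (γ t) = 0 := by
            by_contra! hc
            refine hi (hMs.mem_interior_iff.2 fun v hv => ?_)
            exact lt_of_le_of_ne (hMs.bary_nonneg htM v) (hc v hv).symm
          obtain ⟨a, ha, ha0⟩ := hbd
          have hγB : γ t ∈ Metric.ball z ε := by
            have := (convex_ball z ε) hxB hyB (a := 1 - t) (b := t) (by linarith) ht0 (by ring)
            convert this using 1; simp only [hγ]; module
          have has : a ∉ s := fun h => (hball _ hγB M a h).ne' ha0
          have hse : s ⊆ M.1.erase a := fun v hv =>
            Finset.mem_erase.2 ⟨fun h => has (h ▸ hv), hsub M hv⟩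
          have hγe : γ t ∈ hull (M.1.erase a) := (hMs.mem_hull_erase_iff ha).2 ⟨htM, ha0⟩
          -- A second vanishing coordinate would put `γ t` on a face of codimension two. As `t < 1`,
          -- the point `x` is on the line through `y` and `γ t`, so it would lie in a span excluded
          -- by the choice of `x`.
          have hpos : ∀ v ∈ M.1.erase a, 0 < bary M.1 v (γ t) := by
            intro b hb
            refine lt_of_le_of_ne (hMs.bary_nonneg htM b) fun hb0 => ?_
            refine hgen M.1 (hel M) a ha b hb ?_
            have h1 : γ t ∈ hull ((M.1.erase a).erase b) := by
              rw [hMs.mem_hull_face_iff ((Finset.erase_subset _ _).trans (Finset.erase_subset _ _))]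
              refine ⟨hMs.mem_hull_iff.1 htM, fun v hv hvn => ?_⟩
              by_cases hva : v = a
              · rw [hva, ha0]
              · by_cases hvb : v = b
                · rw [hvb, ← hb0]
                · exact absurd (Finset.mem_erase.2 ⟨hvb, Finset.mem_erase.2 ⟨hva, hv⟩⟩) hvn
            have h2 : γ t ∈ affineSpan ℝ
                ((insert y ((M.1.erase a).erase b) : Finset (Sp d)) : Set (Sp d)) :=
              mem_affineSpan_of_mem_hull (hull_mono (Finset.subset_insert _ _) h1)
            have h3 : y ∈ affineSpan ℝ
                ((insert y ((M.1.erase a).erase b) : Finset (Sp d)) : Set (Sp d)) :=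
              subset_affineSpan ℝ _ (by simp)
            have h4 := AffineMap.lineMap_mem (1 - t)⁻¹ h3 h2
            have h5 : (1 - t) ≠ 0 := by linarith
            have h6 : AffineMap.lineMap y (γ t) (1 - t)⁻¹ = x := by
              have h7 : γ t - y = (1 - t) • (x - y) := by simp only [hγ]; module
              rw [AffineMap.lineMap_apply, vsub_eq_sub, vadd_eq_add, h7, smul_smul,
                inv_mul_cancel₀ h5, one_smul, sub_add_cancel]
            rwa [h6] at h4
          have heM : M.1.erase a ∈ sides M.1 := hMs.mem_sides_iff.2 ⟨a, ha, rfl⟩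
          obtain ⟨K', hK', hne, he'⟩ := exists_neighbor hΩ hd (hel M) heM (hno M hM _ heM hse)
          obtain ⟨a', ha', he⟩ := (isSimplex hK').mem_sides_iff.1 he'
          have hK's : K' ∈ T.star s := mem_star.2 ⟨hK', hse.trans (by
            rw [he]; exact Finset.erase_subset _ _)⟩
          have hadj : (T.starGraph s).Adj M ⟨K', hK's⟩ :=
            ⟨fun h => hne (congrArg Subtype.val h), _, heM, he', hse⟩
          have hnb := union_mem_nhds hd (hel M) hK' hne ha ha' he hγe hpos
          refine Filter.mem_of_superset (hγc.continuousAt.preimage_mem_nhds hnb) ?_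
          rintro r (hr | hr)
          · exact ⟨M, hM, hr⟩
          · exact ⟨⟨K', hK's⟩, hM.trans hadj.reachable, hr⟩
      have h1 : S ∩ Set.Ioc t t' ∈ 𝓝[>] t :=
        Filter.inter_mem (mem_nhdsWithin_of_mem_nhds hnhds) (Ioc_mem_nhdsGT ht')
      exact Filter.nonempty_of_mem h1
  obtain ⟨M, hM, hy⟩ := hIcc (Set.right_mem_Icc.2 zero_le_one)
  have hy' : y ∈ hull M.1 := by simpa [hγ] using hy
  have : L = M := Subtype.ext (eq_of_mem_interior (hel L) (hel M) hyL hy')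
  rwa [this]

/-! ### Consequences of shape regularity -/

/-- Let `r` be the smallest diameter among the elements at `v`. Shrinking each element towards `v`
to diameter `r` places a ball of radius `r / σ` in its intersection with the ball of radius `r`
about `v`. These balls have disjoint interiors, and comparing volumes gives `σ ^ d`. No
comparability of neighbouring sizes is presupposed. -/
lemma card_vertex_star_le (hd : 1 ≤ d) {σ : ℝ} (hσ : 0 < σ) (hT : T.ShapeRegular σ) (v : Sp d) :
    ((T.elements.filter (v ∈ ·)).card : ℝ) ≤ σ ^ d := by
  set E := T.elements.filter (v ∈ ·) with hE
  rcases E.eq_empty_or_nonempty with h | h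
  · rw [h]; simp; positivity
  have hmem : ∀ K ∈ E, K ∈ T.elements ∧ v ∈ K := fun K hK => by simpa [hE] using hK
  obtain ⟨K₀, hK₀, hmin⟩ := E.exists_min_image size h
  set r := size K₀ with hr
  have hr0 : 0 < r := (isSimplex (hmem K₀ hK₀).1).size_pos hd
  have hball : ∀ K ∈ E, ∃ y, Metric.closedBall y (r / σ) ⊆ hull K ∩ Metric.closedBall v r := by
    intro K hK
    obtain ⟨x, hx⟩ := hT K (hmem K hK).1
    have hsz := (isSimplex (hmem K hK).1).size_pos hd
    have hvK : v ∈ hull K := mem_hull_of_mem (hmem K hK).2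
    set t := r / size K with ht
    have ht0 : 0 < t := by positivity
    have ht1 : t ≤ 1 := (div_le_one hsz).2 (hmin K hK)
    refine ⟨v + t • (x - v), fun y hy => ?_⟩
    set x' := v + t⁻¹ • (y - v) with hx'
    have hyx : y = v + t • (x' - v) := by
      rw [hx', add_sub_cancel_left, smul_smul, mul_inv_cancel₀ ht0.ne', one_smul]; abel
    have hx'K : x' ∈ hull K := by
      apply hx
      rw [Metric.mem_closedBall, dist_eq_norm] at hy ⊢
      have e : x' - x = t⁻¹ • (y - (v + t • (x - v))) := by
        have h1 : y - (v + t • (x - v)) = (y - v) - t • (x - v) := by abel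
        rw [hx', h1, smul_sub t⁻¹ (y - v), smul_smul, inv_mul_cancel₀ ht0.ne', one_smul]; abel
      rw [e, norm_smul, norm_inv, Real.norm_of_nonneg ht0.le, inv_mul_le_iff₀ ht0]
      refine hy.trans (le_of_eq ?_)
      rw [ht]; field_simp
    refine ⟨hyx ▸ segment_mem_hull hvK hx'K ht0.le ht1, ?_⟩
    rw [Metric.mem_closedBall, dist_eq_norm, hyx, add_sub_cancel_left, norm_smul,
      Real.norm_of_nonneg ht0.le, ← dist_eq_norm]
    calc t * dist x' v ≤ t * size K := by
          gcongr; exact dist_le_size hx'K hvK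
      _ = r := by rw [ht]; field_simp
  have hy : ∀ K, ∃ y, K ∈ E → Metric.closedBall y (r / σ) ⊆ hull K ∩ Metric.closedBall v r := by
    intro K
    by_cases hK : K ∈ E
    · obtain ⟨y, hy⟩ := hball K hK
      exact ⟨y, fun _ => hy⟩
    · exact ⟨0, fun h => absurd h hK⟩
  choose y hy using hy
  have hdisj : (E : Set (Finset (Sp d))).PairwiseDisjoint fun K => Metric.ball (y K) (r / σ) := by
    intro K hK K' hK' hne
    refine Set.disjoint_left.2 fun x hx hx' => hne ?_
    have h1 : Metric.ball (y K) (r / σ) ⊆ interior (hull K) := by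
      refine interior_maximal ?_ Metric.isOpen_ball
      exact Metric.ball_subset_closedBall.trans ((hy K hK).trans Set.inter_subset_left)
    exact eq_of_mem_interior (hmem K hK).1 (hmem K' hK').1 (h1 hx)
      ((hy K' hK' (Metric.ball_subset_closedBall hx')).1)
  have hvol : ∑ K ∈ E, volume (Metric.ball (y K) (r / σ)) ≤ volume (Metric.closedBall v r) := by
    rw [← measure_biUnion_finset hdisj fun K _ => measurableSet_ball]
    exact measure_mono (Set.iUnion₂_subset fun K hK =>
      Metric.ball_subset_closedBall.trans ((hy K hK).trans Set.inter_subset_right))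
  have hb0 : volume (Metric.ball (0 : Sp d) 1) ≠ 0 := (Metric.measure_ball_pos _ _ one_pos).ne'
  have hb1 : volume (Metric.ball (0 : Sp d) 1) ≠ ⊤ := measure_ball_lt_top.ne
  have hrσ : 0 < r / σ := by positivity
  rw [Finset.sum_congr rfl fun K _ => Measure.addHaar_ball_of_pos volume (y K) hrσ,
    Measure.addHaar_closedBall _ _ hr0.le, Finset.sum_const, nsmul_eq_mul, ← mul_assoc,
    ENNReal.mul_le_mul_iff_left hb0 hb1, finrank_euclideanSpace_fin, ← ENNReal.ofReal_natCast,
    ← ENNReal.ofReal_mul (by positivity), ENNReal.ofReal_le_ofReal_iff (by positivity), div_pow,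
    ← mul_div_assoc, div_le_iff₀ (by positivity), mul_comm (r ^ d)] at hvol
  exact le_of_mul_le_mul_right hvol (by positivity)

/-- For `d ≥ 2` a side has two vertices, and their distance is at least a height of `K` and at most
the diameter of `K'`. For `d = 1` a side is a point and neighbouring sizes are unrelated. -/
lemma size_le_of_shared (hd : 2 ≤ d) {σ : ℝ} (hσ : 0 < σ) (hT : T.ShapeRegular σ)
    {K K' e : Finset (Sp d)} (hK : K ∈ T.elements) (he : e ∈ sides K)
    (he' : e ∈ sides K') : size K ≤ σ * size K' := by
  have hs := isSimplex hK
  obtain ⟨h1, h2⟩ := Finset.mem_powersetCard.1 he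
  obtain ⟨b, hb, c, hc, hbc⟩ := Finset.one_lt_card.1 (by omega : 1 < e.card)
  obtain ⟨x₀, hx₀⟩ := hT K hK
  have h3 := hs.size_le_height (by omega) (h1 hb) hσ hx₀
  have h4 := hs.height_le_norm (by omega) (h1 hb)
    (mem_hull_of_mem (Finset.mem_erase.2 ⟨hbc.symm, h1 hc⟩))
  have h5 : (e : Set (Sp d)) ⊆ hull K' := fun x hx =>
    mem_hull_of_mem ((Finset.mem_powersetCard.1 he').1 hx)
  have h6 := dist_le_size (h5 hc) (h5 hb)
  rw [dist_eq_norm] at h6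
  have h7 := mul_le_mul_of_nonneg_left (h4.trans h6) hσ.le
  linarith [size_nonneg K]

end Triangulation

/-! ### Conforming piecewise polynomials -/

lemma card_piAntidiag_le (K : Finset (Sp d)) (m : ℕ) :
    (K.piAntidiag m).card ≤ (m + 1) ^ K.card := by
  have h1 : ∀ β ∈ K.piAntidiag m, ∀ v ∈ K, β v < m + 1 := by
    intro β hβ v hv
    have h2 : ∑ w ∈ K, β w = m := (Finset.mem_piAntidiag.1 hβ).1
    have h3 := Finset.single_le_sum (f := β) (fun j _ => Nat.zero_le _) hv
    omega
  calc (K.piAntidiag m).card ≤ (Finset.univ : Finset (K → Fin (m + 1))).card := by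
        refine Finset.card_le_card_of_injOn (fun β v => Fin.ofNat (m + 1) (β v))
          (fun _ _ => Finset.mem_coe.2 (Finset.mem_univ _)) ?_
        intro β hβ γ hγ h
        ext v
        by_cases hv : v ∈ K
        · have h4 := congrArg Fin.val (congrFun h ⟨v, hv⟩)
          simp only [Fin.val_ofNat] at h4
          rwa [Nat.mod_eq_of_lt (h1 β hβ v hv), Nat.mod_eq_of_lt (h1 γ hγ v hv)] at h4
        · have h5 : β v = 0 := by_contra fun h => hv ((Finset.mem_piAntidiag.1 hβ).2 v h)
          have h6 : γ v = 0 := by_contra fun h => hv ((Finset.mem_piAntidiag.1 hγ).2 v h)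
          rw [h5, h6]
    _ = (m + 1) ^ K.card := by simp

lemma mem_piAntidiag_of_subset {K e : Finset (Sp d)} {m : ℕ} {β : Sp d → ℕ}
    (hβ : β ∈ K.piAntidiag m) (he : K.filter (fun w => β w ≠ 0) ⊆ e) : β ∈ e.piAntidiag m := by
  have h := Finset.mem_piAntidiag.1 hβ
  have hsub : ∀ w, β w ≠ 0 → w ∈ e := fun w hw =>
    he (Finset.mem_filter.2 ⟨h.2 w hw, hw⟩)
  refine Finset.mem_piAntidiag.2 ⟨?_, hsub⟩
  rw [← h.1]
  have h1 : ∑ w ∈ K.filter (fun w => β w ≠ 0), β w = ∑ w ∈ e, β w :=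
    Finset.sum_subset he fun w _ hw => by
      by_contra h0
      exact hw (Finset.mem_filter.2 ⟨h.2 w h0, h0⟩)
  have h2 : ∑ w ∈ K.filter (fun w => β w ≠ 0), β w = ∑ w ∈ K, β w :=
    Finset.sum_subset (Finset.filter_subset _ _) fun w hwK hw => by
      by_contra h0
      exact hw (Finset.mem_filter.2 ⟨hwK, h0⟩)
  exact h1.symm.trans h2

lemma IsSimplex.volume_le {K : Finset (Sp d)} (hK : IsSimplex K) :
    (volOn K).real Set.univ ≤ size K ^ d * (volume (Metric.ball (0 : Sp d) 1)).toReal := by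
  obtain ⟨a, ha⟩ := hK.nonempty
  rw [← volume_closedBall_toReal a (size_nonneg K), Measure.real, volOn,
    Measure.restrict_apply_univ]
  exact ENNReal.toReal_mono measure_closedBall_lt_top.ne
    (measure_mono fun x hx => dist_le_size hx (mem_hull_of_mem ha))

/-- The gradient of a polynomial on an element is controlled by its Bernstein coefficients. -/
lemma exists_grad_bern_bound (hd : 1 ≤ d) (m : ℕ) {σ : ℝ} (hσ : 0 < σ) :
    ∃ C > 0, ∀ (K : Finset (Sp d)), IsSimplex K →
      (∃ x₀, Metric.closedBall x₀ (size K / σ) ⊆ hull K) →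
      ∀ (c : (Sp d → ℕ) → ℝ) (v : Sp d → ℝ), IsPoly m v → Rep K m c v → ∀ M : ℝ,
      (∀ β ∈ K.piAntidiag m, size K ^ d * c β ^ 2 ≤ size K ^ 2 * M) → ∀ i,
      ∫ x, pderiv i v x ^ 2 ∂(volOn K) ≤ C * M := by
  obtain ⟨C₁, hC₁, hinv⟩ := exists_inverse d m hσ
  set ω' := (volume (Metric.ball (0 : Sp d) 1)).toReal with hω
  have hω0 : 0 < ω' := ENNReal.toReal_pos (Metric.measure_ball_pos _ _ one_pos).ne'
    measure_ball_lt_top.ne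
  set N : ℝ := ((m : ℝ) + 1) ^ (d + 1) with hN
  have hN0 : 0 < N := by positivity
  refine ⟨C₁ * ω' ^ 2 * N ^ 2, by positivity, fun K hK hball c v hv hrep M hM i => ?_⟩
  obtain ⟨x₀, hball⟩ := hball
  have hsz := hK.size_pos hd
  have hx₀ : x₀ ∈ hull K := hball (Metric.mem_closedBall_self (by positivity))
  have hcard : ((K.piAntidiag m).card : ℝ) ≤ N := by
    have := card_piAntidiag_le K m
    rw [hK.card] at this
    rw [hN]
    exact_mod_cast this
  set S := ∑ β ∈ K.piAntidiag m, |c β| with hS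
  have hS0 : 0 ≤ S := Finset.sum_nonneg fun _ _ => abs_nonneg _
  -- The bound at one exponent, concentrated at a vertex, already forces `M` to be nonnegative.
  have hM0 : 0 ≤ M := by
    obtain ⟨a, ha⟩ := hK.nonempty
    have hβ : (fun w => if w = a then m else 0) ∈ K.piAntidiag m := by
      refine Finset.mem_piAntidiag.2 ⟨by simp [ha], fun w hw => ?_⟩
      by_cases h : w = a
      · rwa [h]
      · simp [h] at hw
    have h1 := hM _ hβ
    have h2 : 0 ≤ size K ^ d * c (fun w => if w = a then m else 0) ^ 2 := by positivity
    have h3 : 0 < size K ^ 2 := by positivity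
    by_contra! hneg
    nlinarith [mul_neg_of_pos_of_neg h3 hneg]
  have hS2 : size K ^ d * S ^ 2 ≤ N ^ 2 * (size K ^ 2 * M) := by
    have h1 : S ^ 2 ≤ (K.piAntidiag m).card * ∑ β ∈ K.piAntidiag m, c β ^ 2 := by
      have := sq_sum_le_card_mul_sum_sq (s := K.piAntidiag m) (f := fun β => |c β|)
      simpa using this
    calc size K ^ d * S ^ 2 ≤ size K ^ d * ((K.piAntidiag m).card * ∑ β ∈ K.piAntidiag m, c β ^ 2) := by
          gcongr
      _ = (K.piAntidiag m).card * ∑ β ∈ K.piAntidiag m, size K ^ d * c β ^ 2 := by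
          rw [← Finset.mul_sum]; ring
      _ ≤ (K.piAntidiag m).card * ∑ _β ∈ K.piAntidiag m, size K ^ 2 * M := by
          exact mul_le_mul_of_nonneg_left (Finset.sum_le_sum fun β hβ => hM β hβ) (by positivity)
      _ = (K.piAntidiag m).card * ((K.piAntidiag m).card * (size K ^ 2 * M)) := by
          rw [Finset.sum_const, nsmul_eq_mul]
      _ ≤ N * (N * (size K ^ 2 * M)) := by gcongr
      _ = _ := by ring
  have hvc := hv.continuous
  have hpc := continuous_pderiv hv.contDiff i
  have hvol := hK.volume_le
  rw [← hω] at hvol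
  have hmid : ∫ x, v x ^ 2 ∂(volOn K) ≤ size K ^ d * ω' * S ^ 2 := by
    calc ∫ x, v x ^ 2 ∂(volOn K) ≤ ∫ _x, S ^ 2 ∂(volOn K) := by
          refine integral_mono_ae (integrable_volOn (by fun_prop)) (integrable_const _) ?_
          filter_upwards [ae_mem_hull_volOn K] with x hx
          have := hrep.abs_le hx
          exact sq_le_sq' (by linarith [neg_abs_le (v x)]) ((le_abs_self _).trans this)
      _ = (volOn K).real Set.univ * S ^ 2 := by rw [integral_const, smul_eq_mul]
      _ ≤ _ := by gcongr
  have hpt : ∀ x ∈ hull K, size K ^ (d + 2) * pderiv i v x ^ 2 ≤ C₁ * (size K ^ d * ω' * S ^ 2) :=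
    fun x hx => ((hinv K x₀ (size K) hsz hball (fun y hy => dist_le_size hy hx₀) v hv x hx).2 i).trans
      (by gcongr)
  have h2 : size K ^ (d + 2) * ∫ x, pderiv i v x ^ 2 ∂(volOn K) ≤
      size K ^ d * ω' * (C₁ * (size K ^ d * ω' * S ^ 2)) := by
    rw [← integral_const_mul]
    calc _ ≤ ∫ _x, C₁ * (size K ^ d * ω' * S ^ 2) ∂(volOn K) := by
          refine integral_mono_ae (integrable_volOn (by fun_prop)) (integrable_const _) ?_
          filter_upwards [ae_mem_hull_volOn K] with x hx using hpt x hx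
      _ = (volOn K).real Set.univ * (C₁ * (size K ^ d * ω' * S ^ 2)) := by
          rw [integral_const, smul_eq_mul]
      _ ≤ _ := by gcongr
  have h3 : size K ^ (d + 2) * ∫ x, pderiv i v x ^ 2 ∂(volOn K) ≤
      size K ^ (d + 2) * (C₁ * ω' ^ 2 * N ^ 2 * M) := by
    calc _ ≤ _ := h2
      _ = C₁ * ω' ^ 2 * size K ^ d * (size K ^ d * S ^ 2) := by ring
      _ ≤ C₁ * ω' ^ 2 * size K ^ d * (N ^ 2 * (size K ^ 2 * M)) := by gcongr
      _ = _ := by ring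
  exact le_of_mul_le_mul_left h3 (by positivity)

namespace Triangulation

variable {Ω : Set (Sp d)} {T : Triangulation Ω}

/-- The squared mismatch between a piecewise function and a function on the skeleton. -/
def jump (P Pe : Finset (Sp d) → Sp d → ℝ) (K : Finset (Sp d)) : ℝ :=
  (size K)⁻¹ * ∑ e ∈ sides K, ∫ x, (P K x - Pe e x) ^ 2 ∂(surfOn e)

lemma jump_nonneg (P Pe : Finset (Sp d) → Sp d → ℝ) (K : Finset (Sp d)) : 0 ≤ jump P Pe K :=
  mul_nonneg (inv_nonneg.2 (size_nonneg K))
    (Finset.sum_nonneg fun _ _ => integral_nonneg fun _ => sq_nonneg _)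

lemma transfer_size {h h' A x y : ℝ} (hh : 0 < h) (hh' : 0 < h') (hA : 1 ≤ A) (h1 : h ≤ A * h')
    (h2 : h' ≤ A * h) (hx : 0 ≤ x) (hy : 0 ≤ y) {n : ℕ} (hxy : h' ^ n * x ≤ h' ^ 2 * y) :
    h ^ n * x ≤ A ^ (n + 2) * (h ^ 2 * y) := by
  calc h ^ n * x ≤ (A * h') ^ n * x := by gcongr
    _ = A ^ n * (h' ^ n * x) := by rw [mul_pow]; ring
    _ ≤ A ^ n * (h' ^ 2 * y) := by gcongr
    _ ≤ A ^ n * ((A * h) ^ 2 * y) := by gcongr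
    _ = _ := by rw [pow_add]; ring

/-- Crossing a side `e₁` compares the coefficients of both elements with `ce e₁`, so the difference
telescopes along the walk. Squaring a sum of three terms and adding three equal bounds gives the
factor nine, and passing from the size of one element to that of its neighbour gives `A ^ (d + 2)`.
-/
lemma coeff_walk_le (hd : 2 ≤ d) {σ A C J : ℝ} (hσ : 0 < σ) (hT : T.ShapeRegular σ) (hA : 1 ≤ A)
    (hσA : σ ≤ A) (hC : 0 < C) (hJ : 0 ≤ J) {s : Finset (Sp d)} (c : Finset (Sp d) → ℝ)
    (ce : Finset (Sp d) → ℝ)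
    (hstep : ∀ K ∈ T.star s, ∀ e ∈ sides K, s ⊆ e →
      size K ^ d * (c K - ce e) ^ 2 ≤ size K ^ 2 * (C * J))
    {K M : T.star s} (p : (T.starGraph s).Walk K M) {e : Finset (Sp d)} (he : e ∈ sides M.1)
    (hse : s ⊆ e) :
    size K.1 ^ d * (c K.1 - ce e) ^ 2 ≤ size K.1 ^ 2 * (C * J * (9 * A ^ (d + 2)) ^ p.length) := by
  induction p with
  | nil => simpa using hstep _ (Subtype.property _) e he hse
  | @cons K K₁ M hadj p ih =>
    obtain ⟨e₁, he₁, he₁', hse₁⟩ : ∃ e, e ∈ sides K.1 ∧ e ∈ sides K₁.1 ∧ s ⊆ e := hadj.2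
    have ih := ih he
    have hK := (mem_star.1 K.2).1
    have hK₁ := (mem_star.1 K₁.2).1
    have hs := (isSimplex hK).size_pos (by omega)
    have hs₁ := (isSimplex hK₁).size_pos (by omega)
    have h1 : size K.1 ≤ A * size K₁.1 := (size_le_of_shared hd hσ hT hK he₁ he₁').trans
      (mul_le_mul_of_nonneg_right hσA hs₁.le)
    have h2 : size K₁.1 ≤ A * size K.1 := (size_le_of_shared hd hσ hT hK₁ he₁' he₁).trans
      (mul_le_mul_of_nonneg_right hσA hs.le)
    have hCJ : 0 ≤ C * J := mul_nonneg hC.le hJ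
    set q := (9 * A ^ (d + 2)) ^ p.length with hq
    have hA2 : 1 ≤ A ^ (d + 2) := one_le_pow₀ hA
    have hq1 : 1 ≤ q := one_le_pow₀ (by linarith)
    have t1 := transfer_size hs hs₁ hA h1 h2 (sq_nonneg _) hCJ (hstep _ K₁.2 e₁ he₁' hse₁)
    have t2 := transfer_size hs hs₁ hA h1 h2 (sq_nonneg _) (mul_nonneg hCJ (by linarith)) ih
    have t0 := hstep _ K.2 e₁ he₁ hse₁
    have h3 : (c K.1 - ce e) ^ 2 ≤ 3 * (c K.1 - ce e₁) ^ 2 + 3 * (c K₁.1 - ce e₁) ^ 2 +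
        3 * (c K₁.1 - ce e) ^ 2 := by
      nlinarith [sq_nonneg (c K.1 - ce e₁ + (c K₁.1 - ce e₁)),
        sq_nonneg (c K.1 - ce e₁ - (c K₁.1 - ce e)), sq_nonneg (c K₁.1 - ce e₁ + (c K₁.1 - ce e))]
    have h4 := mul_le_mul_of_nonneg_left h3 (pow_nonneg hs.le d)
    have h5 : 0 ≤ size K.1 ^ 2 * (C * J) := by positivity
    rw [SimpleGraph.Walk.length_cons, pow_succ (9 * A ^ (d + 2)), ← hq]
    have h6 : size K.1 ^ 2 * (C * J) + A ^ (d + 2) * (size K.1 ^ 2 * (C * J)) +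
        A ^ (d + 2) * (size K.1 ^ 2 * (C * J * q)) ≤
        3 * (A ^ (d + 2) * (size K.1 ^ 2 * (C * J * q))) := by
      have h7 : A ^ (d + 2) * (size K.1 ^ 2 * (C * J)) ≤ A ^ (d + 2) * (size K.1 ^ 2 * (C * J * q)) := by
        exact mul_le_mul_of_nonneg_left (mul_le_mul_of_nonneg_left
          (le_mul_of_one_le_right hCJ hq1) (by positivity)) (by positivity)
      have h8 : size K.1 ^ 2 * (C * J) ≤ A ^ (d + 2) * (size K.1 ^ 2 * (C * J)) :=
        le_mul_of_one_le_left h5 hA2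
      linarith
    calc _ ≤ _ := h4
      _ ≤ 3 * (size K.1 ^ 2 * (C * J) + A ^ (d + 2) * (size K.1 ^ 2 * (C * J)) +
        A ^ (d + 2) * (size K.1 ^ 2 * (C * J * q))) := by linarith
      _ ≤ 3 * (3 * (A ^ (d + 2) * (size K.1 ^ 2 * (C * J * q)))) := by gcongr
      _ = _ := by ring

/-- From every element of a star one reaches a side on the boundary or, if there is none, any
prescribed side of the star. -/
lemma exists_walk_to_side (hΩ : IsBddDomain Ω) (hd : 1 ≤ d) {s : Finset (Sp d)} (hs : s.Nonempty)
    (K L : T.star s) {e : Finset (Sp d)} (he : e ∈ sides L.1) (hse : s ⊆ e) :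
    ∃ (M : T.star s) (p : (T.starGraph s).Walk K M), p.length < (T.star s).card ∧
      ∃ e' ∈ sides M.1, s ⊆ e' ∧ (hull e' ⊆ frontier Ω ∨ e' = e) := by
  have key : ∀ M : T.star s, (T.starGraph s).Reachable K M →
      ∃ p : (T.starGraph s).Walk K M, p.length < (T.star s).card := by
    intro M hM
    obtain ⟨p, hp⟩ := hM.exists_isPath
    have := hp.length_lt
    rw [Fintype.card_coe] at this
    exact ⟨p, this⟩
  by_cases h : ∃ M : T.star s, (T.starGraph s).Reachable K M ∧ ∃ e' ∈ sides M.1, s ⊆ e' ∧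
      hull e' ⊆ frontier Ω
  · obtain ⟨M, hM, e', he', hse', hb⟩ := h
    obtain ⟨p, hp⟩ := key M hM
    exact ⟨M, p, hp, e', he', hse', Or.inl hb⟩
  · push Not at h
    obtain ⟨p, hp⟩ := key L (reachable_of_interior hΩ hd hs K L fun M hM e he hse => h M hM e he hse)
    exact ⟨L, p, hp, e, he, hse, Or.inr rfl⟩

/-- The elements that meet `K`. -/
def patch (T : Triangulation Ω) (K : Finset (Sp d)) : Finset (Finset (Sp d)) :=
  {K' ∈ T.elements | (K ∩ K').Nonempty}

lemma card_patch_le (hd : 1 ≤ d) {σ : ℝ} (hσ : 0 < σ) (hT : T.ShapeRegular σ) {K : Finset (Sp d)}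
    (hK : K ∈ T.elements) : ((T.patch K).card : ℝ) ≤ (d + 1) * σ ^ d := by
  have hsub : T.patch K ⊆ K.biUnion fun v => T.elements.filter (v ∈ ·) := by
    intro K' hK'
    obtain ⟨h1, v, hv⟩ := Finset.mem_filter.1 hK'
    obtain ⟨hv1, hv2⟩ := Finset.mem_inter.1 hv
    exact Finset.mem_biUnion.2 ⟨v, hv1, Finset.mem_filter.2 ⟨h1, hv2⟩⟩
  have h1 : (T.patch K).card ≤ ∑ v ∈ K, (T.elements.filter (v ∈ ·)).card :=
    (Finset.card_le_card hsub).trans Finset.card_biUnion_le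
  calc ((T.patch K).card : ℝ) ≤ ((∑ v ∈ K, (T.elements.filter (v ∈ ·)).card : ℕ) : ℝ) := by
        exact_mod_cast h1
    _ = ∑ v ∈ K, ((T.elements.filter (v ∈ ·)).card : ℝ) := by push_cast; rfl
    _ ≤ ∑ _v ∈ K, σ ^ d := Finset.sum_le_sum fun v _ => card_vertex_star_le hd hσ hT v
    _ = _ := by rw [Finset.sum_const, (isSimplex hK).card, nsmul_eq_mul]; push_cast; ring

lemma sum_patch_le (hd : 1 ≤ d) {σ : ℝ} (hσ : 0 < σ) (hT : T.ShapeRegular σ)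
    {j : Finset (Sp d) → ℝ} (hj : ∀ K, 0 ≤ j K) :
    ∑ K ∈ T.elements, ∑ K' ∈ T.patch K, j K' ≤ (d + 1) * σ ^ d * ∑ K ∈ T.elements, j K := by
  have h1 : ∑ K ∈ T.elements, ∑ K' ∈ T.patch K, j K' =
      ∑ K' ∈ T.elements, ∑ K ∈ T.patch K', j K' := by
    unfold patch
    simp_rw [Finset.sum_filter]
    rw [Finset.sum_comm]
    refine Finset.sum_congr rfl fun K' _ => Finset.sum_congr rfl fun K _ => ?_
    rw [Finset.inter_comm]
  rw [h1, Finset.mul_sum]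
  refine Finset.sum_le_sum fun K hK => ?_
  rw [Finset.sum_const, nsmul_eq_mul]
  exact mul_le_mul_of_nonneg_right (card_patch_le hd hσ hT hK) (hj K)

lemma rep_zero_of_forall {e : Finset (Sp d)} {m : ℕ} {c : (Sp d → ℕ) → ℝ} {v : Sp d → ℝ}
    (h : Rep e m c v) (hc : ∀ β ∈ e.piAntidiag m, c β = 0) {x : Sp d} (hx : x ∈ hull e) :
    v x = 0 := by
  have h1 := h.abs_le hx
  rw [Finset.sum_eq_zero fun β hβ => by rw [hc β hβ, abs_zero]] at h1
  exact abs_eq_zero.1 (le_antisymm h1 (abs_nonneg _))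

/-- A piecewise polynomial is close to a conforming one vanishing on the boundary, as measured by
its mismatch with a function on the skeleton that vanishes on the boundary. -/
lemma exists_conforming (hΩ : IsBddDomain Ω) (hd : 1 ≤ d) {m : ℕ} (hm : 1 ≤ m) {σ : ℝ}
    (hσ : 0 < σ) : ∃ C > 0, ∀ T : Triangulation Ω, T.ShapeRegular σ →
      ∀ P Pe : Finset (Sp d) → Sp d → ℝ, MemV T m P →
      (∀ K ∈ T.elements, ∀ e ∈ sides K, IsPoly m (Pe e) ∧
        (hull e ⊆ frontier Ω → ∀ x, Pe e x = 0)) →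
      ∃ I Ie : Finset (Sp d) → Sp d → ℝ, MemV T m I ∧ MemVhat T m Ie ∧
        (∀ K ∈ T.elements, ∀ e ∈ sides K, ∀ x ∈ hull e, I K x = Ie e x) ∧
        ∑ K ∈ T.elements, ∑ i, ∫ x, pderiv i (fun x => P K x - I K x) x ^ 2 ∂(volOn K) ≤
          C * ∑ K ∈ T.elements, jump P Pe K := by
  obtain ⟨C₁, hC₁, hsurf⟩ := exists_bern_surf_bound hd m hσ
  obtain ⟨C₂, hC₂, hgrad⟩ := exists_grad_bern_bound hd m hσ
  set A := max 1 σ with hAdef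
  have hA : 1 ≤ A := le_max_left _ _
  obtain ⟨N, hN⟩ := exists_nat_ge (σ ^ d)
  set Q := (9 * A ^ (d + 2)) ^ N with hQ
  have hA2 : 1 ≤ A ^ (d + 2) := one_le_pow₀ hA
  have hQ1 : 1 ≤ Q := one_le_pow₀ (by linarith)
  refine ⟨C₂ * (C₁ * Q) * d * ((d + 1) * σ ^ d), by positivity, fun T hT P Pe hP hPe => ?_⟩
  have hc : ∀ K, ∃ c, K ∈ T.elements → Rep K m c (P K) := by
    intro K
    by_cases hK : K ∈ T.elements
    · obtain ⟨c, hc⟩ := (hP K hK).exists_rep K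
      exact ⟨c, fun _ => hc⟩
    · exact ⟨0, fun h => absurd h hK⟩
  choose c hc using hc
  have hce : ∀ e, ∃ c : (Sp d → ℕ) → ℝ, (hull e ⊆ frontier Ω → c = 0) ∧
      ∀ K ∈ T.elements, e ∈ sides K → Rep e m c (Pe e) := by
    intro e
    by_cases he : ∃ K ∈ T.elements, e ∈ sides K
    · obtain ⟨K, hK, he⟩ := he
      by_cases hb : hull e ⊆ frontier Ω
      · refine ⟨0, fun _ => rfl, fun _ _ _ l _ _ => ?_⟩
        rw [(hPe K hK e he).2 hb]
        simp [bern]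
      · obtain ⟨c, hc⟩ := (hPe K hK e he).1.exists_rep e
        exact ⟨c, fun h => absurd h hb, fun _ _ _ => hc⟩
    · exact ⟨0, fun _ => rfl, fun K hK h => absurd ⟨K, hK, h⟩ he⟩
  choose ce hce0 hce using hce
  -- A coefficient is attached to the face spanned by the support of its exponent. If a boundary
  -- side contains this face the new coefficient is zero. If only interior sides contain it, the
  -- value is taken from one chosen side, the same for all elements. If no side contains it, the
  -- element keeps its own.
  set isB : (Sp d → ℕ) → Prop := fun β => ∃ e, (∃ K ∈ T.elements, e ∈ sides K) ∧
    hull e ⊆ frontier Ω ∧ β ∈ e.piAntidiag m with hisB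
  set isF : (Sp d → ℕ) → Prop := fun β => ∃ e, (∃ K ∈ T.elements, e ∈ sides K) ∧
    β ∈ e.piAntidiag m with hisF
  set cI : Finset (Sp d) → (Sp d → ℕ) → ℝ := fun K β =>
    if isB β then 0 else if h : isF β then ce h.choose β else c K β with hcI
  set I : Finset (Sp d) → Sp d → ℝ := fun K => bernPoly K K m (cI K) with hI
  set Ie : Finset (Sp d) → Sp d → ℝ := fun e =>
    if h : ∃ K ∈ T.elements, e ∈ sides K then I h.choose else 0 with hIe
  have hIrep : ∀ K ∈ T.elements, Rep K m (cI K) (I K) := fun K hK =>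
    (isSimplex hK).rep_bernPoly le_rfl m _
  have hIpoly : ∀ K ∈ T.elements, IsPoly m (I K) := fun K hK => (isSimplex hK).isPoly_bernPoly K m _
  have hsides : ∀ {K e : Finset (Sp d)}, e ∈ sides K → e ⊆ K := fun he =>
    (Finset.mem_powersetCard.1 he).1
  -- On a side only coefficients with exponents supported there count, and for those `cI` does not
  -- depend on the element; so the element chosen in `Ie` is immaterial.
  have hconf : ∀ K ∈ T.elements, ∀ e ∈ sides K, ∀ x ∈ hull e, I K x = Ie e x := by
    intro K hK e he x hx
    have hex : ∃ K ∈ T.elements, e ∈ sides K := ⟨K, hK, he⟩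
    have h1 : Ie e = I hex.choose := by simp only [hIe, dif_pos hex]
    obtain ⟨hK', he'⟩ := hex.choose_spec
    rw [h1]
    have h2 := ((hIrep K hK).face (hsides he)).sub ((hIrep _ hK').face (hsides he'))
    refine sub_eq_zero.1 (rep_zero_of_forall h2 (fun β hβ => ?_) hx)
    have hF : isF β := ⟨e, hex, hβ⟩
    simp only [hcI, dif_pos hF, sub_self]
  refine ⟨I, Ie, hIpoly, ?_, hconf, ?_⟩
  · intro K hK e he
    refine ⟨fun hb x hx => ?_, fun _ => ?_⟩
    · rw [← hconf K hK e he x hx]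
      refine rep_zero_of_forall ((hIrep K hK).face (hsides he)) (fun β hβ => ?_) hx
      have hB : isB β := ⟨e, ⟨K, hK, he⟩, hb, hβ⟩
      simp only [hcI, if_pos hB]
    · exact ⟨I K, hIpoly K hK, fun x hx => (hconf K hK e he x hx).symm⟩
  · have hcoef : ∀ K ∈ T.elements, ∀ β ∈ K.piAntidiag m, size K ^ d * (c K β - cI K β) ^ 2 ≤
        size K ^ 2 * (C₁ * Q * ∑ K' ∈ T.patch K, jump P Pe K') := by
      intro K hK β hβ
      set J := ∑ K' ∈ T.patch K, jump P Pe K' with hJdef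
      have hJ : 0 ≤ J := Finset.sum_nonneg fun _ _ => jump_nonneg _ _ _
      -- The face that carries the coefficient; it is nonempty because the degree `m` is positive.
      set s := K.filter (fun w => β w ≠ 0) with hs
      have hsK : s ⊆ K := Finset.filter_subset _ _
      have hsub : ∀ e : Finset (Sp d), β ∈ e.piAntidiag m → s ⊆ e := fun e he w hw =>
        (Finset.mem_piAntidiag.1 he).2 w (Finset.mem_filter.1 hw).2
      have hsne : s.Nonempty := by
        by_contra h0
        rw [Finset.not_nonempty_iff_eq_empty] at h0
        have h1 := (Finset.mem_piAntidiag.1 hβ).1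
        rw [Finset.sum_eq_zero fun w hw => by
          by_contra h2
          have : w ∈ s := Finset.mem_filter.2 ⟨hw, h2⟩
          rw [h0] at this
          exact absurd this (Finset.notMem_empty w)] at h1
        omega
      have hstep : ∀ K' ∈ T.star s, ∀ e ∈ sides K', s ⊆ e →
          size K' ^ d * (c K' β - ce e β) ^ 2 ≤ size K' ^ 2 * (C₁ * J) := by
        intro K' hK' e he hse
        obtain ⟨hK'e, hsK'⟩ := mem_star.1 hK'
        have hS := isSimplex hK'e
        have hsz := hS.size_pos hd
        have hrep := ((hc K' hK'e).face (hsides he)).sub (hce e K' hK'e he)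
        have hpatch : K' ∈ T.patch K := by
          obtain ⟨w, hw⟩ := hsne
          exact Finset.mem_filter.2 ⟨hK'e, w, Finset.mem_inter.2 ⟨hsK hw, hsK' hw⟩⟩
        have h1 : ∫ x, (P K' x - Pe e x) ^ 2 ∂(surfOn e) ≤ size K' * jump P Pe K' := by
          rw [jump, ← mul_assoc, mul_inv_cancel₀ hsz.ne', one_mul]
          exact Finset.single_le_sum
            (f := fun e => ∫ x, (P K' x - Pe e x) ^ 2 ∂(surfOn e))
            (fun _ _ => integral_nonneg fun _ => sq_nonneg _) he
        have h2 : jump P Pe K' ≤ J :=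
          Finset.single_le_sum (f := fun K' => jump P Pe K') (fun _ _ => jump_nonneg _ _ _) hpatch
        obtain ⟨a, ha, rfl⟩ := hS.mem_sides_iff.1 he
        have h3 := hsurf K' hS (hT K' hK'e) a ha _ _ hrep β (mem_piAntidiag_of_subset hβ hse)
        calc _ ≤ _ := h3
          _ ≤ C₁ * (size K' * (size K' * J)) := by gcongr; exact h1.trans (by gcongr)
          _ = _ := by ring
      have hKs : K ∈ T.star s := mem_star.2 ⟨hK, hsK⟩
      have hcard : (T.star s).card ≤ N := by
        obtain ⟨v, hv⟩ := hsne
        have h1 : T.star s ⊆ T.elements.filter (v ∈ ·) := fun K' hK' =>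
          Finset.mem_filter.2 ⟨(mem_star.1 hK').1, (mem_star.1 hK').2 hv⟩
        have h2 := card_vertex_star_le hd hσ hT v
        have h3 : ((T.elements.filter (v ∈ ·)).card : ℝ) ≤ N := h2.trans hN
        exact (Finset.card_le_card h1).trans (by exact_mod_cast h3)
      -- The walk starts at `K` and ends at `e` or at a boundary side. In dimension one sizes of
      -- neighbours cannot be compared, but there `e = s` is already a side of `K` and no walk is
      -- needed.
      have reach : ∀ L ∈ T.elements, ∀ e ∈ sides L, s ⊆ e → ∃ e' M, M ∈ T.elements ∧ e' ∈ sides M ∧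
          s ⊆ e' ∧ (hull e' ⊆ frontier Ω ∨ e' = e) ∧
          size K ^ d * (c K β - ce e' β) ^ 2 ≤ size K ^ 2 * (C₁ * Q * J) := by
        intro L hL e he hse
        rcases Nat.lt_or_ge d 2 with hd1 | hd2
        · have hce' : e.card = 1 := by
            rw [(Finset.mem_powersetCard.1 he).2]; omega
          have hes : e = s := (Finset.eq_of_subset_of_card_le hse (by
            rw [hce']; exact hsne.card_pos)).symm
          have heK : e ∈ sides K := mem_sides_of_subset (Finset.mem_powersetCard.1 he).2 (hes ▸ hsK)
          refine ⟨e, K, hK, heK, hse, Or.inr rfl, (hstep K hKs e heK hse).trans ?_⟩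
          have : C₁ * J ≤ C₁ * Q * J := by
            rw [mul_assoc]
            exact mul_le_mul_of_nonneg_left (le_mul_of_one_le_left hJ hQ1) hC₁.le
          gcongr
        · obtain ⟨M, p, hp, e', he', hse', hor⟩ := exists_walk_to_side hΩ hd hsne ⟨K, hKs⟩
            ⟨L, mem_star.2 ⟨hL, hse.trans (hsides he)⟩⟩ he hse
          refine ⟨e', M.1, (mem_star.1 M.2).1, he', hse', hor, ?_⟩
          have h1 := coeff_walk_le hd2 hσ hT hA (le_max_right _ _) hC₁ hJ (fun K => c K β)
            (fun e => ce e β) hstep p he' hse'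
          refine h1.trans ?_
          have h2 : (9 * A ^ (d + 2)) ^ p.length ≤ Q :=
            pow_le_pow_right₀ (by linarith) (by omega)
          calc size K ^ 2 * (C₁ * J * (9 * A ^ (d + 2)) ^ p.length) ≤ size K ^ 2 * (C₁ * J * Q) := by
                gcongr
            _ = _ := by ring
      -- For a boundary exponent both possible ends of the walk lie on the boundary, with
      -- coefficient zero. For another side exponent a boundary end is impossible, so the walk ends
      -- at the very side that defines the new coefficient.
      by_cases hB : isB β
      · have h0 : cI K β = 0 := by simp only [hcI, if_pos hB]
        obtain ⟨e, ⟨L, hL, he⟩, hb, hβe⟩ := hB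
        obtain ⟨e', M, hM, he', hse', hor, hle⟩ := reach L hL e he (hsub e hβe)
        have hb' : hull e' ⊆ frontier Ω := by
          rcases hor with h | h
          · exact h
          · rw [h]; exact hb
        rw [hce0 e' hb'] at hle
        rw [h0]
        exact hle
      · by_cases hF : isF β
        · have h0 : cI K β = ce hF.choose β := by simp only [hcI, if_neg hB, dif_pos hF]
          obtain ⟨⟨L, hL, he⟩, hβe⟩ := hF.choose_spec
          obtain ⟨e', M, hM, he', hse', hor, hle⟩ := reach L hL _ he (hsub _ hβe)
          rcases hor with h | h
          · exact absurd ⟨e', ⟨M, hM, he'⟩, h, mem_piAntidiag_of_subset hβ hse'⟩ hB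
          · rw [h0, ← h]; exact hle
        · have h0 : cI K β = c K β := by simp only [hcI, if_neg hB, dif_neg hF]
          rw [h0, sub_self]
          have : 0 ≤ size K ^ 2 * (C₁ * Q * J) := by positivity
          simpa using this
    have hlocal : ∀ K ∈ T.elements, ∀ i, ∫ x, pderiv i (fun x => P K x - I K x) x ^ 2 ∂(volOn K) ≤
        C₂ * (C₁ * Q * ∑ K' ∈ T.patch K, jump P Pe K') := fun K hK i =>
      hgrad K (isSimplex hK) (hT K hK) _ _ ((hP K hK).sub (hIpoly K hK))
        ((hc K hK).sub (hIrep K hK)) _ (hcoef K hK) i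
    calc _ ≤ ∑ K ∈ T.elements, ∑ _i : Fin d, C₂ * (C₁ * Q * ∑ K' ∈ T.patch K, jump P Pe K') :=
          Finset.sum_le_sum fun K hK => Finset.sum_le_sum fun i _ => hlocal K hK i
      _ = C₂ * (C₁ * Q) * d * ∑ K ∈ T.elements, ∑ K' ∈ T.patch K, jump P Pe K' := by
          rw [Finset.mul_sum]
          refine Finset.sum_congr rfl fun K _ => ?_
          rw [Finset.sum_const, Finset.card_univ, Fintype.card_fin, nsmul_eq_mul]
          ring
      _ ≤ C₂ * (C₁ * Q) * d * ((d + 1) * σ ^ d * ∑ K ∈ T.elements, jump P Pe K) :=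
          mul_le_mul_of_nonneg_left (sum_patch_le hd hσ hT fun K => jump_nonneg _ _ K) (by positivity)
      _ = _ := by ring

end Triangulation

/-! ### Approximation on the elements -/

lemma derivFam_single (Ω : Set (Sp d)) (w : Sp d → ℝ) (i : Fin d) :
    derivFam Ω w (Pi.single i 1) = weakDeriv Ω (Pi.single i 1) w := by
  rw [derivFam, if_neg]
  intro h
  have := congrFun h i
  simp at this

/-- The weak partial derivatives of `w`. -/
def wgrad (Ω : Set (Sp d)) (w : Sp d → ℝ) (i : Fin d) : Sp d → ℝ := weakDeriv Ω (Pi.single i 1) w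

lemma MemH.memLp_wgrad {Ω : Set (Sp d)} {m : ℕ} {w : Sp d → ℝ} (h : MemH Ω (m + 1) w) (i : Fin d) :
    MemLp (wgrad Ω w i) 2 (volume.restrict Ω) := (h.isWeakDeriv (by simp)).memLp

lemma MemH.integral_wgrad {Ω : Set (Sp d)} {m : ℕ} {w : Sp d → ℝ} (h : MemH Ω (m + 1) w)
    (i : Fin d) {φ : Sp d → ℝ} (hφ : IsTest Ω φ) :
    (∫ x in Ω, wgrad Ω w i x * φ x) + ∫ x in Ω, w x * pderiv i φ x = 0 := by
  have h1 := (h.isWeakDeriv (β := Pi.single i 1) (by simp)).integral_eq φ hφ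
  rw [multiDeriv_single hφ.smooth] at h1
  rw [h1]
  simp [wgrad]

lemma MemH.exists_H1Lim {Ω : Set (Sp d)} {m : ℕ} {w : Sp d → ℝ} (h : MemH Ω (m + 1) w)
    {K : Finset (Sp d)} (hKs : IsSimplex K) (hK : interior (hull K) ⊆ Ω) :
    ∃ φ, H1Lim K w (wgrad Ω w) φ := by
  obtain ⟨φ, hφ⟩ := h.sobFam hKs hK 0 (by simp)
  refine ⟨φ, ?_⟩
  have h0 : derivFam Ω w 0 = w := by simp [derivFam]
  simp only [zero_add, derivFam_single, h0] at hφ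
  exact hφ

/-- Polynomial approximation on an element, with an estimate for the trace. -/
lemma exists_poly_trace (hd : 1 ≤ d) (r : ℕ) {σ : ℝ} (hσ : 0 < σ) :
    ∃ C > 0, ∀ (Ω : Set (Sp d)) (K : Finset (Sp d)), IsSimplex K → interior (hull K) ⊆ Ω →
      (∃ x₀, Metric.closedBall x₀ (size K / σ) ⊆ hull K) →
      ∀ w, MemH Ω (r + 1) w → ∃ P, IsPoly r P ∧
        ∫ x, (w x - P x) ^ 2 ∂(volOn K) ≤
          C * (size K ^ (2 * (r + 1)) * semiSqOn K (derivFam Ω w) (r + 1)) ∧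
        size K ^ 2 * ∑ i, ∫ x, (wgrad Ω w i x - pderiv i P x) ^ 2 ∂(volOn K) ≤
          C * (size K ^ (2 * (r + 1)) * semiSqOn K (derivFam Ω w) (r + 1)) ∧
        ∀ t, HasTrace K w (wgrad Ω w) t → ∀ e ∈ sides K,
          size K * ∫ x, (t e x - P x) ^ 2 ∂(surfOn e) ≤
            C * (size K ^ (2 * (r + 1)) * semiSqOn K (derivFam Ω w) (r + 1)) := by
  have hd0 : (0 : ℝ) < d := by exact_mod_cast hd
  set b := σ ^ d * d with hb
  set C₀ := b ^ (r + 1) + d * b ^ r with hC₀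
  have hC₀p : 0 < C₀ := by positivity
  refine ⟨C₀ + σ * (d + 1) * C₀, by positivity, fun Ω K hKs hK hball w hw => ?_⟩
  obtain ⟨x₀, hball⟩ := hball
  obtain ⟨P, hP, h1, h2⟩ := (hw.sobFam hKs hK).exists_poly hKs hd hσ hball
  set S := semiSqOn K (derivFam Ω w) (r + 1) with hS
  have hS0 : 0 ≤ S := semiSqOn_nonneg _ _ _
  set X := size K ^ (2 * (r + 1)) * S with hX
  have hX0 : 0 ≤ X := mul_nonneg (pow_nonneg (size_nonneg K) _) hS0
  have e1 : (σ ^ d * size K ^ 2 * d) ^ (r + 1) * S = b ^ (r + 1) * X := by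
    rw [hX, hb, pow_mul, ← mul_assoc, ← mul_pow]; ring
  have e2 : size K ^ 2 * (d * ((σ ^ d * size K ^ 2 * d) ^ r * S)) = d * b ^ r * X := by
    rw [hX, hb, pow_mul, pow_succ (size K ^ 2)]
    rw [show σ ^ d * size K ^ 2 * d = (σ ^ d * d) * size K ^ 2 by ring, mul_pow]; ring
  have h0 : derivFam Ω w 0 = w := by simp [derivFam]
  simp only [h0, derivFam_single] at h1 h2
  rw [e1] at h1
  have h2' := mul_le_mul_of_nonneg_left h2 (sq_nonneg (size K))
  rw [e2] at h2'
  have hb0 : 0 ≤ b ^ (r + 1) * X := by positivity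
  have hb1 : 0 ≤ d * b ^ r * X := by positivity
  have hC1 : C₀ * X = b ^ (r + 1) * X + d * b ^ r * X := by rw [hC₀]; ring
  have hC2 : 0 ≤ σ * (d + 1) * C₀ * X := by positivity
  refine ⟨P, hP, by rw [add_mul]; linarith, ?_, fun t ht e he => ?_⟩
  · rw [add_mul]
    have : size K ^ 2 * ∑ i, ∫ x, (wgrad Ω w i x - pderiv i P x) ^ 2 ∂(volOn K) ≤ d * b ^ r * X := h2'
    linarith
  · have h3 := ht.trace_le hKs hd hP.contDiff hσ hball he
    have h4 : ∫ x, (w x - P x) ^ 2 ∂(volOn K) +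
        size K ^ 2 * ∑ i, ∫ x, (wgrad Ω w i x - pderiv i P x) ^ 2 ∂(volOn K) ≤ C₀ * X := by
      rw [hC1]
      exact add_le_add h1 h2'
    have h5 := mul_le_mul_of_nonneg_left h4 (by positivity : 0 ≤ σ * ((d : ℝ) + 1))
    have h6 : 0 ≤ C₀ * X := by positivity
    calc _ ≤ _ := h3
      _ ≤ σ * (d + 1) * (C₀ * X) := h5
      _ ≤ _ := by rw [add_mul]; linarith

/-! ### From elements to the mesh: boundary traces and the conforming interpolant. -/

namespace Triangulation

variable {Ω : Set (Sp d)} {T : Triangulation Ω}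

lemma sum_semiSqOn (hΩ : IsBddDomain Ω) (T : Triangulation Ω) {m : ℕ} {w : Sp d → ℝ}
    (hw : MemH Ω (m + 1) w) :
    ∑ K ∈ T.elements, semiSqOn K (derivFam Ω w) (m + 1) = semiSq Ω (m + 1) w := by
  unfold semiSqOn semiSq
  rw [Finset.sum_comm]
  refine Finset.sum_congr rfl fun β hβ => ?_
  rw [mem_piAntidiag_univ] at hβ
  have hne : β ≠ 0 := by
    rintro rfl
    simp at hβ
  rw [integral_eq_sum hΩ T (hw.isWeakDeriv hβ.le).memLp.integrable_sq]
  simp only [derivFam, if_neg hne]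

lemma size_le_meshSize {K : Finset (Sp d)} (hK : K ∈ T.elements) : size K ≤ T.meshSize :=
  le_ciSup (f := fun K : T.elements => size K.1) (Set.finite_range _).bddAbove ⟨K, hK⟩

lemma sum_size_mul_le (hΩ : IsBddDomain Ω) (T : Triangulation Ω) {m : ℕ} {w : Sp d → ℝ}
    (hw : MemH Ω (m + 1) w) (n : ℕ) :
    ∑ K ∈ T.elements, size K ^ n * semiSqOn K (derivFam Ω w) (m + 1) ≤
      T.meshSize ^ n * semiSq Ω (m + 1) w := by
  rw [← sum_semiSqOn hΩ T hw, Finset.mul_sum]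
  refine Finset.sum_le_sum fun K hK => ?_
  exact mul_le_mul_of_nonneg_right (pow_le_pow_left₀ (size_nonneg K) (size_le_meshSize hK) n)
    (semiSqOn_nonneg _ _ _)

/-- The traces on the sides of a function in `H¹₀(Ω)`; they vanish on the boundary. -/
lemma exists_trace_H10 (hΩ : IsBddDomain Ω) (hd : 1 ≤ d) (T : Triangulation Ω) {u : Sp d → ℝ}
    (hu : MemH10 Ω u) : ∃ t : Finset (Sp d) → Sp d → ℝ, ∀ K ∈ T.elements,
      HasTrace K u (wgrad Ω u) t ∧
      ∀ e ∈ sides K, hull e ⊆ frontier Ω → ∫ x, t e x ^ 2 ∂(surfOn e) = 0 := by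
  obtain ⟨φ, hφ, h1, h2⟩ := hu.approx
  have hlim : ∀ K ∈ T.elements, H1Lim K u (wgrad Ω u) φ := by
    intro K hK
    have hle := volOn_le_restrict (interior_hull_subset hΩ hK)
    refine H1Lim.of_eLpNorm (hu.memH.memLp.mono_measure hle)
      (fun i => (hu.memH.memLp_wgrad i).mono_measure hle) ⟨fun n => (hφ n).smooth, ?_, fun i => ?_⟩
    · exact tendsto_of_tendsto_of_tendsto_of_le_of_le tendsto_const_nhds h1 (fun _ => zero_le)
        fun n => eLpNorm_mono_measure _ hle
    · exact tendsto_of_tendsto_of_tendsto_of_le_of_le tendsto_const_nhds (h2 i) (fun _ => zero_le)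
        fun n => eLpNorm_mono_measure _ hle
  have ht : ∀ e, ∃ t, ∀ K ∈ T.elements, e ∈ sides K → L2Lim (surfOn e) φ t := by
    intro e
    by_cases he : ∃ K ∈ T.elements, e ∈ sides K
    · obtain ⟨K, hK, he⟩ := he
      obtain ⟨t, ht⟩ := (hlim K hK).exists_trace (isSimplex hK) hd he
      exact ⟨t, fun _ _ _ => ht⟩
    · exact ⟨0, fun K hK h => absurd ⟨K, hK, h⟩ he⟩
  choose t ht using ht
  refine ⟨t, fun K hK => ⟨⟨φ, hlim K hK, fun e he => ht e K hK he⟩, fun e he hb => ?_⟩⟩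
  have h3 := (ht e K hK he).tendsto
  -- The approximating test functions vanish on `∂Ω`, so their distance to the trace on a boundary
  -- side is the same for all `n`; since it tends to zero, it is zero.
  have h4 : ∀ n, ∫ x, (φ n x - t e x) ^ 2 ∂(surfOn e) = ∫ x, t e x ^ 2 ∂(surfOn e) := by
    intro n
    refine integral_congr_ae ?_
    filter_upwards [ae_mem_hull_surfOn e] with x hx
    have : x ∉ Ω := fun hxΩ => by
      have := hb hx
      rw [hΩ.isOpen.frontier_eq] at this
      exact this.2 hxΩ
    rw [(hφ n).eq_zero this, zero_sub, neg_sq]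
  simp only [h4] at h3
  exact tendsto_nhds_unique tendsto_const_nhds h3

/-- A conforming interpolant of `u`. -/
lemma exists_interpolant (hΩ : IsBddDomain Ω) (hd : 1 ≤ d) (k : ℕ) {σ : ℝ} (hσ : 0 < σ) :
    ∃ C > 0, ∀ T : Triangulation Ω, T.ShapeRegular σ → ∀ u, MemH10 Ω u → MemH Ω (k + 2) u →
      ∃ I Ie : Finset (Sp d) → Sp d → ℝ, MemV T (k + 1) I ∧ MemVhat T (k + 1) Ie ∧
        (∀ K ∈ T.elements, ∀ e ∈ sides K, ∀ x ∈ hull e, I K x = Ie e x) ∧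
        ∑ K ∈ T.elements, ∑ i, ∫ x, (wgrad Ω u i x - pderiv i (I K) x) ^ 2 ∂(volOn K) ≤
          C * (T.meshSize ^ (2 * (k + 1)) * semiSq Ω (k + 2) u) := by
  obtain ⟨C₁, hC₁, happ⟩ := exists_poly_trace hd (k + 1) hσ
  obtain ⟨C₂, hC₂, hconf⟩ := exists_conforming hΩ hd (m := k + 1) (by omega) hσ
  refine ⟨2 * C₁ + 2 * (C₂ * (4 * (d + 1) * C₁)), by positivity, fun T hT u hu hu2 => ?_⟩
  have hP : ∀ K, ∃ P, K ∈ T.elements → IsPoly (k + 1) P ∧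
      ∫ x, (u x - P x) ^ 2 ∂(volOn K) ≤
        C₁ * (size K ^ (2 * (k + 1 + 1)) * semiSqOn K (derivFam Ω u) (k + 1 + 1)) ∧
      size K ^ 2 * ∑ i, ∫ x, (wgrad Ω u i x - pderiv i P x) ^ 2 ∂(volOn K) ≤
        C₁ * (size K ^ (2 * (k + 1 + 1)) * semiSqOn K (derivFam Ω u) (k + 1 + 1)) ∧
      ∀ t, HasTrace K u (wgrad Ω u) t → ∀ e ∈ sides K,
        size K * ∫ x, (t e x - P x) ^ 2 ∂(surfOn e) ≤
          C₁ * (size K ^ (2 * (k + 1 + 1)) * semiSqOn K (derivFam Ω u) (k + 1 + 1)) := by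
    intro K
    by_cases hK : K ∈ T.elements
    · obtain ⟨P, hP⟩ := happ Ω K (isSimplex hK) (interior_hull_subset hΩ hK) (hT K hK) u hu2
      exact ⟨P, fun _ => hP⟩
    · exact ⟨0, fun h => absurd h hK⟩
  choose P hP using hP
  obtain ⟨t, ht⟩ := exists_trace_H10 hΩ hd T hu
  -- On an interior side the skeleton function is the elementwise polynomial closest to the trace of
  -- `u`. Its distance to the trace is then at most that of either neighbour, so the mismatch of
  -- each `P K` is bounded by its own trace error alone, with no comparison of element sizes.
  have hmin : ∀ e, ∃ K', ∀ K ∈ T.elements, e ∈ sides K → K' ∈ T.elements ∧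
      ∫ x, (t e x - P K' x) ^ 2 ∂(surfOn e) ≤ ∫ x, (t e x - P K x) ^ 2 ∂(surfOn e) := by
    intro e
    rcases (T.elements.filter (e ∈ sides ·)).eq_empty_or_nonempty with h | h
    · refine ⟨∅, fun K hK he => ?_⟩
      have : K ∈ T.elements.filter (e ∈ sides ·) := Finset.mem_filter.2 ⟨hK, he⟩
      rw [h] at this
      exact absurd this (Finset.notMem_empty K)
    · obtain ⟨K', hK', hm⟩ := Finset.exists_min_image _
        (fun K => ∫ x, (t e x - P K x) ^ 2 ∂(surfOn e)) h
      exact ⟨K', fun K hK he => ⟨(Finset.mem_filter.1 hK').1,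
        hm K (Finset.mem_filter.2 ⟨hK, he⟩)⟩⟩
  choose Km hKm using hmin
  set Pe : Finset (Sp d) → Sp d → ℝ := fun e =>
    if hull e ⊆ frontier Ω then fun _ => 0 else P (Km e) with hPe
  obtain ⟨I, Ie, hI, hIe, hIc, hIb⟩ := hconf T hT P Pe (fun K hK => (hP K hK).1) (by
    intro K hK e he
    by_cases hb : hull e ⊆ frontier Ω
    · simp only [hPe, if_pos hb]
      exact ⟨isPoly_const _ _, by simp⟩
    · simp only [hPe, if_neg hb]
      exact ⟨(hP _ (hKm e K hK he).1).1, fun h => absurd h hb⟩)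
  have hmis : ∀ K ∈ T.elements, ∀ e ∈ sides K, ∫ x, (P K x - Pe e x) ^ 2 ∂(surfOn e) ≤
      4 * ∫ x, (t e x - P K x) ^ 2 ∂(surfOn e) := by
    intro K hK e he
    have hs := isSimplex hK
    have mP := hs.memLp_surfOn_of_mem_sides hd he (hP K hK).1.continuous 2
    have mt := (ht K hK).1.memLp he
    have h0 : 0 ≤ ∫ x, (t e x - P K x) ^ 2 ∂(surfOn e) := integral_nonneg fun _ => sq_nonneg _
    by_cases hb : hull e ⊆ frontier Ω
    · have h1 := integral_sub_sq_le mt (memLp_sub_fun mt mP)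
      rw [(ht K hK).2 e he hb] at h1
      simp only [hPe, if_pos hb, sub_sub_cancel] at h1 ⊢
      simp only [sub_zero]
      linarith
    · have hK' := hKm e K hK he
      have mP' := hs.memLp_surfOn_of_mem_sides hd he (hP _ hK'.1).1.continuous 2
      have h1 := integral_sub_sq_le (memLp_sub_fun mt mP') (memLp_sub_fun mt mP)
      simp only [hPe, if_neg hb, sub_sub_sub_cancel_left] at h1 ⊢
      linarith [hK'.2]
  have hjump : ∀ K ∈ T.elements, jump P Pe K ≤ 4 * (d + 1) * C₁ *
      (size K ^ (2 * (k + 1)) * semiSqOn K (derivFam Ω u) (k + 2)) := by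
    intro K hK
    have hsz := (isSimplex hK).size_pos hd
    set S := semiSqOn K (derivFam Ω u) (k + 2) with hS
    have h1 : ∀ e ∈ sides K, size K * ∫ x, (P K x - Pe e x) ^ 2 ∂(surfOn e) ≤
        4 * (C₁ * (size K ^ (2 * (k + 1 + 1)) * S)) := by
      intro e he
      have := (hP K hK).2.2.2 t (ht K hK).1 e he
      have h2 := mul_le_mul_of_nonneg_left (hmis K hK e he) hsz.le
      linarith
    have h2 : size K ^ 2 * jump P Pe K ≤ (d + 1) * (4 * (C₁ * (size K ^ (2 * (k + 1 + 1)) * S))) := by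
      calc size K ^ 2 * jump P Pe K = ∑ e ∈ sides K,
            size K * ∫ x, (P K x - Pe e x) ^ 2 ∂(surfOn e) := by
            rw [jump, ← Finset.mul_sum]; field_simp
        _ ≤ ∑ _e ∈ sides K, 4 * (C₁ * (size K ^ (2 * (k + 1 + 1)) * S)) := Finset.sum_le_sum h1
        _ = _ := by
            rw [Finset.sum_const, sides, Finset.card_powersetCard, (isSimplex hK).card]
            simp
    have h3 : size K ^ 2 * jump P Pe K ≤ size K ^ 2 * (4 * (d + 1) * C₁ *
        (size K ^ (2 * (k + 1)) * S)) := by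
      refine h2.trans (le_of_eq ?_)
      rw [show 2 * (k + 1 + 1) = 2 * (k + 1) + 2 by ring, pow_add]; ring
    exact le_of_mul_le_mul_left h3 (by positivity)
  have hsum := sum_size_mul_le hΩ T hu2 (2 * (k + 1))
  have hjs : ∑ K ∈ T.elements, jump P Pe K ≤ 4 * (d + 1) * C₁ *
      (T.meshSize ^ (2 * (k + 1)) * semiSq Ω (k + 2) u) := by
    refine (Finset.sum_le_sum hjump).trans ?_
    rw [← Finset.mul_sum]
    exact mul_le_mul_of_nonneg_left hsum (by positivity)
  have hgs : ∑ K ∈ T.elements, ∑ i, ∫ x, (wgrad Ω u i x - pderiv i (P K) x) ^ 2 ∂(volOn K) ≤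
      C₁ * (T.meshSize ^ (2 * (k + 1)) * semiSq Ω (k + 2) u) := by
    refine le_trans (Finset.sum_le_sum (g := fun K => C₁ *
      (size K ^ (2 * (k + 1)) * semiSqOn K (derivFam Ω u) (k + 2))) fun K hK => ?_) ?_
    · have hsz := (isSimplex hK).size_pos hd
      refine le_of_mul_le_mul_left ((hP K hK).2.2.1.trans (le_of_eq ?_)) (pow_pos hsz 2)
      rw [show 2 * (k + 1 + 1) = 2 * (k + 1) + 2 by ring, pow_add]; ring
    · rw [← Finset.mul_sum]
      exact mul_le_mul_of_nonneg_left hsum hC₁.le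
  refine ⟨I, Ie, hI, hIe, hIc, ?_⟩
  have hle : ∀ K ∈ T.elements, ∀ i, ∫ x, (wgrad Ω u i x - pderiv i (I K) x) ^ 2 ∂(volOn K) ≤
      2 * ∫ x, (wgrad Ω u i x - pderiv i (P K) x) ^ 2 ∂(volOn K) +
      2 * ∫ x, pderiv i (fun x => P K x - I K x) x ^ 2 ∂(volOn K) := by
    intro K hK i
    have dP := (hP K hK).1.contDiff
    have dI := (hI K hK).contDiff
    have mg := (hu2.memLp_wgrad i).mono_measure (volOn_le_restrict (interior_hull_subset hΩ hK))
    have mP := memLp_volOn (K := K) (continuous_pderiv dP i) 2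
    have mI := memLp_volOn (K := K) (continuous_pderiv dI i) 2
    have := integral_add_sq_le (memLp_sub_fun mg mP) (memLp_sub_fun mP mI)
    rw [pderiv_sub (dP.differentiable (by simp)) (dI.differentiable (by simp))]
    simpa using this
  calc _ ≤ ∑ K ∈ T.elements, ∑ i, (2 * ∫ x, (wgrad Ω u i x - pderiv i (P K) x) ^ 2 ∂(volOn K) +
      2 * ∫ x, pderiv i (fun x => P K x - I K x) x ^ 2 ∂(volOn K)) :=
        Finset.sum_le_sum fun K hK => Finset.sum_le_sum fun i _ => hle K hK i
    _ = 2 * ∑ K ∈ T.elements, ∑ i, ∫ x, (wgrad Ω u i x - pderiv i (P K) x) ^ 2 ∂(volOn K) +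
      2 * ∑ K ∈ T.elements, ∑ i, ∫ x, pderiv i (fun x => P K x - I K x) x ^ 2 ∂(volOn K) := by
        simp only [Finset.sum_add_distrib, Finset.mul_sum]
    _ ≤ 2 * (C₁ * (T.meshSize ^ (2 * (k + 1)) * semiSq Ω (k + 2) u)) +
      2 * (C₂ * (4 * (d + 1) * C₁ * (T.meshSize ^ (2 * (k + 1)) * semiSq Ω (k + 2) u))) :=
        add_le_add (mul_le_mul_of_nonneg_left hgs (by norm_num)) (mul_le_mul_of_nonneg_left
          (hIb.trans (mul_le_mul_of_nonneg_left hjs hC₂.le)) (by norm_num))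
    _ = _ := by ring

/-! ### Continuity of the normal traces -/

/-- Almost every point of a side has positive coordinates at all its vertices. Another side through
such a point must contain all these vertices and, having the same number of them, equals `e`. -/
lemma ae_notMem_other_sides (hΩ : IsBddDomain Ω) (hd : 1 ≤ d) {K : Finset (Sp d)}
    (hK : K ∈ T.elements) {e : Finset (Sp d)} (he : e ∈ sides K) (hmid : ¬ hull e ⊆ frontier Ω) :
    ∀ᵐ x ∂(surfOn e), x ∈ Ω ∧ ∀ K' ∈ T.elements, ∀ e' ∈ sides K', e' ≠ e → x ∉ hull e' := by
  have hs := isSimplex hK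
  have hcard : e.card = d := (Finset.mem_powersetCard.1 he).2
  obtain ⟨a, ha, rfl⟩ := hs.mem_sides_iff.1 he
  filter_upwards [hs.ae_bary_pos hd ha, ae_mem_hull_surfOn (K.erase a)] with x hpos hx
  refine ⟨mem_of_bary_pos hΩ hd hK ha hmid hx hpos, fun K' hK' e' he' hne hx' => hne ?_⟩
  have hs' := isSimplex hK'
  have hcard' : e'.card = d := (Finset.mem_powersetCard.1 he').2
  have hsub : K.erase a ⊆ K' := subset_of_bary_pos hK hK' (Finset.erase_subset a K)
    (hull_mono (Finset.erase_subset _ _) hx)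
    (hull_mono (Finset.mem_powersetCard.1 he').1 hx') hpos
  obtain ⟨b, hb, rfl⟩ := hs'.mem_sides_iff.1 he'
  have hb0 := ((hs'.mem_hull_erase_iff hb).1 hx').2
  have hbe : b ∉ K.erase a := by
    intro hbe
    have := hpos b hbe
    rw [hs.bary_eq_of_face hs' (Finset.erase_subset a K) hsub hx hbe, hb0] at this
    exact lt_irrefl _ this
  have hsub' : K.erase a ⊆ K'.erase b := fun v hv => Finset.mem_erase.2
    ⟨fun h => hbe (by rw [← h]; exact hv), hsub hv⟩
  exact (Finset.eq_of_subset_of_card_le hsub' (by rw [hcard, hcard'])).symm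

/-- The traces from the two sides of an interior side agree. -/
lemma ae_sum_trace_eq_zero (hΩ : IsBddDomain Ω) (hd : 1 ≤ d) {m : ℕ} {w : Sp d → ℝ}
    (hw : MemH Ω (m + 1) w) {t : Finset (Sp d) → Finset (Sp d) → Sp d → ℝ}
    (ht : ∀ K ∈ T.elements, HasTrace K w (wgrad Ω w) (t K)) {K₀ e : Finset (Sp d)}
    (hK₀ : K₀ ∈ T.elements) (he₀ : e ∈ sides K₀) (hmid : ¬ hull e ⊆ frontier Ω) (i : Fin d) :
    ∀ᵐ x ∂(surfOn e), ∑ K ∈ T.elements.filter (e ∈ sides ·), outNormal K e i * t K e x = 0 := by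
  -- Test functions supported in `U` see no side but `e`. Summing Green's formula over the elements
  -- leaves only the terms on `e`, because the volume terms add up to the definition of the weak
  -- derivative on `Ω`; and `U` contains almost all of `e`.
  set U : Set (Sp d) := Ω ∩ ⋂ K ∈ T.elements, ⋂ e' ∈ (sides K).filter (· ≠ e), (hull e')ᶜ with hU
  have hUo : IsOpen U := hΩ.isOpen.inter (isOpen_biInter_finset fun K _ =>
    isOpen_biInter_finset fun e' _ => (isClosed_hull e').isOpen_compl)
  have hUmem : ∀ x, x ∈ U ↔ x ∈ Ω ∧ ∀ K' ∈ T.elements, ∀ e' ∈ sides K', e' ≠ e → x ∉ hull e' := by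
    intro x
    simp only [hU, Set.mem_inter_iff, Set.mem_iInter, Set.mem_compl_iff, Finset.mem_filter, and_imp]
  have hfin : IsFiniteMeasure (surfOn e) := by
    obtain ⟨a, ha, rfl⟩ := (isSimplex hK₀).mem_sides_iff.1 he₀
    exact (isSimplex hK₀).isFiniteMeasure_surfOn hd ha
  set F : Sp d → ℝ := fun x => ∑ K ∈ T.elements.filter (e ∈ sides ·), outNormal K e i * t K e x with hF
  have hti : ∀ K ∈ T.elements.filter (e ∈ sides ·), Integrable (t K e) (surfOn e) := fun K hK =>
    ((ht K (Finset.mem_filter.1 hK).1).memLp (Finset.mem_filter.1 hK).2).integrable (by norm_num)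
  have hFi : Integrable F (surfOn e) := integrable_finsetSum _ fun K hK => (hti K hK).const_mul _
  have hzero : ∀ g : Sp d → ℝ, ContDiff ℝ ∞ g → HasCompactSupport g → tsupport g ⊆ U →
      ∫ x, g x • F x ∂(surfOn e) = 0 := by
    intro g hg hgc hgs
    have htest : IsTest Ω g := ⟨hg, hgc, hgs.trans Set.inter_subset_left⟩
    have hg0 : ∀ K ∈ T.elements, ∀ e' ∈ sides K, e' ≠ e →
        ∫ x, t K e' x * g x ∂(surfOn e') = 0 := by
      intro K hK e' he' hne
      refine integral_eq_zero_of_ae ?_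
      filter_upwards [ae_mem_hull_surfOn e'] with x hx
      have : g x = 0 := image_eq_zero_of_notMem_tsupport fun h =>
        ((hUmem x).1 (hgs h)).2 K hK e' he' hne hx
      rw [this, mul_zero, Pi.zero_apply]
    have h1 : ∀ K ∈ T.elements, ∑ e' ∈ sides K, outNormal K e' i * ∫ x, t K e' x * g x ∂(surfOn e') =
        if e ∈ sides K then outNormal K e i * ∫ x, t K e x * g x ∂(surfOn e) else 0 := by
      intro K hK
      by_cases he : e ∈ sides K
      · rw [if_pos he, Finset.sum_eq_single_of_mem e he fun e' he' hne => by
          rw [hg0 K hK e' he' hne, mul_zero]]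
      · rw [if_neg he]
        refine Finset.sum_eq_zero fun e' he' => ?_
        rw [hg0 K hK e' he' fun h => he (h ▸ he'), mul_zero]
    have h2 : ∑ K ∈ T.elements, ∑ e' ∈ sides K, outNormal K e' i * ∫ x, t K e' x * g x ∂(surfOn e') = 0 := by
      rw [Finset.sum_congr rfl fun K hK => ((ht K hK).green (isSimplex hK) hd hg i).symm,
        Finset.sum_add_distrib, ← integral_eq_sum hΩ T, ← integral_eq_sum hΩ T]
      · exact hw.integral_wgrad i htest
      · exact integrable_mul_L2 hw.memLp
          (((contDiff_pderiv hg i).continuous.memLp_of_hasCompactSupport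
            (htest.pderiv i).compact).restrict _)
      · exact integrable_mul_L2 (hw.memLp_wgrad i)
          ((hg.continuous.memLp_of_hasCompactSupport hgc).restrict _)
    rw [Finset.sum_congr rfl h1, ← Finset.sum_filter] at h2
    rw [← h2]
    have h3 : (fun x => g x • F x) = fun x => ∑ K ∈ T.elements.filter (e ∈ sides ·),
        outNormal K e i * (t K e x * g x) := by
      ext x
      rw [hF, smul_eq_mul, Finset.mul_sum]
      exact Finset.sum_congr rfl fun K _ => by ring
    rw [h3, integral_finsetSum]
    · exact Finset.sum_congr rfl fun K _ => integral_const_mul _ _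
    · intro K hK
      refine Integrable.const_mul (integrable_mul_L2 ((ht K (Finset.mem_filter.1 hK).1).memLp
        (Finset.mem_filter.1 hK).2) ?_) _
      exact (isSimplex hK₀).memLp_surfOn_of_mem_sides hd he₀ hg.continuous 2
  have hae := hUo.ae_eq_zero_of_integral_contDiff_smul_eq_zero
    (hFi.locallyIntegrable.locallyIntegrableOn U) hzero
  filter_upwards [hae, ae_notMem_other_sides hΩ hd hK₀ he₀ hmid] with x hx hx'
  exact hx ((hUmem x).2 hx')

lemma sum_sides_comm (T : Triangulation Ω) (X : Finset (Sp d) → Finset (Sp d) → ℝ) :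
    ∑ K ∈ T.elements, ∑ e ∈ sides K, X K e =
      ∑ e ∈ T.elements.biUnion sides, ∑ K ∈ T.elements.filter (e ∈ sides ·), X K e := by
  refine Finset.sum_comm' fun K e => ?_
  simp only [Finset.mem_biUnion, Finset.mem_filter]
  exact ⟨fun h => ⟨h, K, h⟩, fun h => h.1⟩

/-- The normal traces are orthogonal to the functions on the skeleton that vanish on the
boundary. -/
lemma sum_normal_trace_eq_zero (hΩ : IsBddDomain Ω) (hd : 1 ≤ d) {m r : ℕ} {p : Fin d → Sp d → ℝ}
    (hp : ∀ i, MemH Ω (m + 1) (p i)) {t : Fin d → Finset (Sp d) → Finset (Sp d) → Sp d → ℝ}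
    (ht : ∀ i, ∀ K ∈ T.elements, HasTrace K (p i) (wgrad Ω (p i)) (t i K))
    {v : Finset (Sp d) → Sp d → ℝ} (hv : MemVhat T r v) :
    ∑ K ∈ T.elements, ∑ e ∈ sides K,
      ∫ x, v e x * ∑ i, outNormal K e i * t i K e x ∂(surfOn e) = 0 := by
  rw [sum_sides_comm]
  refine Finset.sum_eq_zero fun e he => ?_
  obtain ⟨K₀, hK₀, he₀⟩ := Finset.mem_biUnion.1 he
  by_cases hb : hull e ⊆ frontier Ω
  · refine Finset.sum_eq_zero fun K _ => integral_eq_zero_of_ae ?_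
    filter_upwards [ae_mem_hull_surfOn e] with x hx
    rw [(hv K₀ hK₀ e he₀).1 hb x hx, zero_mul, Pi.zero_apply]
  · obtain ⟨P, hP, hvP⟩ := (hv K₀ hK₀ e he₀).2 hb
    have hmv : MemLp (v e) 2 (surfOn e) := by
      refine MemLp.ae_eq ?_ ((isSimplex hK₀).memLp_surfOn_of_mem_sides hd he₀ hP.continuous 2)
      filter_upwards [ae_mem_hull_surfOn e] with x hx using (hvP hx).symm
    rw [← integral_finsetSum]
    · refine integral_eq_zero_of_ae ?_
      filter_upwards [ae_all_iff.2 fun i => ae_sum_trace_eq_zero hΩ hd (hp i) (ht i) hK₀ he₀ hb i]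
        with x hx
      rw [← Finset.mul_sum, Finset.sum_comm, Finset.sum_eq_zero fun i _ => hx i, mul_zero,
        Pi.zero_apply]
    · intro K hK
      refine integrable_mul_L2 hmv (memLp_finsetSum _ fun i _ => ?_)
      exact ((ht i K (Finset.mem_filter.1 hK).1).memLp (Finset.mem_filter.1 hK).2).const_mul _

end Triangulation

/-! ### The coefficient matrix -/

lemma aemeasurable_det {n : ℕ} {X : Type*} [MeasurableSpace X] {μ : Measure X}
    {B : X → Matrix (Fin n) (Fin n) ℝ} (hB : ∀ i j, AEMeasurable (fun x => B x i j) μ) :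
    AEMeasurable (fun x => (B x).det) μ := by
  simp only [Matrix.det_apply]
  refine Finset.aemeasurable_fun_sum _ fun s _ => ?_
  exact (Finset.aemeasurable_fun_prod _ fun i _ => hB _ _).const_smul _

/-- The inverse is the adjugate divided by the determinant, and both are polynomial in the entries.
-/
lemma aemeasurable_inv {n : ℕ} {X : Type*} [MeasurableSpace X] {μ : Measure X}
    {B : X → Matrix (Fin n) (Fin n) ℝ} (hB : ∀ i j, AEMeasurable (fun x => B x i j) μ)
    (i j : Fin n) : AEMeasurable (fun x => (B x)⁻¹ i j) μ := by
  simp only [Matrix.inv_def, Matrix.smul_apply, Ring.inverse_eq_inv', smul_eq_mul,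
    Matrix.adjugate_apply]
  refine (aemeasurable_det hB).inv.mul (aemeasurable_det fun a b => ?_)
  simp only [Matrix.updateRow_apply]
  split_ifs
  · exact aemeasurable_const
  · exact hB a b

lemma inner_eq_sum (a b : Sp d) : inner ℝ a b = ∑ i, a i * b i := by
  rw [PiLp.inner_apply]
  exact Finset.sum_congr rfl fun i _ => by simp [mul_comm]

lemma norm_sq_eq_sum (a : Sp d) : ‖a‖ ^ 2 = ∑ i, a i ^ 2 := by
  rw [EuclideanSpace.norm_sq_eq]
  simp

/-- Write `y = α⁻¹ ξ`. Positivity of `α` at `y` gives `lam * ‖y‖ ^ 2 ≤ ⟨y, ξ⟩` and hence the upper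
bound for `y`; boundedness of the entries gives `‖ξ‖ ^ 2 ≤ L * ‖y‖ ^ 2`, which turns the former into
coercivity with `lam / L`. -/
lemma IsCoefficient.exists_bounds {Ω : Set (Sp d)} {α : Sp d → Matrix (Fin d) (Fin d) ℝ}
    (hα : IsCoefficient Ω α) : ∃ κ β : ℝ, 0 < κ ∧ 0 < β ∧ ∀ x ∈ Ω, ∀ ξ : Sp d,
      κ * ‖ξ‖ ^ 2 ≤ inner ℝ (cMul α x ξ) ξ ∧ ‖cMul α x ξ‖ ≤ β * ‖ξ‖ := by
  obtain ⟨M, hM⟩ := hα.bounded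
  obtain ⟨lam, hlam, hpos⟩ := hα.posDef
  -- The summand one makes `L` positive without a case distinction.
  set L : ℝ := d * (d * M ^ 2) + 1 with hL
  have hL0 : 0 < L := by positivity
  refine ⟨lam / L, lam⁻¹, by positivity, by positivity, fun x hx ξ => ?_⟩
  have hdot : ∀ a : Sp d, WithLp.ofLp a ⬝ᵥ WithLp.ofLp a = ‖a‖ ^ 2 := fun a => by
    rw [norm_sq_eq_sum, dotProduct]
    exact Finset.sum_congr rfl fun i _ => by ring
  have hinj : Function.Injective (α x).mulVec := by
    intro a b hab
    have h0 : α x *ᵥ (a - b) = 0 := by rw [Matrix.mulVec_sub, sub_eq_zero]; exact hab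
    have h1 := hpos x hx (a - b)
    rw [h0, dotProduct_zero] at h1
    have h2 : (a - b) ⬝ᵥ (a - b) ≤ 0 := nonpos_of_mul_nonpos_right h1 hlam
    have h3 : 0 ≤ (a - b) ⬝ᵥ (a - b) := Finset.sum_nonneg fun i _ => mul_self_nonneg _
    exact sub_eq_zero.1 (dotProduct_self_eq_zero.1 (le_antisymm h2 h3))
  have hunit : IsUnit (α x) := Matrix.mulVec_injective_iff_isUnit.1 hinj
  have hdet : IsUnit (α x).det := (Matrix.isUnit_iff_isUnit_det _).1 hunit
  set y : Sp d := cMul α x ξ with hy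
  have hAy : α x *ᵥ WithLp.ofLp y = WithLp.ofLp ξ := by
    rw [hy, cMul, Matrix.mulVec_mulVec, Matrix.mul_nonsing_inv _ hdet, Matrix.one_mulVec]
  have hin : inner ℝ y ξ = WithLp.ofLp y ⬝ᵥ WithLp.ofLp ξ := inner_eq_sum y ξ
  have h1 : lam * ‖y‖ ^ 2 ≤ inner ℝ y ξ := by
    have := hpos x hx (WithLp.ofLp y)
    rwa [hAy, hdot, ← hin] at this
  have h2 : ‖ξ‖ ^ 2 ≤ L * ‖y‖ ^ 2 := by
    have h3 : ∀ i, ξ i ^ 2 ≤ d * M ^ 2 * ‖y‖ ^ 2 := by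
      intro i
      have h4 : ξ i = ∑ j, α x i j * y j := by
        have := congrFun hAy i
        rw [← this]; rfl
      rw [h4]
      refine (Finset.sum_mul_sq_le_sq_mul_sq _ _ _).trans ?_
      rw [norm_sq_eq_sum]
      refine mul_le_mul_of_nonneg_right ?_ (Finset.sum_nonneg fun _ _ => sq_nonneg _)
      refine (Finset.sum_le_sum fun j _ => sq_le_sq.2 ((hM x hx i j).trans (le_abs_self M))).trans ?_
      simp
    rw [norm_sq_eq_sum ξ]
    refine (Finset.sum_le_sum fun i _ => h3 i).trans ?_
    simp only [Finset.sum_const, Finset.card_univ, Fintype.card_fin, nsmul_eq_mul]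
    rw [hL]
    nlinarith [sq_nonneg ‖y‖]
  refine ⟨?_, ?_⟩
  · refine le_trans ?_ h1
    rw [div_mul_eq_mul_div, div_le_iff₀ hL0]
    nlinarith
  · have h5 := h1.trans (real_inner_le_norm y ξ)
    rcases (norm_nonneg y).eq_or_lt with h0 | h0
    · rw [← h0]; positivity
    · have h6 : lam * ‖y‖ ≤ ‖ξ‖ := le_of_mul_le_mul_right (by nlinarith) h0
      rw [inv_mul_eq_div, le_div_iff₀ hlam]
      linarith

lemma aestronglyMeasurable_cMul {α : Sp d → Matrix (Fin d) (Fin d) ℝ} {μ : Measure (Sp d)}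
    (hα : ∀ i j, AEMeasurable (fun x => α x i j) μ) {F : Sp d → Sp d}
    (hF : AEStronglyMeasurable F μ) : AEStronglyMeasurable (fun x => cMul α x (F x)) μ := by
  refine AEMeasurable.aestronglyMeasurable ?_
  refine (WithLp.measurable_toLp 2 (Fin d → ℝ)).comp_aemeasurable (aemeasurable_pi_iff.2 fun i => ?_)
  simp only [Matrix.mulVec, dotProduct]
  refine Finset.aemeasurable_fun_sum _ fun j _ => (aemeasurable_inv hα i j).mul ?_
  exact (EuclideanSpace.proj j : Sp d →L[ℝ] ℝ).continuous.measurable.comp_aemeasurable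
    hF.aemeasurable

lemma cMul_add (α : Sp d → Matrix (Fin d) (Fin d) ℝ) (x a b : Sp d) :
    cMul α x (a + b) = cMul α x a + cMul α x b := by
  simp [cMul, Matrix.mulVec_add]

lemma cMul_sub (α : Sp d → Matrix (Fin d) (Fin d) ℝ) (x a b : Sp d) :
    cMul α x (a - b) = cMul α x a - cMul α x b := by
  simp [cMul, Matrix.mulVec_sub]

/-! ### Vector fields in `L²` -/

lemma memLp_vec {μ : Measure (Sp d)} {F : Sp d → Sp d} (h : ∀ i, MemLp (fun x => F x i) 2 μ) :
    MemLp F 2 μ := by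
  have : F = fun x => ∑ i, F x i • EuclideanSpace.single i (1 : ℝ) := by
    ext x j
    simp [Finset.sum_apply, Pi.single_apply]
  rw [this]
  refine memLp_finsetSum _ fun i _ => ?_
  exact (ContinuousLinearMap.toSpanSingleton ℝ (EuclideanSpace.single i (1 : ℝ))).comp_memLp' (h i)

lemma memLp_vec_apply {μ : Measure (Sp d)} {F : Sp d → Sp d} (h : MemLp F 2 μ) (i : Fin d) :
    MemLp (fun x => F x i) 2 μ :=
  (EuclideanSpace.proj i : Sp d →L[ℝ] ℝ).comp_memLp' h

lemma integrable_inner_L2 {μ : Measure (Sp d)} {F G : Sp d → Sp d} (hF : MemLp F 2 μ)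
    (hG : MemLp G 2 μ) : Integrable (fun x => inner ℝ (F x) (G x)) μ := by
  simp only [inner_eq_sum]
  exact integrable_finsetSum _ fun i _ => integrable_mul_L2 (memLp_vec_apply hF i) (memLp_vec_apply hG i)

lemma integrable_norm_sq_L2 {μ : Measure (Sp d)} {F : Sp d → Sp d} (hF : MemLp F 2 μ) :
    Integrable (fun x => ‖F x‖ ^ 2) μ := hF.norm.integrable_sq

/-- Young's inequality. -/
lemma abs_integral_inner_le {μ : Measure (Sp d)} {F G : Sp d → Sp d} (hF : MemLp F 2 μ)
    (hG : MemLp G 2 μ) {s : ℝ} (hs : 0 < s) :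
    |∫ x, inner ℝ (F x) (G x) ∂μ| ≤ s * ∫ x, ‖G x‖ ^ 2 ∂μ + s⁻¹ * ∫ x, ‖F x‖ ^ 2 ∂μ := by
  rw [← integral_const_mul, ← integral_const_mul, ← integral_add
    ((integrable_norm_sq_L2 hG).const_mul s) ((integrable_norm_sq_L2 hF).const_mul s⁻¹)]
  refine abs_integral_le_integral_abs.trans (integral_mono (integrable_inner_L2 hF hG).abs
    (((integrable_norm_sq_L2 hG).const_mul s).add ((integrable_norm_sq_L2 hF).const_mul s⁻¹))
    fun x => ?_)
  refine (abs_real_inner_le_norm _ _).trans ?_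
  have h1 : s * ‖G x‖ ^ 2 + s⁻¹ * ‖F x‖ ^ 2 - ‖F x‖ * ‖G x‖ =
      s * (‖G x‖ - s⁻¹ * ‖F x‖ / 2) ^ 2 + 3 / 4 * (s⁻¹ * ‖F x‖ ^ 2) := by field_simp; ring
  have h2 : 0 ≤ s * (‖G x‖ - s⁻¹ * ‖F x‖ / 2) ^ 2 + 3 / 4 * (s⁻¹ * ‖F x‖ ^ 2) := by positivity
  linarith

lemma abs_integral_mul_le_young {μ : Measure (Sp d)} {f g : Sp d → ℝ} (hf : MemLp f 2 μ)
    (hg : MemLp g 2 μ) {s : ℝ} (hs : 0 < s) :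
    |∫ x, f x * g x ∂μ| ≤ s * ∫ x, g x ^ 2 ∂μ + s⁻¹ * ∫ x, f x ^ 2 ∂μ := by
  rw [← integral_const_mul, ← integral_const_mul, ← integral_add
    (hg.integrable_sq.const_mul s) (hf.integrable_sq.const_mul s⁻¹)]
  refine abs_integral_le_integral_abs.trans (integral_mono (integrable_mul_L2 hf hg).abs
    ((hg.integrable_sq.const_mul s).add (hf.integrable_sq.const_mul s⁻¹)) fun x => ?_)
  have h1 : s * g x ^ 2 + s⁻¹ * f x ^ 2 - |f x * g x| =
      s * (|g x| - s⁻¹ * |f x| / 2) ^ 2 + 3 / 4 * (s⁻¹ * |f x| ^ 2) := by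
    rw [abs_mul, ← sq_abs (g x), ← sq_abs (f x)]
    field_simp; ring
  have h2 : 0 ≤ s * (|g x| - s⁻¹ * |f x| / 2) ^ 2 + 3 / 4 * (s⁻¹ * |f x| ^ 2) := by positivity
  show |f x * g x| ≤ s * g x ^ 2 + s⁻¹ * f x ^ 2
  linarith

lemma integral_norm_sq {μ : Measure (Sp d)} {F : Sp d → Sp d} (hF : MemLp F 2 μ) :
    ∫ x, ‖F x‖ ^ 2 ∂μ = ∑ i, ∫ x, F x i ^ 2 ∂μ := by
  simp only [norm_sq_eq_sum]
  exact integral_finsetSum _ fun i _ => (memLp_vec_apply hF i).integrable_sq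

lemma integral_norm_add_sq_le {μ : Measure (Sp d)} {F G : Sp d → Sp d} (hF : MemLp F 2 μ)
    (hG : MemLp G 2 μ) :
    ∫ x, ‖F x + G x‖ ^ 2 ∂μ ≤ 2 * ∫ x, ‖F x‖ ^ 2 ∂μ + 2 * ∫ x, ‖G x‖ ^ 2 ∂μ := by
  rw [← integral_const_mul, ← integral_const_mul, ← integral_add
    ((integrable_norm_sq_L2 hF).const_mul 2) ((integrable_norm_sq_L2 hG).const_mul 2)]
  refine integral_mono (integrable_norm_sq_L2 (hF.add hG)) (((integrable_norm_sq_L2 hF).const_mul 2).add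
    ((integrable_norm_sq_L2 hG).const_mul 2)) fun x => ?_
  have h1 := norm_add_le (F x) (G x)
  have h2 := pow_le_pow_left₀ (norm_nonneg _) h1 2
  show ‖F x + G x‖ ^ 2 ≤ 2 * ‖F x‖ ^ 2 + 2 * ‖G x‖ ^ 2
  nlinarith [sq_nonneg (‖F x‖ - ‖G x‖)]

/-! ### Green's formula for vector fields -/

lemma gradient_apply (v : Sp d → ℝ) (x : Sp d) (i : Fin d) : gradient v x i = pderiv i v x := by
  have h := inner_gradient_left (𝕜 := ℝ) (f := v) (x := x) (y := EuclideanSpace.single i 1)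
  rw [EuclideanSpace.inner_single_right] at h
  simpa [pderiv] using h

/-- Normalizing gives norm one or, for the zero vector, zero; so the bound needs no nondegeneracy.
-/
lemma abs_outNormal_le (K e : Finset (Sp d)) : ‖outNormal K e‖ ≤ 1 := by
  unfold outNormal
  simp only
  rw [norm_smul, norm_inv, norm_norm]
  exact inv_mul_le_one

lemma IsPoly.memLp_gradient {m : ℕ} {v : Sp d → ℝ} (hv : IsPoly m v) (K : Finset (Sp d)) :
    MemLp (gradient v) 2 (volOn K) :=
  memLp_vec fun i => by
    simp only [gradient_apply]
    exact memLp_volOn (continuous_pderiv hv.contDiff i) 2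

lemma IsSimplex.green_vec {K : Finset (Sp d)} (hK : IsSimplex K) (hd : 1 ≤ d) {m r : ℕ}
    {q : Sp d → Sp d} (hq : ∀ i, IsPoly m (fun x => q x i)) {v : Sp d → ℝ} (hv : IsPoly r v) :
    ∫ x, v x * divg q x ∂(volOn K) + ∫ x, inner ℝ (gradient v x) (q x) ∂(volOn K) =
      ∑ e ∈ sides K, ∫ x, v x * inner ℝ (q x) (outNormal K e) ∂(surfOn e) := by
  have cq := fun i => (hq i).continuous
  have cv := hv.continuous
  have cdq : ∀ i, Continuous (pderiv i fun x => q x i) := fun i => continuous_pderiv (hq i).contDiff i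
  have cdv : ∀ i, Continuous (pderiv i v) := fun i => continuous_pderiv hv.contDiff i
  have h1 : ∀ i, ∫ x, v x * pderiv i (fun y => q y i) x ∂(volOn K) +
      ∫ x, pderiv i v x * q x i ∂(volOn K) =
      ∑ e ∈ sides K, ∫ x, v x * (q x i * outNormal K e i) ∂(surfOn e) := by
    intro i
    have i1 : Integrable (fun x => v x * pderiv i (fun y => q y i) x) (volOn K) :=
      integrable_volOn (cv.mul (cdq i))
    have i2 : Integrable (fun x => pderiv i v x * q x i) (volOn K) :=
      integrable_volOn ((cdv i).mul (cq i))
    rw [← integral_add i1 i2]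
    have h2 := hK.integral_pderiv hd (hv.contDiff.mul (hq i).contDiff) i
    have h3 : ∀ x, pderiv i (fun x => v x * q x i) x =
        v x * pderiv i (fun y => q y i) x + pderiv i v x * q x i := fun x => by
      rw [pderiv_mul (hv.contDiff.differentiable (by simp)) ((hq i).contDiff.differentiable (by simp))]
      ring
    simp only [← h3]
    refine h2.trans (Finset.sum_congr rfl fun e _ => ?_)
    rw [← integral_const_mul]
    exact integral_congr_ae (.of_forall fun x => by ring)
  have h4 := Finset.sum_congr rfl fun (i : Fin d) (_ : i ∈ Finset.univ) => h1 i
  rw [Finset.sum_add_distrib, ← integral_finsetSum, ← integral_finsetSum, Finset.sum_comm] at h4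
  · simp only [divg, Finset.mul_sum, inner_eq_sum, gradient_apply]
    refine h4.trans (Finset.sum_congr rfl fun e he => ?_)
    rw [integral_finsetSum]
    intro i _
    exact memLp_one_iff_integrable.1
      (hK.memLp_surfOn_of_mem_sides hd he (cv.mul ((cq i).mul continuous_const)) 1)
  · exact fun i _ => integrable_volOn ((cdv i).mul (cq i))
  · exact fun i _ => integrable_volOn (cv.mul (cdq i))

/-- Green's formula for a vector field in `H¹` and a polynomial. -/
lemma green_trace_vec {K : Finset (Sp d)} (hK : IsSimplex K) (hd : 1 ≤ d) {p : Sp d → Sp d}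
    {g : Fin d → Fin d → Sp d → ℝ} {t : Fin d → Finset (Sp d) → Sp d → ℝ}
    (hp : MemLp p 2 (volOn K)) (hg : ∀ i, MemLp (g i i) 2 (volOn K))
    (h : ∀ i, HasTrace K (fun x => p x i) (g i) (t i)) {r : ℕ} {v : Sp d → ℝ} (hv : IsPoly r v) :
    ∫ x, (∑ i, g i i x) * v x ∂(volOn K) + ∫ x, inner ℝ (p x) (gradient v x) ∂(volOn K) =
      ∑ e ∈ sides K, ∫ x, v x * ∑ i, outNormal K e i * t i e x ∂(surfOn e) := by
  have mv : MemLp v 2 (volOn K) := memLp_volOn hv.continuous 2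
  have h1 := Finset.sum_congr rfl fun (i : Fin d) (_ : i ∈ Finset.univ) =>
    (h i).green hK hd hv.contDiff i
  rw [Finset.sum_add_distrib, ← integral_finsetSum, ← integral_finsetSum, Finset.sum_comm] at h1
  · simp only [Finset.sum_mul, inner_eq_sum, gradient_apply]
    refine h1.trans (Finset.sum_congr rfl fun e he => ?_)
    simp only [Finset.mul_sum]
    rw [integral_finsetSum]
    · refine Finset.sum_congr rfl fun i _ => ?_
      rw [← integral_const_mul]
      exact integral_congr_ae (.of_forall fun x => by ring)
    · intro i _
      exact integrable_mul_L2 (hK.memLp_surfOn_of_mem_sides hd he hv.continuous 2)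
        (((h i).memLp he).const_mul _)
  · exact fun i _ => integrable_mul_L2 (memLp_vec_apply hp i)
      (memLp_volOn (continuous_pderiv hv.contDiff i) 2)
  · exact fun i _ => integrable_mul_L2 (hg i) mv

/-- The discrete trace inequality. -/
lemma exists_discrete_trace (hd : 1 ≤ d) (m : ℕ) {σ : ℝ} (hσ : 0 < σ) :
    ∃ C > 0, ∀ (K : Finset (Sp d)), IsSimplex K →
      (∃ x₀, Metric.closedBall x₀ (size K / σ) ⊆ hull K) → ∀ v : Sp d → ℝ, IsPoly m v →
      ∀ e ∈ sides K, size K * ∫ x, v x ^ 2 ∂(surfOn e) ≤ C * ∫ x, v x ^ 2 ∂(volOn K) := by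
  obtain ⟨C₁, hC₁, hinv⟩ := exists_inverse d m hσ
  set ω' := (volume (Metric.ball (0 : Sp d) 1)).toReal with hω
  have hω0 : 0 < ω' := ENNReal.toReal_pos (Metric.measure_ball_pos _ _ one_pos).ne'
    measure_ball_lt_top.ne
  have hd0 : (0 : ℝ) < d := by exact_mod_cast hd
  refine ⟨σ * d * ω' * C₁, by positivity, fun K hK hball v hv e he => ?_⟩
  obtain ⟨x₀, hball⟩ := hball
  have hsz := hK.size_pos hd
  have hx₀ : x₀ ∈ hull K := hball (Metric.mem_closedBall_self (by positivity))
  obtain ⟨a, ha, rfl⟩ := hK.mem_sides_iff.1 he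
  have := hK.isFiniteMeasure_surfOn hd ha
  have hsub : hull (K.erase a) ⊆ hull K := hull_mono (Finset.erase_subset _ _)
  set X := ∫ x, v x ^ 2 ∂(volOn K) with hX
  have hX0 : 0 ≤ X := integral_nonneg fun _ => sq_nonneg _
  set S := (surfOn (K.erase a)).real Set.univ with hS
  -- The pointwise inverse inequality is integrated over the side. The area of the side is then
  -- bounded through `volume_eq`, since the height is comparable with `size K`.
  have h1 : size K ^ d * ∫ x, v x ^ 2 ∂(surfOn (K.erase a)) ≤ S * (C₁ * X) := by
    rw [← integral_const_mul]
    calc _ ≤ ∫ _x, C₁ * X ∂(surfOn (K.erase a)) := by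
          refine integral_mono_ae ?_ (integrable_const _) ?_
          · exact (hK.integrable_surfOn hd ha (hv.continuous.pow 2)).const_mul _
          filter_upwards [ae_mem_hull_surfOn (K.erase a)] with x hx
          exact (hinv K x₀ (size K) hsz hball (fun y hy => dist_le_size hy hx₀) v hv x (hsub hx)).1
      _ = _ := by rw [integral_const, smul_eq_mul]
  have h2 := hK.volume_eq hd ha
  have h3 := hK.volume_le
  have h4 := hK.size_le_height hd ha hσ hball
  have hS0 : 0 ≤ S := measureReal_nonneg
  have h5 : size K * S ≤ σ * d * ω' * size K ^ d := by
    have h6 : size K * S ≤ σ * (height K a * S) := by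
      have := mul_le_mul_of_nonneg_right h4 hS0
      nlinarith [mul_nonneg hsz.le hS0]
    rw [← h2] at h6
    refine h6.trans ?_
    have := mul_le_mul_of_nonneg_left h3 (by positivity : 0 ≤ σ * (d : ℝ))
    rw [← hω] at this
    linarith
  refine le_of_mul_le_mul_left ?_ (pow_pos hsz d)
  calc size K ^ d * (size K * ∫ x, v x ^ 2 ∂(surfOn (K.erase a)))
      = size K * (size K ^ d * ∫ x, v x ^ 2 ∂(surfOn (K.erase a))) := by ring
    _ ≤ size K * (S * (C₁ * X)) := mul_le_mul_of_nonneg_left h1 hsz.le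
    _ = size K * S * (C₁ * X) := by ring
    _ ≤ σ * d * ω' * size K ^ d * (C₁ * X) := mul_le_mul_of_nonneg_right h5 (by positivity)
    _ = _ := by ring

/-! ### The exact solution -/

/-- Both functions have the same integrals against all test functions, so they agree almost
everywhere in `Ω`. This replaces the weak equation by one that can be used on each element. -/
lemma IsExactSolution.div_ae {Ω : Set (Sp d)} (hΩ : IsOpen Ω)
    {α : Sp d → Matrix (Fin d) (Fin d) ℝ} {f : Sp d → ℝ} {p : Sp d → Sp d} {u : Sp d → ℝ}
    (h : IsExactSolution Ω α f p u) (hf : MemLp f 2 (volume.restrict Ω)) {m : ℕ}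
    (hp : ∀ i, MemH Ω (m + 1) (fun x => p x i)) :
    ∀ᵐ x ∂(volume.restrict Ω), f x = ∑ i, wgrad Ω (fun x => p x i) i x := by
  have mg := fun i => (hp i).memLp_wgrad i
  have mG : MemLp (fun x => f x - ∑ i, wgrad Ω (fun x => p x i) i x) 2 (volume.restrict Ω) :=
    memLp_sub_fun hf (memLp_finsetSum _ fun i _ => mg i)
  have hloc : LocallyIntegrableOn (fun x => f x - ∑ i, wgrad Ω (fun x => p x i) i x) Ω :=
    locallyIntegrableOn_of_locallyIntegrable_restrict (mG.locallyIntegrable (by norm_num))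
  have hz := hΩ.ae_eq_zero_of_integral_contDiff_smul_eq_zero hloc fun φ hφ hφc hφs => ?_
  · rw [ae_restrict_iff' hΩ.measurableSet]
    filter_upwards [hz] with x hx hxΩ using sub_eq_zero.1 (hx hxΩ)
  · have ht : IsTest Ω φ := ⟨hφ, hφc, hφs⟩
    have mφ : MemLp φ 2 (volume.restrict Ω) :=
      (hφ.continuous.memLp_of_hasCompactSupport hφc).restrict _
    have mdφ : ∀ i, MemLp (pderiv i φ) 2 (volume.restrict Ω) := fun i =>
      ((contDiff_pderiv hφ i).continuous.memLp_of_hasCompactSupport (ht.pderiv i).compact).restrict _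
    have h0 : ∀ x, x ∉ Ω → φ x • (f x - ∑ i, wgrad Ω (fun x => p x i) i x) = 0 := fun x hx => by
      rw [ht.eq_zero hx, zero_smul]
    rw [← setIntegral_eq_integral_of_forall_compl_eq_zero h0]
    have h1 := h.div_eq φ ht
    simp only [inner_eq_sum, gradient_apply] at h1
    rw [integral_finsetSum _ fun i _ => integrable_mul_L2 (hp i).memLp (mdφ i)] at h1
    have h2 : ∀ x, φ x • (f x - ∑ i, wgrad Ω (fun x => p x i) i x) =
        f x * φ x - ∑ i, wgrad Ω (fun x => p x i) i x * φ x := fun x => by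
      rw [smul_eq_mul, ← Finset.sum_mul]; ring
    simp only [h2]
    rw [integral_sub (integrable_mul_L2 hf mφ)
      (integrable_finsetSum _ fun i _ => integrable_mul_L2 (mg i) mφ),
      integral_finsetSum _ fun i _ => integrable_mul_L2 (mg i) mφ, ← h1,
      ← Finset.sum_neg_distrib, ← Finset.sum_sub_distrib]
    refine Finset.sum_eq_zero fun i _ => ?_
    have := (hp i).integral_wgrad i ht
    linarith

/-! ### The error equations -/

/-- The inner product of piecewise vector fields. -/
def ip {Ω : Set (Sp d)} (T : Triangulation Ω) (F G : Finset (Sp d) → Sp d → Sp d) : ℝ :=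
  ∑ K ∈ T.elements, ∫ x, inner ℝ (F K x) (G K x) ∂(volOn K)

/-- The square of the `L²` norm of a piecewise vector field. -/
def nsq {Ω : Set (Sp d)} (T : Triangulation Ω) (F : Finset (Sp d) → Sp d → Sp d) : ℝ :=
  ∑ K ∈ T.elements, ∫ x, ‖F K x‖ ^ 2 ∂(volOn K)

/-- The inner product of functions on the boundaries of the elements. -/
def sip {Ω : Set (Sp d)} (T : Triangulation Ω) (w z : Finset (Sp d) → Finset (Sp d) → Sp d → ℝ) :
    ℝ :=
  ∑ K ∈ T.elements, ∑ e ∈ sides K, ∫ x, w K e x * z K e x ∂(surfOn e)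

/-- Piecewise vector fields in `L²`. -/
def PieceL2 {Ω : Set (Sp d)} (T : Triangulation Ω) (F : Finset (Sp d) → Sp d → Sp d) : Prop :=
  ∀ K ∈ T.elements, MemLp (F K) 2 (volOn K)

/-- Functions in `L²` on the boundaries of the elements. -/
def SideL2 {Ω : Set (Sp d)} (T : Triangulation Ω) (w : Finset (Sp d) → Finset (Sp d) → Sp d → ℝ) :
    Prop :=
  ∀ K ∈ T.elements, ∀ e ∈ sides K, MemLp (w K e) 2 (surfOn e)

/-- The normal component of a piecewise vector field. -/
def nrm (q : Finset (Sp d) → Sp d → Sp d) : Finset (Sp d) → Finset (Sp d) → Sp d → ℝ :=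
  fun K e x => inner ℝ (q K x) (outNormal K e)

/-- The difference on `∂K` of a piecewise function and a function on the skeleton. -/
def gap (v vhat : Finset (Sp d) → Sp d → ℝ) : Finset (Sp d) → Finset (Sp d) → Sp d → ℝ :=
  fun K e x => v K x - vhat e x

/-! ### Pairings of piecewise fields, and the discrete spaces in terms of them. -/

section Pairings

variable {Ω : Set (Sp d)} {T : Triangulation Ω}

lemma nsq_nonneg (F : Finset (Sp d) → Sp d → Sp d) : 0 ≤ nsq T F :=
  Finset.sum_nonneg fun _ _ => integral_nonneg fun _ => sq_nonneg _

lemma ip_self (F : Finset (Sp d) → Sp d → Sp d) : ip T F F = nsq T F := by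
  simp only [ip, nsq, real_inner_self_eq_norm_sq]

variable {F F' G : Finset (Sp d) → Sp d → Sp d}

lemma PieceL2.sub (hF : PieceL2 T F) (hG : PieceL2 T G) : PieceL2 T (fun K x => F K x - G K x) :=
  fun K hK => (hF K hK).sub (hG K hK)

lemma ip_add_left (hF : PieceL2 T F) (hF' : PieceL2 T F') (hG : PieceL2 T G) :
    ip T (fun K x => F K x + F' K x) G = ip T F G + ip T F' G := by
  rw [ip, ip, ip, ← Finset.sum_add_distrib]
  refine Finset.sum_congr rfl fun K hK => ?_
  simp only [inner_add_left]
  exact integral_add (integrable_inner_L2 (hF K hK) (hG K hK))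
    (integrable_inner_L2 (hF' K hK) (hG K hK))

lemma ip_sub_left (hF : PieceL2 T F) (hF' : PieceL2 T F') (hG : PieceL2 T G) :
    ip T (fun K x => F K x - F' K x) G = ip T F G - ip T F' G := by
  rw [ip, ip, ip, ← Finset.sum_sub_distrib]
  refine Finset.sum_congr rfl fun K hK => ?_
  simp only [inner_sub_left]
  exact integral_sub (integrable_inner_L2 (hF K hK) (hG K hK))
    (integrable_inner_L2 (hF' K hK) (hG K hK))

lemma ip_comm (F G : Finset (Sp d) → Sp d → Sp d) : ip T F G = ip T G F := by
  simp only [ip, real_inner_comm]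

lemma ip_congr_ae {F'' : Finset (Sp d) → Sp d → Sp d}
    (h : ∀ K ∈ T.elements, ∀ᵐ x ∂(volOn K), F K x = F'' K x) (G : Finset (Sp d) → Sp d → Sp d) :
    ip T F G = ip T F'' G := by
  refine Finset.sum_congr rfl fun K hK => integral_congr_ae ?_
  filter_upwards [h K hK] with x hx
  rw [hx]

lemma abs_ip_le (hF : PieceL2 T F) (hG : PieceL2 T G) {s : ℝ} (hs : 0 < s) :
    |ip T F G| ≤ s * nsq T G + s⁻¹ * nsq T F := by
  rw [ip, nsq, nsq, Finset.mul_sum, Finset.mul_sum, ← Finset.sum_add_distrib]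
  exact (Finset.abs_sum_le_sum_abs _ _).trans
    (Finset.sum_le_sum fun K hK => abs_integral_inner_le (hF K hK) (hG K hK) hs)

lemma nsq_add_le (hF : PieceL2 T F) (hG : PieceL2 T G) :
    nsq T (fun K x => F K x + G K x) ≤ 2 * nsq T F + 2 * nsq T G := by
  rw [nsq, nsq, nsq, Finset.mul_sum, Finset.mul_sum, ← Finset.sum_add_distrib]
  exact Finset.sum_le_sum fun K hK => integral_norm_add_sq_le (hF K hK) (hG K hK)

lemma nsq_sub_le (hF : PieceL2 T F) (hG : PieceL2 T G) :
    nsq T (fun K x => F K x - G K x) ≤ 2 * nsq T F + 2 * nsq T G := by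
  have h := nsq_add_le hF (G := fun K x => -G K x) fun K hK => (hG K hK).neg
  simpa only [← sub_eq_add_neg, nsq, norm_neg] using h

variable {w z z' : Finset (Sp d) → Finset (Sp d) → Sp d → ℝ}

lemma SideL2.sub (hw : SideL2 T w) (hz : SideL2 T z) :
    SideL2 T (fun K e x => w K e x - z K e x) :=
  fun K hK e he => memLp_sub_fun (hw K hK e he) (hz K hK e he)

lemma sip_add_right (hw : SideL2 T w) (hz : SideL2 T z) (hz' : SideL2 T z') :
    sip T w (fun K e x => z K e x + z' K e x) = sip T w z + sip T w z' := by
  simp only [sip, ← Finset.sum_add_distrib]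
  refine Finset.sum_congr rfl fun K hK => Finset.sum_congr rfl fun e he => ?_
  simp only [mul_add]
  exact integral_add (integrable_mul_L2 (hw K hK e he) (hz K hK e he))
    (integrable_mul_L2 (hw K hK e he) (hz' K hK e he))

lemma sip_sub_right (hw : SideL2 T w) (hz : SideL2 T z) (hz' : SideL2 T z') :
    sip T w (fun K e x => z K e x - z' K e x) = sip T w z - sip T w z' := by
  simp only [sip, ← Finset.sum_sub_distrib]
  refine Finset.sum_congr rfl fun K hK => Finset.sum_congr rfl fun e he => ?_
  simp only [mul_sub]
  exact integral_sub (integrable_mul_L2 (hw K hK e he) (hz K hK e he))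
    (integrable_mul_L2 (hw K hK e he) (hz' K hK e he))

lemma sip_congr_hull {w' : Finset (Sp d) → Finset (Sp d) → Sp d → ℝ}
    (h : ∀ K ∈ T.elements, ∀ e ∈ sides K, ∀ x ∈ hull e, w K e x = w' K e x)
    (z : Finset (Sp d) → Finset (Sp d) → Sp d → ℝ) : sip T w z = sip T w' z := by
  refine Finset.sum_congr rfl fun K hK => Finset.sum_congr rfl fun e he => integral_congr_ae ?_
  filter_upwards [ae_mem_hull_surfOn e] with x hx
  rw [h K hK e he x hx]

/-- Young's inequality on each `∂K` with weight `s * size K`. The two resulting scalings are those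
of the stabilization and of the trace inequality. -/
lemma abs_sip_le (hd : 1 ≤ d) (hw : SideL2 T w) (hz : SideL2 T z) {s : ℝ} (hs : 0 < s) :
    |sip T w z| ≤ s * ∑ K ∈ T.elements, size K * ∑ e ∈ sides K, ∫ x, z K e x ^ 2 ∂(surfOn e) +
      s⁻¹ * ∑ K ∈ T.elements, (size K)⁻¹ * ∑ e ∈ sides K, ∫ x, w K e x ^ 2 ∂(surfOn e) := by
  rw [sip, Finset.mul_sum, Finset.mul_sum, ← Finset.sum_add_distrib]
  refine (Finset.abs_sum_le_sum_abs _ _).trans (Finset.sum_le_sum fun K hK => ?_)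
  rw [← mul_assoc, ← mul_assoc, ← mul_inv, Finset.mul_sum, Finset.mul_sum,
    ← Finset.sum_add_distrib]
  refine (Finset.abs_sum_le_sum_abs _ _).trans (Finset.sum_le_sum fun e he => ?_)
  exact abs_integral_mul_le_young (hw K hK e he) (hz K hK e he)
    (mul_pos hs ((Triangulation.isSimplex hK).size_pos hd))

/-! ### The discrete spaces -/

variable {m : ℕ} {v v' vhat vhat' : Finset (Sp d) → Sp d → ℝ} {q q' : Finset (Sp d) → Sp d → Sp d}

lemma MemV.sub (hv : MemV T m v) (hv' : MemV T m v') : MemV T m (fun K x => v K x - v' K x) :=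
  fun K hK => (hv K hK).sub (hv' K hK)

lemma MemQ.sub (hq : MemQ T m q) (hq' : MemQ T m q') : MemQ T m (fun K x => q K x - q' K x) :=
  fun K hK i => (hq K hK i).sub (hq' K hK i)

lemma MemVhat.sub (hv : MemVhat T m vhat) (hv' : MemVhat T m vhat') :
    MemVhat T m (fun e x => vhat e x - vhat' e x) := by
  refine fun K hK e he => ⟨fun hb x hx => ?_, fun hb => ?_⟩
  · simp only [(hv K hK e he).1 hb x hx, (hv' K hK e he).1 hb x hx, sub_zero]
  · obtain ⟨P, hP, h1⟩ := (hv K hK e he).2 hb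
    obtain ⟨P', hP', h2⟩ := (hv' K hK e he).2 hb
    exact ⟨fun x => P x - P' x, hP.sub hP', fun x hx => by simp only [h1 hx, h2 hx]⟩

lemma MemVhat.memLp (hd : 1 ≤ d) (hv : MemVhat T m vhat) {K e : Finset (Sp d)}
    (hK : K ∈ T.elements) (he : e ∈ sides K) : MemLp (vhat e) 2 (surfOn e) := by
  obtain ⟨P, hP, h⟩ : ∃ P : Sp d → ℝ, IsPoly m P ∧ Set.EqOn (vhat e) P (hull e) := by
    by_cases hb : hull e ⊆ frontier Ω
    · exact ⟨fun _ => 0, isPoly_const _ _, (hv K hK e he).1 hb⟩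
    · exact (hv K hK e he).2 hb
  refine MemLp.ae_eq ?_
    ((Triangulation.isSimplex hK).memLp_surfOn_of_mem_sides hd he hP.continuous 2)
  filter_upwards [ae_mem_hull_surfOn e] with x hx using (h hx).symm

lemma MemQ.pieceL2 (hq : MemQ T m q) : PieceL2 T q :=
  fun K hK => memLp_vec fun i => memLp_volOn (hq K hK i).continuous 2

lemma MemV.pieceL2_gradient (hv : MemV T m v) : PieceL2 T (fun K => gradient (v K)) :=
  fun K hK => (hv K hK).memLp_gradient K

/-- The reason for pairing fluxes of degree `k` with scalars of degree `k + 1`: gradients of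
discrete scalars are admissible test fluxes. -/
lemma MemV.memQ_gradient (hv : MemV T (m + 1) v) : MemQ T m (fun K => gradient (v K)) := by
  intro K hK i
  simp only [gradient_apply]
  exact (hv K hK).pderiv i

lemma MemQ.sideL2 (hd : 1 ≤ d) (hq : MemQ T m q) : SideL2 T (nrm q) := by
  intro K hK e he
  have h : nrm q K e = fun x => ∑ i, q K x i * outNormal K e i := funext fun x => inner_eq_sum _ _
  rw [h]
  exact (Triangulation.isSimplex hK).memLp_surfOn_of_mem_sides hd he
    (continuous_finsetSum _ fun i _ => (hq K hK i).continuous.mul continuous_const) 2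

lemma sideL2_gap (hd : 1 ≤ d) (hv : MemV T m v) (hvh : MemVhat T m vhat) :
    SideL2 T (gap v vhat) := fun K hK _ he =>
  memLp_sub_fun ((Triangulation.isSimplex hK).memLp_surfOn_of_mem_sides hd he
    (hv K hK).continuous 2) (hvh.memLp hd hK he)

/-- Integration by parts on each element. In this form the skeleton function enters only through the
gap, which is what the stabilization controls. -/
lemma bForm_eq (hd : 1 ≤ d) {r : ℕ} (hq : MemQ T r q) (hv : MemV T m v) (hvh : MemVhat T m vhat) :
    bForm T q v vhat = ip T (fun K => gradient (v K)) q - sip T (gap v vhat) (nrm q) := by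
  rw [bForm, ip, sip, ← Finset.sum_neg_distrib, ← Finset.sum_add_distrib, ← Finset.sum_sub_distrib]
  refine Finset.sum_congr rfl fun K hK => ?_
  have hs := Triangulation.isSimplex hK
  have hg := hs.green_vec hd (hq K hK) (hv K hK)
  have h1 : ∑ e ∈ sides K, ∫ x, gap v vhat K e x * nrm q K e x ∂(surfOn e) =
      ∑ e ∈ sides K, ∫ x, v K x * inner ℝ (q K x) (outNormal K e) ∂(surfOn e) -
      ∑ e ∈ sides K, ∫ x, vhat e x * inner ℝ (q K x) (outNormal K e) ∂(surfOn e) := by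
    rw [← Finset.sum_sub_distrib]
    refine Finset.sum_congr rfl fun e he => ?_
    simp only [gap, sub_mul]
    exact integral_sub (integrable_mul_L2 (hs.memLp_surfOn_of_mem_sides hd he
      (hv K hK).continuous 2) (hq.sideL2 hd K hK e he))
      (integrable_mul_L2 (hvh.memLp hd hK he) (hq.sideL2 hd K hK e he))
  rw [h1]
  linarith

lemma gradient_sub_apply (hv : MemV T m v) (hv' : MemV T m v') {K : Finset (Sp d)}
    (hK : K ∈ T.elements) (x : Sp d) :
    gradient (fun x => v K x - v' K x) x = gradient (v K) x - gradient (v' K) x := by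
  ext i
  rw [PiLp.sub_apply, gradient_apply, gradient_apply, gradient_apply,
    pderiv_sub ((hv K hK).contDiff.differentiable (by simp))
      ((hv' K hK).contDiff.differentiable (by simp))]

lemma exists_sum_nrm_sq_le (hd : 1 ≤ d) (m : ℕ) {σ : ℝ} (hσ : 0 < σ) :
    ∃ C > 0, ∀ (Ω : Set (Sp d)) (T : Triangulation Ω), T.ShapeRegular σ → ∀ q, MemQ T m q →
      ∑ K ∈ T.elements, size K * ∑ e ∈ sides K, ∫ x, nrm q K e x ^ 2 ∂(surfOn e) ≤
        C * nsq T q := by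
  obtain ⟨C, hC, h⟩ := exists_discrete_trace hd m hσ
  refine ⟨(d + 1) * C, by positivity, fun Ω T hT q hq => ?_⟩
  rw [nsq, Finset.mul_sum]
  refine Finset.sum_le_sum fun K hK => ?_
  have hs := Triangulation.isSimplex hK
  rw [integral_norm_sq (hq.pieceL2 K hK), Finset.mul_sum]
  have h1 : ∀ e ∈ sides K, size K * ∫ x, nrm q K e x ^ 2 ∂(surfOn e) ≤
      C * ∑ i, ∫ x, q K x i ^ 2 ∂(volOn K) := by
    intro e he
    have mi := fun i => hs.memLp_surfOn_of_mem_sides hd he (hq K hK i).continuous 2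
    have h2 : ∫ x, nrm q K e x ^ 2 ∂(surfOn e) ≤ ∑ i, ∫ x, q K x i ^ 2 ∂(surfOn e) := by
      rw [← integral_finsetSum _ fun i _ => (mi i).integrable_sq]
      refine integral_mono (hq.sideL2 hd K hK e he).integrable_sq
        (integrable_finsetSum _ fun i _ => (mi i).integrable_sq) fun x => ?_
      show nrm q K e x ^ 2 ≤ ∑ i, q K x i ^ 2
      rw [← norm_sq_eq_sum, nrm]
      refine sq_le_sq' ?_ ?_
      · have := (abs_le.1 (abs_real_inner_le_norm (q K x) (outNormal K e))).1
        nlinarith [norm_nonneg (q K x), abs_outNormal_le K e]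
      · have := real_inner_le_norm (q K x) (outNormal K e)
        nlinarith [norm_nonneg (q K x), abs_outNormal_le K e]
    refine (mul_le_mul_of_nonneg_left h2 (size_nonneg K)).trans ?_
    rw [Finset.mul_sum, Finset.mul_sum]
    exact Finset.sum_le_sum fun i _ => h K hs (hT K hK) _ (hq K hK i) e he
  refine (Finset.sum_le_sum h1).trans (le_of_eq ?_)
  rw [Finset.sum_const, sides, Finset.card_powersetCard, hs.card]
  simp [mul_assoc]

end Pairings

/-! ### Bounds for the coefficient form, and the two error identities. -/

section

variable {Ω : Set (Sp d)} {T : Triangulation Ω}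

lemma ae_volOn_of_ae (hΩ : IsBddDomain Ω) {P : Sp d → Prop} (h : ∀ᵐ x ∂(volume.restrict Ω), P x)
    {K : Finset (Sp d)} (hK : K ∈ T.elements) : ∀ᵐ x ∂(volOn K), P x :=
  ae_mono (volOn_le_restrict (Triangulation.interior_hull_subset hΩ hK)) h

lemma pieceL2_of_memLp (hΩ : IsBddDomain Ω) {F : Sp d → Sp d} (hF : MemLp F 2 (volume.restrict Ω)) :
    PieceL2 T (fun _ => F) := fun _ hK =>
  hF.mono_measure (volOn_le_restrict (Triangulation.interior_hull_subset hΩ hK))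

lemma pieceL2_cMul (hΩ : IsBddDomain Ω) {α : Sp d → Matrix (Fin d) (Fin d) ℝ}
    (hα : IsCoefficient Ω α) {F : Finset (Sp d) → Sp d → Sp d} (hF : PieceL2 T F) :
    PieceL2 T (fun K x => cMul α x (F K x)) := by
  obtain ⟨κ, β, -, hβ, hb⟩ := hα.exists_bounds
  intro K hK
  refine MemLp.of_le_mul (c := β) (hF K hK) (aestronglyMeasurable_cMul (fun i j =>
    (hα.measurable i j).mono_measure (volOn_le_restrict (Triangulation.interior_hull_subset hΩ hK)))
    (hF K hK).1) ?_
  filter_upwards [ae_volOn_of_ae hΩ (ae_restrict_mem hΩ.isOpen.measurableSet) hK] with x hx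
  exact (hb x hx _).2

lemma nsq_cMul_le (hΩ : IsBddDomain Ω) {α : Sp d → Matrix (Fin d) (Fin d) ℝ}
    (hα : IsCoefficient Ω α) {β : ℝ} (hb : ∀ x ∈ Ω, ∀ ξ : Sp d, ‖cMul α x ξ‖ ≤ β * ‖ξ‖)
    {F : Finset (Sp d) → Sp d → Sp d} (hF : PieceL2 T F) :
    nsq T (fun K x => cMul α x (F K x)) ≤ β ^ 2 * nsq T F := by
  rw [nsq, nsq, Finset.mul_sum]
  refine Finset.sum_le_sum fun K hK => ?_
  rw [← integral_const_mul]
  refine integral_mono_ae (integrable_norm_sq_L2 (pieceL2_cMul hΩ hα hF K hK))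
    ((integrable_norm_sq_L2 (hF K hK)).const_mul _) ?_
  filter_upwards [ae_volOn_of_ae hΩ (ae_restrict_mem hΩ.isOpen.measurableSet) hK] with x hx
  rw [← mul_pow]
  exact pow_le_pow_left₀ (norm_nonneg _) (hb x hx _) 2

lemma le_aForm_self (hΩ : IsBddDomain Ω) {α : Sp d → Matrix (Fin d) (Fin d) ℝ}
    (hα : IsCoefficient Ω α) {κ : ℝ} (hb : ∀ x ∈ Ω, ∀ ξ : Sp d, κ * ‖ξ‖ ^ 2 ≤ inner ℝ (cMul α x ξ) ξ)
    {F : Finset (Sp d) → Sp d → Sp d} (hF : PieceL2 T F) : κ * nsq T F ≤ aForm T α F F := by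
  rw [nsq, aForm, Finset.mul_sum]
  refine Finset.sum_le_sum fun K hK => ?_
  rw [← integral_const_mul]
  refine integral_mono_ae ((integrable_norm_sq_L2 (hF K hK)).const_mul _)
    (integrable_inner_L2 (pieceL2_cMul hΩ hα hF K hK) (hF K hK)) ?_
  filter_upwards [ae_volOn_of_ae hΩ (ae_restrict_mem hΩ.isOpen.measurableSet) hK] with x hx
  exact hb x hx _

lemma abs_aForm_le (hΩ : IsBddDomain Ω) {α : Sp d → Matrix (Fin d) (Fin d) ℝ}
    (hα : IsCoefficient Ω α) {β : ℝ} (hb : ∀ x ∈ Ω, ∀ ξ : Sp d, ‖cMul α x ξ‖ ≤ β * ‖ξ‖)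
    {F G : Finset (Sp d) → Sp d → Sp d} (hF : PieceL2 T F) (hG : PieceL2 T G) {s : ℝ} (hs : 0 < s) :
    |aForm T α F G| ≤ s * nsq T G + s⁻¹ * (β ^ 2 * nsq T F) :=
  (abs_ip_le (pieceL2_cMul hΩ hα hF) hG hs).trans (add_le_add_right
    (mul_le_mul_of_nonneg_left (nsq_cMul_le hΩ hα hb hF) (inv_pos.2 hs).le) _)

lemma memLp_weakGrad {u : Sp d → ℝ} {m : ℕ} (hu : MemH Ω (m + 1) u) :
    MemLp (weakGrad Ω u) 2 (volume.restrict Ω) := memLp_vec fun i => hu.memLp_wgrad i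

section ErrorEquations

variable {α : Sp d → Matrix (Fin d) (Fin d) ℝ} {f : Sp d → ℝ} {p : Sp d → Sp d} {u : Sp d → ℝ}
  {τ : Finset (Sp d) → ℝ} {k : ℕ} {ph : Finset (Sp d) → Sp d → Sp d}
  {uh uhat : Finset (Sp d) → Sp d → ℝ}

/-- The exact equation `c p + ∇u = 0` is paired with `q`; it has no boundary term because `u` is
single-valued across the sides. The first discrete equation, rewritten by `bForm_eq`, is then
subtracted. -/
lemma IsHDGSolution.error_flux (hΩ : IsBddDomain Ω) (hd : 1 ≤ d) (hα : IsCoefficient Ω α)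
    (hex : IsExactSolution Ω α f p u) (h : IsHDGSolution T α f τ k (k + 1) (k + 1) ph uh uhat)
    {q : Finset (Sp d) → Sp d → Sp d} (hq : MemQ T k q) :
    aForm T α (fun K x => p x - ph K x) q +
      ip T (fun K x => weakGrad Ω u x - gradient (uh K) x) q + sip T (gap uh uhat) (nrm q) = 0 := by
  have mq := hq.pieceL2
  have mp : PieceL2 T (fun _ => p) := pieceL2_of_memLp hΩ hex.p_memLp
  have mu : PieceL2 T (fun _ => weakGrad Ω u) := pieceL2_of_memLp hΩ (memLp_weakGrad hex.u_mem.memH)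
  have h1 := h.eq_flux q hq
  rw [bForm_eq hd hq h.u_mem h.uhat_mem] at h1
  have h2 : aForm T α (fun K x => p x - ph K x) q = ip T (fun _ x => cMul α x (p x)) q -
      aForm T α ph q := by
    show ip T (fun K x => cMul α x (p x - ph K x)) q = _
    simp only [cMul_sub]
    exact ip_sub_left (pieceL2_cMul hΩ hα mp) (pieceL2_cMul hΩ hα h.p_mem.pieceL2) mq
  have h3 := ip_sub_left mu h.u_mem.pieceL2_gradient mq
  have h4 : ip T (fun _ x => cMul α x (p x)) q + ip T (fun _ => weakGrad Ω u) q = 0 := by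
    rw [← ip_add_left (pieceL2_cMul hΩ hα mp) mu mq, ip_congr_ae (F'' := fun _ _ => 0) fun K hK =>
      ae_volOn_of_ae hΩ hex.flux hK]
    simp [ip]
  rw [h2, h3]
  linarith

/-- The normal component of the traces of a vector field. -/
def traceNormal (t : Fin d → Finset (Sp d) → Finset (Sp d) → Sp d → ℝ) :
    Finset (Sp d) → Finset (Sp d) → Sp d → ℝ :=
  fun K e x => ∑ i, outNormal K e i * t i K e x

lemma sideL2_traceNormal {t : Fin d → Finset (Sp d) → Finset (Sp d) → Sp d → ℝ}
    (ht : ∀ i, ∀ K ∈ T.elements, HasTrace K (fun x => p x i) (wgrad Ω fun x => p x i) (t i K)) :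
    SideL2 T (traceNormal t) := fun K hK _ he =>
  memLp_finsetSum _ fun i _ => ((ht i K hK).memLp he).const_mul _

/-- `div p = f` is paired with `v` and integrated by parts on each element. On `∂K` one writes `v`
as the gap plus `vhat`; the `vhat` part of the flux of `p` adds up to zero because its normal traces
are opposite across interior sides and `vhat` vanishes on the boundary. -/
lemma IsHDGSolution.error_div (hΩ : IsBddDomain Ω) (hd : 1 ≤ d)
    (hex : IsExactSolution Ω α f p u) (hf : MemLp f 2 (volume.restrict Ω))
    (h : IsHDGSolution T α f τ k (k + 1) (k + 1) ph uh uhat) {m : ℕ}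
    (hp : ∀ i, MemH Ω (m + 1) (fun x => p x i))
    {t : Fin d → Finset (Sp d) → Finset (Sp d) → Sp d → ℝ}
    (ht : ∀ i, ∀ K ∈ T.elements, HasTrace K (fun x => p x i) (wgrad Ω fun x => p x i) (t i K))
    {v vhat : Finset (Sp d) → Sp d → ℝ} (hv : MemV T (k + 1) v) (hvh : MemVhat T (k + 1) vhat) :
    ip T (fun K x => p x - ph K x) (fun K => gradient (v K)) -
      sip T (gap v vhat) (fun K e x => traceNormal t K e x - nrm ph K e x) +
      ∑ K ∈ T.elements, τ K * ∑ e ∈ sides K,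
        ∫ x, gap uh uhat K e x * gap v vhat K e x ∂(surfOn e) = 0 := by
  have mp : PieceL2 T (fun _ => p) := pieceL2_of_memLp hΩ hex.p_memLp
  have mv := hv.pieceL2_gradient
  have h1 := h.eq_div v vhat hv hvh
  rw [bForm_eq hd h.p_mem hv hvh, ip_comm] at h1
  have hload : load T f v = sip T (gap v vhat) (traceNormal t) -
      ip T (fun _ => p) (fun K => gradient (v K)) := by
    have h2 : ∀ K ∈ T.elements, ∫ x, f x * v K x ∂(volOn K) =
        (∑ e ∈ sides K, ∫ x, gap v vhat K e x * traceNormal t K e x ∂(surfOn e) +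
          ∑ e ∈ sides K, ∫ x, vhat e x * traceNormal t K e x ∂(surfOn e)) -
          ∫ x, inner ℝ (p x) (gradient (v K) x) ∂(volOn K) := by
      intro K hK
      have hs := Triangulation.isSimplex hK
      have h3 := green_trace_vec hs hd (mp K hK) (fun i => ((hp i).memLp_wgrad i).mono_measure
        (volOn_le_restrict (Triangulation.interior_hull_subset hΩ hK))) (fun i => ht i K hK) (hv K hK)
      have h4 : ∫ x, f x * v K x ∂(volOn K) =
          ∫ x, (∑ i, wgrad Ω (fun x => p x i) i x) * v K x ∂(volOn K) := by
        refine integral_congr_ae ?_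
        filter_upwards [ae_volOn_of_ae hΩ (hex.div_ae hΩ.isOpen hf hp) hK] with x hx
        rw [hx]
      have h5 : ∑ e ∈ sides K, ∫ x, gap v vhat K e x * traceNormal t K e x ∂(surfOn e) +
          ∑ e ∈ sides K, ∫ x, vhat e x * traceNormal t K e x ∂(surfOn e) =
          ∑ e ∈ sides K, ∫ x, v K x * ∑ i, outNormal K e i * t i K e x ∂(surfOn e) := by
        rw [← Finset.sum_add_distrib]
        refine Finset.sum_congr rfl fun e he => ?_
        have mt := sideL2_traceNormal ht K hK e he
        rw [← integral_add (integrable_mul_L2 (sideL2_gap hd hv hvh K hK e he) mt)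
          (integrable_mul_L2 (hvh.memLp hd hK he) mt)]
        refine integral_congr_ae (.of_forall fun x => ?_)
        simp only [gap, traceNormal]
        ring
      rw [h4, h5]
      linarith
    have h6 := Triangulation.sum_normal_trace_eq_zero hΩ hd hp ht hvh
    rw [load, Finset.sum_congr rfl h2, Finset.sum_sub_distrib, Finset.sum_add_distrib]
    rw [show ∑ K ∈ T.elements, ∑ e ∈ sides K, ∫ x, vhat e x * traceNormal t K e x ∂(surfOn e) = 0
      from h6, add_zero]
    rfl
  have h7 := ip_sub_left mp h.p_mem.pieceL2 mv
  have h8 := sip_sub_right (sideL2_gap hd hv hvh) (sideL2_traceNormal ht) (h.p_mem.sideL2 hd)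
  have h9 : cForm T τ uh uhat v vhat = -∑ K ∈ T.elements, τ K * ∑ e ∈ sides K,
        ∫ x, gap uh uhat K e x * gap v vhat K e x ∂(surfOn e) := rfl
  rw [h7, h8]
  rw [h9, hload] at h1
  linarith

end ErrorEquations

end

/-! ### The energy estimate -/

/-- The absorption argument in isolation. `N`, `Y`, `G` and `J` stand for the flux error, the
stabilization, the gradient error and the unweighted jump; `η`, `δ` and `ζ` are approximation
errors. The second family of inequalities bounds `G` by `N`, `J` and data, and this is inserted into
the first with a weight small enough to absorb. -/
lemma exists_energy_const {κ β γ : ℝ} (hκ : 0 < κ) (hγ : 0 < γ) :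
    ∃ C > 0, ∀ N Y G J η δ ζ : ℝ, 0 ≤ N → 0 ≤ Y → 0 ≤ G → 0 ≤ J → 0 ≤ η → 0 ≤ δ → 0 ≤ ζ → J ≤ Y →
      (∀ s > 0, κ * N + Y ≤ (s * N + s⁻¹ * (β ^ 2 * η)) + (s * N + s⁻¹ * δ) + (s * G + s⁻¹ * η) +
        (s⁻¹ * ζ + s * J)) →
      (∀ s > 0, G ≤ (s * G + s⁻¹ * (β ^ 2 * η)) + (s * G + s⁻¹ * (β ^ 2 * N)) + (s * G + s⁻¹ * δ) +
        (s * (γ * G) + s⁻¹ * J)) →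
      N + Y + G ≤ C * (η + δ + ζ) := by
  set c := 4 * (3 + γ) * (β ^ 2 + 1) with hc
  have hc0 : 0 < c := by positivity
  set m := min κ 1 with hm
  have hm0 : 0 < m := lt_min hκ one_pos
  -- Chosen so that the terms `s * (2 + c) * (N + Y)` left on the right are half of `m * (N + Y)`.
  set s := m / (2 * (2 + c)) with hs
  have hs0 : 0 < s := by positivity
  set B := s * c + s⁻¹ * (β ^ 2 + 1) with hB
  have hB0 : 0 < B := by positivity
  set C₁ := 2 / m * B with hC₁
  have hC₁0 : 0 < C₁ := by positivity
  refine ⟨C₁ + c * (1 + C₁), by positivity,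
    fun N Y G J η δ ζ hN hY hG hJ hη hδ hζ hJY h1 h2 => ?_⟩
  have hb : 0 ≤ β ^ 2 := sq_nonneg β
  have h3 : G ≤ c * (η + N + δ + J) := by
    -- With this weight the four occurrences of `G` on the right add up to `G / 2`.
    have h4 := h2 (1 / (2 * (3 + γ))) (by positivity)
    have e1 : (1 / (2 * (3 + γ)))⁻¹ = 2 * (3 + γ) := by rw [one_div, inv_inv]
    have e2 : 1 / (2 * (3 + γ)) * (3 + γ) = 1 / 2 := by field_simp
    rw [e1] at h4
    have h5 : G ≤ (1 / (2 * (3 + γ)) * (3 + γ)) * G +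
        2 * (3 + γ) * (β ^ 2 * η + β ^ 2 * N + δ + J) := by linarith
    rw [e2] at h5
    have h6 : β ^ 2 * η + β ^ 2 * N + δ + J ≤ (β ^ 2 + 1) * (η + N + δ + J) := by
      nlinarith [mul_nonneg hb hδ, mul_nonneg hb hJ]
    have h7 := mul_le_mul_of_nonneg_left h6 (by positivity : 0 ≤ 2 * (3 + γ))
    rw [hc]
    linarith
  set D := η + δ + ζ with hD
  have hDη : 0 ≤ D := by positivity
  have h8 : G ≤ c * (D + N + Y) := h3.trans (mul_le_mul_of_nonneg_left (by rw [hD]; linarith) hc0.le)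
  have hsc : s * (2 + c) = m / 2 := by rw [hs]; field_simp
  have h9 : N + Y ≤ C₁ * D := by
    have h10 := h1 s hs0
    have h11 : β ^ 2 * η + δ + η + ζ ≤ (β ^ 2 + 1) * D := by
      rw [hD]; nlinarith [mul_nonneg hb hδ, mul_nonneg hb hζ]
    have h12 := mul_le_mul_of_nonneg_left h11 (inv_pos.2 hs0).le
    have h13 := mul_le_mul_of_nonneg_left h8 hs0.le
    have h14 := mul_le_mul_of_nonneg_left hJY hs0.le
    have h15 : κ * N + Y ≤ s * (2 + c) * N + s * (2 + c) * Y + B * D := by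
      rw [hB]
      nlinarith [mul_nonneg hs0.le hY]
    rw [hsc] at h15
    have h16 : m * N ≤ κ * N := mul_le_mul_of_nonneg_right (min_le_left _ _) hN
    have h17 : m * Y ≤ 1 * Y := mul_le_mul_of_nonneg_right (min_le_right _ _) hY
    have h18 : m / 2 * (N + Y) ≤ B * D := by linarith
    have h19 := mul_le_mul_of_nonneg_left h18 (by positivity : 0 ≤ 2 / m)
    have e3 : 2 / m * (m / 2 * (N + Y)) = N + Y := by field_simp
    rw [e3] at h19
    rw [hC₁]
    linarith
  have h20 : c * (D + N + Y) ≤ c * (D + C₁ * D) := mul_le_mul_of_nonneg_left (by linarith) hc0.le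
  have h21 : (C₁ + c * (1 + C₁)) * D = C₁ * D + c * (D + C₁ * D) := by ring
  rw [h21]
  linarith

/-! ### Assembly of the error estimate. -/

section

variable {Ω : Set (Sp d)}

/-- The test functions are `Q - ph` and `∇(uh - I)` in the flux identity and `(uh - I, uhat - Ie)`
in the divergence identity. Any `Q` and any conforming `I` are allowed, so the result is a
best-approximation bound and polynomial accuracy enters only afterwards. -/
lemma exists_energy_estimate (hΩ : IsBddDomain Ω) (hd : 1 ≤ d)
    {α : Sp d → Matrix (Fin d) (Fin d) ℝ} (hα : IsCoefficient Ω α) (k : ℕ) {σ : ℝ} (hσ : 0 < σ) :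
    ∃ C > 0, ∀ T : Triangulation Ω, T.ShapeRegular σ → ∀ ρ : ℝ, 0 < ρ → ρ ≤ 1 →
      ∀ (f : Sp d → ℝ) (p : Sp d → Sp d) (u : Sp d → ℝ), MemLp f 2 (volume.restrict Ω) →
      IsExactSolution Ω α f p u → (∀ i, MemH Ω (k + 1) (fun x => p x i)) →
      ∀ (ph : Finset (Sp d) → Sp d → Sp d) (uh uhat : Finset (Sp d) → Sp d → ℝ),
      IsHDGSolution T α f (fun K => ρ⁻¹ * (size K)⁻¹) k (k + 1) (k + 1) ph uh uhat →
      ∀ t : Fin d → Finset (Sp d) → Finset (Sp d) → Sp d → ℝ,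
      (∀ i, ∀ K ∈ T.elements, HasTrace K (fun x => p x i) (wgrad Ω fun x => p x i) (t i K)) →
      ∀ (Q : Finset (Sp d) → Sp d → Sp d) (I Ie : Finset (Sp d) → Sp d → ℝ), MemQ T k Q →
      MemV T (k + 1) I → MemVhat T (k + 1) Ie →
      (∀ K ∈ T.elements, ∀ e ∈ sides K, ∀ x ∈ hull e, I K x = Ie e x) →
      nsq T (fun K x => Q K x - ph K x) +
        ρ⁻¹ * (∑ K ∈ T.elements, (size K)⁻¹ * ∑ e ∈ sides K,
          ∫ x, gap uh uhat K e x ^ 2 ∂(surfOn e)) +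
        nsq T (fun K x => gradient (uh K) x - gradient (I K) x) ≤
      C * (nsq T (fun K x => p x - Q K x) +
        nsq T (fun K x => weakGrad Ω u x - gradient (I K) x) +
        ∑ K ∈ T.elements, size K * ∑ e ∈ sides K,
          ∫ x, (traceNormal t K e x - nrm Q K e x) ^ 2 ∂(surfOn e)) := by
  obtain ⟨κ, β, hκ, -, hb⟩ := hα.exists_bounds
  obtain ⟨γ, hγ, hnrm⟩ := exists_sum_nrm_sq_le hd k hσ
  obtain ⟨C, hC, hen⟩ := exists_energy_const (β := β) hκ hγ
  refine ⟨C, hC, fun T hT ρ hρ hρ1 f p u hf hex hp ph uh uhat hsol t ht Q I Ie hQ hI hIe hconf => ?_⟩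
  have hbκ := fun x hx ξ => (hb x hx ξ).1
  have hbβ := fun x hx ξ => (hb x hx ξ).2
  set E : Finset (Sp d) → Sp d → Sp d := fun K x => Q K x - ph K x with hE
  set ψ : Finset (Sp d) → Sp d → Sp d := fun K x => gradient (uh K) x - gradient (I K) x with hψ
  set η : Finset (Sp d) → Sp d → Sp d := fun K x => p x - Q K x with hη
  set δ : Finset (Sp d) → Sp d → Sp d := fun K x => weakGrad Ω u x - gradient (I K) x with hδ
  set z : Finset (Sp d) → Finset (Sp d) → Sp d → ℝ :=
    fun K e x => traceNormal t K e x - nrm Q K e x with hz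
  set w := gap uh uhat with hw
  have qE : MemQ T k E := hQ.sub hsol.p_mem
  have qψ : MemQ T k ψ := hsol.u_mem.memQ_gradient.sub hI.memQ_gradient
  have mE := qE.pieceL2
  have mψ := qψ.pieceL2
  have mp : PieceL2 T (fun _ => p) := pieceL2_of_memLp hΩ hex.p_memLp
  have mu : PieceL2 T (fun _ => weakGrad Ω u) := pieceL2_of_memLp hΩ (memLp_weakGrad hex.u_mem.memH)
  have mη : PieceL2 T η := mp.sub hQ.pieceL2
  have mδ : PieceL2 T δ := mu.sub hI.pieceL2_gradient
  have mw : SideL2 T w := sideL2_gap hd hsol.u_mem hsol.uhat_mem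
  have mz : SideL2 T z := (sideL2_traceNormal ht).sub (hQ.sideL2 hd)
  have eθ : (fun (K : Finset (Sp d)) x => p x - ph K x) = fun K x => η K x + E K x := by
    funext K x; simp [hη, hE]
  have eγ : (fun (K : Finset (Sp d)) x => weakGrad Ω u x - gradient (uh K) x) =
      fun K x => δ K x - ψ K x := by
    funext K x; simp [hδ, hψ]
  have hflux : ∀ q, MemQ T k q → aForm T α η q + aForm T α E q + (ip T δ q - ip T ψ q) +
      sip T w (nrm q) = 0 := by
    intro q hq
    have h1 := hsol.error_flux hΩ hd hα hex hq
    have h2 : aForm T α (fun K x => η K x + E K x) q = aForm T α η q + aForm T α E q := by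
      show ip T (fun K x => cMul α x (η K x + E K x)) q = _
      simp only [cMul_add]
      exact ip_add_left (pieceL2_cMul hΩ hα mη) (pieceL2_cMul hΩ hα mE) hq.pieceL2
    rwa [eθ, eγ, h2, ip_sub_left mδ mψ hq.pieceL2] at h1
  set J := ∑ K ∈ T.elements, (size K)⁻¹ * ∑ e ∈ sides K, ∫ x, w K e x ^ 2 ∂(surfOn e) with hJ
  have hJ0 : 0 ≤ J := Finset.sum_nonneg fun K _ => mul_nonneg (inv_nonneg.2 (size_nonneg K))
    (Finset.sum_nonneg fun e _ => integral_nonneg fun _ => sq_nonneg _)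
  set ζ := ∑ K ∈ T.elements, size K * ∑ e ∈ sides K, ∫ x, z K e x ^ 2 ∂(surfOn e) with hζ
  have hζ0 : 0 ≤ ζ := Finset.sum_nonneg fun K _ => mul_nonneg (size_nonneg K)
    (Finset.sum_nonneg fun e _ => integral_nonneg fun _ => sq_nonneg _)
  -- The upper bound on `ρ` enters here: the gradient estimate produces the jump without the weight
  -- `ρ⁻¹`, while the energy contains it with the weight.
  have hJY : J ≤ ρ⁻¹ * J := le_mul_of_one_le_left hJ0 ((one_le_inv₀ hρ).2 hρ1)
  -- Subtracting a conforming function does not change the gap. This is why the stabilization term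
  -- of the tested identity is exactly the squared jump, with no interpolation jump multiplied by
  -- `ρ⁻¹`.
  have hgap : ∀ K ∈ T.elements, ∀ e ∈ sides K, ∀ x ∈ hull e,
      gap (fun K x => uh K x - I K x) (fun e x => uhat e x - Ie e x) K e x = w K e x := by
    intro K hK e he x hx
    simp only [gap, hw, hconf K hK e he x hx]
    ring
  have hdiv : ip T η ψ + ip T E ψ - sip T w z - sip T w (nrm E) + ρ⁻¹ * J = 0 := by
    have h1 := hsol.error_div hΩ hd hex hf hp ht (hsol.u_mem.sub hI) (hsol.uhat_mem.sub hIe)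
    have h3 : ip T (fun K x => p x - ph K x) (fun K => gradient (fun x => uh K x - I K x)) =
        ip T η ψ + ip T E ψ := by
      rw [← ip_add_left mη mE mψ, ← eθ]
      refine Finset.sum_congr rfl fun K hK => ?_
      simp only [gradient_sub_apply hsol.u_mem hI hK, hψ]
    have h4 : (fun K e x => traceNormal t K e x - nrm ph K e x) =
        fun K e x => z K e x + nrm E K e x := by
      funext K e x
      simp only [hz, nrm, hE, inner_sub_left]
      ring
    have h5 : ∑ K ∈ T.elements, ρ⁻¹ * (size K)⁻¹ * ∑ e ∈ sides K, ∫ x, w K e x *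
        gap (fun K x => uh K x - I K x) (fun e x => uhat e x - Ie e x) K e x ∂(surfOn e) =
        ρ⁻¹ * J := by
      rw [hJ, Finset.mul_sum]
      refine Finset.sum_congr rfl fun K hK => ?_
      rw [mul_assoc]
      congr 2
      refine Finset.sum_congr rfl fun e he => integral_congr_ae ?_
      filter_upwards [ae_mem_hull_surfOn e] with x hx
      rw [hgap K hK e he x hx, sq]
    rw [h3, h4, h5, sip_congr_hull hgap, sip_add_right mw mz (qE.sideL2 hd)] at h1
    linarith
  refine hen _ _ _ J _ _ _ (nsq_nonneg _) (mul_nonneg (inv_nonneg.2 hρ.le) hJ0) (nsq_nonneg _) hJ0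
    (nsq_nonneg _) (nsq_nonneg _) hζ0 hJY (fun s hs => ?_) (fun s hs => ?_)
  -- Adding this identity to `hdiv` cancels the coupling of `ψ` with `E` and that of `w` with the
  -- normal component of `E`. Left of the equality remain coercive terms, and everything else has an
  -- approximation error as a factor.
  · have h1 := hflux E qE
    have h2 := le_aForm_self hΩ hα hbκ mE
    have h3 := (abs_le.1 (abs_aForm_le hΩ hα hbβ mη mE hs)).1
    have h4 := (abs_le.1 (abs_ip_le mδ mE hs)).1
    have h5 := (abs_le.1 (abs_ip_le mη mψ hs)).1
    -- The inverse weight is used so that the small factor falls on the jump and the large one on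
    -- the data.
    have h6 := (abs_le.1 (abs_sip_le hd mw mz (inv_pos.2 hs))).2
    rw [inv_inv] at h6
    have h7 := ip_comm (T := T) ψ E
    linarith
  -- Tested with `ψ`, the flux identity isolates `‖ψ‖²`. The boundary term is controlled by the jump
  -- and by the discrete trace inequality for `ψ`.
  · have h1 := hflux ψ qψ
    rw [ip_self] at h1
    have h2 := (abs_le.1 (abs_aForm_le hΩ hα hbβ mη mψ hs)).2
    have h3 := (abs_le.1 (abs_aForm_le hΩ hα hbβ mE mψ hs)).2
    have h4 := (abs_le.1 (abs_ip_le mδ mψ hs)).2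
    have h5 := (abs_le.1 (abs_sip_le hd mw (qψ.sideL2 hd) hs)).2
    have h6 := mul_le_mul_of_nonneg_left (hnrm Ω T hT ψ qψ) hs.le
    linarith

/-- The elementwise polynomial approximation of a vector field. -/
lemma exists_flux_approx (hΩ : IsBddDomain Ω) (hd : 1 ≤ d) (k : ℕ) {σ : ℝ} (hσ : 0 < σ) :
    ∃ C > 0, ∀ T : Triangulation Ω, T.ShapeRegular σ → ∀ p : Sp d → Sp d,
      (∀ i, MemH Ω (k + 1) (fun x => p x i)) →
      ∃ (t : Fin d → Finset (Sp d) → Finset (Sp d) → Sp d → ℝ) (Q : Finset (Sp d) → Sp d → Sp d),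
        (∀ i, ∀ K ∈ T.elements, HasTrace K (fun x => p x i) (wgrad Ω fun x => p x i) (t i K)) ∧
        MemQ T k Q ∧ nsq T (fun K x => p x - Q K x) +
          ∑ K ∈ T.elements, size K * ∑ e ∈ sides K,
            ∫ x, (traceNormal t K e x - nrm Q K e x) ^ 2 ∂(surfOn e) ≤
          C * (T.meshSize ^ (2 * (k + 1)) * ∑ i, semiSq Ω (k + 1) (fun x => p x i)) := by
  obtain ⟨C, hC, happ⟩ := exists_poly_trace hd k hσ
  refine ⟨C + (d + 1) * C, by positivity, fun T hT p hp => ?_⟩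
  have hP : ∀ i K, ∃ P t, K ∈ T.elements → IsPoly k P ∧
      HasTrace K (fun x => p x i) (wgrad Ω fun x => p x i) t ∧
      ∫ x, (p x i - P x) ^ 2 ∂(volOn K) ≤ C * (size K ^ (2 * (k + 1)) *
        semiSqOn K (derivFam Ω fun x => p x i) (k + 1)) ∧
      ∀ e ∈ sides K, size K * ∫ x, (t e x - P x) ^ 2 ∂(surfOn e) ≤ C * (size K ^ (2 * (k + 1)) *
        semiSqOn K (derivFam Ω fun x => p x i) (k + 1)) := by
    intro i K
    by_cases hK : K ∈ T.elements
    · have hs := Triangulation.isSimplex hK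
      have hmid := Triangulation.interior_hull_subset hΩ hK
      obtain ⟨P, hP, h1, -, h2⟩ := happ Ω K hs hmid (hT K hK) _ (hp i)
      obtain ⟨φ, hφ⟩ := (hp i).exists_H1Lim hs hmid
      obtain ⟨t, ht⟩ := hφ.exists_hasTrace hs hd
      exact ⟨P, t, fun _ => ⟨hP, ht, h1, h2 t ht⟩⟩
    · exact ⟨0, 0, fun h => absurd h hK⟩
  choose P t hP using hP
  set Q : Finset (Sp d) → Sp d → Sp d := fun K x => WithLp.toLp 2 fun i => P i K x with hQ
  have hQm : MemQ T k Q := fun K hK i => (hP i K hK).1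
  have ht : ∀ i, ∀ K ∈ T.elements, HasTrace K (fun x => p x i) (wgrad Ω fun x => p x i) (t i K) :=
    fun i K hK => (hP i K hK).2.1
  refine ⟨t, Q, ht, hQm, ?_⟩
  have hsum : ∑ K ∈ T.elements, ∑ i, size K ^ (2 * (k + 1)) *
      semiSqOn K (derivFam Ω fun x => p x i) (k + 1) ≤
      T.meshSize ^ (2 * (k + 1)) * ∑ i, semiSq Ω (k + 1) (fun x => p x i) := by
    rw [Finset.sum_comm, Finset.mul_sum]
    exact Finset.sum_le_sum fun i _ => Triangulation.sum_size_mul_le hΩ T (hp i) _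
  rw [add_mul]
  refine add_le_add (le_trans ?_ (mul_le_mul_of_nonneg_left hsum hC.le))
    (le_trans ?_ (mul_le_mul_of_nonneg_left hsum (by positivity)))
  · rw [nsq, Finset.mul_sum]
    refine Finset.sum_le_sum fun K hK => ?_
    have mp : MemLp p 2 (volOn K) := memLp_vec fun i => (hp i).memLp.mono_measure
      (volOn_le_restrict (Triangulation.interior_hull_subset hΩ hK))
    rw [integral_norm_sq (F := fun x => p x - Q K x) (mp.sub (hQm.pieceL2 K hK)), Finset.mul_sum]
    exact Finset.sum_le_sum fun i _ => (hP i K hK).2.2.1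
  · rw [Finset.mul_sum]
    refine Finset.sum_le_sum fun K hK => ?_
    have hs := Triangulation.isSimplex hK
    have h1 : ∀ e ∈ sides K, size K * ∫ x, (traceNormal t K e x - nrm Q K e x) ^ 2 ∂(surfOn e) ≤
        C * ∑ i, size K ^ (2 * (k + 1)) * semiSqOn K (derivFam Ω fun x => p x i) (k + 1) := by
      intro e he
      have mi : ∀ i, MemLp (fun x => t i K e x - P i K x) 2 (surfOn e) := fun i =>
        memLp_sub_fun ((ht i K hK).memLp he)
          (hs.memLp_surfOn_of_mem_sides hd he (hP i K hK).1.continuous 2)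
      have h2 : ∫ x, (traceNormal t K e x - nrm Q K e x) ^ 2 ∂(surfOn e) ≤
          ∑ i, ∫ x, (t i K e x - P i K x) ^ 2 ∂(surfOn e) := by
        rw [← integral_finsetSum _ fun i _ => (mi i).integrable_sq]
        refine integral_mono ((sideL2_traceNormal ht).sub (hQm.sideL2 hd) K hK e he).integrable_sq
          (integrable_finsetSum _ fun i _ => (mi i).integrable_sq) fun x => ?_
        have h3 : traceNormal t K e x - nrm Q K e x =
            ∑ i, outNormal K e i * (t i K e x - P i K x) := by
          rw [traceNormal, nrm, inner_eq_sum, ← Finset.sum_sub_distrib]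
          exact Finset.sum_congr rfl fun i _ => by simp only [hQ]; ring
        show (traceNormal t K e x - nrm Q K e x) ^ 2 ≤ ∑ i, (t i K e x - P i K x) ^ 2
        rw [h3]
        refine (Finset.sum_mul_sq_le_sq_mul_sq _ _ _).trans ?_
        rw [← norm_sq_eq_sum]
        exact mul_le_of_le_one_left (Finset.sum_nonneg fun _ _ => sq_nonneg _)
          (pow_le_one₀ (norm_nonneg _) (abs_outNormal_le K e))
      refine (mul_le_mul_of_nonneg_left h2 (size_nonneg K)).trans ?_
      rw [Finset.mul_sum, Finset.mul_sum]
      exact Finset.sum_le_sum fun i _ => (hP i K hK).2.2.2 e he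
    rw [Finset.mul_sum]
    refine (Finset.sum_le_sum h1).trans (le_of_eq ?_)
    rw [Finset.sum_const, sides, Finset.card_powersetCard, hs.card]
    simp [mul_assoc]

lemma sqrt_mul_pow_le {M h a b : ℝ} (hM : 0 ≤ M) (hh : 0 ≤ h) (ha : 0 ≤ a) (hb : 0 ≤ b) (n : ℕ) :
    √(M * (h ^ (2 * n) * (a + b))) ≤ √M * (h ^ n * (√a + √b)) := by
  rw [Real.sqrt_mul hM, Real.sqrt_mul (pow_nonneg hh _), mul_comm 2, pow_mul,
    Real.sqrt_sq (pow_nonneg hh _)]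
  have h1 : √(a + b) ≤ √a + √b := by
    rw [Real.sqrt_le_left (add_nonneg (Real.sqrt_nonneg a) (Real.sqrt_nonneg b))]
    nlinarith [Real.sq_sqrt ha, Real.sq_sqrt hb, mul_nonneg (Real.sqrt_nonneg a) (Real.sqrt_nonneg b)]
  exact mul_le_mul_of_nonneg_left (mul_le_mul_of_nonneg_left h1 (pow_nonneg hh n)) (Real.sqrt_nonneg M)

/-- The error estimate for the HDG method. -/
theorem exists_error_estimate (hΩ : IsBddDomain Ω) (hd : 1 ≤ d)
    {α : Sp d → Matrix (Fin d) (Fin d) ℝ} (hα : IsCoefficient Ω α) (k : ℕ) {σ : ℝ} (hσ : 0 < σ) :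
    ∃ C > 0, ∀ T : Triangulation Ω, T.ShapeRegular σ → ∀ ρ : ℝ, 0 < ρ → ρ ≤ 1 →
      ∀ (f : Sp d → ℝ) (p : Sp d → Sp d) (u t : Sp d → ℝ), MemLp f 2 (volume.restrict Ω) →
      IsExactSolution Ω α f p u → (∀ i, MemH Ω (k + 1) (fun x => p x i)) → MemH Ω (k + 2) u →
      ∀ (ph : Finset (Sp d) → Sp d → Sp d) (uh uhat : Finset (Sp d) → Sp d → ℝ),
      IsHDGSolution T α f (fun K => ρ⁻¹ * (size K)⁻¹) k (k + 1) (k + 1) ph uh uhat →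
      fluxNorm T α (fun K x => p x - ph K x) +
          tildeNorm T ρ (fun K x => weakGrad Ω u x - gradient (uh K) x)
            (fun K x => t x - uh K x) (fun e x => t x - uhat e x) ≤
        C * T.meshSize ^ (k + 1) * (vecSemi Ω (k + 1) p + semi Ω (k + 2) u) := by
  obtain ⟨κ, β, -, hβ, hb⟩ := hα.exists_bounds
  obtain ⟨C₁, hC₁, hflux⟩ := exists_flux_approx hΩ hd k hσ
  obtain ⟨C₂, hC₂, hmid⟩ := Triangulation.exists_interpolant hΩ hd k hσ
  obtain ⟨C₃, hC₃, hen⟩ := exists_energy_estimate hΩ hd hα k hσ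
  -- The factor two is the triangle inequality for squares, `1 + β ^ 2` bounds the coefficient form,
  -- `1 + C₃` adds the approximation error to the discrete error, and `C₁ + C₂` collects the two
  -- approximation results.
  set M := 2 * (1 + β ^ 2) * (1 + C₃) * (C₁ + C₂) with hM
  have hM0 : 0 < M := by positivity
  refine ⟨2 * √M, by positivity, fun T hT ρ hρ hρ1 f p u t hf hex hp hu ph uh uhat hsol => ?_⟩
  obtain ⟨tp, Q, htp, hQ, hD₁⟩ := hflux T hT p hp
  obtain ⟨I, Ie, hI, hIe, hconf, hD₂⟩ := hmid T hT u hex.u_mem hu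
  have hE := hen T hT ρ hρ hρ1 f p u hf hex hp ph uh uhat hsol tp htp Q I Ie hQ hI hIe hconf
  have mp : PieceL2 T (fun _ => p) := pieceL2_of_memLp hΩ hex.p_memLp
  have mu : PieceL2 T (fun _ => weakGrad Ω u) := pieceL2_of_memLp hΩ (memLp_weakGrad hu)
  have mη : PieceL2 T (fun K x => p x - Q K x) := mp.sub hQ.pieceL2
  have mδ : PieceL2 T (fun K x => weakGrad Ω u x - gradient (I K) x) := mu.sub hI.pieceL2_gradient
  have mE := (hQ.sub hsol.p_mem).pieceL2
  have mψ := (hsol.u_mem.memQ_gradient.sub hI.memQ_gradient).pieceL2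
  have hδ : nsq T (fun K x => weakGrad Ω u x - gradient (I K) x) ≤
      C₂ * (T.meshSize ^ (2 * (k + 1)) * semiSq Ω (k + 2) u) := by
    refine le_trans (le_of_eq ?_) hD₂
    refine Finset.sum_congr rfl fun K hK => ?_
    rw [integral_norm_sq (F := fun x => weakGrad Ω u x - gradient (I K) x) (mδ K hK)]
    simp only [PiLp.sub_apply, gradient_apply]
    rfl
  set η := nsq T (fun K x => p x - Q K x) with hη
  set δ := nsq T (fun K x => weakGrad Ω u x - gradient (I K) x) with hδd
  set ζ := ∑ K ∈ T.elements, size K * ∑ e ∈ sides K,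
    ∫ x, (traceNormal tp K e x - nrm Q K e x) ^ 2 ∂(surfOn e) with hζ
  set N := nsq T (fun K x => Q K x - ph K x) with hN
  set G := nsq T (fun K x => gradient (uh K) x - gradient (I K) x) with hG
  set Y := ρ⁻¹ * (∑ K ∈ T.elements, (size K)⁻¹ * ∑ e ∈ sides K,
    ∫ x, gap uh uhat K e x ^ 2 ∂(surfOn e)) with hY
  have hη0 : 0 ≤ η := nsq_nonneg _
  have hδ0 : 0 ≤ δ := nsq_nonneg _
  have hN0 : 0 ≤ N := nsq_nonneg _
  have hG0 : 0 ≤ G := nsq_nonneg _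
  have hζ0 : 0 ≤ ζ := Finset.sum_nonneg fun K _ => mul_nonneg (size_nonneg K)
    (Finset.sum_nonneg fun e _ => integral_nonneg fun _ => sq_nonneg _)
  have hY0 : 0 ≤ Y := mul_nonneg (inv_nonneg.2 hρ.le) (Finset.sum_nonneg fun K _ =>
    mul_nonneg (inv_nonneg.2 (size_nonneg K)) (Finset.sum_nonneg fun e _ =>
      integral_nonneg fun _ => sq_nonneg _))
  set A := ∑ i, semiSq Ω (k + 1) (fun x => p x i) with hA
  set B := semiSq Ω (k + 2) u with hB
  have hsemi : ∀ m w, 0 ≤ semiSq Ω m w := fun m w =>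
    Finset.sum_nonneg fun _ _ => integral_nonneg fun _ => sq_nonneg _
  have hA0 : 0 ≤ A := Finset.sum_nonneg fun i _ => hsemi _ _
  have hB0 : 0 ≤ B := hsemi _ _
  have hh : 0 ≤ T.meshSize := Real.iSup_nonneg fun K => size_nonneg K.1
  set H := T.meshSize ^ (2 * (k + 1)) with hH
  have hH0 : 0 ≤ H := by positivity
  have hD : η + δ + ζ ≤ (C₁ + C₂) * (H * (A + B)) := by
    have h1 : 0 ≤ C₁ * (H * B) := by positivity
    have h2 : 0 ≤ C₂ * (H * A) := by positivity
    linarith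
  have hMD : 2 * (1 + β ^ 2) * (1 + C₃) * (η + δ + ζ) ≤ M * (H * (A + B)) := by
    rw [hM, mul_assoc _ (C₁ + C₂)]
    exact mul_le_mul_of_nonneg_left hD (by positivity)
  have hD0 : 0 ≤ η + δ + ζ := by positivity
  have hfl : aForm T α (fun K x => p x - ph K x) (fun K x => p x - ph K x) ≤ M * (H * (A + B)) := by
    have eθ : (fun (K : Finset (Sp d)) x => p x - ph K x) =
        fun K x => (p x - Q K x) + (Q K x - ph K x) := by
      funext K x; simp
    have mθ := mp.sub hsol.p_mem.pieceL2
    have h1 := (abs_le.1 (abs_aForm_le hΩ hα (fun x hx ξ => (hb x hx ξ).2) mθ mθ one_pos)).2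
    have h2 := nsq_add_le mη mE
    rw [← eθ] at h2
    have h3 : nsq T (fun K x => p x - ph K x) ≤ 2 * (1 + C₃) * (η + δ + ζ) := by linarith
    have h4 := mul_le_mul_of_nonneg_left h3 (by positivity : 0 ≤ 1 + β ^ 2)
    rw [inv_one] at h1
    linarith
  have hti : (∑ K ∈ T.elements, ∫ x, inner ℝ (weakGrad Ω u x - gradient (uh K) x)
        (weakGrad Ω u x - gradient (uh K) x) ∂(volOn K)) +
      ρ⁻¹ * ∑ K ∈ T.elements, ((size K)⁻¹ * ∑ e ∈ sides K,
        ∫ x, (t x - uh K x - (t x - uhat e x)) * (t x - uh K x - (t x - uhat e x)) ∂(surfOn e)) ≤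
      M * (H * (A + B)) := by
    have eγ : (fun (K : Finset (Sp d)) x => weakGrad Ω u x - gradient (uh K) x) =
        fun K x => (weakGrad Ω u x - gradient (I K) x) - (gradient (uh K) x - gradient (I K) x) := by
      funext K x; simp
    have h1 := nsq_sub_le mδ mψ
    rw [← eγ] at h1
    have h2 : ρ⁻¹ * ∑ K ∈ T.elements, ((size K)⁻¹ * ∑ e ∈ sides K,
        ∫ x, (t x - uh K x - (t x - uhat e x)) * (t x - uh K x - (t x - uhat e x)) ∂(surfOn e)) =
        Y := by
      -- The trace of `u` cancels between the two components of the error, so the boundary part of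
      -- the norm is the stabilization term of the discrete solution.
      have h3 : ∀ K e x, (t x - uh K x - (t x - uhat e x)) * (t x - uh K x - (t x - uhat e x)) =
          gap uh uhat K e x ^ 2 := fun K e x => by simp only [gap]; ring
      simp only [h3, hY]
    rw [h2]
    have h4 := ip_self (T := T) (fun K x => weakGrad Ω u x - gradient (uh K) x)
    simp only [ip] at h4
    rw [h4]
    have h5 : 2 * (1 + C₃) * (η + δ + ζ) ≤ 2 * (1 + β ^ 2) * (1 + C₃) * (η + δ + ζ) := by
      have : 0 ≤ β ^ 2 * ((1 + C₃) * (η + δ + ζ)) := by positivity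
      linarith
    linarith
  have hsq : √(M * (H * (A + B))) ≤ √M * (T.meshSize ^ (k + 1) * (√A + √B)) :=
    sqrt_mul_pow_le hM0.le hh hA0 hB0 (k + 1)
  have h1 : fluxNorm T α (fun K x => p x - ph K x) ≤ √M * (T.meshSize ^ (k + 1) * (√A + √B)) :=
    (Real.sqrt_le_sqrt hfl).trans hsq
  have h2 : tildeNorm T ρ (fun K x => weakGrad Ω u x - gradient (uh K) x)
      (fun K x => t x - uh K x) (fun e x => t x - uhat e x) ≤
      √M * (T.meshSize ^ (k + 1) * (√A + √B)) := (Real.sqrt_le_sqrt hti).trans hsq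
  have h3 : vecSemi Ω (k + 1) p = √A := rfl
  have h4 : semi Ω (k + 2) u = √B := rfl
  rw [h3, h4]
  linarith

end

end HDG

end

theorem mainTheorem4 {d : ℕ} (hd : 1 ≤ d) (k : ℕ)
    (Ω : Set (HDG.Sp d)) (hΩ : HDG.IsBddDomain Ω)
    (α : HDG.Sp d → Matrix (Fin d) (Fin d) ℝ) (hα : HDG.IsCoefficient Ω α)
    (σ : ℝ) (hσ : 0 < σ) :
    ∃ ρ₀ C : ℝ, 0 < ρ₀ ∧ 0 < C ∧
      ∀ (T : HDG.Triangulation Ω), T.ShapeRegular σ →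
      ∀ ρ : ℝ, 0 < ρ → ρ ≤ ρ₀ →
      ∀ (f : HDG.Sp d → ℝ) (p : HDG.Sp d → HDG.Sp d) (u t : HDG.Sp d → ℝ),
        MeasureTheory.MemLp f 2 (MeasureTheory.volume.restrict Ω) →
        HDG.IsExactSolution Ω α f p u →
        (∀ i, HDG.MemH Ω (k + 1) (fun x => p x i)) →
        HDG.MemH Ω (k + 2) u →
        HDG.IsSkeletonTrace T u t →
      ∀ (ph : Finset (HDG.Sp d) → HDG.Sp d → HDG.Sp d)
        (uh uhat : Finset (HDG.Sp d) → HDG.Sp d → ℝ),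
        HDG.IsHDGSolution T α f (fun K => ρ⁻¹ * (HDG.size K)⁻¹) k (k + 1) (k + 1) ph uh uhat →
        HDG.fluxNorm T α (fun K x => p x - ph K x) +
          HDG.tildeNorm T ρ (fun K x => HDG.weakGrad Ω u x - gradient (uh K) x)
            (fun K x => t x - uh K x) (fun e x => t x - uhat e x) ≤
        C * T.meshSize ^ (k + 1) * (HDG.vecSemi Ω (k + 1) p + HDG.semi Ω (k + 2) u) := by
  obtain ⟨C, hC, h⟩ := HDG.exists_error_estimate hΩ hd hα k hσ
  -- `ρ₀ = 1` suffices, since the energy argument only asks that the weight `ρ⁻¹` be at least one.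
  exact ⟨1, C, one_pos, hC, fun T hT ρ hρ hρ1 f p u t hf hex hp hu _ ph uh uhat hsol =>
    h T hT ρ hρ hρ1 f p u t hf hex hp hu ph uh uhat hsol⟩
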